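/- Let $0<q<1$, $0\le s\le 1$, $N\in\frac12\mathbb Z\setminus\{0\}$ and $[x]=\frac{q^x-q^{-x}}{q-q^{-1}}$. **Algebras.** $\mathcal A=\mathcal A(S^2_{qs})$ is the $*$-algebra generated by $A=A^*,B,B^*$ with $AB=q^2BA$, $BB^*+(A+s^2)(A-1)=0$, $B^*B+(q^2A+s^2)(q^2A-1)=0$. $U_q(su(2))$ is the Hopf algebra generated by $K^{\pm1},E,F$ with $KE=qEK$, $KF=q^{-1}FK$, $EF-FE=\frac{K^2-K^{-2}}{q-q^{-1}}$, $\Delta K=K\otimes K$, $\Delta E=E\otimes K+K^{-1}\otimes E$, $\Delta F=F\otimes K+K^{-1}\otimes F$, $\epsilon(K)=1$, $\epsilon(E)=\epsilon(F)=0$. It acts on $\mathcal A$, with $h\triangleright(ab)=(h_{(1)}\triangleright a)(h_{(2)}\triangleright b)$ and $h\triangleright1=\epsilon(h)1$, by $K\triangleright A=A$, $K\triangleright B=qB$, $K\triangleright B^*=q^{-1}B^*$; $E\triangleright A=-q^{-1/2}B$, $E\triangleright B=0$, $E\triangleright B^*=q^{1/2}(1+q^2)A-q^{1/2}(1-s^2)$;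 $F\triangleright A=q^{-3/2}B^*$, $F\triangleright B=-q^{-1/2}(1+q^2)A+q^{-1/2}(1-s^2)$, $F\triangleright B^*=0$. The modular automorphism of $\mathcal A$ is $\kappa(a)=K^2\triangleright a$. **Twisted Hochschild homology.** $C^\kappa_n\subset\mathcal A^{\otimes(n+1)}$ is the space of tensors fixed by $\kappa^{\otimes(n+1)}$, the boundary $b_\kappa:C^\kappa_{n+1}\to C^\kappa_n$ is $$b_\kappa(a_0\otimes\dots\otimes a_{n+1})=\sum_{j=0}^n(-1)^ja_0\otimes\dots\otimes a_ja_{j+1}\otimes\dots\otimes a_{n+1}+(-1)^{n+1}\kappa(a_{n+1})a_0\otimes a_1\otimes\dots\otimes a_n ,$$ $HH^\kappa_\bullet(\mathcal A)$ is the homology of this complex, and $\mathrm{Hdim}^\kappa(\mathcal A)=\sup\{n: HH^\kappa_n(\mathcal A)\ne0\}$. **The tensor.** Let $$e_s=\frac1{1+s^2}\begin{pmatrix}s^2+A&qB\\ q^{-1}B^*&1-q^2A\end{pmatrix},\qquad \gamma_s=2e_s-1,\qquad \eta=\begin{pmatrix}q&0\\0&q^{-1}\end{pmatrix},$$ $$\omega_2=\tfrac18\sum_{i,j,k,l}\eta_{ij}(\gamma_s)_{jk}\otimes(1+\gamma_s)_{kl}\otimes(1-\gamma_s)_{li}\in\mathcal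 A^{\otimes3}.$$ **The Fredholm module.** $\mathcal H_{N}$ has the orthonormal basis $|l,m;N\rangle$ with $l-|N|,\,l-|m|\in\mathbb N$. With $x_1=(q[2])^{1/2}B$, $x_0=-q[2]A+1-s^2$, $x_{-1}=-q^{-1}x_1^*$, $\mathcal A$ is represented on $\mathcal H_N$ by bounded operators through (label $N$ suppressed) $$x_1|l,m\rangle=B^+_{l,m}|l{+}1,m{+}1\rangle+B^0_{l,m}|l,m{+}1\rangle+B^-_{l,m}|l{-}1,m{+}1\rangle,$$ $$x_0|l,m\rangle=A^+_{l,m}|l{+}1,m\rangle+A^0_{l,m}|l,m\rangle+A^+_{l-1,m}|l{-}1,m\rangle,$$ $$-qx_{-1}|l,m\rangle=B^-_{l+1,m-1}|l{+}1,m{-}1\rangle+B^0_{l,m-1}|l,m{-}1\rangle+B^+_{l-1,m-1}|l{-}1,m{-}1\rangle,$$ where kets out of range are $0$ and $A^+_{l,m}=q^m\sqrt{[2][l-m+1][l+m+1]}\,\alpha_{l+1}$, $A^0_{l,m}=([2l]-q^{l+m+1}[2][l-m])\beta_l$, $B^+_{l,m}=q^{-l+m}\sqrt{[l+m+1][l+m+2]}\,\alpha_{l+1}$,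 $B^0_{l,m}=-q^{m+2}\sqrt{[2][l-m][l+m+1]}\,\beta_l$, $B^-_{l,m}=-q^{l+m+1}\sqrt{[l-m][l-m-1]}\,\alpha_l$, with $\alpha_{|N|}=0$ and $$\alpha_l=\frac1{[2l]}\sqrt{\frac{[2][l+N][l-N]}{[2l-1][2l+1]}}\sqrt{(q^{l+N}+q^{-(l+N)}s^2)(q^{l-N}s^2+q^{-(l-N)})},$$ $$\beta_l=\frac{([2l]-q^{l+N+1}[2][l-N])(1-s^2)+q[2][2N]s^2}{q^2[2l][2l+2]}.$$ On $\mathcal H=\mathcal H_{-N}\oplus\mathcal H_N$ put $\gamma=1\oplus-1$, $F|l,m;\pm N\rangle=|l,m;\mp N\rangle$ and $K|l,m;\pm N\rangle=q^m|l,m;\pm N\rangle$. Let $$\mathrm{ch}^{F,\kappa}_2(a_0,a_1,a_2)=\tfrac12\mathrm{Tr}_{\mathcal H}\bigl(K^{-2}\gamma F[F,a_0][F,a_1][F,a_2]\bigr),$$ extended linearly to $\mathcal A^{\otimes3}$. Put $\mathcal H'_\pm=\tfrac12(1\pm\gamma)e_s(\mathcal H\otimes\mathbb C^2)$, let $F^+_{e_s}:\mathcal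 H'_+\to\mathcal H'_-$ be given by $\tfrac14(1-\gamma)e_sFe_s(1+\gamma)$, and let $$q\text{-Index}(F^+_{e_s})=\mathrm{Tr}_{\ker F^+_{e_s}}(K^{-2}\eta)-\mathrm{Tr}_{\operatorname{coker}F^+_{e_s}}(K^{-2}\eta),$$ where $\operatorname{coker}F^+_{e_s}=\mathcal H'_- /F^+_{e_s}(\mathcal H'_+)$ and $K^{-2}\eta$ is taken with its maximal domain. **Lemma.** The tensor $\omega_2$ is $U_q(su(2))$-invariant, $h\triangleright\omega_2=\epsilon(h)\omega_2$, and it is a twisted Hochschild $2$-cycle for $\kappa$. The formulas above define a unique representation of $\mathcal A$ on $\mathcal H$ by bounded operators; the operators $K^{-2}\gamma F[F,a_0][F,a_1][F,a_2]$ are of trace class; $\ker F^+_{e_s}$ and $\operatorname{coker}F^+_{e_s}$ are finite dimensional, $K^{-2}\eta$ is defined on the first, maps it to itself, and induces an everywhere defined operator on the second; and $$q\text{-Index}(F^+_{e_s})=\mathrm{ch}^{F,\kappa}_2(\omega_2)=[2N].$$ In particular $[\omega_2]\ne0$ in $HH^\kappa_2(\mathcal A(S^2_{qs}))$, so that $\mathrm{Hdim}^\kappa(\mathcal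 A(S^2_{qs}))\ge2$: there is no dimension drop. -/

import Mathlib

set_option linter.unusedSimpArgs false
set_option linter.unnecessarySeqFocus false
set_option linter.unreachableTactic false
set_option linter.unusedTactic false
open scoped TensorProduct

/-- The space `A^{⊗(n+1)}`. -/
abbrev HochChain (A : Type*) [Ring A] [Algebra ℂ A] (n : ℕ) : Type _ :=
  ⨂[ℂ] _ : Fin (n + 1), A

theorem contractNth_update {A : Type*} [Ring A] {n : ℕ} (j : Fin (n + 1)) (a : Fin (n + 2) → A)
    (i : Fin (n + 2)) : ∃ (k : Fin (n + 1)) (u v : A), ∀ x,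
      Fin.contractNth j.castSucc (· * ·) (Function.update a i x) =
        Function.update (Fin.contractNth j.castSucc (· * ·) a) k (u * x * v) := by
  rcases lt_trichotomy (i : ℕ) j with h | h | h
  · refine ⟨⟨i, by omega⟩, 1, 1, fun x => ?_⟩
    funext k
    have := j.2
    have := k.2
    simp only [Fin.contractNth, Function.update_apply, Fin.ext_iff, Fin.val_castSucc, Fin.val_succ]
    split_ifs <;> first | omega | simp
  · refine ⟨j, 1, a j.succ, fun x => ?_⟩
    funext k
    by_cases hk : k = j
    · subst hk
      have h1 : k.castSucc = i := by ext; simp [h]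
      have h2 : k.succ ≠ i := by intro e; rw [← e] at h; simp at h
      simp [Fin.contractNth, h1, h2, h]
    · have hk' : (k : ℕ) ≠ j := fun e => hk (Fin.ext e)
      simp only [Fin.contractNth, Function.update_apply, Fin.ext_iff, Fin.val_castSucc, Fin.val_succ]
      split_ifs <;> first | omega | rfl
  · by_cases h' : (i : ℕ) = j + 1
    · refine ⟨j, a j.castSucc, 1, fun x => ?_⟩
      funext k
      by_cases hk : k = j
      · subst hk
        have h1 : k.succ = i := by ext; simp [h']
        have h2 : k.castSucc ≠ i := by intro e; rw [← e] at h; simp at h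
        simp [Fin.contractNth, h1, h2]
      · have hk' : (k : ℕ) ≠ j := fun e => hk (Fin.ext e)
        simp only [Fin.contractNth, Function.update_apply, Fin.ext_iff, Fin.val_castSucc,
          Fin.val_succ]
        split_ifs <;> first | omega | rfl
    · refine ⟨⟨i - 1, by omega⟩, 1, 1, fun x => ?_⟩
      funext k
      simp only [Fin.contractNth, Function.update_apply, Fin.ext_iff, Fin.val_castSucc,
        Fin.val_succ, one_mul, mul_one]
      split_ifs <;> first | omega | rfl

/-- The face `a₀ ⊗ ⋯ ⊗ a_{n+1} ↦ a₀ ⊗ ⋯ ⊗ a_j a_{j+1} ⊗ ⋯ ⊗ a_{n+1}`. -/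
noncomputable def hochFace {A : Type*} [Ring A] [Algebra ℂ A] {n : ℕ} (j : Fin (n + 1)) :
    MultilinearMap ℂ (fun _ : Fin (n + 2) => A) (HochChain A n) :=
  MultilinearMap.mk' (fun a => PiTensorProduct.tprod ℂ (Fin.contractNth j.castSucc (· * ·) a))
    (by
      intro a i x y
      obtain ⟨k, u, v, h⟩ := contractNth_update j a i
      simp only [h, mul_add, add_mul, MultilinearMap.map_update_add])
    (by
      intro a i c x
      obtain ⟨k, u, v, h⟩ := contractNth_update j a i
      simp only [h, mul_smul_comm, smul_mul_assoc, MultilinearMap.map_update_smul])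

theorem lastFace_update {A : Type*} [Ring A] [Algebra ℂ A] (κ : A ≃ₐ[ℂ] A) {n : ℕ}
    (a : Fin (n + 2) → A) (i : Fin (n + 2)) : ∃ (k : Fin (n + 1)) (g : A →ₗ[ℂ] A), ∀ x,
      (Fin.cons (κ (Function.update a i x (Fin.last (n + 1))) * Function.update a i x 0)
        (fun k : Fin n => Function.update a i x k.succ.castSucc) : Fin (n + 1) → A) =
      Function.update (Fin.cons (κ (a (Fin.last (n + 1))) * a 0)
        (fun k : Fin n => a k.succ.castSucc)) k (g x) := by
  by_cases h0 : i = 0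
  · subst h0
    refine ⟨0, LinearMap.mulLeft ℂ (κ (a (Fin.last (n + 1)))), fun x => ?_⟩
    funext k
    refine Fin.cases ?_ (fun k => ?_) k <;> simp [Function.update_apply, Fin.ext_iff]
  · by_cases h1 : i = Fin.last (n + 1)
    · subst h1
      refine ⟨0, LinearMap.mulRight ℂ (a 0) ∘ₗ κ.toLinearMap, fun x => ?_⟩
      funext k
      refine Fin.cases ?_ (fun k => ?_) k
      · simp [Function.update_apply, Fin.ext_iff]
      · have := k.2
        simp [Function.update_apply, Fin.ext_iff]
        omega
    · have hi : (i : ℕ) ≠ 0 := fun e => h0 (Fin.ext e)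
      have hi' : (i : ℕ) ≠ n + 1 := fun e => h1 (Fin.ext e)
      refine ⟨⟨i, by omega⟩, LinearMap.id, fun x => ?_⟩
      funext k
      refine Fin.cases ?_ (fun k => ?_) k
      · simp [Function.update_apply, Fin.ext_iff, hi, Ne.symm hi, Ne.symm hi']
      · simp [Function.update_apply, Fin.ext_iff]

/-- The last, twisted face `a₀ ⊗ ⋯ ⊗ a_{n+1} ↦ κ(a_{n+1}) a₀ ⊗ a₁ ⊗ ⋯ ⊗ a_n`. -/
noncomputable def hochLastFace {A : Type*} [Ring A] [Algebra ℂ A] (κ : A ≃ₐ[ℂ] A) (n : ℕ) :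
    MultilinearMap ℂ (fun _ : Fin (n + 2) => A) (HochChain A n) :=
  MultilinearMap.mk' (fun a => PiTensorProduct.tprod ℂ
      (Fin.cons (κ (a (Fin.last (n + 1))) * a 0) (fun k : Fin n => a k.succ.castSucc)))
    (by
      intro a i x y
      obtain ⟨k, g, hg⟩ := lastFace_update κ a i
      simp only [hg, map_add, MultilinearMap.map_update_add])
    (by
      intro a i c x
      obtain ⟨k, g, hg⟩ := lastFace_update κ a i
      simp only [hg, map_smul, MultilinearMap.map_update_smul])

/-- The twisted Hochschild boundary `b_κ : A^{⊗(n+2)} → A^{⊗(n+1)}`,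
`b_κ(a₀ ⊗ ⋯ ⊗ a_{n+1}) = ∑_{j ≤ n} (-1)^j a₀ ⊗ ⋯ ⊗ a_j a_{j+1} ⊗ ⋯ ⊗ a_{n+1}
  + (-1)^{n+1} κ(a_{n+1}) a₀ ⊗ a₁ ⊗ ⋯ ⊗ a_n`. -/
noncomputable def hochBoundary {A : Type*} [Ring A] [Algebra ℂ A] (κ : A ≃ₐ[ℂ] A) (n : ℕ) :
    HochChain A (n + 1) →ₗ[ℂ] HochChain A n :=
  PiTensorProduct.lift
    (∑ j : Fin (n + 1), (-1 : ℂ) ^ (j : ℕ) • hochFace j + (-1 : ℂ) ^ (n + 1) • hochLastFace κ n)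

/-- Twisted chains: the elements of `A^{⊗(n+1)}` fixed by `κ ⊗ ⋯ ⊗ κ`. -/
noncomputable def twistedChains {A : Type*} [Ring A] [Algebra ℂ A] (κ : A ≃ₐ[ℂ] A) (n : ℕ) :
    Submodule ℂ (HochChain A n) :=
  LinearMap.ker (PiTensorProduct.map (fun _ => κ.toLinearMap) - LinearMap.id)

/-- Twisted `n`-cycles: the twisted chains killed by `b_κ` (all of them if `n = 0`). -/
noncomputable def twistedCycles {A : Type*} [Ring A] [Algebra ℂ A] (κ : A ≃ₐ[ℂ] A) :
    (n : ℕ) → Submodule ℂ (HochChain A n)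
  | 0 => twistedChains κ 0
  | n + 1 => twistedChains κ (n + 1) ⊓ LinearMap.ker (hochBoundary κ n)

/-- Twisted `n`-boundaries: the image under `b_κ` of the twisted `(n+1)`-chains. -/
noncomputable def twistedBoundaries {A : Type*} [Ring A] [Algebra ℂ A] (κ : A ≃ₐ[ℂ] A) (n : ℕ) :
    Submodule ℂ (HochChain A n) :=
  (twistedChains κ (n + 1)).map (hochBoundary κ n)

/-- The twisted Hochschild homology `HH^κ_n(A)` of the complex of twisted chains. -/
abbrev TwistedHH {A : Type*} [Ring A] [Algebra ℂ A] (κ : A ≃ₐ[ℂ] A) (n : ℕ) : Type _ :=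
  twistedCycles κ n ⧸ (twistedBoundaries κ n).submoduleOf (twistedCycles κ n)

/-- The twisted Hochschild dimension `sup {n | HH^κ_n(A) ≠ 0}`. -/
noncomputable def twistedHochschildDim {A : Type*} [Ring A] [Algebra ℂ A] (κ : A ≃ₐ[ℂ] A) : ℕ∞ :=
  ⨆ n ∈ {n : ℕ | Nontrivial (TwistedHH κ n)}, (n : ℕ∞)



/-- The parameters `0 < q < 1` and `0 ≤ s ≤ 1` of a Podleś sphere. -/
structure PodlesParam where
  q : ℝ
  s : ℝ
  q_pos : 0 < q
  q_lt_one : q < 1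
  s_nonneg : 0 ≤ s
  s_le_one : s ≤ 1

namespace PodlesParam
/-- `q` as complex -/
noncomputable def qc (p : PodlesParam) : ℂ := (p.q : ℂ)
/-- `q^{1/2}` -/
noncomputable def rc (p : PodlesParam) : ℂ := (Real.sqrt p.q : ℂ)
/-- `s` as complex -/
noncomputable def sc (p : PodlesParam) : ℂ := (p.s : ℂ)

theorem qc_ne (p : PodlesParam) : p.qc ≠ 0 := by
  simpa [qc] using p.q_pos.ne'

theorem rc_sq (p : PodlesParam) : p.rc ^ 2 = p.qc := by
  simp only [rc, qc, ← Complex.ofReal_pow, Real.sq_sqrt p.q_pos.le]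

theorem rc_ne (p : PodlesParam) : p.rc ≠ 0 := by
  intro h
  apply p.qc_ne
  rw [← p.rc_sq, h]
  simp

theorem qc_sub_ne (p : PodlesParam) : p.qc - p.qc⁻¹ ≠ 0 := by
  have h : p.q - p.q⁻¹ < 0 := by
    have := (one_lt_inv₀ p.q_pos).2 p.q_lt_one
    have := p.q_lt_one
    linarith
  simp only [qc, ← Complex.ofReal_inv, ← Complex.ofReal_sub]
  exact_mod_cast h.ne
end PodlesParam

/-- The names `A`, `B`, `B^*` of the generators. -/
inductive PodlesGen
  | A | B | Bs

open PodlesGen in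
/-- The relations of `𝒜(S²_{qs})`: `AB = q² BA`, its adjoint `B^*A = q² AB^*`,
`BB^* + (A + s²)(A - 1) = 0` and `B^*B + (q²A + s²)(q²A - 1) = 0`. -/
inductive PodlesRel (p : PodlesParam) :
    FreeAlgebra ℂ PodlesGen → FreeAlgebra ℂ PodlesGen → Prop
  | AB : PodlesRel p (FreeAlgebra.ι ℂ A * FreeAlgebra.ι ℂ B)
      (p.qc ^ 2 • (FreeAlgebra.ι ℂ B * FreeAlgebra.ι ℂ A))
  | BsA : PodlesRel p (FreeAlgebra.ι ℂ Bs * FreeAlgebra.ι ℂ A)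
      (p.qc ^ 2 • (FreeAlgebra.ι ℂ A * FreeAlgebra.ι ℂ Bs))
  | BBs : PodlesRel p (FreeAlgebra.ι ℂ B * FreeAlgebra.ι ℂ Bs
      + (FreeAlgebra.ι ℂ A + algebraMap ℂ _ (p.sc ^ 2)) * (FreeAlgebra.ι ℂ A - 1)) 0
  | BsB : PodlesRel p (FreeAlgebra.ι ℂ Bs * FreeAlgebra.ι ℂ B
      + (p.qc ^ 2 • FreeAlgebra.ι ℂ A + algebraMap ℂ _ (p.sc ^ 2))
        * (p.qc ^ 2 • FreeAlgebra.ι ℂ A - 1)) 0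

/-- The coordinate algebra `𝒜(S²_{qs})` of the Podleś sphere, as a complex algebra. -/
abbrev Podles (p : PodlesParam) : Type := RingQuot (PodlesRel p)

namespace Podles
/-- The generators of `𝒜(S²_{qs})`. -/
noncomputable def gen (p : PodlesParam) (x : PodlesGen) : Podles p :=
  RingQuot.mkAlgHom ℂ (PodlesRel p) (FreeAlgebra.ι ℂ x)

noncomputable abbrev A (p : PodlesParam) : Podles p := gen p .A
noncomputable abbrev B (p : PodlesParam) : Podles p := gen p .B
noncomputable abbrev Bs (p : PodlesParam) : Podles p := gen p .Bs

theorem rel_AB (p : PodlesParam) : A p * B p = p.qc ^ 2 • (B p * A p) := by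
  simpa only [A, B, Bs, gen, map_mul, map_smul] using RingQuot.mkAlgHom_rel ℂ (PodlesRel.AB (p := p))

theorem rel_BsA (p : PodlesParam) : Bs p * A p = p.qc ^ 2 • (A p * Bs p) := by
  simpa only [A, B, Bs, gen, map_mul, map_smul] using RingQuot.mkAlgHom_rel ℂ (PodlesRel.BsA (p := p))

theorem rel_BBs (p : PodlesParam) :
    B p * Bs p + (A p + algebraMap ℂ _ (p.sc ^ 2)) * (A p - 1) = 0 := by
  simpa only [A, B, Bs, gen, map_mul, map_smul, map_add, map_sub, map_one, map_zero,
    AlgHom.commutes] using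
    RingQuot.mkAlgHom_rel ℂ (PodlesRel.BBs (p := p))

theorem rel_BsB (p : PodlesParam) :
    Bs p * B p + (p.qc ^ 2 • A p + algebraMap ℂ _ (p.sc ^ 2)) * (p.qc ^ 2 • A p - 1) = 0 := by
  simpa only [A, B, Bs, gen, map_mul, map_smul, map_add, map_sub, map_one, map_zero,
    AlgHom.commutes] using
    RingQuot.mkAlgHom_rel ℂ (PodlesRel.BsB (p := p))

/-- The universal property. -/
noncomputable def lift (p : PodlesParam) {R : Type*} [Ring R] [Algebra ℂ R] (a b c : R)
    (h1 : a * b = p.qc ^ 2 • (b * a)) (h2 : c * a = p.qc ^ 2 • (a * c))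
    (h3 : b * c + (a + algebraMap ℂ R (p.sc ^ 2)) * (a - 1) = 0)
    (h4 : c * b + (p.qc ^ 2 • a + algebraMap ℂ R (p.sc ^ 2)) * (p.qc ^ 2 • a - 1) = 0) :
    Podles p →ₐ[ℂ] R :=
  RingQuot.liftAlgHom ℂ ⟨FreeAlgebra.lift ℂ (fun x => match x with | .A => a | .B => b | .Bs => c),
    by
      intro x y h
      cases h <;>
      simp only [map_mul, map_smul, map_add, map_sub, map_one, map_zero, AlgHom.commutes,
        FreeAlgebra.lift_ι_apply] <;> assumption⟩

section
variable (p : PodlesParam) {R : Type*} [Ring R] [Algebra ℂ R] (a b c : R)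
    (h1 : a * b = p.qc ^ 2 • (b * a)) (h2 : c * a = p.qc ^ 2 • (a * c))
    (h3 : b * c + (a + algebraMap ℂ R (p.sc ^ 2)) * (a - 1) = 0)
    (h4 : c * b + (p.qc ^ 2 • a + algebraMap ℂ R (p.sc ^ 2)) * (p.qc ^ 2 • a - 1) = 0)

@[simp] theorem lift_A : lift p a b c h1 h2 h3 h4 (A p) = a := by simp [lift, gen]
@[simp] theorem lift_B : lift p a b c h1 h2 h3 h4 (B p) = b := by simp [lift, gen]
@[simp] theorem lift_Bs : lift p a b c h1 h2 h3 h4 (Bs p) = c := by simp [lift, gen]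
end

theorem induction {p : PodlesParam} {P : Podles p → Prop}
    (hs : ∀ c : ℂ, P (algebraMap ℂ _ c)) (hA : P (A p)) (hB : P (B p)) (hBs : P (Bs p))
    (hadd : ∀ x y, P x → P y → P (x + y)) (hmul : ∀ x y, P x → P y → P (x * y))
    (x : Podles p) : P x := by
  obtain ⟨y, rfl⟩ := RingQuot.mkAlgHom_surjective ℂ (PodlesRel p) x
  induction y using FreeAlgebra.induction with
  | grade0 c => simpa using hs c
  | grade1 g => cases g <;> assumption
  | mul a b ha hb => simpa using hmul _ _ ha hb
  | add a b ha hb => simpa using hadd _ _ ha hb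

/-- The algebra map `A ↦ A`, `B ↦ z B`, `B^* ↦ z⁻¹ B^*`. -/
noncomputable def scaleHom (p : PodlesParam) (z : ℂ) (hz : z ≠ 0) : Podles p →ₐ[ℂ] Podles p :=
  lift p (A p) (z • B p) (z⁻¹ • Bs p)
    (by rw [mul_smul_comm, smul_mul_assoc, rel_AB, smul_comm])
    (by rw [mul_smul_comm, smul_mul_assoc, rel_BsA, smul_comm])
    (by rw [smul_mul_smul_comm, mul_inv_cancel₀ hz, one_smul, rel_BBs])
    (by rw [smul_mul_smul_comm, inv_mul_cancel₀ hz, one_smul, rel_BsB])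

@[simp] theorem scaleHom_A (p : PodlesParam) (z : ℂ) (hz : z ≠ 0) :
    scaleHom p z hz (A p) = A p := by simp [scaleHom]
@[simp] theorem scaleHom_B (p : PodlesParam) (z : ℂ) (hz : z ≠ 0) :
    scaleHom p z hz (B p) = z • B p := by simp [scaleHom]
@[simp] theorem scaleHom_Bs (p : PodlesParam) (z : ℂ) (hz : z ≠ 0) :
    scaleHom p z hz (Bs p) = z⁻¹ • Bs p := by simp [scaleHom]

theorem rel_BBs' (p : PodlesParam) : B p * Bs p = 
    - (A p * A p) + (1 - p.sc ^ 2) • A p + p.sc ^ 2 • (1 : Podles p) := by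
  have := rel_BBs p
  rw [Algebra.algebraMap_eq_smul_one] at this
  linear_combination (norm := skip) this
  simp only [add_mul, mul_sub, smul_mul_assoc, one_mul, mul_one]
  module

theorem rel_BsB' (p : PodlesParam) : Bs p * B p = 
    - p.qc ^ 4 • (A p * A p) + (p.qc ^ 2 * (1 - p.sc ^ 2)) • A p + p.sc ^ 2 • (1 : Podles p) := by
  have := rel_BsB p
  rw [Algebra.algebraMap_eq_smul_one] at this
  linear_combination (norm := skip) this
  simp only [add_mul, mul_sub, smul_mul_assoc, mul_smul_comm, one_mul, mul_one]
  module

/-- The algebra map `x ↦ !![K⁻¹ ▷ x, E ▷ x; 0, K ▷ x]`, which encodes the action of `E` on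
products, `E ▷ xy = (E ▷ x)(K ▷ y) + (K⁻¹ ▷ x)(E ▷ y)`. -/
noncomputable def matE (p : PodlesParam) : Podles p →ₐ[ℂ] Matrix (Fin 2) (Fin 2) (Podles p) :=
  lift p
    !![A p, -p.rc⁻¹ • B p; 0, A p]
    !![p.qc⁻¹ • B p, 0; 0, p.qc • B p]
    !![p.qc • Bs p, (p.rc * (1 + p.qc ^ 2)) • A p - (p.rc * (1 - p.sc ^ 2)) • 1; 0, p.qc⁻¹ • Bs p]
    (by
      have hq := p.qc_ne
      have hr := p.rc_ne
      have hrq := p.rc_sq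
      try simp only [Matrix.algebraMap_eq_diagonal]
      ext i j
      fin_cases i <;> fin_cases j <;> simp [Matrix.mul_apply, Fin.sum_univ_two, rel_AB, rel_BsA,
        rel_BBs', rel_BsB', sub_mul, mul_sub, Algebra.algebraMap_eq_smul_one, add_mul, mul_add]
      all_goals match_scalars <;> field_simp
      all_goals try simp only [← hrq]
      all_goals ring)
    (by
      have hq := p.qc_ne
      have hr := p.rc_ne
      have hrq := p.rc_sq
      try simp only [Matrix.algebraMap_eq_diagonal]
      ext i j
      fin_cases i <;> fin_cases j <;> simp [Matrix.mul_apply, Fin.sum_univ_two, rel_AB, rel_BsA,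
        rel_BBs', rel_BsB', sub_mul, mul_sub, Algebra.algebraMap_eq_smul_one, add_mul, mul_add]
      all_goals match_scalars <;> field_simp
      all_goals try simp only [← hrq]
      all_goals ring)
    (by
      have hq := p.qc_ne
      have hr := p.rc_ne
      have hrq := p.rc_sq
      try simp only [Matrix.algebraMap_eq_diagonal]
      ext i j
      fin_cases i <;> fin_cases j <;> simp [Matrix.mul_apply, Fin.sum_univ_two, rel_AB, rel_BsA,
        rel_BBs', rel_BsB', sub_mul, mul_sub, Algebra.algebraMap_eq_smul_one, add_mul, mul_add]
      all_goals match_scalars <;> field_simp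
      all_goals try simp only [← hrq]
      all_goals ring)
    (by
      have hq := p.qc_ne
      have hr := p.rc_ne
      have hrq := p.rc_sq
      try simp only [Matrix.algebraMap_eq_diagonal]
      ext i j
      fin_cases i <;> fin_cases j <;> simp [Matrix.mul_apply, Fin.sum_univ_two, rel_AB, rel_BsA,
        rel_BBs', rel_BsB', sub_mul, mul_sub, Algebra.algebraMap_eq_smul_one, add_mul, mul_add]
      all_goals match_scalars <;> field_simp
      all_goals try simp only [← hrq]
      all_goals ring)

/-- The algebra map `x ↦ !![K⁻¹ ▷ x, F ▷ x; 0, K ▷ x]`, which encodes the action of `F` on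
products, `F ▷ xy = (F ▷ x)(K ▷ y) + (K⁻¹ ▷ x)(F ▷ y)`. -/
noncomputable def matF (p : PodlesParam) : Podles p →ₐ[ℂ] Matrix (Fin 2) (Fin 2) (Podles p) :=
  lift p
    !![A p, (p.rc⁻¹) ^ 3 • Bs p; 0, A p]
    !![p.qc⁻¹ • B p, -(p.rc⁻¹ * (1 + p.qc ^ 2)) • A p + (p.rc⁻¹ * (1 - p.sc ^ 2)) • 1; 0, p.qc • B p]
    !![p.qc • Bs p, 0; 0, p.qc⁻¹ • Bs p]
    (by
      have hq := p.qc_ne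
      have hr := p.rc_ne
      have hrq := p.rc_sq
      try simp only [Matrix.algebraMap_eq_diagonal]
      ext i j
      fin_cases i <;> fin_cases j <;> simp [Matrix.mul_apply, Fin.sum_univ_two, rel_AB, rel_BsA,
        rel_BBs', rel_BsB', sub_mul, mul_sub, Algebra.algebraMap_eq_smul_one, add_mul, mul_add]
      all_goals match_scalars <;> field_simp
      all_goals try simp only [← hrq]
      all_goals ring)
    (by
      have hq := p.qc_ne
      have hr := p.rc_ne
      have hrq := p.rc_sq
      try simp only [Matrix.algebraMap_eq_diagonal]
      ext i j
      fin_cases i <;> fin_cases j <;> simp [Matrix.mul_apply, Fin.sum_univ_two, rel_AB, rel_BsA,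
        rel_BBs', rel_BsB', sub_mul, mul_sub, Algebra.algebraMap_eq_smul_one, add_mul, mul_add]
      all_goals match_scalars <;> field_simp
      all_goals try simp only [← hrq]
      all_goals ring)
    (by
      have hq := p.qc_ne
      have hr := p.rc_ne
      have hrq := p.rc_sq
      try simp only [Matrix.algebraMap_eq_diagonal]
      ext i j
      fin_cases i <;> fin_cases j <;> simp [Matrix.mul_apply, Fin.sum_univ_two, rel_AB, rel_BsA,
        rel_BBs', rel_BsB', sub_mul, mul_sub, Algebra.algebraMap_eq_smul_one, add_mul, mul_add]
      all_goals match_scalars <;> field_simp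
      all_goals try simp only [← hrq]
      all_goals ring)
    (by
      have hq := p.qc_ne
      have hr := p.rc_ne
      have hrq := p.rc_sq
      try simp only [Matrix.algebraMap_eq_diagonal]
      ext i j
      fin_cases i <;> fin_cases j <;> simp [Matrix.mul_apply, Fin.sum_univ_two, rel_AB, rel_BsA,
        rel_BBs', rel_BsB', sub_mul, mul_sub, Algebra.algebraMap_eq_smul_one, add_mul, mul_add]
      all_goals match_scalars <;> field_simp
      all_goals try simp only [← hrq]
      all_goals ring)

/-- `K ▷ ·`: `A ↦ A`, `B ↦ qB`, `B^* ↦ q⁻¹B^*`. -/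
noncomputable abbrev actK (p : PodlesParam) : Podles p →ₐ[ℂ] Podles p := scaleHom p p.qc p.qc_ne
/-- `K⁻¹ ▷ ·`: `A ↦ A`, `B ↦ q⁻¹B`, `B^* ↦ q B^*`. -/
noncomputable abbrev actKi (p : PodlesParam) : Podles p →ₐ[ℂ] Podles p :=
  scaleHom p p.qc⁻¹ (inv_ne_zero p.qc_ne)

/-- `E ▷ ·`: `E ▷ A = -q^{-1/2} B`, `E ▷ B = 0`, `E ▷ B^* = q^{1/2}((1 + q²) A - (1 - s²))`. -/
noncomputable def actE (p : PodlesParam) : Module.End ℂ (Podles p) :=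
  Matrix.entryLinearMap ℂ (Podles p) 0 1 ∘ₗ (matE p).toLinearMap

/-- `F ▷ ·`: `F ▷ A = q^{-3/2} B^*`, `F ▷ B = -q^{-1/2}((1 + q²) A - (1 - s²))`, `F ▷ B^* = 0`. -/
noncomputable def actF (p : PodlesParam) : Module.End ℂ (Podles p) :=
  Matrix.entryLinearMap ℂ (Podles p) 0 1 ∘ₗ (matF p).toLinearMap

theorem matE_eq (p : PodlesParam) (x : Podles p) :
    matE p x = !![actKi p x, actE p x; 0, actK p x] := by
  induction x using Podles.induction with
  | hs c => 
    ext i j; fin_cases i <;> fin_cases j <;> simp [actE, Matrix.algebraMap_eq_diagonal]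
  | hA => ext i j; fin_cases i <;> fin_cases j <;> simp [actE, matE]
  | hB => ext i j; fin_cases i <;> fin_cases j <;> simp [actE, matE]
  | hBs => ext i j; fin_cases i <;> fin_cases j <;> simp [actE, matE]
  | hadd x y hx hy =>
    rw [map_add, hx, hy]
    ext i j; fin_cases i <;> fin_cases j <;> simp
  | hmul x y hx hy =>
    have h : actE p (x * y) = (matE p x * matE p y) 0 1 := by simp [actE]
    rw [map_mul, h, hx, hy]
    ext i j; fin_cases i <;> fin_cases j <;> simp [Matrix.mul_apply]

theorem matF_eq (p : PodlesParam) (x : Podles p) :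
    matF p x = !![actKi p x, actF p x; 0, actK p x] := by
  induction x using Podles.induction with
  | hs c => 
    ext i j; fin_cases i <;> fin_cases j <;> simp [actF, Matrix.algebraMap_eq_diagonal]
  | hA => ext i j; fin_cases i <;> fin_cases j <;> simp [actF, matF]
  | hB => ext i j; fin_cases i <;> fin_cases j <;> simp [actF, matF]
  | hBs => ext i j; fin_cases i <;> fin_cases j <;> simp [actF, matF]
  | hadd x y hx hy =>
    rw [map_add, hx, hy]
    ext i j; fin_cases i <;> fin_cases j <;> simp
  | hmul x y hx hy =>
    have h : actF p (x * y) = (matF p x * matF p y) 0 1 := by simp [actF]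
    rw [map_mul, h, hx, hy]
    ext i j; fin_cases i <;> fin_cases j <;> simp [Matrix.mul_apply]

theorem actE_mul (p : PodlesParam) (x y : Podles p) :
    actE p (x * y) = actE p x * actK p y + actKi p x * actE p y := by
  have h : actE p (x * y) = (matE p x * matE p y) 0 1 := by simp [actE]
  rw [h, matE_eq, matE_eq]
  simp [Matrix.mul_apply, add_comm]

theorem actF_mul (p : PodlesParam) (x y : Podles p) :
    actF p (x * y) = actF p x * actK p y + actKi p x * actF p y := by
  have h : actF p (x * y) = (matF p x * matF p y) 0 1 := by simp [actF]
  rw [h, matF_eq, matF_eq]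
  simp [Matrix.mul_apply, add_comm]

@[simp] theorem actE_scalar (p : PodlesParam) (c : ℂ) : actE p (algebraMap ℂ _ c) = 0 := by
  simp [actE, Matrix.algebraMap_eq_diagonal]
@[simp] theorem actE_one (p : PodlesParam) : actE p 1 = 0 := by
  simp [actE]
@[simp] theorem actE_A (p : PodlesParam) : actE p (A p) = -p.rc⁻¹ • B p := by
  simp [actE, matE]
@[simp] theorem actE_B (p : PodlesParam) : actE p (B p) = 0 := by
  simp [actE, matE]
@[simp] theorem actE_Bs (p : PodlesParam) : actE p (Bs p) =
    (p.rc * (1 + p.qc ^ 2)) • A p - (p.rc * (1 - p.sc ^ 2)) • 1 := by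
  simp [actE, matE]
@[simp] theorem actF_scalar (p : PodlesParam) (c : ℂ) : actF p (algebraMap ℂ _ c) = 0 := by
  simp [actF, Matrix.algebraMap_eq_diagonal]
@[simp] theorem actF_one (p : PodlesParam) : actF p 1 = 0 := by
  simp [actF]
@[simp] theorem actF_A (p : PodlesParam) : actF p (A p) = (p.rc⁻¹) ^ 3 • Bs p := by
  simp [actF, matF]
@[simp] theorem actF_B (p : PodlesParam) : actF p (B p) =
    -(p.rc⁻¹ * (1 + p.qc ^ 2)) • A p + (p.rc⁻¹ * (1 - p.sc ^ 2)) • 1 := by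
  simp [actF, matF]
@[simp] theorem actF_Bs (p : PodlesParam) : actF p (Bs p) = 0 := by
  simp [actF, matF]

theorem actK_actKi (p : PodlesParam) (x : Podles p) : actK p (actKi p x) = x := by
  have hq := p.qc_ne
  induction x using Podles.induction with
  | hs c => simp
  | hA => simp
  | hB => simp [smul_smul, hq]
  | hBs => simp [smul_smul, hq]
  | hadd x y hx hy => simp only [map_add, hx, hy]
  | hmul x y hx hy => simp only [map_mul, hx, hy]

theorem actKi_actK (p : PodlesParam) (x : Podles p) : actKi p (actK p x) = x := by
  have hq := p.qc_ne
  induction x using Podles.induction with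
  | hs c => simp
  | hA => simp
  | hB => simp [smul_smul, hq]
  | hBs => simp [smul_smul, hq]
  | hadd x y hx hy => simp only [map_add, hx, hy]
  | hmul x y hx hy => simp only [map_mul, hx, hy]

theorem actK_actE (p : PodlesParam) (x : Podles p) :
    actK p (actE p x) = p.qc • actE p (actK p x) := by
  have hq := p.qc_ne
  induction x using Podles.induction with
  | hs c => simp
  | hA => simp [smul_smul, mul_comm]
  | hB => simp
  | hBs => simp [smul_smul, hq]
  | hadd x y hx hy => simp only [map_add, hx, hy, smul_add]
  | hmul x y hx hy =>
    simp only [map_mul, actE_mul, map_add, hx, hy, smul_add, actK_actKi, actKi_actK,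
      smul_mul_assoc, mul_smul_comm]

theorem actK_actF (p : PodlesParam) (x : Podles p) :
    actK p (actF p x) = p.qc⁻¹ • actF p (actK p x) := by
  have hq := p.qc_ne
  induction x using Podles.induction with
  | hs c => simp
  | hA => simp [smul_smul, mul_comm]
  | hB =>
    simp [smul_smul, hq]
    module
  | hBs => simp
  | hadd x y hx hy => simp only [map_add, hx, hy, smul_add]
  | hmul x y hx hy =>
    simp only [map_mul, actF_mul, map_add, hx, hy, smul_add, actK_actKi, actKi_actK,
      smul_mul_assoc, mul_smul_comm]

theorem actE_actKi (p : PodlesParam) (x : Podles p) :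
    actE p (actKi p x) = p.qc • actKi p (actE p x) := by
  have h := congrArg (actKi p) (actK_actE p (actKi p x))
  rw [actKi_actK, actK_actKi, map_smul] at h
  exact h

theorem actF_actKi (p : PodlesParam) (x : Podles p) :
    actF p (actKi p x) = p.qc⁻¹ • actKi p (actF p x) := by
  have h := congrArg (actKi p) (actK_actF p (actKi p x))
  rw [actKi_actK, actK_actKi, map_smul] at h
  exact h

theorem actE_actF (p : PodlesParam) (x : Podles p) :
    actE p (actF p x) - actF p (actE p x) =
      (p.qc - p.qc⁻¹)⁻¹ • (actK p (actK p x) - actKi p (actKi p x)) := by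
  have hq := p.qc_ne
  have hr := p.rc_ne
  have hrq := p.rc_sq
  have hqq := p.qc_sub_ne
  induction x using Podles.induction with
  | hs c => simp
  | hA => 
    simp
    match_scalars <;> field_simp <;> (try simp only [← hrq]) <;> ring
  | hB =>
    have h2 : p.qc ^ 2 - 1 ≠ 0 := by
      intro h
      apply hqq
      field_simp
      simpa using h
    simp [smul_smul]
    match_scalars 
    field_simp
    simp only [← hrq]
    ring
  | hBs => 
    have h2 : p.qc ^ 2 - 1 ≠ 0 := by
      intro h
      apply hqq
      field_simp
      simpa using h
    simp [smul_smul]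
    match_scalars 
    field_simp
    simp only [← hrq]
    ring
  | hadd x y hx hy =>
    simp only [map_add] 
    linear_combination (norm := module) hx + hy
  | hmul x y hx hy =>
    have e1 : actE p (actF p x) = (p.qc - p.qc⁻¹)⁻¹ • (actK p (actK p x) - actKi p (actKi p x)) + actF p (actE p x) := by rw [← hx]; abel
    have e2 : actE p (actF p y) = (p.qc - p.qc⁻¹)⁻¹ • (actK p (actK p y) - actKi p (actKi p y)) + actF p (actE p y) := by rw [← hy]; abel
    simp only [map_mul, actF_mul, actE_mul, map_add, actK_actE, actK_actF, actE_actKi, actF_actKi, e1, e2, smul_mul_assoc, mul_smul_comm, add_mul, mul_add, sub_mul, mul_sub, smul_sub, smul_smul]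
    match_scalars <;> field_simp <;> ring
end Podles


/-- The names `K`, `K⁻¹`, `E`, `F` of the generators. -/
inductive UqGen
  | K | Ki | E | F

open UqGen in
/-- The relations of `U_q(su(2))`: `KK⁻¹ = K⁻¹K = 1`, `KE = qEK`, `KF = q⁻¹FK`,
`EF - FE = (K² - K⁻²)/(q - q⁻¹)`. -/
inductive UqRel (p : PodlesParam) : FreeAlgebra ℂ UqGen → FreeAlgebra ℂ UqGen → Prop
  | KKi : UqRel p (FreeAlgebra.ι ℂ K * FreeAlgebra.ι ℂ Ki) 1
  | KiK : UqRel p (FreeAlgebra.ι ℂ Ki * FreeAlgebra.ι ℂ K) 1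
  | KE : UqRel p (FreeAlgebra.ι ℂ K * FreeAlgebra.ι ℂ E)
      (p.qc • (FreeAlgebra.ι ℂ E * FreeAlgebra.ι ℂ K))
  | KF : UqRel p (FreeAlgebra.ι ℂ K * FreeAlgebra.ι ℂ F)
      (p.qc⁻¹ • (FreeAlgebra.ι ℂ F * FreeAlgebra.ι ℂ K))
  | EF : UqRel p (FreeAlgebra.ι ℂ E * FreeAlgebra.ι ℂ F - FreeAlgebra.ι ℂ F * FreeAlgebra.ι ℂ E)
      ((p.qc - p.qc⁻¹)⁻¹ • (FreeAlgebra.ι ℂ K * FreeAlgebra.ι ℂ K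
        - FreeAlgebra.ι ℂ Ki * FreeAlgebra.ι ℂ Ki))

/-- The algebra `U_q(su(2))`. -/
abbrev Uq (p : PodlesParam) : Type := RingQuot (UqRel p)

theorem map_vec3 {M N : Type*} [AddCommGroup M] [Module ℂ M] [AddCommGroup N] [Module ℂ N]
    (f : MultilinearMap ℂ (fun _ : Fin 3 => M) N) (x y z w : M) (c : ℂ) :
    (f ![x + w, y, z] = f ![x, y, z] + f ![w, y, z] ∧ f ![c • x, y, z] = c • f ![x, y, z]) ∧
    (f ![x, y + w, z] = f ![x, y, z] + f ![x, w, z] ∧ f ![x, c • y, z] = c • f ![x, y, z]) ∧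
    (f ![x, y, z + w] = f ![x, y, z] + f ![x, y, w] ∧ f ![x, y, c • z] = c • f ![x, y, z]) := by
  have u0 : ∀ v, Function.update ![x, y, z] 0 v = ![v, y, z] := by
    intro v
    funext i
    fin_cases i <;> rfl
  have u1 : ∀ v, Function.update ![x, y, z] 1 v = ![x, v, z] := by
    intro v
    funext i
    fin_cases i <;> rfl
  have u2 : ∀ v, Function.update ![x, y, z] 2 v = ![x, y, v] := by
    intro v
    funext i
    fin_cases i <;> rfl
  have a0 := f.map_update_add ![x, y, z] 0 x w
  have a1 := f.map_update_add ![x, y, z] 1 y w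
  have a2 := f.map_update_add ![x, y, z] 2 z w
  have s0 := f.map_update_smul ![x, y, z] 0 c x
  have s1 := f.map_update_smul ![x, y, z] 1 c y
  have s2 := f.map_update_smul ![x, y, z] 2 c z
  simp only [u0, u1, u2] at a0 a1 a2 s0 s1 s2
  exact ⟨⟨a0, s0⟩, ⟨a1, s1⟩, ⟨a2, s2⟩⟩

/-- The linear map on `(M ⊗ M) ⊗ M` given by a trilinear map. -/
noncomputable def linearOfTrilinear {M N : Type*} [AddCommGroup M] [Module ℂ M] [AddCommGroup N]
    [Module ℂ N] (f : MultilinearMap ℂ (fun _ : Fin 3 => M) N) : (M ⊗[ℂ] M) ⊗[ℂ] M →ₗ[ℂ] N :=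
  TensorProduct.lift (TensorProduct.lift (LinearMap.mk₂ ℂ
    (fun x y =>
      { toFun := fun z => f ![x, y, z]
        map_add' := fun z w => (map_vec3 f x y z w 0).2.2.1
        map_smul' := fun c z => (map_vec3 f x y z 0 c).2.2.2 })
    (fun x w y => LinearMap.ext fun z => (map_vec3 f x y z w 0).1.1)
    (fun c x y => LinearMap.ext fun z => (map_vec3 f x y z 0 c).1.2)
    (fun x y w => LinearMap.ext fun z => (map_vec3 f x y z w 0).2.1.1)
    (fun c x y => LinearMap.ext fun z => (map_vec3 f x y z 0 c).2.1.2)))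

namespace Uq

/-- The generators of `U_q(su(2))`. -/
noncomputable def gen (p : PodlesParam) (x : UqGen) : Uq p :=
  RingQuot.mkAlgHom ℂ (UqRel p) (FreeAlgebra.ι ℂ x)

noncomputable abbrev K (p : PodlesParam) : Uq p := gen p .K
noncomputable abbrev Ki (p : PodlesParam) : Uq p := gen p .Ki
noncomputable abbrev E (p : PodlesParam) : Uq p := gen p .E
noncomputable abbrev F (p : PodlesParam) : Uq p := gen p .F

theorem rel_KKi (p : PodlesParam) : K p * Ki p = 1 := by
  simpa only [K, Ki, gen, map_mul, map_one] using RingQuot.mkAlgHom_rel ℂ (UqRel.KKi (p := p))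
theorem rel_KiK (p : PodlesParam) : Ki p * K p = 1 := by
  simpa only [K, Ki, gen, map_mul, map_one] using RingQuot.mkAlgHom_rel ℂ (UqRel.KiK (p := p))
theorem rel_KE (p : PodlesParam) : K p * E p = p.qc • (E p * K p) := by
  simpa only [K, E, gen, map_mul, map_smul] using RingQuot.mkAlgHom_rel ℂ (UqRel.KE (p := p))
theorem rel_KF (p : PodlesParam) : K p * F p = p.qc⁻¹ • (F p * K p) := by
  simpa only [K, F, gen, map_mul, map_smul] using RingQuot.mkAlgHom_rel ℂ (UqRel.KF (p := p))
theorem rel_EF (p : PodlesParam) : E p * F p - F p * E p =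
    (p.qc - p.qc⁻¹)⁻¹ • (K p * K p - Ki p * Ki p) := by
  simpa only [K, Ki, E, F, gen, map_mul, map_smul, map_sub] using
    RingQuot.mkAlgHom_rel ℂ (UqRel.EF (p := p))

theorem rel_EKi (p : PodlesParam) : E p * Ki p = p.qc • (Ki p * E p) := by
  calc E p * Ki p = Ki p * (K p * E p) * Ki p := by rw [← mul_assoc, rel_KiK, one_mul]
    _ = p.qc • (Ki p * E p * (K p * Ki p)) := by
      rw [rel_KE, mul_smul_comm, smul_mul_assoc]; simp only [mul_assoc]
    _ = _ := by rw [rel_KKi, mul_one]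

theorem rel_FKi (p : PodlesParam) : F p * Ki p = p.qc⁻¹ • (Ki p * F p) := by
  calc F p * Ki p = Ki p * (K p * F p) * Ki p := by rw [← mul_assoc, rel_KiK, one_mul]
    _ = p.qc⁻¹ • (Ki p * F p * (K p * Ki p)) := by
      rw [rel_KF, mul_smul_comm, smul_mul_assoc]; simp only [mul_assoc]
    _ = _ := by rw [rel_KKi, mul_one]

/-- The universal property. -/
noncomputable def lift (p : PodlesParam) {R : Type*} [Ring R] [Algebra ℂ R] (k ki e f : R)
    (h1 : k * ki = 1) (h2 : ki * k = 1) (h3 : k * e = p.qc • (e * k))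
    (h4 : k * f = p.qc⁻¹ • (f * k))
    (h5 : e * f - f * e = (p.qc - p.qc⁻¹)⁻¹ • (k * k - ki * ki)) : Uq p →ₐ[ℂ] R :=
  RingQuot.liftAlgHom ℂ ⟨FreeAlgebra.lift ℂ
      (fun x => match x with | .K => k | .Ki => ki | .E => e | .F => f), by
    intro x y h
    cases h <;>
    simp only [map_mul, map_smul, map_sub, map_one, FreeAlgebra.lift_ι_apply] <;> assumption⟩

section
variable (p : PodlesParam) {R : Type*} [Ring R] [Algebra ℂ R] (k ki e f : R)
    (h1 : k * ki = 1) (h2 : ki * k = 1) (h3 : k * e = p.qc • (e * k))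
    (h4 : k * f = p.qc⁻¹ • (f * k))
    (h5 : e * f - f * e = (p.qc - p.qc⁻¹)⁻¹ • (k * k - ki * ki))

@[simp] theorem lift_K : lift p k ki e f h1 h2 h3 h4 h5 (K p) = k := by simp [lift, gen]
@[simp] theorem lift_Ki : lift p k ki e f h1 h2 h3 h4 h5 (Ki p) = ki := by simp [lift, gen]
@[simp] theorem lift_E : lift p k ki e f h1 h2 h3 h4 h5 (E p) = e := by simp [lift, gen]
@[simp] theorem lift_F : lift p k ki e f h1 h2 h3 h4 h5 (F p) = f := by simp [lift, gen]
end

/-- The counit `ε(K) = 1`, `ε(E) = ε(F) = 0`. -/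
noncomputable def counit (p : PodlesParam) : Uq p →ₐ[ℂ] ℂ :=
  lift p 1 1 0 0 (by simp) (by simp) (by simp) (by simp) (by simp)

/-- The coproduct `Δ K = K ⊗ K`, `Δ E = E ⊗ K + K⁻¹ ⊗ E`, `Δ F = F ⊗ K + K⁻¹ ⊗ F`. -/
noncomputable def comul (p : PodlesParam) : Uq p →ₐ[ℂ] Uq p ⊗[ℂ] Uq p :=
  lift p (R := Uq p ⊗[ℂ] Uq p) (K p ⊗ₜ[ℂ] K p) (Ki p ⊗ₜ[ℂ] Ki p)
    (E p ⊗ₜ[ℂ] K p + Ki p ⊗ₜ[ℂ] E p) (F p ⊗ₜ[ℂ] K p + Ki p ⊗ₜ[ℂ] F p)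
    (by simp [rel_KKi, Algebra.TensorProduct.one_def])
    (by simp [rel_KiK, Algebra.TensorProduct.one_def])
    (by
      simp only [mul_add, add_mul, Algebra.TensorProduct.tmul_mul_tmul, rel_KE, rel_KKi, rel_KiK,
        smul_add, TensorProduct.smul_tmul', TensorProduct.tmul_smul])
    (by
      simp only [mul_add, add_mul, Algebra.TensorProduct.tmul_mul_tmul, rel_KF, rel_KKi, rel_KiK,
        smul_add, TensorProduct.smul_tmul', TensorProduct.tmul_smul])
    (by
      have hq := p.qc_ne
      have e1 : E p * F p = F p * E p + (p.qc - p.qc⁻¹)⁻¹ • (K p * K p - Ki p * Ki p) := by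
        rw [← rel_EF]; abel
      simp only [mul_add, add_mul, Algebra.TensorProduct.tmul_mul_tmul, rel_KE, rel_KF, rel_EKi,
        rel_FKi, e1, smul_add, smul_sub, TensorProduct.tmul_smul, TensorProduct.add_tmul,
        TensorProduct.tmul_add, TensorProduct.sub_tmul, TensorProduct.tmul_sub,
        ← TensorProduct.smul_tmul']
      match_scalars <;> field_simp <;> ring)

/-- The left action `▷` of `U_q(su(2))` on `𝒜(S²_{qs})`. -/
noncomputable def act (p : PodlesParam) : Uq p →ₐ[ℂ] Module.End ℂ (Podles p) :=
  lift p (Podles.actK p).toLinearMap (Podles.actKi p).toLinearMap (Podles.actE p) (Podles.actF p)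
    (LinearMap.ext fun x => Podles.actK_actKi p x)
    (LinearMap.ext fun x => Podles.actKi_actK p x)
    (LinearMap.ext fun x => Podles.actK_actE p x)
    (LinearMap.ext fun x => Podles.actK_actF p x)
    (LinearMap.ext fun x => Podles.actE_actF p x)

/-- `h ⊗ h' ⊗ h'' ↦ (x ⊗ y ⊗ z ↦ (h ▷ x) ⊗ (h' ▷ y) ⊗ (h'' ▷ z))`. -/
noncomputable def tensorAct (p : PodlesParam) :
    (Uq p ⊗[ℂ] Uq p) ⊗[ℂ] Uq p →ₗ[ℂ] Module.End ℂ (HochChain (Podles p) 2) :=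
  linearOfTrilinear ((PiTensorProduct.mapMultilinear ℂ (fun _ : Fin 3 => Podles p)
    (fun _ => Podles p)).compLinearMap (fun _ => (act p).toLinearMap))

/-- `h ▷ (x ⊗ y ⊗ z) = (h₍₁₎ ▷ x) ⊗ (h₍₂₎ ▷ y) ⊗ (h₍₃₎ ▷ z)`. -/
noncomputable def actTensor (p : PodlesParam) :
    Uq p →ₗ[ℂ] Module.End ℂ (HochChain (Podles p) 2) :=
  tensorAct p ∘ₗ LinearMap.rTensor (Uq p) (comul p).toLinearMap ∘ₗ (comul p).toLinearMap

end Uq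

namespace Podles

/-- The modular automorphism `κ(a) = K² ▷ a`, i.e. `A ↦ A`, `B ↦ q²B`, `B^* ↦ q⁻²B^*`. -/
noncomputable def modular (p : PodlesParam) : Podles p ≃ₐ[ℂ] Podles p :=
  AlgEquiv.ofAlgHom ((actK p).comp (actK p)) ((actKi p).comp (actKi p))
    (AlgHom.ext fun x => by simp only [AlgHom.comp_apply, actK_actKi, AlgHom.id_apply])
    (AlgHom.ext fun x => by simp only [AlgHom.comp_apply, actKi_actK, AlgHom.id_apply])

theorem modular_apply (p : PodlesParam) (x : Podles p) :
    modular p x = Uq.act p (Uq.K p ^ 2) x := by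
  rw [map_pow, Uq.act, Uq.lift_K]
  rfl

/-- The idempotent `e_s = (1 + s²)⁻¹ !![s² + A, q B; q⁻¹ B^*, 1 - q² A]`. -/
noncomputable def bott (p : PodlesParam) : Matrix (Fin 2) (Fin 2) (Podles p) :=
  (1 + p.sc ^ 2)⁻¹ • !![algebraMap ℂ _ (p.sc ^ 2) + A p, p.qc • B p;
    p.qc⁻¹ • Bs p, 1 - p.qc ^ 2 • A p]

/-- The matrix `η = diag(q, q⁻¹)`. -/
noncomputable def eta (p : PodlesParam) : Matrix (Fin 2) (Fin 2) ℂ := !![p.qc, 0; 0, p.qc⁻¹]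

/-- `γ_s = 2 e_s - 1`. -/
noncomputable def gammaS (p : PodlesParam) : Matrix (Fin 2) (Fin 2) (Podles p) := 2 • bott p - 1

/-- `ω₂ = ⅛ ∑_{ijkl} η_{ij} (γ_s)_{jk} ⊗ (1 + γ_s)_{kl} ⊗ (1 - γ_s)_{li}`. -/
noncomputable def omega₂ (p : PodlesParam) : HochChain (Podles p) 2 :=
  (1 / 8 : ℂ) • ∑ i, ∑ j, ∑ k, ∑ l, eta p i j •
    PiTensorProduct.tprod ℂ ![gammaS p j k, (1 + gammaS p) k l, (1 - gammaS p) l i]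

end Podles

/-- The `q`-number `[x] = (q^x - q^{-x})/(q - q⁻¹)`. -/
noncomputable def qNum (q x : ℝ) : ℝ := (q ^ x - q ^ (-x)) / (q - q⁻¹)

/-- The pairs `(2l, 2m)` with `l - a/2 ∈ ℕ` and `m ∈ {-l, -l + 1, …, l}`, where `a = 2|N|`.
All half integers are stored doubled. -/
abbrev SpinIdx (a : ℕ) : Type :=
  {x : ℤ × ℤ // (a : ℤ) ≤ x.1 ∧ 2 ∣ x.1 - a ∧ |x.2| ≤ x.1 ∧ 2 ∣ x.1 - x.2}

/-- The Hilbert space `ℋ = ℋ_{-N} ⊕ ℋ_N`, with `n = 2N`; `ℋ_{±N}` has the orthonormal basis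
`|l,m;±N⟩`, `l = |N|, |N| + 1, …`, `m = -l, …, l`. The value `true` of the second index marks
`ℋ_{-N}` (where the grading is `+1`), the value `false` marks `ℋ_N`. -/
abbrev SpinorSpace (n : ℤ) : Type := lp (fun _ : SpinIdx n.natAbs × Bool => ℂ) 2

/-- The operator `(v_i) ↦ (c_i v_{e(i)})` on `ℓ²(ι)`, where `|c_i| = 1`. -/
noncomputable def lpSignedPerm {ι : Type*} (e : ι ≃ ι) (c : ι → ℂ) (hc : ∀ i, ‖c i‖ = 1) :
    lp (fun _ : ι => ℂ) 2 →L[ℂ] lp (fun _ : ι => ℂ) 2 :=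
  LinearMap.mkContinuous
    { toFun := fun v => ⟨fun i => c i * v (e i), by
        have h := lp.memℓp v
        rw [memℓp_gen_iff (by norm_num)] at h
        exact (memℓp_gen_iff (by norm_num)).2 (by simpa [hc, Function.comp_def] using (Equiv.summable_iff e).2 h)⟩
      map_add' := fun v w => by
        ext i
        exact mul_add _ _ _
      map_smul' := fun a v => by
        ext i
        exact mul_left_comm _ _ _ } 1
    (fun v => by
      rw [one_mul]
      apply le_of_eq
      rw [lp.norm_eq_tsum_rpow (by norm_num), lp.norm_eq_tsum_rpow (by norm_num)]
      congr 1
      simpa [hc] using Equiv.tsum_eq e (fun i => ‖v i‖ ^ (2 : ℝ)))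

/-- The operator `F`, which exchanges `|l,m;N⟩` and `|l,m;-N⟩`. -/
noncomputable def spinF (n : ℤ) : SpinorSpace n →L[ℂ] SpinorSpace n :=
  lpSignedPerm ((Equiv.refl _).prodCongr Equiv.boolNot) (fun _ => 1) (by simp)

/-- The grading `γ`, `+1` on `ℋ_{-N}` and `-1` on `ℋ_N`. -/
noncomputable def spinGamma (n : ℤ) : SpinorSpace n →L[ℂ] SpinorSpace n :=
  lpSignedPerm (Equiv.refl _) (fun i => if i.2 then 1 else -1) (by intro i; split_ifs <;> simp)

theorem spinF_apply (n : ℤ) (v : SpinorSpace n) (x : SpinIdx n.natAbs) (b : Bool) :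
    spinF n v (x, b) = v (x, !b) := one_mul _

theorem spinGamma_apply (n : ℤ) (v : SpinorSpace n) (x : SpinIdx n.natAbs) (b : Bool) :
    spinGamma n v (x, b) = if b then v (x, b) else -v (x, b) := by
  change (if b then (1 : ℂ) else -1) * v (x, b) = _
  split_ifs <;> simp

/-- The basis vector `|L/2, M/2; ∓N⟩` (`-N` for `b = true`, `N` for `b = false`); it is `0` if
`(L, M)` is out of range. -/
noncomputable def spinKet (n : ℤ) (b : Bool) (L M : ℤ) : SpinorSpace n :=
  if h : (n.natAbs : ℤ) ≤ L ∧ 2 ∣ L - n.natAbs ∧ |M| ≤ L ∧ 2 ∣ L - M then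
    lp.single 2 ((⟨(L, M), h⟩ : SpinIdx n.natAbs), b) (1 : ℂ)
  else 0

namespace PodlesParam
/-- `[x]`. -/
noncomputable def num (p : PodlesParam) (x : ℝ) : ℝ := qNum p.q x

/-- `α_N(l) = [2l]⁻¹ √([2][l+N][l-N] / ([2l-1][2l+1]))
  √((q^{l+N} + q^{-l-N}s²)(q^{l-N}s² + q^{-l+N}))`; it vanishes at `l = |N|`. -/
noncomputable def alpha (p : PodlesParam) (N l : ℝ) : ℝ :=
  1 / p.num (2 * l) *
    √(p.num 2 * p.num (l + N) * p.num (l - N) / (p.num (2 * l - 1) * p.num (2 * l + 1))) *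
    √((p.q ^ (l + N) + p.q ^ (-(l + N)) * p.s ^ 2) * (p.q ^ (l - N) * p.s ^ 2 + p.q ^ (-(l - N))))

/-- `β_N(l) = (([2l] - q^{l+N+1}[2][l-N])(1 - s²) + q[2][2N]s²) / (q²[2l][2l+2])`. -/
noncomputable def beta (p : PodlesParam) (N l : ℝ) : ℝ :=
  ((p.num (2 * l) - p.q ^ (l + N + 1) * p.num 2 * p.num (l - N)) * (1 - p.s ^ 2)
    + p.q * p.num 2 * p.num (2 * N) * p.s ^ 2) / (p.q ^ 2 * p.num (2 * l) * p.num (2 * l + 2))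

/-- `A^+_{l,m} = q^m √([2][l-m+1][l+m+1]) α_N(l+1)`. -/
noncomputable def cAp (p : PodlesParam) (N l m : ℝ) : ℝ :=
  p.q ^ m * √(p.num 2 * p.num (l - m + 1) * p.num (l + m + 1)) * p.alpha N (l + 1)

/-- `A^0_{l,m} = ([2l] - q^{l+m+1}[2][l-m]) β_N(l)`. -/
noncomputable def cA0 (p : PodlesParam) (N l m : ℝ) : ℝ :=
  (p.num (2 * l) - p.q ^ (l + m + 1) * p.num 2 * p.num (l - m)) * p.beta N l

/-- `B^+_{l,m} = q^{-l+m} √([l+m+1][l+m+2]) α_N(l+1)`. -/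
noncomputable def cBp (p : PodlesParam) (N l m : ℝ) : ℝ :=
  p.q ^ (-l + m) * √(p.num (l + m + 1) * p.num (l + m + 2)) * p.alpha N (l + 1)

/-- `B^0_{l,m} = -q^{m+2} √([2][l-m][l+m+1]) β_N(l)`. -/
noncomputable def cB0 (p : PodlesParam) (N l m : ℝ) : ℝ :=
  -(p.q ^ (m + 2)) * √(p.num 2 * p.num (l - m) * p.num (l + m + 1)) * p.beta N l

/-- `B^-_{l,m} = -q^{l+m+1} √([l-m][l-m-1]) α_N(l)`. -/
noncomputable def cBm (p : PodlesParam) (N l m : ℝ) : ℝ :=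
  -(p.q ^ (l + m + 1)) * √(p.num (l - m) * p.num (l - m - 1)) * p.alpha N l
end PodlesParam

namespace Podles

/-- `x₁ = √(q[2]) B`. -/
noncomputable def x₁ (p : PodlesParam) : Podles p := ((√(p.q * p.num 2) : ℝ) : ℂ) • B p
/-- `x₀ = -q[2] A + 1 - s²`. -/
noncomputable def x₀ (p : PodlesParam) : Podles p :=
  -((p.q * p.num 2 : ℝ) : ℂ) • A p + (1 - p.sc ^ 2) • 1
/-- `x₋₁ = -q⁻¹ x₁^* = -q⁻¹ √(q[2]) B^*`. -/
noncomputable def xm₁ (p : PodlesParam) : Podles p :=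
  -p.qc⁻¹ • ((√(p.q * p.num 2) : ℝ) : ℂ) • Bs p

/-- The label `-N` (for `true`) or `N` (for `false`), where `n = 2N`. -/
noncomputable def label (n : ℤ) (b : Bool) : ℝ := if b then -((n : ℝ) / 2) else (n : ℝ) / 2

/-- `π` is the representation of `𝒜(S²_{qs})` on `ℋ_{-N} ⊕ ℋ_N` by bounded operators that is given
by (with the coefficients of the respective label `∓N`)
`x₁|l,m⟩ = B^+_{l,m}|l+1,m+1⟩ + B^0_{l,m}|l,m+1⟩ + B^-_{l,m}|l-1,m+1⟩`,
`x₀|l,m⟩ = A^+_{l,m}|l+1,m⟩ + A^0_{l,m}|l,m⟩ + A^+_{l-1,m}|l-1,m⟩`,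
`-q x₋₁|l,m⟩ = B^-_{l+1,m-1}|l+1,m-1⟩ + B^0_{l,m-1}|l,m-1⟩ + B^+_{l-1,m-1}|l-1,m-1⟩`. -/
structure IsSpinorRep (p : PodlesParam) (n : ℤ)
    (π : Podles p →ₐ[ℂ] (SpinorSpace n →L[ℂ] SpinorSpace n)) : Prop where
  x₁_apply : ∀ (x : SpinIdx n.natAbs) (b : Bool) (l m : ℝ), l = x.1.1 / 2 → m = x.1.2 / 2 →
    π (x₁ p) (spinKet n b x.1.1 x.1.2) =
      (p.cBp (label n b) l m : ℂ) • spinKet n b (x.1.1 + 2) (x.1.2 + 2)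
      + (p.cB0 (label n b) l m : ℂ) • spinKet n b x.1.1 (x.1.2 + 2)
      + (p.cBm (label n b) l m : ℂ) • spinKet n b (x.1.1 - 2) (x.1.2 + 2)
  x₀_apply : ∀ (x : SpinIdx n.natAbs) (b : Bool) (l m : ℝ), l = x.1.1 / 2 → m = x.1.2 / 2 →
    π (x₀ p) (spinKet n b x.1.1 x.1.2) =
      (p.cAp (label n b) l m : ℂ) • spinKet n b (x.1.1 + 2) x.1.2
      + (p.cA0 (label n b) l m : ℂ) • spinKet n b x.1.1 x.1.2
      + (p.cAp (label n b) (l - 1) m : ℂ) • spinKet n b (x.1.1 - 2) x.1.2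
  xm₁_apply : ∀ (x : SpinIdx n.natAbs) (b : Bool) (l m : ℝ), l = x.1.1 / 2 → m = x.1.2 / 2 →
    π (-p.qc • xm₁ p) (spinKet n b x.1.1 x.1.2) =
      (p.cBm (label n b) (l + 1) (m - 1) : ℂ) • spinKet n b (x.1.1 + 2) (x.1.2 - 2)
      + (p.cB0 (label n b) l (m - 1) : ℂ) • spinKet n b x.1.1 (x.1.2 - 2)
      + (p.cBp (label n b) (l - 1) (m - 1) : ℂ) • spinKet n b (x.1.1 - 2) (x.1.2 - 2)

/-- `T ↦ [F, T]`. -/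
noncomputable def commF (n : ℤ) : (SpinorSpace n →L[ℂ] SpinorSpace n) →ₗ[ℂ]
    (SpinorSpace n →L[ℂ] SpinorSpace n) :=
  LinearMap.mulLeft ℂ (spinF n) - LinearMap.mulRight ℂ (spinF n)

/-- The linear extension of `a₀ ⊗ ⋯ ⊗ a_k ↦ γ F [F,π(a₀)] ⋯ [F,π(a_k)]`. -/
noncomputable def chernOp (p : PodlesParam) (n : ℤ)
    (π : Podles p →ₐ[ℂ] (SpinorSpace n →L[ℂ] SpinorSpace n)) (k : ℕ) :
    HochChain (Podles p) k →ₗ[ℂ] (SpinorSpace n →L[ℂ] SpinorSpace n) :=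
  LinearMap.mulLeft ℂ (spinGamma n * spinF n) ∘ₗ
    PiTensorProduct.lift ((MultilinearMap.mkPiAlgebraFin ℂ (k + 1) _).compLinearMap
      (fun _ => commF n ∘ₗ π.toLinearMap))

end Podles


/-- Trace class operators on a Hilbert space (in nuclear form): `S = ∑_k ⟨y_k, ·⟩ x_k` with
`∑_k ‖x_k‖ ‖y_k‖ < ∞`. -/
def IsTraceClass {H : Type*} [NormedAddCommGroup H] [InnerProductSpace ℂ H]
    (S : H →L[ℂ] H) : Prop :=
  ∃ x y : ℕ → H, Summable (fun k => ‖x k‖ * ‖y k‖) ∧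
    ∀ v, HasSum (fun k => (inner ℂ (y k) v : ℂ) • x k) (S v)

namespace Podles
/-- The eigenvalue `q^{-2m}` of `K⁻²` at the basis vector `|l,m;±N⟩`, since `K|l,m;±N⟩ = q^m|l,m;±N⟩`. -/
noncomputable def kWeight (p : PodlesParam) {n : ℤ} (i : SpinIdx n.natAbs × Bool) : ℂ :=
  p.qc ^ (-i.1.1.2)

/-- `ch^{F,κ}_2(ω) = ½ Tr_ℋ(K⁻² γ F [F,a₀][F,a₁][F,a₂])` for `ω = a₀ ⊗ a₁ ⊗ a₂`, extended linearly;
the trace is computed in the basis `|l,m;±N⟩`. -/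
noncomputable def chern (p : PodlesParam) (n : ℤ)
    (π : Podles p →ₐ[ℂ] (SpinorSpace n →L[ℂ] SpinorSpace n))
    (ω : HochChain (Podles p) 2) : ℂ :=
  (1 / 2) * ∑' i, kWeight p i * chernOp p n π 2 ω (lp.single 2 i (1 : ℂ)) i

/-- `ℋ ⊗ ℂ²`, as column vectors. -/
abbrev SpinorSpace₂ (n : ℤ) : Type := Fin 2 → SpinorSpace n

/-- The action of a matrix `e ∈ M₂(𝒜(S²_{qs}))` on `ℋ ⊗ ℂ²`. -/
noncomputable def matOp (p : PodlesParam) (n : ℤ)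
    (π : Podles p →ₐ[ℂ] (SpinorSpace n →L[ℂ] SpinorSpace n))
    (e : Matrix (Fin 2) (Fin 2) (Podles p)) : SpinorSpace₂ n →ₗ[ℂ] SpinorSpace₂ n :=
  LinearMap.pi fun i => ∑ j, (π (e i j)).toLinearMap ∘ₗ LinearMap.proj j

/-- `F ⊗ 1`. -/
noncomputable def spinF₂ (n : ℤ) : SpinorSpace₂ n →ₗ[ℂ] SpinorSpace₂ n :=
  (spinF n).toLinearMap.compLeft (Fin 2)
/-- `γ ⊗ 1`. -/
noncomputable def spinGamma₂ (n : ℤ) : SpinorSpace₂ n →ₗ[ℂ] SpinorSpace₂ n :=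
  (spinGamma n).toLinearMap.compLeft (Fin 2)

/-- `ℋ'_+ = ½(1 + γ) e (ℋ ⊗ ℂ²)`. -/
noncomputable def chiralPlus (p : PodlesParam) (n : ℤ)
    (π : Podles p →ₐ[ℂ] (SpinorSpace n →L[ℂ] SpinorSpace n))
    (e : Matrix (Fin 2) (Fin 2) (Podles p)) : Submodule ℂ (SpinorSpace₂ n) :=
  LinearMap.range (((1 / 2 : ℂ) • (LinearMap.id + spinGamma₂ n)) ∘ₗ matOp p n π e)
/-- `ℋ'_- = ½(1 - γ) e (ℋ ⊗ ℂ²)`. -/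
noncomputable def chiralMinus (p : PodlesParam) (n : ℤ)
    (π : Podles p →ₐ[ℂ] (SpinorSpace n →L[ℂ] SpinorSpace n))
    (e : Matrix (Fin 2) (Fin 2) (Podles p)) : Submodule ℂ (SpinorSpace₂ n) :=
  LinearMap.range (((1 / 2 : ℂ) • (LinearMap.id - spinGamma₂ n)) ∘ₗ matOp p n π e)

/-- `¼ (1 - γ) e F e (1 + γ)` on `ℋ ⊗ ℂ²`. -/
noncomputable def indexOp (p : PodlesParam) (n : ℤ)
    (π : Podles p →ₐ[ℂ] (SpinorSpace n →L[ℂ] SpinorSpace n))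
    (e : Matrix (Fin 2) (Fin 2) (Podles p)) : SpinorSpace₂ n →ₗ[ℂ] SpinorSpace₂ n :=
  (1 / 4 : ℂ) • ((LinearMap.id - spinGamma₂ n) ∘ₗ matOp p n π e ∘ₗ spinF₂ n ∘ₗ matOp p n π e ∘ₗ
    (LinearMap.id + spinGamma₂ n))

/-- `F^+_e = ¼ (1 - γ) e F e (1 + γ)` as a map `ℋ'_+ → ℋ'_-`. -/
noncomputable def FePlus (p : PodlesParam) (n : ℤ)
    (π : Podles p →ₐ[ℂ] (SpinorSpace n →L[ℂ] SpinorSpace n))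
    (e : Matrix (Fin 2) (Fin 2) (Podles p)) : chiralPlus p n π e →ₗ[ℂ] chiralMinus p n π e :=
  (indexOp p n π e).restrict (fun v _ => by
    refine ⟨(1 / 2 : ℂ) • spinF₂ n (matOp p n π e
      ((LinearMap.id + spinGamma₂ n : SpinorSpace₂ n →ₗ[ℂ] SpinorSpace₂ n) v)), ?_⟩
    rw [map_smul]
    simp only [indexOp, LinearMap.comp_apply, LinearMap.smul_apply, smul_smul]
    norm_num)

/-- The graph of `K⁻²η` on `ℋ ⊗ ℂ²` with its maximal domain: `KEta p v w` says that `v` lies in the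
domain and is sent to `w`. -/
def KEta (p : PodlesParam) {n : ℤ} (v w : SpinorSpace₂ n) : Prop :=
  ∀ j i, w j i = eta p j j * kWeight p i * v j i

/-- `c = Tr_{ker F^+_e}(K⁻²η) - Tr_{coker F^+_e}(K⁻²η)`, including that this makes sense: the kernel
and the cokernel are finite dimensional, the kernel lies in the domain of `K⁻²η` and is mapped to
itself, by `S`, and `K⁻²η` induces an everywhere defined operator `T` of the cokernel. -/
structure HasQIndex (p : PodlesParam) (n : ℤ)
    (π : Podles p →ₐ[ℂ] (SpinorSpace n →L[ℂ] SpinorSpace n))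
    (e : Matrix (Fin 2) (Fin 2) (Podles p)) (c : ℂ) : Prop where
  finite_ker : FiniteDimensional ℂ (LinearMap.ker (FePlus p n π e))
  finite_coker : FiniteDimensional ℂ (chiralMinus p n π e ⧸ LinearMap.range (FePlus p n π e))
  value : ∃ (S : Module.End ℂ (LinearMap.ker (FePlus p n π e)))
      (T : Module.End ℂ (chiralMinus p n π e ⧸ LinearMap.range (FePlus p n π e))),
    (∀ v, KEta p v.1.1 (S v).1.1) ∧
    (∀ x, ∃ v w : chiralMinus p n π e, (LinearMap.range (FePlus p n π e)).mkQ v = x ∧ KEta p v.1 w.1) ∧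
    (∀ v w : chiralMinus p n π e, KEta p v.1 w.1 →
      T ((LinearMap.range (FePlus p n π e)).mkQ v) = (LinearMap.range (FePlus p n π e)).mkQ w) ∧
    c = LinearMap.trace ℂ _ S - LinearMap.trace ℂ _ T
end Podles

set_option linter.unusedSectionVars false
set_option linter.unusedVariables false

/-! Identify `ℋ_{-N}` and `ℋ_N` through their basis vectors with equal l, m. Tensored with ℂ² and
conjugated by diag(1, q), the two images of `e_s` become orthogonal projections P (label -N) and Q
(label N) on one Hilbert space. Put T = P - Q and S = 1 - P - Q; then ST = -TS and S² + T² = 1. The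
operator `F^+_{e_s}` turns into Q : ran P → ran Q. Its kernel is ran P ∩ ker Q, its cokernel is
represented by ran Q ∩ ker P, and these are the eigenspaces of T for 1 and -1. They are finite
dimensional because T is compact, and S² is invertible on their orthogonal complement.

In this picture K⁻²η is multiplication by q^{-ν} for an integer weight ν that P and Q preserve. Let
W_k be the projection onto weight k. Anticommutation with S and cyclicity of the trace give two
facts: tr(W_k T) is the multiplicity of the weight k in the kernel minus that in the cokernel
(`tr_weightProj_mul`), and tr(W_k T³) = tr(W_k T) (`tr_weightProj_mul_cube`). Summed against q^{-k},
the first is the q-index and the second is the pairing, since ch(ω₂) = Tr(K⁻²η T³). Separating the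
weights matters: the decay available for T³ absorbs the growth of K⁻², that for T alone does not.
Finally tr(W_k T) is read off the diagonal of T, where the sum over l telescopes (`gap_sum`) to
[2N]/[2|N|] = ±1 if k is a weight of the irreducible representation of dimension 2|N|, and to 0
otherwise. The sum of q^{-k} over these weights is [2|N|], so both invariants equal [2N].

The representation. Each defining relation, applied to a basis vector, is a handful of scalar
identities. After the square roots are squared away they reduce to three relations between α and β
(`alpha_beta_diff`, `alpha_beta_quad`, `beta_succ`), which are identities of rational functions in
q^{2l} and q^{2N}. The diagonal identities are sums of squares, so they also bound all coefficients.

Decay. The coefficients for N and -N differ by O(q^l). Orders are measured in the scale q^{l/2}: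
D(a) = π_{-N}(a) - π_N(a) has order 2, hence a product of three such differences has order 6. Of
these, 4 absorb K⁻² ≤ q^{-2l} and 2 give absolutely summable matrix coefficients, hence trace class
(`hasDecay_diffTriple`, `exists_isL1_kWeight`).

Homology. As κ is implemented by conjugation with K², the functional Tr(K⁻² D D D) vanishes on
boundaries (`wtr_diffTriple_hochBoundary`). The tensor ω₂ is a cycle because γ_s² = 1, κ acts on γ_s
as conjugation by η, and the η-trace of γ_s is a scalar (`hochBoundary_idempotent`). A cycle whose
pairing is [2N] ≠ 0 is not a boundary. -/

/-- The Hilbert space `ℓ²(ι)`. -/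
abbrev Ell2 (ι : Type*) : Type _ := lp (fun _ : ι => ℂ) 2

/-! ### Matrix coefficients, absolute summability and traces on ℓ² -/

namespace Ell2

section
variable {ι κ μ : Type*} [DecidableEq ι] [DecidableEq κ] [DecidableEq μ]

/-- The matrix coefficients of a bounded operator. -/
noncomputable def entry (T : Ell2 κ →L[ℂ] Ell2 ι) (i : ι) (j : κ) : ℂ :=
  T (lp.single 2 j (1 : ℂ)) i

theorem single_eq_smul (j : κ) (c : ℂ) :
    (lp.single 2 j c : Ell2 κ) = c • lp.single 2 j (1 : ℂ) := by
  rw [← lp.single_smul, smul_eq_mul, mul_one]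

theorem hasSum_apply (T : Ell2 κ →L[ℂ] Ell2 ι) (v : Ell2 κ) (i : ι) :
    HasSum (fun j => entry T i j * v j) (T v i) := by
  have h := ((lp.hasSum_single (p := 2) (by norm_num) v).mapL T).mapL
    (lp.evalCLM ℂ (fun _ : ι => ℂ) 2 i)
  have e : ∀ j, lp.evalCLM ℂ (fun _ : ι => ℂ) 2 i (T (lp.single 2 j (v j))) =
      entry T i j * v j := by
    intro j
    rw [single_eq_smul, map_smul, map_smul, smul_eq_mul, mul_comm]
    rfl
  simp only [e] at h
  exact h

/-- The expansion of a vector in the standard basis converges, so a bounded operator is known from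
its coefficients. Most operator identities below are checked in this way. -/
theorem ext_entry {S T : Ell2 κ →L[ℂ] Ell2 ι} (h : ∀ i j, entry S i j = entry T i j) : S = T := by
  ext v i
  exact (hasSum_apply S v i).unique (by simpa only [h] using hasSum_apply T v i)

theorem hasSum_entry_comp (S : Ell2 κ →L[ℂ] Ell2 ι) (T : Ell2 μ →L[ℂ] Ell2 κ) (i : ι) (j : μ) :
    HasSum (fun k => entry S i k * entry T k j) (entry (S ∘L T) i j) :=
  hasSum_apply S _ i

theorem norm_single_one (j : κ) : ‖(lp.single 2 j (1 : ℂ) : Ell2 κ)‖ = 1 := by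
  rw [lp.norm_single (by norm_num)]
  simp

theorem norm_entry_le (T : Ell2 κ →L[ℂ] Ell2 ι) (i : ι) (j : κ) : ‖entry T i j‖ ≤ ‖T‖ := by
  refine (lp.norm_apply_le_norm (by norm_num) _ i).trans ((T.le_opNorm _).trans ?_)
  rw [norm_single_one, mul_one]

@[simp] theorem entry_add (S T : Ell2 κ →L[ℂ] Ell2 ι) (i : ι) (j : κ) :
    entry (S + T) i j = entry S i j + entry T i j := rfl
@[simp] theorem entry_sub (S T : Ell2 κ →L[ℂ] Ell2 ι) (i : ι) (j : κ) :
    entry (S - T) i j = entry S i j - entry T i j := rfl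
@[simp] theorem entry_neg (S : Ell2 κ →L[ℂ] Ell2 ι) (i : ι) (j : κ) :
    entry (-S) i j = -entry S i j := rfl
@[simp] theorem entry_smul (c : ℂ) (S : Ell2 κ →L[ℂ] Ell2 ι) (i : ι) (j : κ) :
    entry (c • S) i j = c * entry S i j := rfl
@[simp] theorem entry_zero (i : ι) (j : κ) : entry (0 : Ell2 κ →L[ℂ] Ell2 ι) i j = 0 := rfl
@[simp] theorem entry_one (i j : ι) :
    entry (1 : Ell2 ι →L[ℂ] Ell2 ι) i j = if i = j then 1 else 0 := by
  change (lp.single 2 j (1 : ℂ) : Ell2 ι) i = _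
  rw [lp.single_apply]
  simp [Pi.single_apply]

theorem entry_eq_inner (T : Ell2 κ →L[ℂ] Ell2 ι) (i : ι) (j : κ) :
    entry T i j = inner ℂ (lp.single 2 i (1 : ℂ) : Ell2 ι) (T (lp.single 2 j (1 : ℂ))) := by
  rw [lp.inner_single_left]
  simp [entry]

/-- An operator is self-adjoint if its matrix is. -/
theorem isSelfAdjoint_of_entry {T : Ell2 ι →L[ℂ] Ell2 ι}
    (h : ∀ i j, entry T j i = (starRingEnd ℂ) (entry T i j)) : IsSelfAdjoint T := by
  rw [ContinuousLinearMap.isSelfAdjoint_iff']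
  refine ext_entry fun i j => ?_
  rw [entry_eq_inner, ContinuousLinearMap.adjoint_inner_right, ← inner_conj_symm, ← entry_eq_inner,
    h, Complex.conj_conj]

/-- A bounded operator of the form `v ↦ (i ↦ c i * v (φ i))`, where `φ` is injective
on the support of the bounded function `c`. -/
theorem exists_weightedComp (φ : ι → κ) (c : ι → ℂ) (hφ : Set.InjOn φ {i | c i ≠ 0})
    (C : ℝ) (hc : ∀ i, ‖c i‖ ≤ C) :
    ∃ T : Ell2 κ →L[ℂ] Ell2 ι, ∀ v i, T v i = c i * v (φ i) := by
  by_cases hι : Nonempty ι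
  swap
  · exact ⟨0, fun v i => (hι ⟨i⟩).elim⟩
  have hC : 0 ≤ C := (norm_nonneg _).trans (hc hι.some)
  -- Finite partial sums suffice. Indices with c i = 0 contribute nothing, and on the others φ is
  -- injective, so the |v (φ i)|² are distinct terms of ‖v‖².
  have key : ∀ (v : Ell2 κ) (s : Finset ι),
      ∑ i ∈ s, ‖c i * v (φ i)‖ ^ (2 : ENNReal).toReal ≤ (C * ‖v‖) ^ (2 : ENNReal).toReal := by
    intro v s
    have h0 : ∑ i ∈ s, ‖c i * v (φ i)‖ ^ (2 : ENNReal).toReal =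
        ∑ i ∈ s with c i ≠ 0, ‖c i * v (φ i)‖ ^ (2 : ENNReal).toReal := by
      rw [Finset.sum_filter]
      refine Finset.sum_congr rfl fun i _ => ?_
      split_ifs with h
      · rfl
      · simp [not_not.1 h]
    have h1 : ∑ i ∈ s with c i ≠ 0, ‖v (φ i)‖ ^ (2 : ENNReal).toReal ≤
        ‖v‖ ^ (2 : ENNReal).toReal := by
      rw [← Finset.sum_image (f := fun k => ‖v k‖ ^ (2 : ENNReal).toReal) (g := φ)]
      · exact lp.sum_rpow_le_norm_rpow (by norm_num) v _
      · intro i hi j hj h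
        exact hφ (by simpa using (Finset.mem_filter.1 hi).2)
          (by simpa using (Finset.mem_filter.1 hj).2) h
    rw [h0, Real.mul_rpow hC (norm_nonneg _)]
    refine le_trans ?_ (mul_le_mul_of_nonneg_left h1 (by positivity))
    rw [Finset.mul_sum]
    refine Finset.sum_le_sum fun i _ => ?_
    rw [norm_mul, Real.mul_rpow (norm_nonneg _) (norm_nonneg _)]
    have := hc i
    gcongr
  refine ⟨LinearMap.mkContinuous
    { toFun := fun v => ⟨fun i => c i * v (φ i), memℓp_gen' (key v)⟩
      map_add' := fun v w => by ext i; exact mul_add _ _ _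
      map_smul' := fun a v => by ext i; exact mul_left_comm _ _ _ } C fun v => ?_, fun v i => rfl⟩
  exact lp.norm_le_of_forall_sum_le (by norm_num) (by positivity) (key v)

/-- The operator `v ↦ (i ↦ c i * v (φ i))`; it is `0` if this is not bounded in an evident way. -/
noncomputable def weightedComp (φ : ι → κ) (c : ι → ℂ) : Ell2 κ →L[ℂ] Ell2 ι :=
  open Classical in
  if h : Set.InjOn φ {i | c i ≠ 0} ∧ ∃ C : ℝ, ∀ i, ‖c i‖ ≤ C then
    (exists_weightedComp φ c h.1 h.2.choose h.2.choose_spec).choose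
  else 0

theorem weightedComp_apply {φ : ι → κ} {c : ι → ℂ} (hφ : Set.InjOn φ {i | c i ≠ 0})
    (C : ℝ) (hc : ∀ i, ‖c i‖ ≤ C) (v : Ell2 κ) (i : ι) :
    weightedComp φ c v i = c i * v (φ i) := by
  have h : Set.InjOn φ {i | c i ≠ 0} ∧ ∃ C : ℝ, ∀ i, ‖c i‖ ≤ C := ⟨hφ, C, hc⟩
  rw [weightedComp, dif_pos h]
  exact (exists_weightedComp φ c h.1 h.2.choose h.2.choose_spec).choose_spec v i

/-- Operators with absolutely summable matrix coefficients. -/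
def IsL1 (T : Ell2 κ →L[ℂ] Ell2 ι) : Prop := Summable fun p : ι × κ => ‖entry T p.1 p.2‖

/-- The trace, in the standard basis. -/
noncomputable def tr (T : Ell2 ι →L[ℂ] Ell2 ι) : ℂ := ∑' i, entry T i i

theorem IsL1.add {S T : Ell2 κ →L[ℂ] Ell2 ι} (hS : IsL1 S) (hT : IsL1 T) : IsL1 (S + T) :=
  Summable.of_nonneg_of_le (fun _ => norm_nonneg _) (fun _ => norm_add_le _ _) (Summable.add hS hT)

theorem IsL1.neg {S : Ell2 κ →L[ℂ] Ell2 ι} (hS : IsL1 S) : IsL1 (-S) := by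
  simpa only [IsL1, entry_neg, norm_neg] using hS

theorem IsL1.sub {S T : Ell2 κ →L[ℂ] Ell2 ι} (hS : IsL1 S) (hT : IsL1 T) : IsL1 (S - T) := by
  rw [sub_eq_add_neg]
  exact hS.add hT.neg

theorem IsL1.summable_diag {T : Ell2 ι →L[ℂ] Ell2 ι} (hT : IsL1 T) :
    Summable fun i => entry T i i := by
  refine Summable.of_norm ?_
  exact hT.comp_injective (i := fun i : ι => (i, i)) fun i j h => congrArg Prod.fst h

theorem tr_add {S T : Ell2 ι →L[ℂ] Ell2 ι} (hS : IsL1 S) (hT : IsL1 T) :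
    tr (S + T) = tr S + tr T := by
  simp only [tr, entry_add]
  exact hS.summable_diag.tsum_add hT.summable_diag

theorem tr_sub {S T : Ell2 ι →L[ℂ] Ell2 ι} (hS : IsL1 S) (hT : IsL1 T) :
    tr (S - T) = tr S - tr T := by
  simp only [tr, entry_sub]
  exact hS.summable_diag.tsum_sub hT.summable_diag

theorem tr_neg (S : Ell2 ι →L[ℂ] Ell2 ι) : tr (-S) = -tr S := by
  simp only [tr, entry_neg, tsum_neg]

/-- The coefficients of B are bounded by ‖B‖, so the double family A_ik B_ki is absolutely summable
and the two sums may be exchanged. Absolute summability is needed for one factor only, and AB itself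
may fail to have it. -/
theorem tr_mul_comm {A : Ell2 ι →L[ℂ] Ell2 ι} (hA : IsL1 A) (B : Ell2 ι →L[ℂ] Ell2 ι) :
    tr (A * B) = tr (B * A) := by
  have hs : Summable fun p : ι × ι => entry A p.1 p.2 * entry B p.2 p.1 := by
    refine Summable.of_norm_bounded (Summable.mul_right ‖B‖ hA) fun p => ?_
    rw [norm_mul]
    exact mul_le_mul_of_nonneg_left (norm_entry_le B _ _) (norm_nonneg _)
  have h1 : tr (A * B) = ∑' i, ∑' k, entry A i k * entry B k i :=
    tsum_congr fun i => (hasSum_entry_comp A B i i).tsum_eq.symm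
  have h2 : tr (B * A) = ∑' k, ∑' i, entry A i k * entry B k i := by
    refine tsum_congr fun k => ?_
    have h : entry (B * A) k k = ∑' i, entry B k i * entry A i k :=
      (hasSum_entry_comp B A k k).tsum_eq.symm
    rw [h]
    exact tsum_congr fun i => mul_comm _ _
  rw [h1, h2]
  exact (Summable.tsum_comm (f := fun i k => entry A i k * entry B k i) hs).symm

/-- Multiplication by a bounded operator on one side can destroy absolute summability, but between
two summable factors it is harmless: |(SBT)_ij| is at most the sum over k, l of |S_ik| ‖B‖ |T_lj|,
and the total is a product of two convergent sums. -/
theorem IsL1.sandwich {S T : Ell2 ι →L[ℂ] Ell2 ι} (hS : IsL1 S) (hT : IsL1 T)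
    (B : Ell2 ι →L[ℂ] Ell2 ι) : IsL1 (S * B * T) := by
  have hS' : Summable fun p : ι × ι => ‖entry S p.1 p.2‖ := hS
  have hT' : Summable fun p : ι × ι => ‖entry T p.1 p.2‖ := hT
  have hST := hS'.mul_of_nonneg hT' (fun _ => norm_nonneg _) (fun _ => norm_nonneg _)
  -- Regroups the indices ((i, k), (l, j)) of the two factors as outer pair and summation pair ((i,
  -- j), (k, l)).
  let e : (ι × ι) × (ι × ι) ≃ (ι × ι) × (ι × ι) :=
    { toFun := fun p => ((p.1.1, p.2.2), (p.1.2, p.2.1))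
      invFun := fun p => ((p.1.1, p.2.1), (p.2.2, p.1.2))
      left_inv := fun _ => rfl
      right_inv := fun _ => rfl }
  have h1 : Summable fun p : (ι × ι) × (ι × ι) =>
      ‖entry S p.1.1 p.2.1‖ * ‖entry T p.2.2 p.1.2‖ * ‖B‖ := by
    have := (e.symm.summable_iff.2 hST).mul_right ‖B‖
    exact this
  have h2 := h1.prod
  refine Summable.of_nonneg_of_le (fun _ => norm_nonneg _) (fun p => ?_) h2
  have hc : Summable fun q : ι × ι => ‖entry S p.1 q.1‖ * ‖entry T q.2 p.2‖ * ‖B‖ :=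
    h1.prod_factor p
  have h3 : entry (S * B * T) p.1 p.2 =
      ∑' k, entry S p.1 k * ∑' l, entry B k l * entry T l p.2 := by
    rw [mul_assoc]
    have h4 : entry (S * (B * T)) p.1 p.2 = ∑' k, entry S p.1 k * entry (B * T) k p.2 :=
      (hasSum_entry_comp S (B * T) p.1 p.2).tsum_eq.symm
    rw [h4]
    refine tsum_congr fun k => congrArg _ (hasSum_entry_comp B T k p.2).tsum_eq.symm
  have hb : ∀ q : ι × ι, ‖entry S p.1 q.1 * (entry B q.1 q.2 * entry T q.2 p.2)‖ ≤
      ‖entry S p.1 q.1‖ * ‖entry T q.2 p.2‖ * ‖B‖ := by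
    intro q
    rw [norm_mul, norm_mul]
    have := norm_entry_le B q.1 q.2
    calc _ ≤ ‖entry S p.1 q.1‖ * (‖B‖ * ‖entry T q.2 p.2‖) := by gcongr
      _ = _ := by ring
  have hs : Summable fun q : ι × ι => entry S p.1 q.1 * (entry B q.1 q.2 * entry T q.2 p.2) :=
    Summable.of_norm_bounded hc hb
  have h5 : entry (S * B * T) p.1 p.2 =
      ∑' q : ι × ι, entry S p.1 q.1 * (entry B q.1 q.2 * entry T q.2 p.2) := by
    rw [h3, hs.tsum_prod]
    exact tsum_congr fun k => tsum_mul_left.symm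
  rw [h5]
  exact tsum_of_norm_bounded hc.hasSum hb

/-- The matrix unit `v ↦ v j • δ_i`. -/
noncomputable def matUnit (i : ι) (j : κ) : Ell2 κ →L[ℂ] Ell2 ι :=
  (lp.evalCLM ℂ (fun _ : κ => ℂ) 2 j).smulRight (lp.single 2 i (1 : ℂ))

theorem matUnit_apply (i : ι) (j : κ) (v : Ell2 κ) :
    matUnit i j v = v j • (lp.single 2 i (1 : ℂ) : Ell2 ι) := rfl

theorem norm_matUnit_le (i : ι) (j : κ) : ‖matUnit i j‖ ≤ 1 := by
  refine ContinuousLinearMap.opNorm_le_bound _ zero_le_one fun v => ?_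
  rw [matUnit_apply, norm_smul, norm_single_one, mul_one, one_mul]
  exact lp.norm_apply_le_norm (by norm_num) v j

theorem entry_matUnit (i i' : ι) (j j' : κ) :
    entry (matUnit i j) i' j' = if (i, j) = (i', j') then 1 else 0 := by
  change (lp.single 2 j' (1 : ℂ) : Ell2 κ) j * (lp.single 2 i (1 : ℂ) : Ell2 ι) i' = _
  rw [lp.single_apply, lp.single_apply]
  by_cases h1 : i = i' <;> by_cases h2 : j = j' <;> simp_all [eq_comm]

/-- Matrix units have norm at most 1, so a summable family of coefficients gives a series that
converges in operator norm. This is both the source of operators such as K⁻²T and the reason why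
absolutely summable operators are compact. -/
theorem exists_hasSum_matUnit (c : ι × κ → ℂ) (hc : Summable fun p => ‖c p‖) :
    ∃ T : Ell2 κ →L[ℂ] Ell2 ι, HasSum (fun p => c p • matUnit p.1 p.2) T ∧
      ∀ i j, entry T i j = c (i, j) := by
  have hs : Summable fun p : ι × κ => c p • matUnit p.1 p.2 := by
    refine Summable.of_norm_bounded hc fun p => ?_
    rw [norm_smul]
    exact mul_le_of_le_one_right (norm_nonneg _) (norm_matUnit_le _ _)
  refine ⟨_, hs.hasSum, fun i j => ?_⟩
  have h := (hs.hasSum.mapL (ContinuousLinearMap.apply ℂ (Ell2 ι)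
    (lp.single 2 j (1 : ℂ) : Ell2 κ))).mapL (lp.evalCLM ℂ (fun _ : ι => ℂ) 2 i)
  have e : ∀ p : ι × κ, lp.evalCLM ℂ (fun _ : ι => ℂ) 2 i
      (ContinuousLinearMap.apply ℂ (Ell2 ι) (lp.single 2 j (1 : ℂ) : Ell2 κ)
        (c p • matUnit p.1 p.2)) = if p = (i, j) then c p else 0 := by
    intro p
    change entry (c p • matUnit p.1 p.2) i j = _
    rw [entry_smul, entry_matUnit]
    simp
  simp only [e] at h
  refine h.unique ?_
  have h' := hasSum_single (f := fun p => if p = (i, j) then c p else 0) (i, j)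
    (fun p hp => if_neg hp)
  rwa [if_pos rfl] at h'

theorem IsL1.hasSum {T : Ell2 κ →L[ℂ] Ell2 ι} (hT : IsL1 T) :
    HasSum (fun p : ι × κ => entry T p.1 p.2 • matUnit p.1 p.2) T := by
  obtain ⟨S, h1, h2⟩ := exists_hasSum_matUnit (fun p : ι × κ => entry T p.1 p.2) hT
  rwa [ext_entry h2] at h1

theorem IsL1.isCompactOperator {T : Ell2 κ →L[ℂ] Ell2 ι} (hT : IsL1 T) : IsCompactOperator T := by
  refine isCompactOperator_of_tendsto hT.hasSum (Filter.Eventually.of_forall fun s => ?_)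
  have h : ∀ i j, IsCompactOperator (matUnit (ι := ι) (κ := κ) i j) := fun i j => by
    have := (isCompactOperator_of_locallyCompactSpace_rng
      (ContinuousLinearMap.toSpanSingleton ℂ (lp.single 2 i (1 : ℂ) : Ell2 ι))).comp_clm
        (lp.evalCLM ℂ (fun _ : κ => ℂ) 2 j)
    exact this
  classical
  induction s using Finset.induction_on with
  | empty => simpa using isCompactOperator_zero
  | insert a s ha ih =>
    rw [Finset.sum_insert ha]
    exact ((h _ _).smul _).add ih

/-- The expansion into matrix units is already a nuclear representation. It is only reindexed by ℕ
along an injection and extended by zero. -/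
theorem isTraceClass_of_isL1 [Countable ι] {T : Ell2 ι →L[ℂ] Ell2 ι} (hT : IsL1 T) :
    IsTraceClass T := by
  obtain ⟨f, hf⟩ := Countable.exists_injective_nat (ι × ι)
  refine ⟨Function.extend f (fun p => entry T p.1 p.2 • (lp.single 2 p.1 (1 : ℂ) : Ell2 ι)) 0,
    Function.extend f (fun p => (lp.single 2 p.2 (1 : ℂ) : Ell2 ι)) 0, ?_, fun v => ?_⟩
  · rw [← hf.summable_iff]
    · simpa only [Function.comp_def, hf.extend_apply, norm_smul, norm_single_one, mul_one, IsL1] using hT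
    · intro k hk
      rw [Function.extend_apply' _ _ _ (by simpa using hk)]
      simp
  · rw [← hf.hasSum_iff]
    · have h := hT.hasSum.mapL (ContinuousLinearMap.apply ℂ (Ell2 ι) v)
      have e : (fun k => (inner ℂ (Function.extend f
          (fun p => (lp.single 2 p.2 (1 : ℂ) : Ell2 ι)) 0 k) v : ℂ) •
          Function.extend f
            (fun p => entry T p.1 p.2 • (lp.single 2 p.1 (1 : ℂ) : Ell2 ι)) 0 k) ∘ f =
          fun p : ι × ι => ContinuousLinearMap.apply ℂ (Ell2 ι) v
            (entry T p.1 p.2 • matUnit p.1 p.2) := by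
        funext p
        rw [Function.comp_apply, hf.extend_apply, hf.extend_apply, lp.inner_single_left]
        change _ = entry T p.1 p.2 • (v p.2 • (lp.single 2 p.1 (1 : ℂ) : Ell2 ι))
        rw [smul_comm]
        simp
      rw [e]
      exact h
    · intro k hk
      rw [Function.extend_apply' _ _ _ (by simpa using hk)]
      simp

end
end Ell2

/-! ### q-numbers and the scalar identities between α and β -/

namespace PodlesParam
variable (p : PodlesParam)

theorem sub_inv_neg : p.q - p.q⁻¹ < 0 := by
  have := (one_lt_inv₀ p.q_pos).2 p.q_lt_one
  have := p.q_lt_one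
  linarith

theorem q_sq_lt_one : p.q ^ 2 < 1 := by
  have := p.q_pos
  have := p.q_lt_one
  nlinarith

theorem num_eq_of {t z : ℝ} (h : p.q ^ t = z) : p.num t = (z - z⁻¹) / (p.q - p.q⁻¹) := by
  rw [num, qNum, Real.rpow_neg p.q_pos.le, h]

theorem num_zero : p.num 0 = 0 := by simp [num, qNum]

theorem num_neg (t : ℝ) : p.num (-t) = -p.num t := by
  simp only [num, qNum, neg_neg]
  ring

theorem num_pos {t : ℝ} (ht : 0 < t) : 0 < p.num t := by
  have h1 : p.q ^ t < 1 := Real.rpow_lt_one p.q_pos.le p.q_lt_one ht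
  have h2 : 1 < p.q ^ (-t) := Real.one_lt_rpow_of_pos_of_lt_one_of_neg p.q_pos p.q_lt_one (by linarith)
  exact div_pos_of_neg_of_neg (by linarith) p.sub_inv_neg

theorem num_nonneg {t : ℝ} (ht : 0 ≤ t) : 0 ≤ p.num t := by
  rcases ht.eq_or_lt with rfl | h
  · rw [num_zero]
  · exact (p.num_pos h).le

theorem num_two : p.num 2 = (1 + p.q ^ 2) / p.q := by
  have h : p.q ^ (2 : ℝ) = p.q ^ 2 := by norm_cast
  have := p.q_pos
  have h2 := p.q_sq_lt_one
  have h3 : p.q ^ 2 - 1 ≠ 0 := by linarith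
  rw [p.num_eq_of h]
  have e : p.q - p.q⁻¹ = (p.q ^ 2 - 1) / p.q := by field_simp
  rw [e]
  field_simp
  ring

/-- The admissible `l` for the label `N`. -/
def LevelRange (N l : ℝ) : Prop := ∃ a k : ℕ, 1 ≤ a ∧ |N| = a / 2 ∧ l = a / 2 + k

variable {p}
variable {N l m : ℝ}

theorem LevelRange.half_le (h : LevelRange N l) : 1 / 2 ≤ l := by
  obtain ⟨a, k, h1, h2, h3⟩ := h
  have h1' : (1 : ℝ) ≤ a := by exact_mod_cast h1
  have h2' : (0 : ℝ) ≤ k := k.cast_nonneg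
  rw [h3]
  linarith

theorem LevelRange.succ (h : LevelRange N l) : LevelRange N (l + 1) := by
  obtain ⟨a, k, h1, h2, h3⟩ := h
  exact ⟨a, k + 1, h1, h2, by rw [h3]; push_cast; ring⟩

theorem LevelRange.eq_or (h : LevelRange N l) : l = |N| ∨ |N| + 1 ≤ l := by
  obtain ⟨a, k, h1, h2, h3⟩ := h
  rcases k with _ | k
  · left; rw [h3, h2]; simp
  · right
    have h2' : (0 : ℝ) ≤ k := k.cast_nonneg
    rw [h3, h2]; push_cast; linarith

theorem alpha_abs (p : PodlesParam) (h : l = |N|) : p.alpha N l = 0 := by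
  rcases abs_choice N with h' | h' <;> rw [h'] at h <;> subst h <;> simp [alpha, num_zero]

variable (p)

theorem q_rpow_lt_one {t : ℝ} (ht : 0 < t) : p.q ^ t < 1 := Real.rpow_lt_one p.q_pos.le p.q_lt_one ht

/-- The factor [2l - 1] stays on the left because it vanishes for l = |N| = 1/2; at l = |N| both
sides are zero. For larger l the radicands are nonnegative and the roots can be squared. -/
theorem alpha_sq_rpow (h : LevelRange N l) :
    p.num (2 * l - 1) * p.alpha N l ^ 2 = p.num 2 * p.num (l + N) * p.num (l - N) *
      ((p.q ^ (l + N) + p.q ^ (-(l + N)) * p.s ^ 2) * (p.q ^ (l - N) * p.s ^ 2 + p.q ^ (-(l - N))))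
      / (p.num (2 * l) ^ 2 * p.num (2 * l + 1)) := by
  have hl := h.half_le
  have hq := p.q_pos
  rcases h.eq_or with h0 | h0
  · rw [alpha_abs p h0]
    rcases abs_choice N with h' | h' <;> rw [h'] at h0 <;> subst h0 <;> simp [num_zero]
  · have h1 : 0 < p.num (2 * l - 1) := p.num_pos (by have := abs_nonneg N; linarith)
    have h2 : 0 < p.num (2 * l) := p.num_pos (by linarith)
    have h3 : 0 < p.num (2 * l + 1) := p.num_pos (by linarith)
    have h4 : 0 ≤ p.num (l + N) := p.num_nonneg (by have := neg_abs_le N; linarith)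
    have h5 : 0 ≤ p.num (l - N) := p.num_nonneg (by have := le_abs_self N; linarith)
    have h6 : 0 ≤ p.num 2 := p.num_nonneg (by norm_num)
    rw [alpha, mul_pow, mul_pow, Real.sq_sqrt (by positivity), Real.sq_sqrt (by positivity)]
    field_simp

/-- `[2l-1] α_N(l)²` as a rational function of `U = q^{2l}`, `W = q^{2N}`. -/
noncomputable def alphaRat (q s U W : ℝ) : ℝ :=
  (1 + q ^ 2) * (U + 1 / U - W - 1 / W) * (U * s ^ 2 + W + s ^ 4 / W + s ^ 2 / U) * U ^ 2 * (U * q) *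
    (q - 1 / q) / (q * (U ^ 2 - 1) ^ 2 * (q ^ 2 * U ^ 2 - 1))

/-- `β_N(l)` as a rational function of `U = q^{2l}`, `W = q^{2N}`. -/
noncomputable def betaRat (q s U W : ℝ) : ℝ :=
  (q ^ 2 - 1) * U * ((1 - s ^ 2) * ((1 + q ^ 2) * W ^ 2 * U - (q ^ 2 * U ^ 2 + 1) * W)
    + (1 + q ^ 2) * s ^ 2 * (W ^ 2 - 1) * U) / (q * W * (U ^ 2 - 1) * (q ^ 4 * U ^ 2 - 1))

theorem q_rpow_two_mul (t : ℝ) : p.q ^ (2 * t) = (p.q ^ t) ^ 2 := by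
  rw [mul_comm, Real.rpow_mul p.q_pos.le]; norm_cast

theorem q_rpow_pos (t : ℝ) : 0 < p.q ^ t := Real.rpow_pos_of_pos p.q_pos t

theorem alpha_sq (h : LevelRange N l) :
    p.num (2 * l - 1) * p.alpha N l ^ 2 = alphaRat p.q p.s (p.q ^ (2 * l)) (p.q ^ (2 * N)) := by
  have hq := p.q_pos
  have hx : 0 < p.q ^ l := p.q_rpow_pos l
  have hw : 0 < p.q ^ N := p.q_rpow_pos N
  have hl := h.half_le
  have hU : (p.q ^ l) ^ 2 < 1 := by
    rw [← q_rpow_two_mul]; exact p.q_rpow_lt_one (by linarith)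
  rw [p.alpha_sq_rpow h, alphaRat, num_two, q_rpow_two_mul, q_rpow_two_mul,
    p.num_eq_of (Real.rpow_add hq l N), p.num_eq_of (Real.rpow_sub hq l N),
    p.num_eq_of (p.q_rpow_two_mul l), p.num_eq_of (t := 2 * l + 1)
      (by rw [Real.rpow_add hq, q_rpow_two_mul, Real.rpow_one]),
    Real.rpow_neg hq.le, Real.rpow_neg hq.le, Real.rpow_add hq, Real.rpow_sub hq]
  generalize p.q ^ l = x at *
  generalize p.q ^ N = w at *
  have hq2 := p.q_sq_lt_one
  have n1 : p.q ^ 2 - 1 ≠ 0 := by linarith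
  have n2 : x ^ 4 - 1 ≠ 0 := by nlinarith [sq_nonneg x]
  have n3 : p.q ^ 2 * x ^ 4 - 1 ≠ 0 := by
    have : x ^ 4 < 1 := by nlinarith [sq_nonneg x]
    have : 0 < x ^ 4 := by positivity
    nlinarith
  have e1 : p.q - p.q⁻¹ = (p.q ^ 2 - 1) / p.q := by field_simp
  have e1' : p.q - 1 / p.q = (p.q ^ 2 - 1) / p.q := by field_simp
  have e2 : x ^ 2 - (x ^ 2)⁻¹ = (x ^ 4 - 1) / x ^ 2 := by field_simp
  have e3 : x ^ 2 * p.q - (x ^ 2 * p.q)⁻¹ = (p.q ^ 2 * x ^ 4 - 1) / (x ^ 2 * p.q) := by field_simp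
  have e4 : (x ^ 2) ^ 2 = x ^ 4 := by ring
  rw [e1, e1', e2, e3, e4]
  field_simp
  ring

theorem beta_eq (h : 1 / 2 ≤ l) : p.beta N l = betaRat p.q p.s (p.q ^ (2 * l)) (p.q ^ (2 * N)) := by
  have hq := p.q_pos
  have hx : 0 < p.q ^ l := p.q_rpow_pos l
  have hw : 0 < p.q ^ N := p.q_rpow_pos N
  have hU : (p.q ^ l) ^ 2 < 1 := by
    rw [← q_rpow_two_mul]; exact p.q_rpow_lt_one (by linarith)
  rw [beta, betaRat, num_two, q_rpow_two_mul, q_rpow_two_mul,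
    p.num_eq_of (Real.rpow_sub hq l N),
    p.num_eq_of (p.q_rpow_two_mul l), p.num_eq_of (p.q_rpow_two_mul N),
    p.num_eq_of (t := 2 * l + 2) (z := (p.q ^ l) ^ 2 * p.q ^ 2)
      (by rw [Real.rpow_add hq, q_rpow_two_mul]; norm_cast),
    Real.rpow_add hq, Real.rpow_add hq, Real.rpow_one]
  generalize p.q ^ l = x at *
  generalize p.q ^ N = w at *
  have hq2 := p.q_sq_lt_one
  have n1 : p.q ^ 2 - 1 ≠ 0 := by linarith
  have n2 : x ^ 4 - 1 ≠ 0 := by nlinarith [sq_nonneg x]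
  have n3 : p.q ^ 4 * x ^ 4 - 1 ≠ 0 := by
    have : x ^ 4 < 1 := by nlinarith [sq_nonneg x]
    have : 0 < x ^ 4 := by positivity
    have : p.q ^ 4 < 1 := by nlinarith [sq_nonneg p.q]
    nlinarith
  have e1 : p.q - p.q⁻¹ = (p.q ^ 2 - 1) / p.q := by field_simp
  have e2 : x ^ 2 - (x ^ 2)⁻¹ = (x ^ 4 - 1) / x ^ 2 := by field_simp
  have e3 : x ^ 2 * p.q ^ 2 - (x ^ 2 * p.q ^ 2)⁻¹ = (p.q ^ 4 * x ^ 4 - 1) / (x ^ 2 * p.q ^ 2) := by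
    field_simp
  have e4 : (x ^ 2) ^ 2 = x ^ 4 := by ring
  rw [e1, e2, e3, e4]
  field_simp
  ring

/-- `[2l+3] α_N(l+1)²` as a rational function of `U = q^{2l}`, `W = q^{2N}`. -/
noncomputable def alphaRatUp (q s U W : ℝ) : ℝ :=
  (1 + q ^ 2) * (q ^ 2 * U + 1 / (q ^ 2 * U) - W - 1 / W) *
    (q ^ 2 * U * s ^ 2 + W + s ^ 4 / W + s ^ 2 / (q ^ 2 * U)) * (q ^ 2 * U) ^ 2 * (U * q) *
    (q - 1 / q) / (q * (q ^ 4 * U ^ 2 - 1) ^ 2 * (q ^ 2 * U ^ 2 - 1))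

theorem alpha_sq_up (h : LevelRange N l) :
    p.num (2 * l + 3) * p.alpha N (l + 1) ^ 2 =
      alphaRatUp p.q p.s (p.q ^ (2 * l)) (p.q ^ (2 * N)) := by
  have hq := p.q_pos
  have hx : 0 < p.q ^ l := p.q_rpow_pos l
  have hw : 0 < p.q ^ N := p.q_rpow_pos N
  have hl := h.half_le
  have hU : (p.q ^ l) ^ 2 < 1 := by
    rw [← q_rpow_two_mul]; exact p.q_rpow_lt_one (by linarith)
  have h3 : 0 < p.num (2 * l + 3) := p.num_pos (by linarith)
  have h1 : 0 < p.num (2 * l + 1) := p.num_pos (by linarith)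
  have hA := p.alpha_sq_rpow h.succ
  rw [show 2 * (l + 1) - 1 = 2 * l + 1 by ring, show 2 * (l + 1) + 1 = 2 * l + 3 by ring,
    show 2 * (l + 1) = 2 * l + 2 by ring] at hA
  -- At l + 1 the formula has [2l + 1] on the left and [2l + 3] in the denominator. Both are
  -- positive for l ≥ 1/2, so they may be exchanged; afterwards no factor of the denominator can
  -- vanish.
  have hA' : p.num (2 * l + 3) * p.alpha N (l + 1) ^ 2 = p.num 2 * p.num (l + 1 + N) *
      p.num (l + 1 - N) * ((p.q ^ (l + 1 + N) + p.q ^ (-(l + 1 + N)) * p.s ^ 2) *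
      (p.q ^ (l + 1 - N) * p.s ^ 2 + p.q ^ (-(l + 1 - N))))
      / (p.num (2 * l + 2) ^ 2 * p.num (2 * l + 1)) := by
    have h2 : 0 < p.num (2 * l + 2) := p.num_pos (by linarith)
    rw [eq_div_iff (by positivity)] at hA ⊢
    linear_combination hA
  have hp : ∀ t : ℝ, p.q ^ (t + 1) = p.q ^ t * p.q := fun t => Real.rpow_add_one hq.ne' t
  rw [hA', alphaRatUp, num_two, q_rpow_two_mul, q_rpow_two_mul,
    p.num_eq_of (Real.rpow_add hq (l + 1) N), p.num_eq_of (Real.rpow_sub hq (l + 1) N),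
    p.num_eq_of (t := 2 * l + 2) (z := (p.q ^ l) ^ 2 * p.q ^ 2)
      (by rw [Real.rpow_add hq, q_rpow_two_mul]; norm_cast), p.num_eq_of (t := 2 * l + 1)
      (by rw [Real.rpow_add hq, q_rpow_two_mul, Real.rpow_one]),
    Real.rpow_neg hq.le, Real.rpow_neg hq.le, Real.rpow_add hq (l + 1), Real.rpow_sub hq (l + 1), hp]
  generalize p.q ^ l = x at *
  generalize p.q ^ N = w at *
  have hq2 := p.q_sq_lt_one
  have n1 : p.q ^ 2 - 1 ≠ 0 := by linarith
  have n2 : x ^ 4 < 1 := by nlinarith [sq_nonneg x]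
  have n3 : p.q ^ 2 * x ^ 4 - 1 ≠ 0 := by
    have : 0 < x ^ 4 := by positivity
    nlinarith
  have n4 : p.q ^ 4 * x ^ 4 - 1 ≠ 0 := by
    have : 0 < x ^ 4 := by positivity
    have : p.q ^ 4 < 1 := by nlinarith [sq_nonneg p.q]
    nlinarith
  have e1 : p.q - p.q⁻¹ = (p.q ^ 2 - 1) / p.q := by field_simp
  have e1' : p.q - 1 / p.q = (p.q ^ 2 - 1) / p.q := by field_simp
  have e2 : x ^ 2 * p.q ^ 2 - (x ^ 2 * p.q ^ 2)⁻¹ = (p.q ^ 4 * x ^ 4 - 1) / (x ^ 2 * p.q ^ 2) := by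
    field_simp
  have e3 : x ^ 2 * p.q - (x ^ 2 * p.q)⁻¹ = (p.q ^ 2 * x ^ 4 - 1) / (x ^ 2 * p.q) := by field_simp
  have e4 : (x ^ 2) ^ 2 = x ^ 4 := by ring
  rw [e1, e1', e2, e3, e4]
  field_simp
  ring

section
variable {q s U W : ℝ} (hq : q ≠ 0) (hU : U ≠ 0) (hW : W ≠ 0) (hc : q ^ 2 - 1 ≠ 0)
  (h0 : U ^ 2 - 1 ≠ 0) (h2 : q ^ 4 * U ^ 2 - 1 ≠ 0) (h1 : q ^ 2 * U ^ 2 - 1 ≠ 0)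
include hq hU hW hc h0 h2 h1

/-- With U = q^{2l} and W = q^{2N} as free variables neither roots nor real powers remain, and this
identity, like the next one, is polynomial after clearing denominators. -/
theorem alphaRat_diff : alphaRatUp q s U W - alphaRat q s U W =
    (1 - q ^ 2) * betaRat q s U W *
      (-(q ^ 2 * U + 1 / U) / (q - 1 / q) * betaRat q s U W - (1 - s ^ 2)) := by
  have e1 : q - 1 / q = (q ^ 2 - 1) / q := by field_simp
  rw [alphaRat, alphaRatUp, betaRat, e1]
  field_simp
  ring

theorem alphaRat_quad : (1 + q ^ 2) * q ^ 2 * U * (q - 1 / q) * alphaRatUp q s U W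
    - (1 + q ^ 2) / U * (q - 1 / q) * alphaRat q s U W
    + ((q ^ 2 * U + 1 / U) ^ 2 - q ^ 2 * (1 + q ^ 2) ^ 2) * betaRat q s U W ^ 2
    + (1 - s ^ 2) * (1 - q ^ 2) * (q - 1 / q) * (q ^ 2 * U + 1 / U) * betaRat q s U W
    - (q ^ 2 * (1 - s ^ 2) ^ 2 + s ^ 2 * (1 + q ^ 2) ^ 2) * (q - 1 / q) ^ 2 = 0 := by
  have e1 : q - 1 / q = (q ^ 2 - 1) / q := by field_simp
  rw [alphaRat, alphaRatUp, betaRat, e1]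
  field_simp
  ring

end

theorem level_ne (hl : 1 / 2 ≤ l) : (p.q ^ (2 * l)) ≠ 0 ∧ p.q ^ 2 - 1 ≠ 0 ∧ (p.q ^ (2 * l)) ^ 2 - 1 ≠ 0 ∧
    p.q ^ 4 * (p.q ^ (2 * l)) ^ 2 - 1 ≠ 0 ∧ p.q ^ 2 * (p.q ^ (2 * l)) ^ 2 - 1 ≠ 0 := by
  have hU : p.q ^ (2 * l) < 1 := p.q_rpow_lt_one (by linarith)
  have h0 : 0 < p.q ^ (2 * l) := p.q_rpow_pos _
  have hq := p.q_pos
  have hq2 := p.q_sq_lt_one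
  generalize p.q ^ (2 * l) = u at *
  have h4 : p.q ^ 4 < 1 := by nlinarith [sq_nonneg p.q]
  have h2 : u ^ 2 < 1 := by nlinarith
  have h3 : 0 < u ^ 2 := by positivity
  exact ⟨h0.ne', by linarith, by linarith, by nlinarith, by nlinarith⟩

/-- First relation between `α` and `β`. -/
theorem alpha_beta_diff (h : LevelRange N l) :
    p.num (2 * l + 3) * p.alpha N (l + 1) ^ 2 - p.num (2 * l - 1) * p.alpha N l ^ 2 =
    (1 - p.q ^ 2) * p.beta N l * (-(p.q ^ 2 * (p.q ^ l) ^ 2 + 1 / (p.q ^ l) ^ 2) / (p.q - 1 / p.q)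
      * p.beta N l - (1 - p.s ^ 2)) := by
  obtain ⟨h1, h2, h3, h4, h5⟩ := p.level_ne h.half_le
  rw [p.alpha_sq h, p.alpha_sq_up h, p.beta_eq h.half_le, ← q_rpow_two_mul]
  exact alphaRat_diff p.q_pos.ne' h1 (p.q_rpow_pos _).ne' h2 h3 h4 h5

/-- Second relation between `α` and `β`. -/
theorem alpha_beta_quad (h : LevelRange N l) :
    (1 + p.q ^ 2) * p.q ^ 2 * (p.q ^ l) ^ 2 * (p.q - 1 / p.q) *
      (p.num (2 * l + 3) * p.alpha N (l + 1) ^ 2)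
    - (1 + p.q ^ 2) / (p.q ^ l) ^ 2 * (p.q - 1 / p.q) * (p.num (2 * l - 1) * p.alpha N l ^ 2)
    + ((p.q ^ 2 * (p.q ^ l) ^ 2 + 1 / (p.q ^ l) ^ 2) ^ 2 - p.q ^ 2 * (1 + p.q ^ 2) ^ 2)
      * p.beta N l ^ 2
    + (1 - p.s ^ 2) * (1 - p.q ^ 2) * (p.q - 1 / p.q) *
      (p.q ^ 2 * (p.q ^ l) ^ 2 + 1 / (p.q ^ l) ^ 2) * p.beta N l
    - (p.q ^ 2 * (1 - p.s ^ 2) ^ 2 + p.s ^ 2 * (1 + p.q ^ 2) ^ 2) * (p.q - 1 / p.q) ^ 2 = 0 := by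
  obtain ⟨h1, h2, h3, h4, h5⟩ := p.level_ne h.half_le
  rw [p.alpha_sq h, p.alpha_sq_up h, p.beta_eq h.half_le, ← q_rpow_two_mul]
  exact alphaRat_quad p.q_pos.ne' h1 (p.q_rpow_pos _).ne' h2 h3 h4 h5

/-- The recursion of `β`. -/
theorem beta_succ (hl : 1 / 2 ≤ l) :
    p.q ^ 2 * (p.num (2 * l + 4) * p.beta N (l + 1) - p.num (2 * l) * p.beta N l) =
      (1 - p.q ^ 2) * (1 - p.s ^ 2) := by
  have hq := p.q_pos
  obtain ⟨h1, h2, h3, h4, h5⟩ := p.level_ne hl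
  obtain ⟨-, -, -, h4', -⟩ := p.level_ne (l := l + 1) (by linarith)
  have hw : 0 < p.q ^ (2 * N) := p.q_rpow_pos _
  have e2 : p.q ^ (2 * l + 2) = p.q ^ (2 * l) * p.q ^ 2 := by rw [Real.rpow_add hq]; norm_cast
  have e4 : p.q ^ (2 * l + 4) = p.q ^ (2 * l) * p.q ^ 4 := by rw [Real.rpow_add hq]; norm_cast
  rw [p.beta_eq hl, p.beta_eq (l := l + 1) (by linarith), p.num_eq_of e4, p.num_eq_of rfl,
    show 2 * (l + 1) = 2 * l + 2 by ring, e2]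
  rw [show 2 * (l + 1) = 2 * l + 2 by ring, e2] at h4'
  rw [betaRat, betaRat]
  generalize p.q ^ (2 * l) = U at *
  generalize p.q ^ (2 * N) = W at *
  have e1 : p.q - p.q⁻¹ = (p.q ^ 2 - 1) / p.q := by field_simp
  have n5 : p.q ^ 4 * (U * p.q ^ 2) ^ 2 - 1 = p.q ^ 8 * U ^ 2 - 1 := by ring
  have n6 : (U * p.q ^ 2) ^ 2 - 1 = p.q ^ 4 * U ^ 2 - 1 := by ring
  have n7 : U * p.q ^ 4 - (U * p.q ^ 4)⁻¹ = (p.q ^ 8 * U ^ 2 - 1) / (U * p.q ^ 4) := by field_simp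
  have n8 : U - U⁻¹ = (U ^ 2 - 1) / U := by field_simp
  rw [n5] at h4'
  rw [n5, n6, n7, n8, e1]
  field_simp
  ring

end PodlesParam

/-! ### The defining relations, one matrix coefficient at a time -/

namespace PodlesParam
variable (p : PodlesParam) {N l m : ℝ}

/-- One nonnegative factor is enough: if the other is negative, `Real.sqrt` makes both sides zero.
This happens at the edge of the index range, where a q-number such as [-1] occurs. -/
theorem sqrt_num_mul {u v : ℝ} (h : 0 ≤ u ∨ 0 ≤ v) :
    √(p.num u * p.num v) = √(p.num u) * √(p.num v) := by
  rcases h with h | h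
  · exact Real.sqrt_mul (p.num_nonneg h) _
  · exact Real.sqrt_mul' _ (p.num_nonneg h)

theorem sqrt_two_num_mul {u v : ℝ} (h : 0 ≤ u ∨ 0 ≤ v) :
    √(p.num 2 * p.num u * p.num v) = √(p.num 2) * √(p.num u) * √(p.num v) := by
  rw [mul_assoc, Real.sqrt_mul (p.num_nonneg (by norm_num)), sqrt_num_mul p h, mul_assoc]

/-- These normal forms split a coefficient into powers of q^l and q^m, roots of single q-numbers,
and α or β. The caller prescribes the arguments, so equal roots in different coefficients become
syntactically equal and can be generalized to variables. -/
theorem cAp_eq {u v y l' : ℝ} (hu : l - m + 1 = u) (hv : l + m + 1 = v) (hl : l + 1 = l')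
    (hy : p.q ^ m = y) (h0 : 0 ≤ u ∨ 0 ≤ v := by first | (left; linarith) | (right; linarith)) :
    p.cAp N l m = y * (√(p.num 2) * √(p.num u) * √(p.num v)) * p.alpha N l' := by
  rw [cAp, hu, hv, hl, hy, sqrt_two_num_mul p h0]

theorem cA0_eq {u y x : ℝ} (hu : l - m = u) (hx : p.q ^ l = x) (hy : p.q ^ m = y) :
    p.cA0 N l m = (p.num (2 * l) - x * y * p.q * p.num 2 * p.num u) * p.beta N l := by
  rw [cA0, hu, Real.rpow_add_one p.q_pos.ne', Real.rpow_add p.q_pos, hx, hy]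

theorem cBp_eq {u v y x l' : ℝ} (hu : l + m + 1 = u) (hv : l + m + 2 = v) (hl : l + 1 = l')
    (hx : p.q ^ l = x) (hy : p.q ^ m = y)
    (h0 : 0 ≤ u ∨ 0 ≤ v := by first | (left; linarith) | (right; linarith)) :
    p.cBp N l m = x⁻¹ * y * (√(p.num u) * √(p.num v)) * p.alpha N l' := by
  rw [cBp, hu, hv, hl, Real.rpow_add p.q_pos, Real.rpow_neg p.q_pos.le, hx, hy, sqrt_num_mul p h0]

theorem cB0_eq {u v y : ℝ} (hu : l - m = u) (hv : l + m + 1 = v) (hy : p.q ^ m = y)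
    (h0 : 0 ≤ u ∨ 0 ≤ v := by first | (left; linarith) | (right; linarith)) :
    p.cB0 N l m = -(y * p.q ^ 2 * (√(p.num 2) * √(p.num u) * √(p.num v)) * p.beta N l) := by
  have e : p.q ^ (m + 2) = y * p.q ^ 2 := by rw [Real.rpow_add p.q_pos, hy]; norm_cast
  rw [cB0, hu, hv, e, sqrt_two_num_mul p h0]
  ring

theorem cBm_eq {u v y x : ℝ} (hu : l - m = u) (hv : l - m - 1 = v)
    (hx : p.q ^ l = x) (hy : p.q ^ m = y)
    (h0 : 0 ≤ u ∨ 0 ≤ v := by first | (left; linarith) | (right; linarith)) :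
    p.cBm N l m = -(x * y * p.q * (√(p.num u) * √(p.num v)) * p.alpha N l) := by
  rw [cBm, hv, hu, Real.rpow_add_one p.q_pos.ne', Real.rpow_add p.q_pos, hx, hy, sqrt_num_mul p h0]
  ring

theorem sqrt_num_sq {t : ℝ} (h : 0 ≤ t) : √(p.num t) ^ 2 = p.num t := Real.sq_sqrt (p.num_nonneg h)

/-- For i = 0 the square of √[i - 1] is not [i - 1] = [-1] < 0, but the factor √[i] vanishes there.
The relations only need the product. -/
theorem sqrt_num_pred_sq (i : ℕ) :
    √(p.num i) * √(p.num (i - 1)) ^ 2 = √(p.num i) * p.num (i - 1) := by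
  rcases i with _ | i
  · simp [num_zero]
  · rw [sqrt_num_sq]
    push_cast
    have : (0 : ℝ) ≤ i := i.cast_nonneg
    linarith

theorem q_rpow_add_one (t : ℝ) : p.q ^ (t + 1) = p.q ^ t * p.q := Real.rpow_add_one p.q_pos.ne' t
theorem q_rpow_sub_one (t : ℝ) : p.q ^ (t - 1) = p.q ^ t / p.q := Real.rpow_sub_one p.q_pos.ne' t
theorem q_rpow_add_two (t : ℝ) : p.q ^ (t + 2) = p.q ^ t * p.q ^ 2 := by
  rw [Real.rpow_add p.q_pos]; norm_cast

theorem num_shift {t z : ℝ} (k : ℤ) (h : p.q ^ t = z) :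
    p.num (t + k) = (z * p.q ^ k - (z * p.q ^ k)⁻¹) / (p.q - p.q⁻¹) := by
  apply p.num_eq_of
  rw [Real.rpow_add p.q_pos, h, Real.rpow_intCast]

theorem sub_inv_eq : p.q - p.q⁻¹ = (p.q ^ 2 - 1) / p.q := by
  have := p.q_pos
  field_simp

theorem q_sq_sub_one_ne : p.q ^ 2 - 1 ≠ 0 := by
  have := p.q_sq_lt_one
  linarith

/-- The powers of `q` that occur in the coefficients, in terms of `x = q^l`, `y = q^m`. -/
theorem exists_powers {i j : ℝ} (hi : l - m = i) (hj : l + m = j) : ∃ x y : ℝ, 0 < x ∧ 0 < y ∧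
    p.q ^ l = x ∧ p.q ^ m = y ∧ p.q ^ (l + 1) = x * p.q ∧ p.q ^ (l - 1) = x / p.q ∧
    p.q ^ (l + 2) = x * p.q ^ 2 ∧ p.q ^ (m + 1) = y * p.q ∧ p.q ^ (m - 1) = y / p.q ∧
    (∀ k : ℤ, p.num (i + k) =
      (x / y * p.q ^ k - (x / y * p.q ^ k)⁻¹) / ((p.q ^ 2 - 1) / p.q)) ∧
    (∀ k : ℤ, p.num (j + k) =
      (x * y * p.q ^ k - (x * y * p.q ^ k)⁻¹) / ((p.q ^ 2 - 1) / p.q)) ∧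
    (∀ k : ℤ, p.num (2 * l + k) =
      (x ^ 2 * p.q ^ k - (x ^ 2 * p.q ^ k)⁻¹) / ((p.q ^ 2 - 1) / p.q)) := by
  refine ⟨p.q ^ l, p.q ^ m, p.q_rpow_pos l, p.q_rpow_pos m, rfl, rfl, p.q_rpow_add_one l,
    p.q_rpow_sub_one l, p.q_rpow_add_two l, p.q_rpow_add_one m, p.q_rpow_sub_one m, ?_, ?_, ?_⟩ <;>
  rw [← p.sub_inv_eq]
  · exact fun k => p.num_shift k (by rw [← hi, Real.rpow_sub p.q_pos])
  · exact fun k => p.num_shift k (by rw [← hj, Real.rpow_add p.q_pos])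
  · exact fun k => p.num_shift k (p.q_rpow_two_mul l)

/-- Coefficient of `|l+2, m+1⟩` in `(x₀x₁ - q²x₁x₀)|l, m⟩ = (1 - q²)(1 - s²)x₁|l, m⟩`. -/
theorem rel_ZX_two {i j : ℕ} (hi : l - m = i) (hj : l + m = j) :
    p.cAp N (l + 1) (m + 1) * p.cBp N l m - p.q ^ 2 * (p.cBp N (l + 1) m * p.cAp N l m) = 0 := by
  have hi' : (0 : ℝ) ≤ i := i.cast_nonneg
  have hj' : (0 : ℝ) ≤ j := j.cast_nonneg
  have hq := p.q_pos
  have hc := p.q_sq_sub_one_ne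
  obtain ⟨x, y, hx0, hy0, hx, hy, hx1, hx2, hx3, hy1, hy2, ni, nj, nl⟩ := p.exists_powers hi hj
  rw [p.cAp_eq (N := N) (l := l + 1) (m := m + 1) (u := i + 1) (v := j + 3) (l' := l + 2) (by linarith) (by linarith) (by ring) hy1,
    p.cBp_eq (N := N) (l := l) (m := m) (u := j + 1) (v := j + 2) (l' := l + 1) (by linarith) (by linarith) (by ring) hx hy,
    p.cBp_eq (N := N) (l := l + 1) (m := m) (u := j + 2) (v := j + 3) (l' := l + 2) (by linarith) (by linarith) (by ring) hx1 hy,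
    p.cAp_eq (N := N) (l := l) (m := m) (u := i + 1) (v := j + 1) (l' := l + 1) (by linarith) (by linarith) (by ring) hy]
  generalize √(p.num 2) = t at *
  generalize √(p.num (i + 1)) = ri1 at *
  generalize √(p.num (j + 1)) = rj1 at *
  generalize √(p.num (j + 2)) = rj2 at *
  generalize √(p.num (j + 3)) = rj3 at *
  field_simp
  ring

/-- Coefficient of `|l+1, m+1⟩` in the same relation. -/
theorem rel_ZX_one (h : LevelRange N l) {i j : ℕ} (hi : l - m = i) (hj : l + m = j) :
    p.cA0 N (l + 1) (m + 1) * p.cBp N l m + p.cAp N l (m + 1) * p.cB0 N l m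
      - p.q ^ 2 * (p.cBp N l m * p.cA0 N l m + p.cB0 N (l + 1) m * p.cAp N l m)
      = (1 - p.q ^ 2) * (1 - p.s ^ 2) * p.cBp N l m := by
  have hi' : (0 : ℝ) ≤ i := i.cast_nonneg
  have hj' : (0 : ℝ) ≤ j := j.cast_nonneg
  have hq := p.q_pos
  have hc := p.q_sq_sub_one_ne
  obtain ⟨x, y, hx0, hy0, hx, hy, hx1, hx2, hx3, hy1, hy2, ni, nj, nl⟩ := p.exists_powers hi hj
  rw [p.cA0_eq (N := N) (l := l + 1) (m := m + 1) (u := i) (by linarith) hx1 hy1,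
    p.cBp_eq (N := N) (l := l) (m := m) (u := j + 1) (v := j + 2) (l' := l + 1) (by linarith) (by linarith) (by ring) hx hy,
    p.cAp_eq (N := N) (l := l) (m := m + 1) (u := i) (v := j + 2) (l' := l + 1) (by linarith) (by linarith) (by ring) hy1,
    p.cB0_eq (N := N) (l := l) (m := m) (u := i) (v := j + 1) (by linarith) (by linarith) hy,
    p.cA0_eq (N := N) (l := l) (m := m) (u := i) (by linarith) hx hy,
    p.cB0_eq (N := N) (l := l + 1) (m := m) (u := i + 1) (v := j + 2) (by linarith) (by linarith) hy,
    p.cAp_eq (N := N) (l := l) (m := m) (u := i + 1) (v := j + 1) (l' := l + 1) (by linarith) (by linarith) (by ring) hy]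
  have ht := Real.sq_sqrt (p.num_nonneg (t := 2) (by norm_num))
  have hT := p.beta_succ (N := N) h.half_le
  have hi0 := p.sqrt_num_sq (t := i) (by linarith)
  have hi1 := p.sqrt_num_sq (t := i + 1) (by linarith)
  have hj1 := p.sqrt_num_sq (t := j + 1) (by linarith)
  have hj2 := p.sqrt_num_sq (t := j + 2) (by linarith)
  generalize √(p.num 2) = t at *
  generalize √(p.num (i)) = ri0 at *
  generalize √(p.num (i + 1)) = ri1 at *
  generalize √(p.num (j + 1)) = rj1 at *
  generalize √(p.num (j + 2)) = rj2 at *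
  have ni0 := ni 0
  have ni1 := ni (1)
  have nj1 := nj (1)
  have nj2 := nj (2)
  have nl0 := nl (0)
  have nl2 := nl (2)
  have nl4 := nl (4)
  simp only [Int.cast_neg, Int.cast_one, Int.cast_ofNat, Int.cast_zero, add_zero, zpow_zero, mul_one,
    ← sub_eq_add_neg, zpow_neg, zpow_one, zpow_ofNat] at ni0 ni1 nj1 nj2 nl0 nl2 nl4
  rw [nl4, nl0] at hT
  rw [num_two] at ht
  rw [ni0] at hi0
  rw [ni1] at hi1
  rw [nj1] at hj1
  rw [nj2] at hj2
  rw [show 2 * (l + 1) = 2 * l + 2 by ring, nl2]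
  rw [ni0, nl0, num_two]
  -- The recursion of β is the mathematical content; the other two lines replace squares of roots by
  -- q-numbers. The rational identity in q^l, q^m that is left goes to `field_simp` and `ring`.
  linear_combination (norm := skip)
    x⁻¹ * y * rj1 * rj2 * p.alpha N (l + 1) * hT
    - y ^ 2 * p.q ^ 3 * rj1 * rj2 * p.alpha N (l + 1) * p.beta N l *
      (ht * ri0 ^ 2 + (1 + p.q ^ 2) / p.q * hi0)
    + y ^ 2 * p.q ^ 4 * rj1 * rj2 * p.alpha N (l + 1) * p.beta N (l + 1) *
      (ht * ri1 ^ 2 + (1 + p.q ^ 2) / p.q * hi1)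
  field_simp
  ring

/-- Coefficient of `|l, m+1⟩` in the same relation. -/
theorem rel_ZX_zero (h : LevelRange N l) {i j : ℕ} (hi : l - m = i) (hj : l + m = j) :
    p.cAp N l (m + 1) * p.cBp N l m + p.cA0 N l (m + 1) * p.cB0 N l m
      + p.cAp N (l - 1) (m + 1) * p.cBm N l m
      - p.q ^ 2 * (p.cBm N (l + 1) m * p.cAp N l m + p.cB0 N l m * p.cA0 N l m
        + p.cBp N (l - 1) m * p.cAp N (l - 1) m)
      = (1 - p.q ^ 2) * (1 - p.s ^ 2) * p.cB0 N l m := by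
  have hi' : (0 : ℝ) ≤ i := i.cast_nonneg
  have hj' : (0 : ℝ) ≤ j := j.cast_nonneg
  have hq := p.q_pos
  have hc := p.q_sq_sub_one_ne
  obtain ⟨x, y, hx0, hy0, hx, hy, hx1, hx2, hx3, hy1, hy2, ni, nj, nl⟩ := p.exists_powers hi hj
  rw [p.cAp_eq (N := N) (l := l) (m := m + 1) (u := i) (v := j + 2) (l' := l + 1) (by linarith) (by linarith) (by ring) hy1,
    p.cBp_eq (N := N) (l := l) (m := m) (u := j + 1) (v := j + 2) (l' := l + 1) (by linarith) (by linarith) (by ring) hx hy,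
    p.cA0_eq (N := N) (l := l) (m := m + 1) (u := i - 1) (by linarith) hx hy1,
    p.cB0_eq (N := N) (l := l) (m := m) (u := i) (v := j + 1) (by linarith) (by linarith) hy,
    p.cAp_eq (N := N) (l := l - 1) (m := m + 1) (u := i - 1) (v := j + 1) (l' := l) (by linarith) (by linarith) (by ring) hy1,
    p.cBm_eq (N := N) (l := l) (m := m) (u := i) (v := i - 1) (by linarith) (by linarith) hx hy,
    p.cBm_eq (N := N) (l := l + 1) (m := m) (u := i + 1) (v := i) (by linarith) (by linarith) hx1 hy,
    p.cAp_eq (N := N) (l := l) (m := m) (u := i + 1) (v := j + 1) (l' := l + 1) (by linarith) (by linarith) (by ring) hy,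
    p.cA0_eq (N := N) (l := l) (m := m) (u := i) (by linarith) hx hy,
    p.cBp_eq (N := N) (l := l - 1) (m := m) (u := j) (v := j + 1) (l' := l) (by linarith) (by linarith) (by ring) hx2 hy,
    p.cAp_eq (N := N) (l := l - 1) (m := m) (u := i) (v := j) (l' := l) (by linarith) (by linarith) (by ring) hy]
  have ht := Real.sq_sqrt (p.num_nonneg (t := 2) (by norm_num))
  have s1 := p.alpha_beta_diff h
  have hin1 := p.sqrt_num_pred_sq i
  have hi0 := p.sqrt_num_sq (t := i) (by linarith)
  have hi1 := p.sqrt_num_sq (t := i + 1) (by linarith)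
  have hj0 := p.sqrt_num_sq (t := j) (by linarith)
  have hj1 := p.sqrt_num_sq (t := j + 1) (by linarith)
  have hj2 := p.sqrt_num_sq (t := j + 2) (by linarith)
  generalize √(p.num 2) = t at *
  generalize √(p.num (i - 1)) = rin1 at *
  generalize √(p.num (i)) = ri0 at *
  generalize √(p.num (i + 1)) = ri1 at *
  generalize √(p.num (j)) = rj0 at *
  generalize √(p.num (j + 1)) = rj1 at *
  generalize √(p.num (j + 2)) = rj2 at *
  have nin1 := ni (-1)
  have ni0 := ni 0
  have ni1 := ni (1)
  have nj0 := nj 0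
  have nj1 := nj (1)
  have nj2 := nj (2)
  have nln1 := nl (-1)
  have nl0 := nl (0)
  have nl3 := nl (3)
  simp only [Int.cast_neg, Int.cast_one, Int.cast_ofNat, Int.cast_zero, add_zero, zpow_zero, mul_one,
    ← sub_eq_add_neg, zpow_neg, zpow_one, zpow_ofNat] at nin1 ni0 ni1 nj0 nj1 nj2 nln1 nl0 nl3
  rw [nl3, nln1, hx, one_div p.q, p.sub_inv_eq] at s1
  rw [num_two] at ht
  rw [nin1] at hin1
  rw [ni0] at hi0
  rw [ni1] at hi1
  rw [nj0] at hj0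
  rw [nj1] at hj1
  rw [nj2] at hj2
  rw [nin1, ni0, nl0, num_two]
  -- Here α(l)², α(l+1)² and β(l)² meet, and the first α–β relation balances them. The factor √[l -
  -- m] in front allows [l - m - 1] to be negative.
  linear_combination (norm := skip)
    (x⁻¹ * y ^ 2 * p.q * t * ri0 * rj1 * p.alpha N (l + 1) ^ 2) * hj2
    - (x * y ^ 2 * p.q ^ 2 * t * rj1 * p.alpha N l ^ 2) * hin1
    + (x * y ^ 2 * p.q ^ 4 * t * ri0 * rj1 * p.alpha N (l + 1) ^ 2) * hi1
    - (p.q ^ 2 * (x / p.q)⁻¹ * y ^ 2 * t * ri0 * rj1 * p.alpha N l ^ 2) * hj0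
    + t * ri0 * rj1 * y * p.q ^ 2 * s1
  field_simp
  ring

/-- Coefficient of `|l, m+1⟩` in the same relation, applied to `|l+1, m⟩`. -/
theorem rel_ZX_neg_one (h : LevelRange N l) {i : ℕ} {j : ℝ} (hi : l - m = i)
    (hj : l + m = j) (hj' : -1 ≤ j) :
    p.cAp N l (m + 1) * p.cB0 N (l + 1) m + p.cA0 N l (m + 1) * p.cBm N (l + 1) m
      - p.q ^ 2 * (p.cBm N (l + 1) m * p.cA0 N (l + 1) m + p.cB0 N l m * p.cAp N l m)
      = (1 - p.q ^ 2) * (1 - p.s ^ 2) * p.cBm N (l + 1) m := by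
  have hi' : (0 : ℝ) ≤ i := i.cast_nonneg
  have hq := p.q_pos
  have hc := p.q_sq_sub_one_ne
  obtain ⟨x, y, hx0, hy0, hx, hy, hx1, hx2, hx3, hy1, hy2, ni, nj, nl⟩ := p.exists_powers hi hj
  -- The source is |l+1, m⟩, so only (l + 1) + m ≥ 0 is known and j may be -1. The arguments j + 1
  -- and j + 2 of the roots are nonnegative all the same.
  rw [p.cAp_eq (N := N) (l := l) (m := m + 1) (u := i) (v := j + 2) (l' := l + 1) (by linarith) (by linarith) (by ring) hy1,
    p.cB0_eq (N := N) (l := l + 1) (m := m) (u := i + 1) (v := j + 2) (by linarith) (by linarith) hy,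
    p.cA0_eq (N := N) (l := l) (m := m + 1) (u := i - 1) (by linarith) hx hy1,
    p.cBm_eq (N := N) (l := l + 1) (m := m) (u := i + 1) (v := i) (by linarith) (by linarith) hx1 hy,
    p.cA0_eq (N := N) (l := l + 1) (m := m) (u := i + 1) (by linarith) hx1 hy,
    p.cB0_eq (N := N) (l := l) (m := m) (u := i) (v := j + 1) (by linarith) (by linarith) hy,
    p.cAp_eq (N := N) (l := l) (m := m) (u := i + 1) (v := j + 1) (l' := l + 1) (by linarith) (by linarith) (by ring) hy]
  have ht := Real.sq_sqrt (p.num_nonneg (t := 2) (by norm_num))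
  have hT := p.beta_succ (N := N) h.half_le
  have hi0 := p.sqrt_num_sq (t := i) (by linarith)
  have hi1 := p.sqrt_num_sq (t := i + 1) (by linarith)
  have hj1 := p.sqrt_num_sq (t := j + 1) (by linarith)
  have hj2 := p.sqrt_num_sq (t := j + 2) (by linarith)
  generalize √(p.num 2) = t at *
  generalize √(p.num (i)) = ri0 at *
  generalize √(p.num (i + 1)) = ri1 at *
  generalize √(p.num (j + 1)) = rj1 at *
  generalize √(p.num (j + 2)) = rj2 at *
  have nin1 := ni (-1)
  have ni0 := ni 0
  have ni1 := ni (1)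
  have nj1 := nj (1)
  have nj2 := nj (2)
  have nl0 := nl (0)
  have nl2 := nl (2)
  have nl4 := nl (4)
  simp only [Int.cast_neg, Int.cast_one, Int.cast_ofNat, Int.cast_zero, add_zero, zpow_zero, mul_one,
    ← sub_eq_add_neg, zpow_neg, zpow_one, zpow_ofNat] at nin1 ni0 ni1 nj1 nj2 nl0 nl2 nl4
  rw [nl4, nl0] at hT
  rw [num_two] at ht
  rw [ni0] at hi0
  rw [ni1] at hi1
  rw [nj1] at hj1
  rw [nj2] at hj2
  rw [show 2 * (l + 1) = 2 * l + 2 by ring, nl2]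
  rw [nin1, ni1, nl0, num_two]
  linear_combination (norm := skip)
    -(x * y * p.q ^ 2 * ri1 * ri0 * p.alpha N (l + 1)) * hT
    - y ^ 2 * p.q ^ 3 * ri0 * ri1 * p.alpha N (l + 1) * p.beta N (l + 1) *
      (ht * rj2 ^ 2 + (1 + p.q ^ 2) / p.q * hj2)
    + y ^ 2 * p.q ^ 4 * ri0 * ri1 * p.alpha N (l + 1) * p.beta N l *
      (ht * rj1 ^ 2 + (1 + p.q ^ 2) / p.q * hj1)
  field_simp
  ring

/-- Coefficient of `|l-1, m+1⟩` in the same relation, applied to `|l+1, m⟩`. -/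
theorem rel_ZX_neg_two {i j : ℕ} (hi : l - m = i) (hj : l + m = j) :
    p.cAp N (l - 1) (m + 1) * p.cBm N (l + 1) m - p.q ^ 2 * (p.cBm N l m * p.cAp N l m) = 0 := by
  have hi' : (0 : ℝ) ≤ i := i.cast_nonneg
  have hj' : (0 : ℝ) ≤ j := j.cast_nonneg
  have hq := p.q_pos
  have hc := p.q_sq_sub_one_ne
  obtain ⟨x, y, hx0, hy0, hx, hy, hx1, hx2, hx3, hy1, hy2, ni, nj, nl⟩ := p.exists_powers hi hj
  rw [p.cAp_eq (N := N) (l := l - 1) (m := m + 1) (u := i - 1) (v := j + 1) (l' := l) (by linarith) (by linarith) (by ring) hy1,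
    p.cBm_eq (N := N) (l := l + 1) (m := m) (u := i + 1) (v := i) (by linarith) (by linarith) hx1 hy,
    p.cBm_eq (N := N) (l := l) (m := m) (u := i) (v := i - 1) (by linarith) (by linarith) hx hy,
    p.cAp_eq (N := N) (l := l) (m := m) (u := i + 1) (v := j + 1) (l' := l + 1) (by linarith) (by linarith) (by ring) hy]
  generalize √(p.num 2) = t at *
  generalize √(p.num (i - 1)) = rin1 at *
  generalize √(p.num (i)) = ri0 at *
  generalize √(p.num (i + 1)) = ri1 at *
  generalize √(p.num (j + 1)) = rj1 at *
  field_simp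
  ring

/-- Coefficient of `|l+2, m⟩` in the relation for `x₁x₁^*`. -/
theorem rel_XY_two {i j : ℕ} (hi : l - m = i) (hj : l + m = j) :
    (1 + p.q ^ 2) * (p.cBp N (l + 1) (m - 1) * p.cBm N (l + 1) (m - 1))
      + p.cAp N (l + 1) m * p.cAp N l m = 0 := by
  have hi' : (0 : ℝ) ≤ i := i.cast_nonneg
  have hj' : (0 : ℝ) ≤ j := j.cast_nonneg
  have hq := p.q_pos
  have hc := p.q_sq_sub_one_ne
  obtain ⟨x, y, hx0, hy0, hx, hy, hx1, hx2, hx3, hy1, hy2, ni, nj, nl⟩ := p.exists_powers hi hj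
  rw [p.cBp_eq (N := N) (l := l + 1) (m := m - 1) (u := j + 1) (v := j + 2) (l' := l + 2) (by linarith) (by linarith) (by ring) hx1 hy2,
    p.cBm_eq (N := N) (l := l + 1) (m := m - 1) (u := i + 2) (v := i + 1) (by linarith) (by linarith) hx1 hy2,
    p.cAp_eq (N := N) (l := l + 1) (m := m) (u := i + 2) (v := j + 2) (l' := l + 2) (by linarith) (by linarith) (by ring) hy,
    p.cAp_eq (N := N) (l := l) (m := m) (u := i + 1) (v := j + 1) (l' := l + 1) (by linarith) (by linarith) (by ring) hy]
  have ht := Real.sq_sqrt (p.num_nonneg (t := 2) (by norm_num))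
  have hi1 := p.sqrt_num_sq (t := i + 1) (by linarith)
  have hi2 := p.sqrt_num_sq (t := i + 2) (by linarith)
  have hj1 := p.sqrt_num_sq (t := j + 1) (by linarith)
  have hj2 := p.sqrt_num_sq (t := j + 2) (by linarith)
  generalize √(p.num 2) = t at *
  generalize √(p.num (i + 1)) = ri1 at *
  generalize √(p.num (i + 2)) = ri2 at *
  generalize √(p.num (j + 1)) = rj1 at *
  generalize √(p.num (j + 2)) = rj2 at *
  have ni1 := ni (1)
  have ni2 := ni (2)
  have nj1 := nj (1)
  have nj2 := nj (2)
  simp only [Int.cast_neg, Int.cast_one, Int.cast_ofNat, Int.cast_zero, add_zero, zpow_zero, mul_one,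
    ← sub_eq_add_neg, zpow_neg, zpow_one, zpow_ofNat] at ni1 ni2 nj1 nj2
  rw [num_two] at ht
  rw [ni1] at hi1
  rw [ni2] at hi2
  rw [nj1] at hj1
  rw [nj2] at hj2
  linear_combination (norm := skip)
    y ^ 2 * ri1 * ri2 * rj1 * rj2 * p.alpha N (l + 1) * p.alpha N (l + 2) * ht
  field_simp
  ring

/-- Coefficient of `|l+1, m⟩` in the relation for `x₁x₁^*`. -/
theorem rel_XY_one (h : LevelRange N l) {i j : ℕ} (hi : l - m = i) (hj : l + m = j) :
    (1 + p.q ^ 2) * (p.cB0 N (l + 1) (m - 1) * p.cBm N (l + 1) (m - 1)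
        + p.cBp N l (m - 1) * p.cB0 N l (m - 1))
      + (p.cA0 N (l + 1) m + p.cA0 N l m) * p.cAp N l m
      - (1 - p.s ^ 2) * (1 - p.q ^ 2) * p.cAp N l m = 0 := by
  have hi' : (0 : ℝ) ≤ i := i.cast_nonneg
  have hj' : (0 : ℝ) ≤ j := j.cast_nonneg
  have hq := p.q_pos
  have hc := p.q_sq_sub_one_ne
  obtain ⟨x, y, hx0, hy0, hx, hy, hx1, hx2, hx3, hy1, hy2, ni, nj, nl⟩ := p.exists_powers hi hj
  rw [p.cB0_eq (N := N) (l := l + 1) (m := m - 1) (u := i + 2) (v := j + 1) (by linarith) (by linarith) hy2,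
    p.cBm_eq (N := N) (l := l + 1) (m := m - 1) (u := i + 2) (v := i + 1) (by linarith) (by linarith) hx1 hy2,
    p.cBp_eq (N := N) (l := l) (m := m - 1) (u := j) (v := j + 1) (l' := l + 1) (by linarith) (by linarith) (by ring) hx hy2,
    p.cB0_eq (N := N) (l := l) (m := m - 1) (u := i + 1) (v := j) (by linarith) (by linarith) hy2,
    p.cA0_eq (N := N) (l := l + 1) (m := m) (u := i + 1) (by linarith) hx1 hy,
    p.cA0_eq (N := N) (l := l) (m := m) (u := i) (by linarith) hx hy,
    p.cAp_eq (N := N) (l := l) (m := m) (u := i + 1) (v := j + 1) (l' := l + 1) (by linarith) (by linarith) (by ring) hy]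
  have ht := Real.sq_sqrt (p.num_nonneg (t := 2) (by norm_num))
  have hT := p.beta_succ (N := N) h.half_le
  have hi1 := p.sqrt_num_sq (t := i + 1) (by linarith)
  have hi2 := p.sqrt_num_sq (t := i + 2) (by linarith)
  have hj0 := p.sqrt_num_sq (t := j) (by linarith)
  have hj1 := p.sqrt_num_sq (t := j + 1) (by linarith)
  generalize √(p.num 2) = t at *
  generalize √(p.num (i + 1)) = ri1 at *
  generalize √(p.num (i + 2)) = ri2 at *
  generalize √(p.num (j)) = rj0 at *
  generalize √(p.num (j + 1)) = rj1 at *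
  have ni0 := ni 0
  have ni1 := ni (1)
  have ni2 := ni (2)
  have nj0 := nj 0
  have nj1 := nj (1)
  have nl0 := nl (0)
  have nl2 := nl (2)
  have nl4 := nl (4)
  simp only [Int.cast_neg, Int.cast_one, Int.cast_ofNat, Int.cast_zero, add_zero, zpow_zero, mul_one,
    ← sub_eq_add_neg, zpow_neg, zpow_one, zpow_ofNat] at ni0 ni1 ni2 nj0 nj1 nl0 nl2 nl4
  rw [nl4, nl0] at hT
  rw [num_two] at ht
  rw [ni1] at hi1
  rw [ni2] at hi2
  rw [nj0] at hj0
  rw [nj1] at hj1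
  rw [show 2 * (l + 1) = 2 * l + 2 by ring, nl2]
  rw [ni0, ni1, nl0, num_two]
  linear_combination (norm := skip)
    y * t * ri1 * rj1 * p.alpha N (l + 1) * hT
    + (1 + p.q ^ 2) * x * y ^ 2 * p.q ^ 2 * t * ri1 * rj1 * p.alpha N (l + 1) * p.beta N (l + 1) * hi2
    - (1 + p.q ^ 2) * x⁻¹ * y ^ 2 * t * ri1 * rj1 * p.alpha N (l + 1) * p.beta N l * hj0
  field_simp
  ring

/-- Coefficient of `|l, m⟩` in the relation for `x₁x₁^*`. -/
theorem rel_XY_zero (h : LevelRange N l) {i j : ℕ} (hi : l - m = i) (hj : l + m = j) :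
    (1 + p.q ^ 2) * (p.cBm N (l + 1) (m - 1) ^ 2 + p.cB0 N l (m - 1) ^ 2 + p.cBp N (l - 1) (m - 1) ^ 2)
      + (p.cAp N l m ^ 2 + p.cA0 N l m ^ 2 + p.cAp N (l - 1) m ^ 2)
      - (1 - p.s ^ 2) * (1 - p.q ^ 2) * p.cA0 N l m
      - (p.q ^ 2 * (1 - p.s ^ 2) ^ 2 + p.s ^ 2 * (1 + p.q ^ 2) ^ 2) = 0 := by
  have hi' : (0 : ℝ) ≤ i := i.cast_nonneg
  have hj' : (0 : ℝ) ≤ j := j.cast_nonneg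
  have hq := p.q_pos
  have hc := p.q_sq_sub_one_ne
  obtain ⟨x, y, hx0, hy0, hx, hy, hx1, hx2, hx3, hy1, hy2, ni, nj, nl⟩ := p.exists_powers hi hj
  rw [p.cBm_eq (N := N) (l := l + 1) (m := m - 1) (u := i + 2) (v := i + 1) (by linarith) (by linarith) hx1 hy2,
    p.cB0_eq (N := N) (l := l) (m := m - 1) (u := i + 1) (v := j) (by linarith) (by linarith) hy2,
    p.cBp_eq (N := N) (l := l - 1) (m := m - 1) (u := j - 1) (v := j) (l' := l) (by linarith) (by linarith) (by ring) hx2 hy2,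
    p.cAp_eq (N := N) (l := l) (m := m) (u := i + 1) (v := j + 1) (l' := l + 1) (by linarith) (by linarith) (by ring) hy,
    p.cA0_eq (N := N) (l := l) (m := m) (u := i) (by linarith) hx hy,
    p.cAp_eq (N := N) (l := l - 1) (m := m) (u := i) (v := j) (l' := l) (by linarith) (by linarith) (by ring) hy]
  have ht := Real.sq_sqrt (p.num_nonneg (t := 2) (by norm_num))
  have s1 := p.alpha_beta_diff h
  have s0 := p.alpha_beta_quad h
  have hi0 := p.sqrt_num_sq (t := i) (by linarith)
  have hi1 := p.sqrt_num_sq (t := i + 1) (by linarith)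
  have hi2 := p.sqrt_num_sq (t := i + 2) (by linarith)
  have hjn1 := p.sqrt_num_pred_sq j
  have hj0 := p.sqrt_num_sq (t := j) (by linarith)
  have hj1 := p.sqrt_num_sq (t := j + 1) (by linarith)
  generalize √(p.num 2) = t at *
  generalize √(p.num (i)) = ri0 at *
  generalize √(p.num (i + 1)) = ri1 at *
  generalize √(p.num (i + 2)) = ri2 at *
  generalize √(p.num (j - 1)) = rjn1 at *
  generalize √(p.num (j)) = rj0 at *
  generalize √(p.num (j + 1)) = rj1 at *
  have ni0 := ni 0
  have ni1 := ni (1)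
  have ni2 := ni (2)
  have njn1 := nj (-1)
  have nj0 := nj 0
  have nj1 := nj (1)
  have nln1 := nl (-1)
  have nl0 := nl (0)
  have nl3 := nl (3)
  simp only [Int.cast_neg, Int.cast_one, Int.cast_ofNat, Int.cast_zero, add_zero, zpow_zero, mul_one,
    ← sub_eq_add_neg, zpow_neg, zpow_one, zpow_ofNat] at ni0 ni1 ni2 njn1 nj0 nj1 nln1 nl0 nl3
  rw [nl3, nln1, hx, one_div p.q, p.sub_inv_eq] at s1
  rw [nl3, nln1, hx, one_div p.q, p.sub_inv_eq] at s0
  rw [num_two] at ht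
  rw [ni0] at hi0
  rw [ni1] at hi1
  rw [ni2] at hi2
  rw [njn1] at hjn1
  rw [nj0] at hj0
  rw [nj1] at hj1
  rw [ni0, nl0, num_two]
  -- As a function of y = q^m the identity has a part without y, which is the quadratic α–β
  -- relation, and a part with y², which is the first one. All remaining terms evaluate squares of
  -- roots.
  linear_combination (norm := skip)
    ((p.q ^ 2 - 1) / p.q)⁻¹ ^ 2 * s0 - (1 + p.q ^ 2) * ((p.q ^ 2 - 1) / p.q)⁻¹ * y ^ 2 * s1
    + (1 + p.q ^ 2) * x ^ 2 * y ^ 2 * p.q ^ 2 * p.alpha N (l + 1) ^ 2 *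
      (hi2 * ri1 ^ 2 + (x / y * p.q ^ 2 - (x / y * p.q ^ 2)⁻¹) / ((p.q ^ 2 - 1) / p.q) * hi1)
    + (1 + p.q ^ 2) * y ^ 2 * p.q ^ 2 * p.beta N l ^ 2 * (ht * ri1 ^ 2 * rj0 ^ 2
      + (1 + p.q ^ 2) / p.q * hi1 * rj0 ^ 2 + (1 + p.q ^ 2) / p.q *
        ((x / y * p.q - (x / y * p.q)⁻¹) / ((p.q ^ 2 - 1) / p.q)) * hj0)
    + (1 + p.q ^ 2) * x⁻¹ ^ 2 * y ^ 2 * p.alpha N l ^ 2 * (rj0 * hjn1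
      + hj0 * ((x * y * p.q⁻¹ - (x * y * p.q⁻¹)⁻¹) / ((p.q ^ 2 - 1) / p.q)))
    + y ^ 2 * p.alpha N (l + 1) ^ 2 * (ht * ri1 ^ 2 * rj1 ^ 2
      + (1 + p.q ^ 2) / p.q * hi1 * rj1 ^ 2 + (1 + p.q ^ 2) / p.q *
        ((x / y * p.q - (x / y * p.q)⁻¹) / ((p.q ^ 2 - 1) / p.q)) * hj1)
    + y ^ 2 * p.alpha N l ^ 2 * (ht * ri0 ^ 2 * rj0 ^ 2
      + (1 + p.q ^ 2) / p.q * hi0 * rj0 ^ 2 + (1 + p.q ^ 2) / p.q *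
        ((x / y - (x / y)⁻¹) / ((p.q ^ 2 - 1) / p.q)) * hj0)
  field_simp
  ring

/-- Coefficient of `|l+2, m⟩` in the relation for `x₁^*x₁`. -/
theorem rel_YX_two {i j : ℕ} (hi : l - m = i) (hj : l + m = j) :
    (1 + p.q ^ 2) * (p.cBm N (l + 2) m * p.cBp N l m)
      + p.q ^ 4 * (p.cAp N (l + 1) m * p.cAp N l m) = 0 := by
  have hi' : (0 : ℝ) ≤ i := i.cast_nonneg
  have hj' : (0 : ℝ) ≤ j := j.cast_nonneg
  have hq := p.q_pos
  have hc := p.q_sq_sub_one_ne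
  obtain ⟨x, y, hx0, hy0, hx, hy, hx1, hx2, hx3, hy1, hy2, ni, nj, nl⟩ := p.exists_powers hi hj
  rw [p.cBm_eq (N := N) (l := l + 2) (m := m) (u := i + 2) (v := i + 1) (by linarith) (by linarith) hx3 hy,
    p.cBp_eq (N := N) (l := l) (m := m) (u := j + 1) (v := j + 2) (l' := l + 1) (by linarith) (by linarith) (by ring) hx hy,
    p.cAp_eq (N := N) (l := l + 1) (m := m) (u := i + 2) (v := j + 2) (l' := l + 2) (by linarith) (by linarith) (by ring) hy,
    p.cAp_eq (N := N) (l := l) (m := m) (u := i + 1) (v := j + 1) (l' := l + 1) (by linarith) (by linarith) (by ring) hy]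
  have ht := Real.sq_sqrt (p.num_nonneg (t := 2) (by norm_num))
  have hi1 := p.sqrt_num_sq (t := i + 1) (by linarith)
  have hi2 := p.sqrt_num_sq (t := i + 2) (by linarith)
  have hj1 := p.sqrt_num_sq (t := j + 1) (by linarith)
  have hj2 := p.sqrt_num_sq (t := j + 2) (by linarith)
  generalize √(p.num 2) = t at *
  generalize √(p.num (i + 1)) = ri1 at *
  generalize √(p.num (i + 2)) = ri2 at *
  generalize √(p.num (j + 1)) = rj1 at *
  generalize √(p.num (j + 2)) = rj2 at *
  have ni1 := ni (1)
  have ni2 := ni (2)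
  have nj1 := nj (1)
  have nj2 := nj (2)
  simp only [Int.cast_neg, Int.cast_one, Int.cast_ofNat, Int.cast_zero, add_zero, zpow_zero, mul_one,
    ← sub_eq_add_neg, zpow_neg, zpow_one, zpow_ofNat] at ni1 ni2 nj1 nj2
  rw [num_two] at ht
  rw [ni1] at hi1
  rw [ni2] at hi2
  rw [nj1] at hj1
  rw [nj2] at hj2
  linear_combination (norm := skip)
    p.q ^ 4 * y ^ 2 * ri1 * ri2 * rj1 * rj2 * p.alpha N (l + 1) * p.alpha N (l + 2) * ht
  field_simp
  ring

/-- Coefficient of `|l+1, m⟩` in the relation for `x₁^*x₁`. -/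
theorem rel_YX_one (h : LevelRange N l) {i j : ℕ} (hi : l - m = i) (hj : l + m = j) :
    (1 + p.q ^ 2) * (p.cB0 N (l + 1) m * p.cBp N l m + p.cBm N (l + 1) m * p.cB0 N l m)
      + p.q ^ 4 * ((p.cA0 N (l + 1) m + p.cA0 N l m) * p.cAp N l m)
      + p.q ^ 2 * (1 - p.q ^ 2) * (1 - p.s ^ 2) * p.cAp N l m = 0 := by
  have hi' : (0 : ℝ) ≤ i := i.cast_nonneg
  have hj' : (0 : ℝ) ≤ j := j.cast_nonneg
  have hq := p.q_pos
  have hc := p.q_sq_sub_one_ne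
  obtain ⟨x, y, hx0, hy0, hx, hy, hx1, hx2, hx3, hy1, hy2, ni, nj, nl⟩ := p.exists_powers hi hj
  rw [p.cB0_eq (N := N) (l := l + 1) (m := m) (u := i + 1) (v := j + 2) (by linarith) (by linarith) hy,
    p.cBp_eq (N := N) (l := l) (m := m) (u := j + 1) (v := j + 2) (l' := l + 1) (by linarith) (by linarith) (by ring) hx hy,
    p.cBm_eq (N := N) (l := l + 1) (m := m) (u := i + 1) (v := i) (by linarith) (by linarith) hx1 hy,
    p.cB0_eq (N := N) (l := l) (m := m) (u := i) (v := j + 1) (by linarith) (by linarith) hy,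
    p.cA0_eq (N := N) (l := l + 1) (m := m) (u := i + 1) (by linarith) hx1 hy,
    p.cA0_eq (N := N) (l := l) (m := m) (u := i) (by linarith) hx hy,
    p.cAp_eq (N := N) (l := l) (m := m) (u := i + 1) (v := j + 1) (l' := l + 1) (by linarith) (by linarith) (by ring) hy]
  have ht := Real.sq_sqrt (p.num_nonneg (t := 2) (by norm_num))
  have hT := p.beta_succ (N := N) h.half_le
  have hi0 := p.sqrt_num_sq (t := i) (by linarith)
  have hi1 := p.sqrt_num_sq (t := i + 1) (by linarith)
  have hj1 := p.sqrt_num_sq (t := j + 1) (by linarith)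
  have hj2 := p.sqrt_num_sq (t := j + 2) (by linarith)
  generalize √(p.num 2) = t at *
  generalize √(p.num (i)) = ri0 at *
  generalize √(p.num (i + 1)) = ri1 at *
  generalize √(p.num (j + 1)) = rj1 at *
  generalize √(p.num (j + 2)) = rj2 at *
  have ni0 := ni 0
  have ni1 := ni (1)
  have nj1 := nj (1)
  have nj2 := nj (2)
  have nl0 := nl (0)
  have nl2 := nl (2)
  have nl4 := nl (4)
  simp only [Int.cast_neg, Int.cast_one, Int.cast_ofNat, Int.cast_zero, add_zero, zpow_zero, mul_one,
    ← sub_eq_add_neg, zpow_neg, zpow_one, zpow_ofNat] at ni0 ni1 nj1 nj2 nl0 nl2 nl4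
  rw [nl4, nl0] at hT
  rw [num_two] at ht
  rw [ni0] at hi0
  rw [ni1] at hi1
  rw [nj1] at hj1
  rw [nj2] at hj2
  rw [show 2 * (l + 1) = 2 * l + 2 by ring, nl2]
  rw [ni0, ni1, nl0, num_two]
  linear_combination (norm := skip)
    -(p.q ^ 2 * y * t * ri1 * rj1 * p.alpha N (l + 1)) * hT
    - (1 + p.q ^ 2) * x⁻¹ * y ^ 2 * p.q ^ 2 * t * ri1 * rj1 * p.alpha N (l + 1) * p.beta N (l + 1) * hj2
    + (1 + p.q ^ 2) * x * y ^ 2 * p.q ^ 4 * t * ri1 * rj1 * p.alpha N (l + 1) * p.beta N l * hi0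
  field_simp
  ring

/-- Coefficient of `|l, m⟩` in the relation for `x₁^*x₁`. -/
theorem rel_YX_zero (h : LevelRange N l) {i j : ℕ} (hi : l - m = i) (hj : l + m = j) :
    (1 + p.q ^ 2) * (p.cBp N l m ^ 2 + p.cB0 N l m ^ 2 + p.cBm N l m ^ 2)
      + p.q ^ 4 * (p.cAp N l m ^ 2 + p.cA0 N l m ^ 2 + p.cAp N (l - 1) m ^ 2)
      + p.q ^ 2 * (1 - p.q ^ 2) * (1 - p.s ^ 2) * p.cA0 N l m
      - (p.q ^ 2 * (1 - p.s ^ 2) ^ 2 + p.s ^ 2 * (1 + p.q ^ 2) ^ 2) = 0 := by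
  have hi' : (0 : ℝ) ≤ i := i.cast_nonneg
  have hj' : (0 : ℝ) ≤ j := j.cast_nonneg
  have hq := p.q_pos
  have hc := p.q_sq_sub_one_ne
  obtain ⟨x, y, hx0, hy0, hx, hy, hx1, hx2, hx3, hy1, hy2, ni, nj, nl⟩ := p.exists_powers hi hj
  rw [p.cBp_eq (N := N) (l := l) (m := m) (u := j + 1) (v := j + 2) (l' := l + 1) (by linarith) (by linarith) (by ring) hx hy,
    p.cB0_eq (N := N) (l := l) (m := m) (u := i) (v := j + 1) (by linarith) (by linarith) hy,
    p.cBm_eq (N := N) (l := l) (m := m) (u := i) (v := i - 1) (by linarith) (by linarith) hx hy,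
    p.cAp_eq (N := N) (l := l) (m := m) (u := i + 1) (v := j + 1) (l' := l + 1) (by linarith) (by linarith) (by ring) hy,
    p.cA0_eq (N := N) (l := l) (m := m) (u := i) (by linarith) hx hy,
    p.cAp_eq (N := N) (l := l - 1) (m := m) (u := i) (v := j) (l' := l) (by linarith) (by linarith) (by ring) hy]
  have ht := Real.sq_sqrt (p.num_nonneg (t := 2) (by norm_num))
  have s1 := p.alpha_beta_diff h
  have s0 := p.alpha_beta_quad h
  have hin1 := p.sqrt_num_pred_sq i
  have hi0 := p.sqrt_num_sq (t := i) (by linarith)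
  have hi1 := p.sqrt_num_sq (t := i + 1) (by linarith)
  have hj0 := p.sqrt_num_sq (t := j) (by linarith)
  have hj1 := p.sqrt_num_sq (t := j + 1) (by linarith)
  have hj2 := p.sqrt_num_sq (t := j + 2) (by linarith)
  generalize √(p.num 2) = t at *
  generalize √(p.num (i - 1)) = rin1 at *
  generalize √(p.num (i)) = ri0 at *
  generalize √(p.num (i + 1)) = ri1 at *
  generalize √(p.num (j)) = rj0 at *
  generalize √(p.num (j + 1)) = rj1 at *
  generalize √(p.num (j + 2)) = rj2 at *
  have nin1 := ni (-1)
  have ni0 := ni 0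
  have ni1 := ni (1)
  have nj0 := nj 0
  have nj1 := nj (1)
  have nj2 := nj (2)
  have nln1 := nl (-1)
  have nl0 := nl (0)
  have nl3 := nl (3)
  simp only [Int.cast_neg, Int.cast_one, Int.cast_ofNat, Int.cast_zero, add_zero, zpow_zero, mul_one,
    ← sub_eq_add_neg, zpow_neg, zpow_one, zpow_ofNat] at nin1 ni0 ni1 nj0 nj1 nj2 nln1 nl0 nl3
  rw [nl3, nln1, hx, one_div p.q, p.sub_inv_eq] at s1
  rw [nl3, nln1, hx, one_div p.q, p.sub_inv_eq] at s0
  rw [num_two] at ht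
  rw [nin1] at hin1
  rw [ni0] at hi0
  rw [ni1] at hi1
  rw [nj0] at hj0
  rw [nj1] at hj1
  rw [nj2] at hj2
  rw [ni0, nl0, num_two]
  -- The same two α–β relations suffice; relative to x₁x₁^* only the multiple of the first one
  -- changes.
  linear_combination (norm := skip)
    ((p.q ^ 2 - 1) / p.q)⁻¹ ^ 2 * s0 + (1 + p.q ^ 2) * ((p.q ^ 2 - 1) / p.q)⁻¹ *
      (p.q ^ 2 * y ^ 2 - (p.q ^ 2 * x ^ 2 + x⁻¹ ^ 2)) * s1
    + (1 + p.q ^ 2) * x⁻¹ ^ 2 * y ^ 2 * p.alpha N (l + 1) ^ 2 *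
      (hj2 * rj1 ^ 2 + (x * y * p.q ^ 2 - (x * y * p.q ^ 2)⁻¹) / ((p.q ^ 2 - 1) / p.q) * hj1)
    + (1 + p.q ^ 2) * y ^ 2 * p.q ^ 4 * p.beta N l ^ 2 * (ht * ri0 ^ 2 * rj1 ^ 2
      + (1 + p.q ^ 2) / p.q * hi0 * rj1 ^ 2 + (1 + p.q ^ 2) / p.q *
        ((x / y - (x / y)⁻¹) / ((p.q ^ 2 - 1) / p.q)) * hj1)
    + (1 + p.q ^ 2) * x ^ 2 * y ^ 2 * p.q ^ 2 * p.alpha N l ^ 2 * (ri0 * hin1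
      + hi0 * ((x / y * p.q⁻¹ - (x / y * p.q⁻¹)⁻¹) / ((p.q ^ 2 - 1) / p.q)))
    + p.q ^ 4 * y ^ 2 * p.alpha N (l + 1) ^ 2 * (ht * ri1 ^ 2 * rj1 ^ 2
      + (1 + p.q ^ 2) / p.q * hi1 * rj1 ^ 2 + (1 + p.q ^ 2) / p.q *
        ((x / y * p.q - (x / y * p.q)⁻¹) / ((p.q ^ 2 - 1) / p.q)) * hj1)
    + p.q ^ 4 * y ^ 2 * p.alpha N l ^ 2 * (ht * ri0 ^ 2 * rj0 ^ 2
      + (1 + p.q ^ 2) / p.q * hi0 * rj0 ^ 2 + (1 + p.q ^ 2) / p.q *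
        ((x / y - (x / y)⁻¹) / ((p.q ^ 2 - 1) / p.q)) * hj0)
  field_simp
  ring

end PodlesParam

/-! ### Matrices of operators as operators on ℓ²(ι × κ) -/

namespace Ell2

section
variable {ι κ : Type*} [DecidableEq ι] [DecidableEq κ]

/-- The inclusion of `ℓ²(ι)` as `ℓ²(ι × {k})`. -/
noncomputable def blockIncl (k : κ) : Ell2 ι →L[ℂ] Ell2 (ι × κ) :=
  weightedComp Prod.fst fun x => if x.2 = k then 1 else 0

/-- The restriction of `ℓ²(ι × κ)` to `ℓ²(ι × {k})`. -/
noncomputable def blockProj (k : κ) : Ell2 (ι × κ) →L[ℂ] Ell2 ι :=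
  weightedComp (fun x => (x, k)) fun _ => 1

theorem blockIncl_apply (k : κ) (v : Ell2 ι) (x : ι × κ) :
    blockIncl k v x = if x.2 = k then v x.1 else 0 := by
  rw [blockIncl, weightedComp_apply (C := 1)]
  · split_ifs <;> simp
  · rintro ⟨x, j⟩ hx ⟨y, j'⟩ hy h
    simp only [Set.mem_ofPred_eq, ne_eq, ite_eq_right_iff, one_ne_zero, imp_false, not_not] at hx hy
    simp_all
  · intro i
    split_ifs <;> simp

theorem blockProj_apply (k : κ) (v : Ell2 (ι × κ)) (x : ι) : blockProj k v x = v (x, k) := by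
  rw [blockProj, weightedComp_apply (C := 1)]
  · simp
  · intro x _ y _ h
    simpa using h
  · simp

theorem blockIncl_single (k : κ) (x : ι) (c : ℂ) :
    blockIncl k (lp.single 2 x c : Ell2 ι) = lp.single 2 (x, k) c := by
  ext ⟨y, j⟩
  rw [blockIncl_apply, lp.single_apply, lp.single_apply]
  by_cases h1 : y = x <;> by_cases h2 : j = k <;> simp [h1, h2]

theorem blockProj_single (k j : κ) (x : ι) (c : ℂ) :
    blockProj k (lp.single 2 (x, j) c : Ell2 (ι × κ)) =
      if j = k then (lp.single 2 x c : Ell2 ι) else 0 := by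
  ext y
  rw [blockProj_apply, lp.single_apply]
  by_cases h2 : j = k
  · by_cases h1 : y = x <;> simp [h1, h2]
  · by_cases h1 : y = x <;> simp [h1, h2, Ne.symm h2]

theorem blockProj_blockIncl (j k : κ) (v : Ell2 ι) :
    blockProj j (blockIncl k v) = if j = k then v else 0 := by
  ext x
  rw [blockProj_apply, blockIncl_apply]
  split_ifs <;> rfl

variable [Fintype κ]

/-- A matrix of operators on `ℓ²(ι)` as an operator on `ℓ²(ι × κ)`. -/
noncomputable def blockOp (M : Matrix κ κ (Ell2 ι →L[ℂ] Ell2 ι)) : Ell2 (ι × κ) →L[ℂ] Ell2 (ι × κ) :=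
  ∑ j, ∑ k, blockIncl j ∘L M j k ∘L blockProj k

theorem blockOp_apply (M : Matrix κ κ (Ell2 ι →L[ℂ] Ell2 ι)) (v : Ell2 (ι × κ)) (x : ι) (j : κ) :
    blockOp M v (x, j) = ∑ k, M j k (blockProj k v) x := by
  have h : blockOp M v = ∑ j, ∑ k, blockIncl j (M j k (blockProj k v)) := by
    simp [blockOp]
  rw [h, lp.coeFn_sum, Finset.sum_apply, Finset.sum_eq_single j]
  · rw [lp.coeFn_sum, Finset.sum_apply]
    simp [blockIncl_apply]
  · intro j' _ hj
    rw [lp.coeFn_sum, Finset.sum_apply]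
    simp [blockIncl_apply, Ne.symm hj]
  · simp

theorem blockProj_blockOp (M : Matrix κ κ (Ell2 ι →L[ℂ] Ell2 ι)) (v : Ell2 (ι × κ)) (j : κ) :
    blockProj j (blockOp M v) = ∑ k, M j k (blockProj k v) := by
  ext x
  rw [blockProj_apply, blockOp_apply, lp.coeFn_sum, Finset.sum_apply]

theorem entry_blockOp (M : Matrix κ κ (Ell2 ι →L[ℂ] Ell2 ι)) (x y : ι) (j k : κ) :
    entry (blockOp M) (x, j) (y, k) = entry (M j k) x y := by
  rw [entry, blockOp_apply, Finset.sum_eq_single k]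
  · rw [blockProj_single, if_pos rfl]
    rfl
  · intro k' _ hk
    rw [blockProj_single, if_neg (Ne.symm hk), map_zero]
    rfl
  · simp

/-- `blockOp` as a homomorphism of algebras. -/
noncomputable def blockHom :
    Matrix κ κ (Ell2 ι →L[ℂ] Ell2 ι) →ₐ[ℂ] (Ell2 (ι × κ) →L[ℂ] Ell2 (ι × κ)) :=
  AlgHom.ofLinearMap
    { toFun := blockOp
      map_add' := fun M M' => ext_entry fun ⟨x, j⟩ ⟨y, k⟩ => by
        simp only [entry_blockOp, entry_add, Matrix.add_apply]
      map_smul' := fun c M => ext_entry fun ⟨x, j⟩ ⟨y, k⟩ => by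
        simp only [entry_blockOp, entry_smul, Matrix.smul_apply, RingHom.id_apply] }
    (ext_entry fun ⟨x, j⟩ ⟨y, k⟩ => by
      change entry (blockOp 1) _ _ = _
      rw [entry_blockOp, entry_one, Matrix.one_apply]
      split_ifs <;> simp_all)
    (fun M M' => by
      change blockOp (M * M') = blockOp M * blockOp M'
      ext v ⟨x, j⟩
      change blockOp (M * M') v (x, j) = blockOp M (blockOp M' v) (x, j)
      rw [blockOp_apply, blockOp_apply]
      simp only [Matrix.mul_apply, blockProj_blockOp, map_sum]
      simp only [_root_.sum_apply, lp.coeFn_sum, Finset.sum_apply]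
      rw [Finset.sum_comm]
      rfl)

theorem entry_blockHom (M : Matrix κ κ (Ell2 ι →L[ℂ] Ell2 ι)) (x y : ι) (j k : κ) :
    entry (blockHom M) (x, j) (y, k) = entry (M j k) x y := entry_blockOp M x y j k

theorem blockProj_blockHom (M : Matrix κ κ (Ell2 ι →L[ℂ] Ell2 ι)) (v : Ell2 (ι × κ)) (j : κ) :
    blockProj j (blockHom M v) = ∑ k, M j k (blockProj k v) := blockProj_blockOp M v j

end
end Ell2

/-! ### Basis vectors and weighted shifts on one component -/

/-- `(L, M)` is the doubled index of a basis vector. -/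
def SpinValid (a : ℕ) (L M : ℤ) : Prop := (a : ℤ) ≤ L ∧ 2 ∣ L - a ∧ |M| ≤ L ∧ 2 ∣ L - M

instance (a : ℕ) (L M : ℤ) : Decidable (SpinValid a L M) := by
  unfold SpinValid
  infer_instance

namespace SpinIdx
open Ell2

variable {a : ℕ}

/-- The basis vector `|L/2, M/2⟩`; it is `0` if `(L, M)` is out of range. -/
noncomputable def ket (a : ℕ) (L M : ℤ) : Ell2 (SpinIdx a) :=
  if h : SpinValid a L M then lp.single 2 (⟨(L, M), h⟩ : SpinIdx a) (1 : ℂ) else 0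

theorem ket_eq (x : SpinIdx a) : ket a x.1.1 x.1.2 = lp.single 2 x (1 : ℂ) := by
  rw [ket, dif_pos (show SpinValid a x.1.1 x.1.2 from x.2)]

theorem ket_of_not {L M : ℤ} (h : ¬SpinValid a L M) : ket a L M = 0 := by
  rw [ket, dif_neg h]

/-- `(l, m) ↦ (l + d/2, m + e/2)` where this makes sense. -/
noncomputable def shift (d e : ℤ) (x : SpinIdx a) : SpinIdx a :=
  if h : SpinValid a (x.1.1 + d) (x.1.2 + e) then ⟨(x.1.1 + d, x.1.2 + e), h⟩ else x

/-- The operator `|L, M⟩ ↦ c(L-d, M-e) |L-d, M-e⟩`. -/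
noncomputable def shiftOp (a : ℕ) (d e : ℤ) (c : ℤ → ℤ → ℝ) : Ell2 (SpinIdx a) →L[ℂ] Ell2 (SpinIdx a) :=
  weightedComp (shift d e) fun x =>
    if SpinValid a (x.1.1 + d) (x.1.2 + e) then (c x.1.1 x.1.2 : ℂ) else 0

theorem shiftOp_apply {d e : ℤ} {c : ℤ → ℤ → ℝ} {C : ℝ}
    (hc : ∀ L M, SpinValid a L M → SpinValid a (L + d) (M + e) → |c L M| ≤ C)
    (hC : 0 ≤ C) (v : Ell2 (SpinIdx a)) (x : SpinIdx a) :
    shiftOp a d e c v x = (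
      if SpinValid a (x.1.1 + d) (x.1.2 + e) then (c x.1.1 x.1.2 : ℂ) else 0) * v (shift d e x) := by
  refine weightedComp_apply ?_ C ?_ v x
  -- Out of range, `shift` returns x itself, but the weight is zero there, so injectivity is only
  -- needed where the shift is genuine.
  · intro x hx y hy h
    have hx' : SpinValid a (x.1.1 + d) (x.1.2 + e) := by
      by_contra h'
      exact hx (if_neg h')
    have hy' : SpinValid a (y.1.1 + d) (y.1.2 + e) := by
      by_contra h'
      exact hy (if_neg h')
    rw [shift, shift, dif_pos hx', dif_pos hy'] at h
    have h1 := congrArg (fun z : SpinIdx a => z.1.1) h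
    have h2 := congrArg (fun z : SpinIdx a => z.1.2) h
    exact Subtype.ext (Prod.ext (by simpa using h1) (by simpa using h2))
  · intro x
    split_ifs with h
    · rw [Complex.norm_real]
      exact hc _ _ x.2 h
    · simpa using hC

theorem shiftOp_ket {d e : ℤ} {c : ℤ → ℤ → ℝ} {C : ℝ}
    (hc : ∀ L M, SpinValid a L M → SpinValid a (L + d) (M + e) → |c L M| ≤ C)
    (hC : 0 ≤ C) {L M : ℤ} (h : SpinValid a L M) :
    shiftOp a d e c (ket a L M) = (c (L - d) (M - e) : ℂ) • ket a (L - d) (M - e) := by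
  ext x
  rw [shiftOp_apply hc hC, ket, dif_pos h, lp.single_apply, lp.coeFn_smul, Pi.smul_apply]
  by_cases hx : x.1.1 = L - d ∧ x.1.2 = M - e
  · obtain ⟨h1, h2⟩ := hx
    have hv : SpinValid a (x.1.1 + d) (x.1.2 + e) := by rw [h1, h2]; simpa using h
    have hs : shift d e x = ⟨(L, M), h⟩ := by
      rw [shift, dif_pos hv]
      simp [h1, h2]
    rw [if_pos hv, hs, ← h1, ← h2, ket_eq, lp.single_apply]
    simp
  · have h0 : ket a (L - d) (M - e) x = 0 := by
      rw [ket]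
      split_ifs with h'
      · rw [lp.single_apply, Pi.single_apply, if_neg]
        intro hx'
        rw [hx'] at hx
        simp at hx
      · rfl
    rw [h0, smul_zero]
    split_ifs with hv
    · rw [Pi.single_apply, if_neg, mul_zero]
      intro hs
      rw [shift, dif_pos hv] at hs
      have h1 := congrArg (fun z : SpinIdx a => z.1.1) hs
      have h2 := congrArg (fun z : SpinIdx a => z.1.2) hs
      dsimp only at h1 h2
      exact hx ⟨by omega, by omega⟩
    · rw [zero_mul]

theorem ext_ket {S T : Ell2 (SpinIdx a) →L[ℂ] Ell2 (SpinIdx a)}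
    (h : ∀ L M, SpinValid a L M → S (ket a L M) = T (ket a L M)) : S = T :=
  ext_entry fun i j => by
    rw [entry, entry, ← ket_eq, h _ _ j.2]

end SpinIdx

/-! ### Boundedness of the coefficients -/

namespace PodlesParam
variable (p : PodlesParam) {N l m : ℝ}

section bounds
variable (h : LevelRange N l) {i j : ℕ} (hi : l - m = i) (hj : l + m = j)
include h hi hj

/-- The diagonal coefficient of the relation for x₁x₁^* is a sum of squares: the squares in a row
add up to at most |A⁰| + 5. Hence |A⁰| ≤ 3, and then no square exceeds 8. No asymptotics of α or β
are used. -/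
theorem row_sq_le : p.cA0 N l m ^ 2 ≤ 9 ∧ p.cAp N l m ^ 2 ≤ 9 ∧ p.cAp N (l - 1) m ^ 2 ≤ 9 ∧
    p.cBm N (l + 1) (m - 1) ^ 2 ≤ 9 ∧ p.cB0 N l (m - 1) ^ 2 ≤ 9 ∧
    p.cBp N (l - 1) (m - 1) ^ 2 ≤ 9 := by
  have hr := p.rel_XY_zero h hi hj
  have hq := p.q_pos
  have hq2 := p.q_sq_lt_one
  have hs := p.s_nonneg
  have hs2 : p.s ^ 2 ≤ 1 := by have := p.s_le_one; nlinarith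
  have hs0 : 0 ≤ p.s ^ 2 := sq_nonneg _
  have hq0 : 0 ≤ p.q ^ 2 := sq_nonneg _
  generalize p.s ^ 2 = σ at *
  generalize p.q ^ 2 = t at *
  generalize p.cA0 N l m = x0 at *
  generalize p.cAp N l m = x1 at *
  generalize p.cAp N (l - 1) m = x2 at *
  generalize p.cBm N (l + 1) (m - 1) = y0 at *
  generalize p.cB0 N l (m - 1) = y1 at *
  generalize p.cBp N (l - 1) (m - 1) = y2 at *
  have h1 : 0 ≤ (1 - σ) * (1 - t) := mul_nonneg (by linarith) (by linarith)
  have h2 : (1 - σ) * (1 - t) ≤ 1 := by nlinarith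
  have h3 : t * (1 - σ) ^ 2 + σ * (1 + t) ^ 2 ≤ 5 := by
    have e1 : t * (1 - σ) ^ 2 ≤ 1 := by
      have : (1 - σ) ^ 2 ≤ 1 := by nlinarith
      nlinarith
    have e2 : σ * (1 + t) ^ 2 ≤ 4 := by
      have : (1 + t) ^ 2 ≤ 4 := by nlinarith
      nlinarith
    linarith
  have h4 : (1 - σ) * (1 - t) * x0 ≤ |x0| := by
    calc _ ≤ (1 - σ) * (1 - t) * |x0| := mul_le_mul_of_nonneg_left (le_abs_self _) h1
      _ ≤ 1 * |x0| := mul_le_mul_of_nonneg_right h2 (abs_nonneg _)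
      _ = _ := one_mul _
  have h5 : 0 ≤ t * (y0 ^ 2 + y1 ^ 2 + y2 ^ 2) := by positivity
  have h6 : (y0 ^ 2 + y1 ^ 2 + y2 ^ 2) + (x1 ^ 2 + x0 ^ 2 + x2 ^ 2) ≤ |x0| + 5 := by linarith
  have h7 : |x0| ≤ 3 := by
    by_contra hc
    rw [← sq_abs x0] at h6
    nlinarith [sq_nonneg y0, sq_nonneg y1, sq_nonneg y2, sq_nonneg x1, sq_nonneg x2]
  have s0 := sq_nonneg y0
  have s1 := sq_nonneg y1
  have s2 := sq_nonneg y2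
  have s3 := sq_nonneg x1
  have s4 := sq_nonneg x2
  have s5 := sq_nonneg x0
  refine ⟨?_, ?_, ?_, ?_, ?_, ?_⟩ <;> linarith

/-- Same argument with the relation for x₁^*x₁, where the linear term in A⁰ is controlled by the
bound just obtained. -/
theorem col_sq_le : p.cBp N l m ^ 2 ≤ 9 ∧ p.cB0 N l m ^ 2 ≤ 9 ∧ p.cBm N l m ^ 2 ≤ 9 := by
  have hr := p.rel_YX_zero h hi hj
  have hA := (p.row_sq_le h hi hj).1
  have hq := p.q_pos
  have hq2 := p.q_sq_lt_one
  have hs := p.s_nonneg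
  have hs2 : p.s ^ 2 ≤ 1 := by have := p.s_le_one; nlinarith
  have hs0 : 0 ≤ p.s ^ 2 := sq_nonneg _
  have hq0 : 0 ≤ p.q ^ 2 := sq_nonneg _
  have hq4 : p.q ^ 4 = (p.q ^ 2) ^ 2 := by ring
  rw [hq4] at hr
  generalize p.s ^ 2 = σ at *
  generalize p.q ^ 2 = t at *
  generalize p.cA0 N l m = x0 at *
  generalize p.cAp N l m = x1 at *
  generalize p.cAp N (l - 1) m = x2 at *
  generalize p.cBm N l m = y0 at *
  generalize p.cB0 N l m = y1 at *
  generalize p.cBp N l m = y2 at *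
  have h1 : 0 ≤ t * (1 - t) * (1 - σ) := mul_nonneg (mul_nonneg hq0 (by linarith)) (by linarith)
  have h2 : t * (1 - t) * (1 - σ) ≤ 1 := by
    have : t * (1 - t) ≤ 1 := by nlinarith
    have : 0 ≤ t * (1 - t) := mul_nonneg hq0 (by linarith)
    nlinarith
  have h3 : t * (1 - σ) ^ 2 + σ * (1 + t) ^ 2 ≤ 5 := by
    have e1 : t * (1 - σ) ^ 2 ≤ 1 := by
      have : (1 - σ) ^ 2 ≤ 1 := by nlinarith
      nlinarith
    have e2 : σ * (1 + t) ^ 2 ≤ 4 := by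
      have : (1 + t) ^ 2 ≤ 4 := by nlinarith
      nlinarith
    linarith
  have h4 : -3 ≤ x0 := by nlinarith
  have h4' : -3 ≤ t * (1 - t) * (1 - σ) * x0 := by nlinarith
  have h5 : 0 ≤ t * (y2 ^ 2 + y1 ^ 2 + y0 ^ 2) := by positivity
  have h6 : 0 ≤ t ^ 2 * (x1 ^ 2 + x0 ^ 2 + x2 ^ 2) := by positivity
  have s0 := sq_nonneg y0
  have s1 := sq_nonneg y1
  have s2 := sq_nonneg y2
  refine ⟨?_, ?_, ?_⟩ <;> linarith

end bounds

end PodlesParam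

theorem abs_le_three {x : ℝ} (h : x ^ 2 ≤ 9) : |x| ≤ 3 := abs_le_of_sq_le_sq (by linarith) (by norm_num)

theorem SpinValid.range {a : ℕ} {L M : ℤ} {N : ℝ} (h : SpinValid a L M) (ha : 1 ≤ a)
    (hN : |N| = a / 2) : PodlesParam.LevelRange N (L / 2) ∧
      ∃ i j : ℕ, (L : ℝ) / 2 - M / 2 = i ∧ (L : ℝ) / 2 + M / 2 = j := by
  obtain ⟨h1, ⟨k, hk⟩, h3, ⟨i, hi⟩⟩ := h
  rw [abs_le] at h3
  refine ⟨⟨a, k.toNat, ha, hN, ?_⟩, i.toNat, (L - i).toNat, ?_, ?_⟩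
  · have e : ((k.toNat : ℕ) : ℝ) = ((k.toNat : ℤ) : ℝ) := by norm_cast
    have e2 : (L : ℝ) - a = 2 * k := by exact_mod_cast hk
    rw [e, Int.toNat_of_nonneg (by omega)]
    linarith
  · have e : ((i.toNat : ℕ) : ℝ) = ((i.toNat : ℤ) : ℝ) := by norm_cast
    have e2 : (L : ℝ) - M = 2 * i := by exact_mod_cast hi
    rw [e, Int.toNat_of_nonneg (by omega)]
    linarith
  · have e : (((L - i).toNat : ℕ) : ℝ) = (((L - i).toNat : ℤ) : ℝ) := by norm_cast
    have e2 : (L : ℝ) - M = 2 * i := by exact_mod_cast hi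
    rw [e, Int.toNat_of_nonneg (by omega)]
    push_cast
    linarith

/-! ### The operators x₁, x₀, -q x₋₁ on one component -/

namespace SpinIdx
open Ell2

variable (p : PodlesParam) (N : ℝ) (a : ℕ)

/-- `x₁` on `ℋ_N`. -/
noncomputable def opX : Ell2 (SpinIdx a) →L[ℂ] Ell2 (SpinIdx a) :=
  -- A shift reads its coefficient at the target, whereas B^± and B⁰ are labelled by the source;
  -- this explains the displaced arguments here and below.
  shiftOp a (-2) (-2) (fun L M => p.cBp N (L / 2 - 1) (M / 2 - 1)) +
  shiftOp a 0 (-2) (fun L M => p.cB0 N (L / 2) (M / 2 - 1)) +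
  shiftOp a 2 (-2) (fun L M => p.cBm N (L / 2 + 1) (M / 2 - 1))

/-- `x₀` on `ℋ_N`. -/
noncomputable def opZ : Ell2 (SpinIdx a) →L[ℂ] Ell2 (SpinIdx a) :=
  shiftOp a (-2) 0 (fun L M => p.cAp N (L / 2 - 1) (M / 2)) +
  shiftOp a 0 0 (fun L M => p.cA0 N (L / 2) (M / 2)) +
  shiftOp a 2 0 (fun L M => p.cAp N (L / 2) (M / 2))

/-- `-q x₋₁` on `ℋ_N`. -/
noncomputable def opY : Ell2 (SpinIdx a) →L[ℂ] Ell2 (SpinIdx a) :=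
  shiftOp a (-2) 2 (fun L M => p.cBm N (L / 2) (M / 2)) +
  shiftOp a 0 2 (fun L M => p.cB0 N (L / 2) (M / 2)) +
  shiftOp a 2 2 (fun L M => p.cBp N (L / 2) (M / 2))

variable {p N a} (ha : 1 ≤ a) (hN : |N| = a / 2)
include ha hN

section ket
variable {L M : ℤ} (h : SpinValid a L M) {l m : ℝ} (hl : l = L / 2) (hm : m = M / 2)
include h hl hm

theorem opX_ket : opX p N a (ket a L M) = (p.cBp N l m : ℂ) • ket a (L + 2) (M + 2)
    + (p.cB0 N l m : ℂ) • ket a L (M + 2) + (p.cBm N l m : ℂ) • ket a (L - 2) (M + 2) := by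
  -- The three coefficients leading into a fixed target |L, M⟩ all occur in the row estimate at that
  -- target.
  have b : ∀ L M : ℤ, SpinValid a L M → |p.cBp N (L / 2 - 1) (M / 2 - 1)| ≤ 3 ∧
      |p.cB0 N (L / 2) (M / 2 - 1)| ≤ 3 ∧ |p.cBm N (L / 2 + 1) (M / 2 - 1)| ≤ 3 := by
    intro L M h
    obtain ⟨h0, i, j, hi, hj⟩ := h.range ha hN
    obtain ⟨-, -, -, h1, h2, h3⟩ := p.row_sq_le h0 hi hj
    exact ⟨abs_le_three h3, abs_le_three h2, abs_le_three h1⟩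
  have e1 : ((L - (-2) : ℤ) : ℝ) / 2 - 1 = l := by rw [hl]; push_cast; ring
  have e2 : ((M - (-2) : ℤ) : ℝ) / 2 - 1 = m := by rw [hm]; push_cast; ring
  have e3 : ((L - 0 : ℤ) : ℝ) / 2 = l := by rw [hl]; push_cast; ring
  have e4 : ((L - 2 : ℤ) : ℝ) / 2 + 1 = l := by rw [hl]; push_cast; ring
  rw [opX, add_apply, add_apply,
    shiftOp_ket (fun L M h _ => (b L M h).1) (by norm_num) h,
    shiftOp_ket (fun L M h _ => (b L M h).2.1) (by norm_num) h,
    shiftOp_ket (fun L M h _ => (b L M h).2.2) (by norm_num) h, e1, e2, e3, e4]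
  simp only [sub_neg_eq_add, sub_zero]

theorem opZ_ket : opZ p N a (ket a L M) = (p.cAp N l m : ℂ) • ket a (L + 2) M
    + (p.cA0 N l m : ℂ) • ket a L M + (p.cAp N (l - 1) m : ℂ) • ket a (L - 2) M := by
  have b : ∀ L M : ℤ, SpinValid a L M → |p.cAp N (L / 2 - 1) (M / 2)| ≤ 3 ∧
      |p.cA0 N (L / 2) (M / 2)| ≤ 3 ∧ |p.cAp N (L / 2) (M / 2)| ≤ 3 := by
    intro L M h
    obtain ⟨h0, i, j, hi, hj⟩ := h.range ha hN
    obtain ⟨h1, h2, h3, -⟩ := p.row_sq_le h0 hi hj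
    exact ⟨abs_le_three h3, abs_le_three h1, abs_le_three h2⟩
  have e1 : ((L - (-2) : ℤ) : ℝ) / 2 - 1 = l := by rw [hl]; push_cast; ring
  have e2 : ((M - 0 : ℤ) : ℝ) / 2 = m := by rw [hm]; push_cast; ring
  have e3 : ((L - 0 : ℤ) : ℝ) / 2 = l := by rw [hl]; push_cast; ring
  have e4 : ((L - 2 : ℤ) : ℝ) / 2 = l - 1 := by rw [hl]; push_cast; ring
  rw [opZ, add_apply, add_apply,
    shiftOp_ket (fun L M h _ => (b L M h).1) (by norm_num) h,
    shiftOp_ket (fun L M h _ => (b L M h).2.1) (by norm_num) h,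
    shiftOp_ket (fun L M h _ => (b L M h).2.2) (by norm_num) h, e1, e2, e3, e4]
  simp only [sub_neg_eq_add, sub_zero]

theorem opY_ket : opY p N a (ket a L M) = (p.cBm N (l + 1) (m - 1) : ℂ) • ket a (L + 2) (M - 2)
    + (p.cB0 N l (m - 1) : ℂ) • ket a L (M - 2)
    + (p.cBp N (l - 1) (m - 1) : ℂ) • ket a (L - 2) (M - 2) := by
  have b : ∀ L M : ℤ, SpinValid a L M → |p.cBm N (L / 2) (M / 2)| ≤ 3 ∧
      |p.cB0 N (L / 2) (M / 2)| ≤ 3 ∧ |p.cBp N (L / 2) (M / 2)| ≤ 3 := by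
    intro L M h
    obtain ⟨h0, i, j, hi, hj⟩ := h.range ha hN
    obtain ⟨h1, h2, h3⟩ := p.col_sq_le h0 hi hj
    exact ⟨abs_le_three h3, abs_le_three h2, abs_le_three h1⟩
  have e1 : ((L - (-2) : ℤ) : ℝ) / 2 = l + 1 := by rw [hl]; push_cast; ring
  have e2 : ((M - 2 : ℤ) : ℝ) / 2 = m - 1 := by rw [hm]; push_cast; ring
  have e3 : ((L - 0 : ℤ) : ℝ) / 2 = l := by rw [hl]; push_cast; ring
  have e4 : ((L - 2 : ℤ) : ℝ) / 2 = l - 1 := by rw [hl]; push_cast; ring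
  rw [opY, add_apply, add_apply,
    shiftOp_ket (fun L M h _ => (b L M h).1) (by norm_num) h,
    shiftOp_ket (fun L M h _ => (b L M h).2.1) (by norm_num) h,
    shiftOp_ket (fun L M h _ => (b L M h).2.2) (by norm_num) h, e1, e2, e3, e4]
  simp only [sub_neg_eq_add, sub_zero]

/-- The step to m + 1 leaves the range only from m = l, where the factor [l - m] vanishes. This
guard and its companions permit a second operator to be applied to every term of a first image, in
range or not. -/
theorem cB0_guard : SpinValid a L (M + 2) ∨ (p.cB0 N l m : ℂ) = 0 := by
  by_cases h' : M + 2 ≤ L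
  · obtain ⟨h1, h2, h3, h4⟩ := h
    rw [abs_le] at h3
    exact Or.inl ⟨h1, h2, abs_le.2 ⟨by omega, h'⟩, by omega⟩
  · obtain ⟨h1, h2, h3, h4⟩ := h
    rw [abs_le] at h3
    have e : M = L := by omega
    right
    rw [PodlesParam.cB0, hl, hm, e]
    simp [PodlesParam.num_zero]

theorem cB0_guard' : SpinValid a L (M - 2) ∨ (p.cB0 N l (m - 1) : ℂ) = 0 := by
  obtain ⟨h1, h2, h3, h4⟩ := h
  rw [abs_le] at h3
  by_cases h' : -L ≤ M - 2
  · exact Or.inl ⟨h1, h2, abs_le.2 ⟨by omega, by omega⟩, by omega⟩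
  · have e : M = -L := by omega
    right
    rw [PodlesParam.cB0, hl, hm, e, show (L : ℝ) / 2 + (((-L : ℤ) : ℝ) / 2 - 1) + 1 = 0 by
      push_cast; ring]
    simp [PodlesParam.num_zero]

/-- Lowering l fails for one of two reasons. Either l = |N|, where α vanishes, or |m| > l - 1, which
by parity forces |m| = l, where a q-number in the coefficient vanishes. -/
theorem alpha_guard : SpinValid a (L - 2) M ∨ |M| = L ∨ p.alpha N l = 0 := by
  obtain ⟨h1, h2, h3, h4⟩ := h
  by_cases h' : (a : ℤ) ≤ L - 2
  · by_cases h'' : |M| ≤ L - 2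
    · exact Or.inl ⟨h', by omega, h'', by omega⟩
    · refine Or.inr (Or.inl ?_)
      obtain ⟨i, hi⟩ := h4
      obtain ⟨k, hk⟩ := h2
      rcases abs_cases M with ⟨e, _⟩ | ⟨e, _⟩ <;> rw [e] at h3 h'' ⊢ <;> omega
  · refine Or.inr (Or.inr (PodlesParam.alpha_abs p ?_))
    have e : L = a := by omega
    rw [hl, hN, e]
    simp

theorem cAp_guard : SpinValid a (L - 2) M ∨ (p.cAp N (l - 1) m : ℂ) = 0 := by
  rcases alpha_guard (p := p) ha hN h hl hm with h' | h' | h'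
  · exact Or.inl h'
  · right
    rw [PodlesParam.cAp]
    rcases (abs_eq (by have := h.1; omega)).1 h' with e | e
    · rw [show l - 1 - m + 1 = 0 by rw [hl, hm, e]; ring]
      simp [PodlesParam.num_zero]
    · rw [show l - 1 + m + 1 = 0 by rw [hl, hm, e]; push_cast; ring]
      simp [PodlesParam.num_zero]
  · right
    rw [PodlesParam.cAp, sub_add_cancel, h']
    simp

theorem cBm_guard : SpinValid a (L - 2) (M + 2) ∨ (p.cBm N l m : ℂ) = 0 := by
  by_cases h' : M + 2 ≤ L - 2
  · rcases alpha_guard (p := p) ha hN h hl hm with h'' | h'' | h''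
    · obtain ⟨h1, h2, h3, h4⟩ := h''
      rw [abs_le] at h3
      exact Or.inl ⟨h1, h2, abs_le.2 ⟨by omega, by omega⟩, by omega⟩
    · by_cases h5 : (a : ℤ) ≤ L - 2
      · obtain ⟨h1, h2, h3, h4⟩ := h
        rw [abs_le] at h3
        exact Or.inl ⟨h5, by omega, abs_le.2 ⟨by omega, by omega⟩, by omega⟩
      · right
        have e : L = a := by have := h.1; have := h.2.1; omega
        rw [PodlesParam.cBm, PodlesParam.alpha_abs p (by rw [hl, hN, e]; simp)]
        simp
    · right
      rw [PodlesParam.cBm, h'']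
      simp
  · right
    obtain ⟨h1, h2, h3, h4⟩ := h
    rw [abs_le] at h3
    rw [PodlesParam.cBm]
    rcases (show M = L ∨ M = L - 2 by omega) with e | e
    · rw [show l - m = 0 by rw [hl, hm, e]; ring]
      simp [PodlesParam.num_zero]
    · rw [show l - m - 1 = 0 by rw [hl, hm, e]; push_cast; ring]
      simp [PodlesParam.num_zero]

theorem cBp_guard : SpinValid a (L - 2) (M - 2) ∨ (p.cBp N (l - 1) (m - 1) : ℂ) = 0 := by
  by_cases h' : -(L - 2) ≤ M - 2
  · by_cases h5 : (a : ℤ) ≤ L - 2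
    · obtain ⟨h1, h2, h3, h4⟩ := h
      rw [abs_le] at h3
      exact Or.inl ⟨h5, by omega, abs_le.2 ⟨by omega, by omega⟩, by omega⟩
    · right
      have e : L = a := by have := h.1; have := h.2.1; omega
      rw [PodlesParam.cBp, sub_add_cancel, PodlesParam.alpha_abs p (by rw [hl, hN, e]; simp)]
      simp
  · right
    obtain ⟨h1, h2, h3, h4⟩ := h
    rw [abs_le] at h3
    rw [PodlesParam.cBp]
    rcases (show M = -L ∨ M = -L + 2 by omega) with e | e
    · rw [show l - 1 + (m - 1) + 2 = 0 by rw [hl, hm, e]; push_cast; ring]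
      simp [PodlesParam.num_zero]
    · rw [show l - 1 + (m - 1) + 1 = 0 by rw [hl, hm, e]; push_cast; ring]
      simp [PodlesParam.num_zero]

end ket
end SpinIdx

/-! ### The defining relations as operator identities -/

namespace SpinIdx
open Ell2

variable {p : PodlesParam} {N : ℝ} {a : ℕ} (ha : 1 ≤ a) (hN : |N| = a / 2)

theorem smul_ket {L M : ℤ} {c d : ℝ} (h : SpinValid a L M → c = d) :
    (c : ℂ) • ket a L M = (d : ℂ) • ket a L M := by
  by_cases h' : SpinValid a L M
  · rw [h h']
  · rw [ket_of_not h', smul_zero, smul_zero]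

section
variable {L M : ℤ} {l m : ℝ} (hl : l = L / 2) (hm : m = M / 2) {c : ℂ}
  (h : SpinValid a L M ∨ c = 0)
include ha hN h hl hm

theorem smul_opX_ket : c • opX p N a (ket a L M) = c • ((p.cBp N l m : ℂ) • ket a (L + 2) (M + 2)
    + (p.cB0 N l m : ℂ) • ket a L (M + 2) + (p.cBm N l m : ℂ) • ket a (L - 2) (M + 2)) := by
  rcases h with h | h
  · rw [opX_ket ha hN h hl hm]
  · rw [h, zero_smul, zero_smul]

theorem smul_opZ_ket : c • opZ p N a (ket a L M) = c • ((p.cAp N l m : ℂ) • ket a (L + 2) M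
    + (p.cA0 N l m : ℂ) • ket a L M + (p.cAp N (l - 1) m : ℂ) • ket a (L - 2) M) := by
  rcases h with h | h
  · rw [opZ_ket ha hN h hl hm]
  · rw [h, zero_smul, zero_smul]

theorem smul_opY_ket : c • opY p N a (ket a L M) =
    c • ((p.cBm N (l + 1) (m - 1) : ℂ) • ket a (L + 2) (M - 2)
    + (p.cB0 N l (m - 1) : ℂ) • ket a L (M - 2)
    + (p.cBp N (l - 1) (m - 1) : ℂ) • ket a (L - 2) (M - 2)) := by
  rcases h with h | h
  · rw [opY_ket ha hN h hl hm]
  · rw [h, zero_smul, zero_smul]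

end

section
variable {L M : ℤ} (h : SpinValid a L M)
include h

theorem _root_.SpinValid.up : SpinValid a (L + 2) M := by
  obtain ⟨h1, h2, h3, h4⟩ := h
  exact ⟨by omega, by omega, by omega, by omega⟩

theorem _root_.SpinValid.up_right : SpinValid a (L + 2) (M + 2) := by
  obtain ⟨h1, h2, h3, h4⟩ := h
  rw [abs_le] at h3
  exact ⟨by omega, by omega, abs_le.2 ⟨by omega, by omega⟩, by omega⟩

theorem _root_.SpinValid.up_left : SpinValid a (L + 2) (M - 2) := by
  obtain ⟨h1, h2, h3, h4⟩ := h
  rw [abs_le] at h3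
  exact ⟨by omega, by omega, abs_le.2 ⟨by omega, by omega⟩, by omega⟩

end

include ha hN

/-- On |l, m⟩ both sides are combinations of the five kets |l+i, m+1⟩ with |i| ≤ 2, and each
coefficient is one of the scalar relations. The relations for i = -1, -2 are used at l - 1. -/
theorem opZ_mul_opX : opZ p N a * opX p N a =
    (p.q ^ 2 : ℂ) • (opX p N a * opZ p N a) + ((1 - p.q ^ 2) * (1 - p.s ^ 2) : ℂ) • opX p N a := by
  refine ext_ket fun L M h => ?_
  obtain ⟨hr, i, j, hi, hj⟩ := h.range ha hN
  obtain ⟨l, hl⟩ : ∃ l : ℝ, l = L / 2 := ⟨_, rfl⟩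
  obtain ⟨m, hm⟩ : ∃ m : ℝ, m = M / 2 := ⟨_, rfl⟩
  rw [← hl, ← hm] at hi hj
  rw [← hl] at hr
  have X0 := opX_ket (p := p) ha hN h hl hm
  have Z0 := opZ_ket (p := p) ha hN h hl hm
  have Z1 := smul_opZ_ket (p := p) ha hN (l := l + 1) (m := m + 1) (by rw [hl]; push_cast; ring)
    (by rw [hm]; push_cast; ring) (c := p.cBp N l m) (Or.inl h.up_right)
  have Z2 := smul_opZ_ket (p := p) ha hN (l := l) (m := m + 1) hl
    (by rw [hm]; push_cast; ring) (c := p.cB0 N l m) (cB0_guard ha hN h hl hm)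
  have Z3 := smul_opZ_ket (p := p) ha hN (l := l - 1) (m := m + 1) (by rw [hl]; push_cast; ring)
    (by rw [hm]; push_cast; ring) (c := p.cBm N l m) (cBm_guard ha hN h hl hm)
  have X1 := smul_opX_ket (p := p) ha hN (l := l + 1) (m := m) (by rw [hl]; push_cast; ring)
    hm (c := p.cAp N l m) (Or.inl h.up)
  have X2 := smul_opX_ket (p := p) ha hN (l := l) (m := m) hl hm (c := p.cA0 N l m) (Or.inl h)
  have X3 := smul_opX_ket (p := p) ha hN (l := l - 1) (m := m) (by rw [hl]; push_cast; ring)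
    hm (c := p.cAp N (l - 1) m) (cAp_guard ha hN h hl hm)
  have r2 := p.rel_ZX_two (N := N) hi hj
  have r1 := p.rel_ZX_one hr hi hj
  have r0 := p.rel_ZX_zero hr hi hj
  -- A lowered ket may be out of range and then vanishes, so the identity is needed only if |l-1,
  -- m+1⟩ exists. That is what supplies a natural number l - 1 - m and the admissible level l - 1.
  have r1' : ((p.cAp N (l - 1) (m + 1) * p.cB0 N l m + p.cA0 N (l - 1) (m + 1) * p.cBm N l m
      - p.q ^ 2 * (p.cBm N l m * p.cA0 N l m + p.cB0 N (l - 1) m * p.cAp N (l - 1) m) : ℝ) : ℂ) •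
        ket a (L - 2) (M + 2) =
      (((1 - p.q ^ 2) * (1 - p.s ^ 2) * p.cBm N l m : ℝ) : ℂ) • ket a (L - 2) (M + 2) := by
    refine smul_ket fun h' => ?_
    obtain ⟨i', hi'⟩ : ∃ i' : ℕ, l - 1 - m = i' := by
      obtain ⟨-, -, h3, k, hk⟩ := h'
      refine ⟨(k + 1).toNat, ?_⟩
      have e : (((k + 1).toNat : ℕ) : ℝ) = (((k + 1).toNat : ℤ) : ℝ) := by norm_cast
      rw [abs_le] at h3
      rw [e, Int.toNat_of_nonneg (by omega), hl, hm]
      have : (L : ℝ) - 2 - (M + 2) = 2 * k := by exact_mod_cast hk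
      push_cast
      linarith
    have := p.rel_ZX_neg_one (N := N) (l := l - 1) (m := m) (i := i') (j := l - 1 + m)
      (by have := (h'.range ha hN).1; rw [hl]; push_cast at this; convert this using 1; ring) hi' rfl
      (by have : (0 : ℝ) ≤ j := j.cast_nonneg
          linarith)
    simpa only [sub_add_cancel] using this
  have r2' : ((p.cAp N (l - 1 - 1) (m + 1) * p.cBm N l m
      - p.q ^ 2 * (p.cBm N (l - 1) m * p.cAp N (l - 1) m) : ℝ) : ℂ) •
        ket a (L - 2 - 2) (M + 2) = ((0 : ℝ) : ℂ) • ket a (L - 2 - 2) (M + 2) := by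
    refine smul_ket fun h' => ?_
    have h'' : SpinValid a (L - 2) M := by
      obtain ⟨h1, h2, h3, h4⟩ := h'
      rw [abs_le] at h3
      exact ⟨by omega, by omega, abs_le.2 ⟨by omega, by omega⟩, by omega⟩
    obtain ⟨-, i, j, hi, hj⟩ := h''.range ha hN
    have := p.rel_ZX_neg_two (N := N) (l := l - 1) (m := m) (i := i) (j := j)
      (by rw [← hi, hl, hm]; push_cast; ring) (by rw [← hj, hl, hm]; push_cast; ring)
    simpa only [sub_add_cancel] using this
  replace r2 := congrArg (fun r : ℝ => (r : ℂ) • ket a (L + 2 + 2) (M + 2)) r2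
  replace r1 := congrArg (fun r : ℝ => (r : ℂ) • ket a (L + 2) (M + 2)) r1
  replace r0 := congrArg (fun r : ℝ => (r : ℂ) • ket a L (M + 2)) r0
  simp only [add_sub_cancel_right, sub_add_cancel] at Z1 Z2 Z3 X1 X2 X3 r2 r1 r0 r1' r2'
  push_cast at r2 r1 r0 r1' r2'
  simp only [mul_apply_eq_comp, smul_apply, add_apply, X0, Z0,
    map_add, map_smul, Z1, Z2, Z3, X1, X2, X3]
  linear_combination (norm := module) r2 + r1 + r0 + r1' + r2'

/-- The operators involved are symmetric, so the lowering coefficients are those of the raising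
relations read at l - 1 and l - 2. No further scalar identities are needed. -/
theorem opX_mul_opY : (1 + p.q ^ 2 : ℂ) • (opX p N a * opY p N a) + opZ p N a * opZ p N a =
    ((1 - p.s ^ 2) * (1 - p.q ^ 2) : ℂ) • opZ p N a +
      (p.q ^ 2 * (1 - p.s ^ 2) ^ 2 + p.s ^ 2 * (1 + p.q ^ 2) ^ 2 : ℂ) • 1 := by
  refine ext_ket fun L M h => ?_
  obtain ⟨hr, i, j, hi, hj⟩ := h.range ha hN
  obtain ⟨l, hl⟩ : ∃ l : ℝ, l = L / 2 := ⟨_, rfl⟩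
  obtain ⟨m, hm⟩ : ∃ m : ℝ, m = M / 2 := ⟨_, rfl⟩
  rw [← hl, ← hm] at hi hj
  rw [← hl] at hr
  have Y0 := opY_ket (p := p) ha hN h hl hm
  have Z0 := opZ_ket (p := p) ha hN h hl hm
  have X1 := smul_opX_ket (p := p) ha hN (l := l + 1) (m := m - 1) (by rw [hl]; push_cast; ring)
    (by rw [hm]; push_cast; ring) (c := p.cBm N (l + 1) (m - 1)) (Or.inl h.up_left)
  have X2 := smul_opX_ket (p := p) ha hN (l := l) (m := m - 1) hl
    (by rw [hm]; push_cast; ring) (c := p.cB0 N l (m - 1)) (cB0_guard' ha hN h hl hm)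
  have X3 := smul_opX_ket (p := p) ha hN (l := l - 1) (m := m - 1) (by rw [hl]; push_cast; ring)
    (by rw [hm]; push_cast; ring) (c := p.cBp N (l - 1) (m - 1)) (cBp_guard ha hN h hl hm)
  have Z1 := smul_opZ_ket (p := p) ha hN (l := l + 1) (m := m) (by rw [hl]; push_cast; ring)
    hm (c := p.cAp N l m) (Or.inl h.up)
  have Z2 := smul_opZ_ket (p := p) ha hN (l := l) (m := m) hl hm (c := p.cA0 N l m) (Or.inl h)
  have Z3 := smul_opZ_ket (p := p) ha hN (l := l - 1) (m := m) (by rw [hl]; push_cast; ring)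
    hm (c := p.cAp N (l - 1) m) (cAp_guard ha hN h hl hm)
  have r2 := p.rel_XY_two (N := N) hi hj
  have r1 := p.rel_XY_one hr hi hj
  have r0 := p.rel_XY_zero hr hi hj
  have r1' : (((1 + p.q ^ 2) * (p.cB0 N l (m - 1) * p.cBm N l (m - 1)
        + p.cBp N (l - 1) (m - 1) * p.cB0 N (l - 1) (m - 1))
      + (p.cA0 N l m + p.cA0 N (l - 1) m) * p.cAp N (l - 1) m
      - (1 - p.s ^ 2) * (1 - p.q ^ 2) * p.cAp N (l - 1) m : ℝ) : ℂ) • ket a (L - 2) M =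
        ((0 : ℝ) : ℂ) • ket a (L - 2) M := by
    refine smul_ket fun h' => ?_
    obtain ⟨hr', i, j, hi, hj⟩ := h'.range ha hN
    have := p.rel_XY_one (N := N) (l := l - 1) (m := m) (i := i) (j := j)
      (by rw [hl]; push_cast at hr'; convert hr' using 1; ring)
      (by rw [← hi, hl, hm]; push_cast; ring) (by rw [← hj, hl, hm]; push_cast; ring)
    simpa only [sub_add_cancel] using this
  have r2' : (((1 + p.q ^ 2) * (p.cBm N (l - 1) (m - 1) * p.cBp N (l - 1) (m - 1))
      + p.cAp N (l - 1 - 1) m * p.cAp N (l - 1) m : ℝ) : ℂ) • ket a (L - 2 - 2) M =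
        ((0 : ℝ) : ℂ) • ket a (L - 2 - 2) M := by
    refine smul_ket fun h' => ?_
    obtain ⟨-, i, j, hi, hj⟩ := h'.range ha hN
    have := p.rel_XY_two (N := N) (l := l - 1 - 1) (m := m) (i := i) (j := j)
      (by rw [← hi, hl, hm]; push_cast; ring) (by rw [← hj, hl, hm]; push_cast; ring)
    simp only [sub_add_cancel] at this
    linarith
  replace r2 := congrArg (fun r : ℝ => (r : ℂ) • ket a (L + 2 + 2) M) r2
  replace r1 := congrArg (fun r : ℝ => (r : ℂ) • ket a (L + 2) M) r1
  replace r0 := congrArg (fun r : ℝ => (r : ℂ) • ket a L M) r0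
  simp only [add_sub_cancel_right, sub_add_cancel] at X1 X2 X3 Z1 Z2 Z3 r2 r1 r0 r1' r2'
  push_cast at r2 r1 r0 r1' r2'
  simp only [mul_apply_eq_comp, smul_apply, add_apply, Y0, Z0,
    map_add, map_smul, Z1, Z2, Z3, X1, X2, X3, one_apply_eq_self]
  linear_combination (norm := module) r2 + r1 + r0 + r1' + r2'

theorem opY_mul_opX : (1 + p.q ^ 2 : ℂ) • (opY p N a * opX p N a)
      + (p.q ^ 4 : ℂ) • (opZ p N a * opZ p N a)
      + (p.q ^ 2 * (1 - p.q ^ 2) * (1 - p.s ^ 2) : ℂ) • opZ p N a =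
      (p.q ^ 2 * (1 - p.s ^ 2) ^ 2 + p.s ^ 2 * (1 + p.q ^ 2) ^ 2 : ℂ) • 1 := by
  refine ext_ket fun L M h => ?_
  obtain ⟨hr, i, j, hi, hj⟩ := h.range ha hN
  obtain ⟨l, hl⟩ : ∃ l : ℝ, l = L / 2 := ⟨_, rfl⟩
  obtain ⟨m, hm⟩ : ∃ m : ℝ, m = M / 2 := ⟨_, rfl⟩
  rw [← hl, ← hm] at hi hj
  rw [← hl] at hr
  have X0 := opX_ket (p := p) ha hN h hl hm
  have Z0 := opZ_ket (p := p) ha hN h hl hm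
  have Y1 := smul_opY_ket (p := p) ha hN (l := l + 1) (m := m + 1) (by rw [hl]; push_cast; ring)
    (by rw [hm]; push_cast; ring) (c := p.cBp N l m) (Or.inl h.up_right)
  have Y2 := smul_opY_ket (p := p) ha hN (l := l) (m := m + 1) hl
    (by rw [hm]; push_cast; ring) (c := p.cB0 N l m) (cB0_guard ha hN h hl hm)
  have Y3 := smul_opY_ket (p := p) ha hN (l := l - 1) (m := m + 1) (by rw [hl]; push_cast; ring)
    (by rw [hm]; push_cast; ring) (c := p.cBm N l m) (cBm_guard ha hN h hl hm)
  have Z1 := smul_opZ_ket (p := p) ha hN (l := l + 1) (m := m) (by rw [hl]; push_cast; ring)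
    hm (c := p.cAp N l m) (Or.inl h.up)
  have Z2 := smul_opZ_ket (p := p) ha hN (l := l) (m := m) hl hm (c := p.cA0 N l m) (Or.inl h)
  have Z3 := smul_opZ_ket (p := p) ha hN (l := l - 1) (m := m) (by rw [hl]; push_cast; ring)
    hm (c := p.cAp N (l - 1) m) (cAp_guard ha hN h hl hm)
  have r2 := p.rel_YX_two (N := N) hi hj
  have r1 := p.rel_YX_one hr hi hj
  have r0 := p.rel_YX_zero hr hi hj
  have r1' : (((1 + p.q ^ 2) * (p.cB0 N l m * p.cBp N (l - 1) m + p.cBm N l m * p.cB0 N (l - 1) m)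
      + p.q ^ 4 * ((p.cA0 N l m + p.cA0 N (l - 1) m) * p.cAp N (l - 1) m)
      + p.q ^ 2 * (1 - p.q ^ 2) * (1 - p.s ^ 2) * p.cAp N (l - 1) m : ℝ) : ℂ) • ket a (L - 2) M =
        ((0 : ℝ) : ℂ) • ket a (L - 2) M := by
    refine smul_ket fun h' => ?_
    obtain ⟨hr', i, j, hi, hj⟩ := h'.range ha hN
    have := p.rel_YX_one (N := N) (l := l - 1) (m := m) (i := i) (j := j)
      (by rw [hl]; push_cast at hr'; convert hr' using 1; ring)
      (by rw [← hi, hl, hm]; push_cast; ring) (by rw [← hj, hl, hm]; push_cast; ring)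
    simpa only [sub_add_cancel] using this
  have r2' : (((1 + p.q ^ 2) * (p.cBm N l m * p.cBp N (l - 1 - 1) m)
      + p.q ^ 4 * (p.cAp N (l - 1 - 1) m * p.cAp N (l - 1) m) : ℝ) : ℂ) • ket a (L - 2 - 2) M =
        ((0 : ℝ) : ℂ) • ket a (L - 2 - 2) M := by
    refine smul_ket fun h' => ?_
    obtain ⟨-, i, j, hi, hj⟩ := h'.range ha hN
    have := p.rel_YX_two (N := N) (l := l - 1 - 1) (m := m) (i := i) (j := j)
      (by rw [← hi, hl, hm]; push_cast; ring) (by rw [← hj, hl, hm]; push_cast; ring)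
    simp only [sub_add_cancel, show l - 1 - 1 + 2 = l by ring] at this
    linarith
  replace r2 := congrArg (fun r : ℝ => (r : ℂ) • ket a (L + 2 + 2) M) r2
  replace r1 := congrArg (fun r : ℝ => (r : ℂ) • ket a (L + 2) M) r1
  replace r0 := congrArg (fun r : ℝ => (r : ℂ) • ket a L M) r0
  simp only [add_sub_cancel_right, sub_add_cancel, show l + 1 + 1 = l + 2 by ring] at Y1 Y2 Y3 Z1 Z2 Z3 r2 r1 r0 r1' r2'
  push_cast at r2 r1 r0 r1' r2'
  simp only [mul_apply_eq_comp, smul_apply, add_apply, X0, Z0,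
    map_add, map_smul, Z1, Z2, Z3, Y1, Y2, Y3, one_apply_eq_self]
  linear_combination (norm := module) r2 + r1 + r0 + r1' + r2'

end SpinIdx

/-! ### Adjoints -/

namespace SpinIdx
open Ell2

variable {p : PodlesParam} {N : ℝ} {a : ℕ}

theorem _root_.Ell2.entry_adjoint {ι : Type*} [DecidableEq ι] (T : Ell2 ι →L[ℂ] Ell2 ι) (i j : ι) :
    entry (ContinuousLinearMap.adjoint T) i j = (starRingEnd ℂ) (entry T j i) := by
  rw [entry_eq_inner, ContinuousLinearMap.adjoint_inner_right, ← inner_conj_symm, ← entry_eq_inner]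

theorem ket_apply (L M : ℤ) (x : SpinIdx a) :
    ket a L M x = if x.1.1 = L ∧ x.1.2 = M then 1 else 0 := by
  by_cases h : SpinValid a L M
  · rw [ket, dif_pos h, lp.single_apply, Pi.single_apply]
    refine if_congr ?_ rfl rfl
    rw [Subtype.ext_iff, Prod.ext_iff]
  · rw [ket_of_not h, if_neg]
    · rfl
    · rintro ⟨rfl, rfl⟩
      exact h x.2

variable (ha : 1 ≤ a) (hN : |N| = a / 2)
include ha hN

theorem entry_opX (x y : SpinIdx a) {l m : ℝ} (hl : l = y.1.1 / 2) (hm : m = y.1.2 / 2) :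
    entry (opX p N a) x y = ((if x.1.1 = y.1.1 + 2 ∧ x.1.2 = y.1.2 + 2 then p.cBp N l m else 0)
      + (if x.1.1 = y.1.1 ∧ x.1.2 = y.1.2 + 2 then p.cB0 N l m else 0)
      + (if x.1.1 = y.1.1 - 2 ∧ x.1.2 = y.1.2 + 2 then p.cBm N l m else 0) : ℝ) := by
  rw [entry, ← ket_eq, opX_ket ha hN y.2 hl hm, lp.coeFn_add, lp.coeFn_add]
  simp only [lp.coeFn_smul, Pi.add_apply, Pi.smul_apply, ket_apply, smul_eq_mul, mul_ite, mul_one,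
    mul_zero, apply_ite Complex.ofReal, Complex.ofReal_zero, Complex.ofReal_add]

theorem entry_opZ (x y : SpinIdx a) {l m : ℝ} (hl : l = y.1.1 / 2) (hm : m = y.1.2 / 2) :
    entry (opZ p N a) x y = ((if x.1.1 = y.1.1 + 2 ∧ x.1.2 = y.1.2 then p.cAp N l m else 0)
      + (if x.1.1 = y.1.1 ∧ x.1.2 = y.1.2 then p.cA0 N l m else 0)
      + (if x.1.1 = y.1.1 - 2 ∧ x.1.2 = y.1.2 then p.cAp N (l - 1) m else 0) : ℝ) := by
  rw [entry, ← ket_eq, opZ_ket ha hN y.2 hl hm, lp.coeFn_add, lp.coeFn_add]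
  simp only [lp.coeFn_smul, Pi.add_apply, Pi.smul_apply, ket_apply, smul_eq_mul, mul_ite, mul_one,
    mul_zero, apply_ite Complex.ofReal, Complex.ofReal_zero, Complex.ofReal_add]

theorem entry_opY (x y : SpinIdx a) {l m : ℝ} (hl : l = y.1.1 / 2) (hm : m = y.1.2 / 2) :
    entry (opY p N a) x y =
      ((if x.1.1 = y.1.1 + 2 ∧ x.1.2 = y.1.2 - 2 then p.cBm N (l + 1) (m - 1) else 0)
      + (if x.1.1 = y.1.1 ∧ x.1.2 = y.1.2 - 2 then p.cB0 N l (m - 1) else 0)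
      + (if x.1.1 = y.1.1 - 2 ∧ x.1.2 = y.1.2 - 2 then p.cBp N (l - 1) (m - 1) else 0) : ℝ) := by
  rw [entry, ← ket_eq, opY_ket ha hN y.2 hl hm, lp.coeFn_add, lp.coeFn_add]
  simp only [lp.coeFn_smul, Pi.add_apply, Pi.smul_apply, ket_apply, smul_eq_mul, mul_ite, mul_one,
    mul_zero, apply_ite Complex.ofReal, Complex.ofReal_zero, Complex.ofReal_add]

theorem isSelfAdjoint_opZ : IsSelfAdjoint (opZ p N a) := by
  refine isSelfAdjoint_of_entry fun x y => ?_
  rw [entry_opZ ha hN _ _ rfl rfl, entry_opZ ha hN _ _ rfl rfl, Complex.conj_ofReal]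
  obtain ⟨⟨L, M⟩, hx⟩ := x
  obtain ⟨⟨L', M'⟩, hy⟩ := y
  dsimp only
  congr 1
  by_cases hM : M = M'
  · subst hM
    by_cases h1 : L' = L + 2
    · subst h1
      rw [if_pos, if_neg, if_neg, if_neg, if_neg, if_pos] <;> first | omega | skip
      push_cast
      simp only [add_zero, zero_add, add_div]
      norm_num
    · by_cases h2 : L' = L
      · subst h2
        simp
      · by_cases h3 : L' = L - 2
        · subst h3
          rw [if_neg, if_neg, if_pos, if_pos, if_neg, if_neg] <;> first | omega | skip
          push_cast
          simp only [add_zero, zero_add, sub_div]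
          norm_num
        · rw [if_neg, if_neg, if_neg, if_neg, if_neg, if_neg] <;> omega
  · rw [if_neg, if_neg, if_neg, if_neg, if_neg, if_neg] <;> omega

theorem adjoint_opX : ContinuousLinearMap.adjoint (opX p N a) = opY p N a := by
  refine ext_entry fun x y => ?_
  rw [entry_adjoint, entry_opY ha hN _ _ rfl rfl, entry_opX ha hN _ _ rfl rfl, Complex.conj_ofReal]
  obtain ⟨⟨L, M⟩, hx⟩ := x
  obtain ⟨⟨L', M'⟩, hy⟩ := y
  dsimp only
  congr 1
  by_cases hM : M = M' - 2
  · subst hM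
    by_cases h1 : L' = L + 2
    · subst h1
      rw [if_pos, if_neg, if_neg, if_neg, if_neg, if_pos] <;> first | omega | skip
      push_cast
      simp only [add_zero, zero_add, add_div, sub_div]
      norm_num
    · by_cases h2 : L' = L
      · subst h2
        rw [if_neg, if_pos, if_neg, if_neg, if_pos, if_neg] <;> first | omega | skip
        push_cast
        simp [sub_div]
      · by_cases h3 : L' = L - 2
        · subst h3
          rw [if_neg, if_neg, if_pos, if_pos, if_neg, if_neg] <;> first | omega | skip
          push_cast
          simp only [add_zero, zero_add, sub_div]
          norm_num
        · rw [if_neg, if_neg, if_neg, if_neg, if_neg, if_neg] <;> omega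
  · rw [if_neg, if_neg, if_neg, if_neg, if_neg, if_neg] <;> omega

/-- Taking adjoints of the relation between x₀ and x₁ replaces another coefficient computation. -/
theorem opY_mul_opZ : opY p N a * opZ p N a =
    (p.q ^ 2 : ℂ) • (opZ p N a * opY p N a) + ((1 - p.q ^ 2) * (1 - p.s ^ 2) : ℂ) • opY p N a := by
  have h := congrArg star (opZ_mul_opX (p := p) ha hN)
  have h1 : star (opX p N a) = opY p N a := adjoint_opX ha hN
  have h2 : star (opZ p N a) = opZ p N a := isSelfAdjoint_opZ ha hN
  simp only [star_mul, star_add, star_smul, h1, h2] at h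
  rw [h]
  simp [Complex.conj_ofReal, mul_comm]

end SpinIdx

/-! ### The representation and its uniqueness -/

namespace Podles
open SpinIdx Ell2
variable (p : PodlesParam) {N : ℝ} {a : ℕ}

theorem _root_.PodlesParam.one_add_sq_ne : (1 + p.q ^ 2 : ℂ) ≠ 0 := by
  have : 0 < 1 + p.q ^ 2 := by have := p.q_pos; positivity
  exact_mod_cast this.ne'

theorem _root_.PodlesParam.one_add_sq_inv_sqrt : ((√(1 + p.q ^ 2))⁻¹ : ℂ) * ((√(1 + p.q ^ 2))⁻¹ : ℂ) =
    (1 + p.q ^ 2 : ℂ)⁻¹ := by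
  have : (0 : ℝ) ≤ 1 + p.q ^ 2 := by have := p.q_pos; positivity
  rw [← mul_inv, ← Complex.ofReal_mul, Real.mul_self_sqrt this]
  push_cast
  rfl

/-- The representation of `𝒜(S²_{qs})` on `ℋ_N`, where `|N| = a/2`. -/
noncomputable def levelRep (ha : 1 ≤ a) (hN : |N| = a / 2) :
    Podles p →ₐ[ℂ] (Ell2 (SpinIdx a) →L[ℂ] Ell2 (SpinIdx a)) :=
  -- As q[2] = 1 + q², these are the formulas defining x₀, x₁, x₋₁ solved for A, B, B^*.
  lift p ((1 + p.q ^ 2 : ℂ)⁻¹ • ((1 - p.s ^ 2 : ℂ) • 1 - opZ p N a))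
    (((√(1 + p.q ^ 2))⁻¹ : ℂ) • opX p N a) (((√(1 + p.q ^ 2))⁻¹ : ℂ) • opY p N a)
    (by
      have h := opZ_mul_opX (p := p) ha hN
      simp only [smul_mul_assoc, mul_smul_comm, sub_mul, mul_sub, one_mul, mul_one, h,
        PodlesParam.qc]
      module)
    (by
      have h := opY_mul_opZ (p := p) ha hN
      simp only [smul_mul_assoc, mul_smul_comm, sub_mul, mul_sub, one_mul, mul_one, h,
        PodlesParam.qc]
      module)
    (by
      have h := opX_mul_opY (p := p) ha hN
      have h0 := p.one_add_sq_ne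
      rw [smul_mul_smul_comm, p.one_add_sq_inv_sqrt]
      simp only [Algebra.algebraMap_eq_smul_one, smul_mul_assoc, mul_smul_comm, sub_mul, mul_sub,
        one_mul, mul_one, PodlesParam.sc, add_mul, smul_add, smul_sub]
      linear_combination (norm := skip) ((1 + p.q ^ 2 : ℂ)⁻¹) ^ 2 • h
      match_scalars <;> field_simp <;> ring)
    (by
      have h := opY_mul_opX (p := p) ha hN
      have h0 := p.one_add_sq_ne
      rw [smul_mul_smul_comm, p.one_add_sq_inv_sqrt]
      simp only [Algebra.algebraMap_eq_smul_one, smul_mul_assoc, mul_smul_comm, sub_mul, mul_sub,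
        one_mul, mul_one, PodlesParam.sc, PodlesParam.qc, add_mul, smul_add, smul_sub]
      linear_combination (norm := skip) ((1 + p.q ^ 2 : ℂ)⁻¹) ^ 2 • h
      match_scalars <;> field_simp <;> ring)

theorem _root_.PodlesParam.q_mul_num_two : p.q * p.num 2 = 1 + p.q ^ 2 := by
  have := p.q_pos
  rw [p.num_two]
  field_simp

theorem _root_.PodlesParam.sqrt_one_add_sq_ne : ((√(1 + p.q ^ 2) : ℝ) : ℂ) ≠ 0 := by
  have : 0 < 1 + p.q ^ 2 := by have := p.q_pos; positivity
  exact_mod_cast (Real.sqrt_pos.2 this).ne'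

variable (ha : 1 ≤ a) (hN : |N| = a / 2)

theorem levelRep_A : levelRep p ha hN (A p) =
    (1 + p.q ^ 2 : ℂ)⁻¹ • ((1 - p.s ^ 2 : ℂ) • 1 - opZ p N a) := lift_A ..
theorem levelRep_B : levelRep p ha hN (B p) = ((√(1 + p.q ^ 2))⁻¹ : ℂ) • opX p N a := lift_B ..
theorem levelRep_Bs : levelRep p ha hN (Bs p) = ((√(1 + p.q ^ 2))⁻¹ : ℂ) • opY p N a := lift_Bs ..

theorem levelRep_x₁ : levelRep p ha hN (x₁ p) = opX p N a := by
  rw [x₁, map_smul, levelRep_B, p.q_mul_num_two, smul_smul, mul_inv_cancel₀ p.sqrt_one_add_sq_ne,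
    one_smul]

theorem levelRep_x₀ : levelRep p ha hN (x₀ p) = opZ p N a := by
  have h0 := p.one_add_sq_ne
  rw [x₀, map_add, map_smul, map_smul, map_one, levelRep_A, p.q_mul_num_two, PodlesParam.sc]
  push_cast
  rw [neg_smul, smul_smul, mul_inv_cancel₀ h0]
  module

theorem levelRep_xm₁ : levelRep p ha hN (-p.qc • xm₁ p) = opY p N a := by
  rw [xm₁, smul_smul, neg_mul_neg, mul_inv_cancel₀ p.qc_ne, one_smul, map_smul, levelRep_Bs,
    p.q_mul_num_two, smul_smul, mul_inv_cancel₀ p.sqrt_one_add_sq_ne, one_smul]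

end Podles

namespace Podles
open SpinIdx Ell2

theorem algHom_ext {p : PodlesParam} {R : Type*} [Ring R] [Algebra ℂ R] {f g : Podles p →ₐ[ℂ] R}
    (hA : f (A p) = g (A p)) (hB : f (B p) = g (B p)) (hBs : f (Bs p) = g (Bs p)) : f = g := by
  refine AlgHom.ext fun x => ?_
  induction x using Podles.induction with
  | hs c => rw [AlgHom.commutes, AlgHom.commutes]
  | hA => exact hA
  | hB => exact hB
  | hBs => exact hBs
  | hadd x y hx hy => rw [map_add, map_add, hx, hy]
  | hmul x y hx hy => rw [map_mul, map_mul, hx, hy]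

variable (p : PodlesParam) {n : ℤ} (hn : n ≠ 0)

theorem abs_label (n : ℤ) (b : Bool) : |label n b| = n.natAbs / 2 := by
  have h : |(n : ℝ) / 2| = n.natAbs / 2 := by
    rw [abs_div, Nat.cast_natAbs, Int.cast_abs, abs_of_pos (zero_lt_two (α := ℝ))]
  cases b
  · exact h
  · change |-((n : ℝ) / 2)| = _
    rw [abs_neg, h]

theorem one_le_natAbs (hn : n ≠ 0) : 1 ≤ n.natAbs := Int.natAbs_pos.2 hn

/-- The component of the spinor representation with label `-N` (for `true`) or `N` (for `false`). -/
noncomputable def compRep (b : Bool) :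
    Podles p →ₐ[ℂ] (Ell2 (SpinIdx n.natAbs) →L[ℂ] Ell2 (SpinIdx n.natAbs)) :=
  levelRep p (one_le_natAbs hn) (abs_label n b)

/-- The representation of `𝒜(S²_{qs})` on `ℋ_{-N} ⊕ ℋ_N`. -/
noncomputable def spinRep : Podles p →ₐ[ℂ] (SpinorSpace n →L[ℂ] SpinorSpace n) :=
  blockHom.comp ((Matrix.diagonalAlgHom ℂ).comp (AlgHom.pi fun b => compRep p hn b))

theorem spinRep_apply (x : Podles p) :
    spinRep p hn x = blockHom (Matrix.diagonal fun b => compRep p hn b x) := rfl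

theorem blockProj_spinRep (x : Podles p) (v : SpinorSpace n) (b : Bool) :
    blockProj b (spinRep p hn x v) = compRep p hn b x (blockProj b v) := by
  rw [spinRep_apply, blockProj_blockHom, Finset.sum_eq_single b]
  · rw [Matrix.diagonal_apply_eq]
  · intro c _ hc
    rw [Matrix.diagonal_apply_ne _ (Ne.symm hc)]
    rfl
  · simp

theorem _root_.Ell2.ext_blockProj {ι κ : Type*} [DecidableEq ι] [DecidableEq κ] {v w : Ell2 (ι × κ)}
    (h : ∀ k, blockProj k v = blockProj k w) : v = w := by
  ext ⟨x, k⟩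
  rw [← blockProj_apply, h, blockProj_apply]

theorem spinRep_blockIncl (x : Podles p) (v : Ell2 (SpinIdx n.natAbs)) (b : Bool) :
    spinRep p hn x (blockIncl b v) = blockIncl b (compRep p hn b x v) := by
  refine ext_blockProj fun c => ?_
  rw [blockProj_spinRep, blockProj_blockIncl, blockProj_blockIncl]
  split_ifs with h
  · rw [h]
  · exact map_zero _

theorem spinKet_eq (n : ℤ) (b : Bool) (L M : ℤ) : spinKet n b L M = blockIncl b (ket n.natAbs L M) := by
  by_cases h : SpinValid n.natAbs L M
  · rw [ket, dif_pos h, blockIncl_single]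
    exact dif_pos h
  · rw [ket_of_not h, map_zero]
    exact dif_neg h

theorem isSpinorRep_spinRep : IsSpinorRep p n (spinRep p hn) where
  x₁_apply x b l m hl hm := by
    simp only [spinKet_eq]
    rw [spinRep_blockIncl, compRep, levelRep_x₁, opX_ket (one_le_natAbs hn) (abs_label n b) x.2 hl hm]
    simp only [map_add, map_smul]
  x₀_apply x b l m hl hm := by
    simp only [spinKet_eq]
    rw [spinRep_blockIncl, compRep, levelRep_x₀, opZ_ket (one_le_natAbs hn) (abs_label n b) x.2 hl hm]
    simp only [map_add, map_smul]
  xm₁_apply x b l m hl hm := by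
    simp only [spinKet_eq]
    rw [spinRep_blockIncl, compRep, levelRep_xm₁, opY_ket (one_le_natAbs hn) (abs_label n b) x.2 hl hm]
    simp only [map_add, map_smul]

theorem ext_spinKet {S T : SpinorSpace n →L[ℂ] SpinorSpace n}
    (h : ∀ (x : SpinIdx n.natAbs) (b : Bool), S (spinKet n b x.1.1 x.1.2) = T (spinKet n b x.1.1 x.1.2)) :
    S = T :=
  ext_entry fun i j => by
    have e : spinKet n j.2 j.1.1.1 j.1.1.2 = lp.single 2 j (1 : ℂ) := by
      rw [spinKet_eq, ket_eq, blockIncl_single]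
    rw [entry, entry, ← e, h]

variable {p} in
-- The formulas fix the images of x₁, x₀ and x₋₁ on a basis, and A, B, B^* are recovered from these
-- because q[2] = 1 + q² and its root are nonzero.
theorem IsSpinorRep.unique {π π' : Podles p →ₐ[ℂ] (SpinorSpace n →L[ℂ] SpinorSpace n)}
    (h : IsSpinorRep p n π) (h' : IsSpinorRep p n π') : π = π' := by
  have e1 : π (x₁ p) = π' (x₁ p) := ext_spinKet fun x b => by
    rw [h.x₁_apply x b _ _ rfl rfl, h'.x₁_apply x b _ _ rfl rfl]
  have e0 : π (x₀ p) = π' (x₀ p) := ext_spinKet fun x b => by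
    rw [h.x₀_apply x b _ _ rfl rfl, h'.x₀_apply x b _ _ rfl rfl]
  have em : π (-p.qc • xm₁ p) = π' (-p.qc • xm₁ p) := ext_spinKet fun x b => by
    rw [h.xm₁_apply x b _ _ rfl rfl, h'.xm₁_apply x b _ _ rfl rfl]
  have hc : ((√(p.q * p.num 2) : ℝ) : ℂ) ≠ 0 := by
    rw [p.q_mul_num_two]
    exact p.sqrt_one_add_sq_ne
  have hd : (-((p.q * p.num 2 : ℝ) : ℂ)) ≠ 0 := by
    rw [p.q_mul_num_two]
    push_cast
    exact neg_ne_zero.2 p.one_add_sq_ne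
  refine algHom_ext ?_ ?_ ?_
  · rw [x₀, map_add, map_add, map_smul, map_smul π', map_smul, map_smul π', map_one, map_one,
      add_left_inj] at e0
    exact smul_right_injective _ hd e0
  · rw [x₁, map_smul, map_smul] at e1
    exact smul_right_injective _ hc e1
  · rw [xm₁, smul_smul, neg_mul_neg, mul_inv_cancel₀ p.qc_ne, one_smul, map_smul, map_smul] at em
    exact smul_right_injective _ hc em

end Podles

/-! ### Comparison of the coefficients for N and -N -/

namespace PodlesParam
variable (p : PodlesParam) {N l m : ℝ}

theorem inv_sub_pos : 0 < p.q⁻¹ - p.q := by have := p.sub_inv_neg; linarith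

/-- With `le_num` this pins the growth of [t] to q^{-t} up to constants, the only asymptotic input
of the estimates. -/
theorem num_le (t : ℝ) : p.num t ≤ (p.q⁻¹ - p.q)⁻¹ * p.q ^ (-t) := by
  have h := p.inv_sub_pos
  have e : p.num t = (p.q⁻¹ - p.q)⁻¹ * (p.q ^ (-t) - p.q ^ t) := by
    have h' := p.sub_inv_neg.ne
    rw [num, qNum, ← neg_sub p.q p.q⁻¹, inv_neg]
    field_simp
    ring
  rw [e]
  have := p.q_rpow_pos t
  exact mul_le_mul_of_nonneg_left (by linarith) (by positivity)

theorem le_num {t : ℝ} (ht : 1 ≤ t) : p.q ^ (1 - t) ≤ p.num t := by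
  have h := p.sub_inv_neg
  have hq := p.q_pos
  rw [num, qNum, le_div_iff_of_neg h]
  have h1 : p.q ^ t ≤ p.q ^ (2 - t) :=
    Real.rpow_le_rpow_of_exponent_ge hq p.q_lt_one.le (by linarith)
  have h2 : p.q ^ (1 - t) * (p.q - p.q⁻¹) = p.q ^ (2 - t) - p.q ^ (-t) := by
    rw [mul_sub, ← Real.rpow_add_one hq.ne', ← div_eq_mul_inv, ← Real.rpow_sub_one hq.ne']
    ring_nf
  linarith

theorem alpha_nonneg (hl : 0 ≤ l) : 0 ≤ p.alpha N l := by
  rw [alpha]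
  have := p.num_nonneg (t := 2 * l) (by linarith)
  positivity

theorem LevelRange_neg (h : LevelRange N l) : LevelRange (-N) l := by
  obtain ⟨a, k, h1, h2, h3⟩ := h
  exact ⟨a, k, h1, by rwa [abs_neg], h3⟩

/-- Passes from α² to α without dividing by α, which vanishes at l = |N|, at the price of half the
exponent. -/
theorem sq_sub_le_abs_sub_sq {x y : ℝ} (hx : 0 ≤ x) (hy : 0 ≤ y) : (x - y) ^ 2 ≤ |x ^ 2 - y ^ 2| := by
  have e : x ^ 2 - y ^ 2 = (x - y) * (x + y) := by ring
  rw [e, abs_mul, ← sq_abs, pow_two]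
  refine mul_le_mul_of_nonneg_left ?_ (abs_nonneg _)
  rw [abs_of_nonneg (add_nonneg hx hy)]
  exact abs_le.2 ⟨by linarith, by linarith⟩

/-- In α² only the product of the two brackets containing s distinguishes N from -N, and there the
change is the constant (q^{2N} - q^{-2N})(1 - s⁴). The remaining numerator is of size q^{-2l} and
the denominator of size q^{-8l}, so the squares differ by O(q^{6l}). -/
theorem exists_alpha_sub_le (N : ℝ) : ∃ C, 0 ≤ C ∧ ∀ l, LevelRange N l →
    |p.alpha N l - p.alpha (-N) l| ≤ C * p.q ^ (3 * l) := by
  have hq := p.q_pos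
  set κ := (p.q⁻¹ - p.q)⁻¹ with hκ
  have hκ0 : 0 ≤ κ := inv_nonneg.2 p.inv_sub_pos.le
  have h2 : 0 ≤ p.num 2 := p.num_nonneg (by norm_num)
  set D := p.num 2 * κ ^ 2 * |p.q ^ (2 * N) - p.q ^ (-(2 * N))| / p.q ^ 4 with hD
  have hD0 : 0 ≤ D := by positivity
  refine ⟨√D, Real.sqrt_nonneg _, fun l h => ?_⟩
  rcases h.eq_or with h0 | h0
  · rw [alpha_abs p h0, alpha_abs p (by rwa [abs_neg]), sub_zero, abs_zero]
    have := p.q_rpow_pos (3 * l)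
    positivity
  have hl := h.half_le
  have hx : 0 < p.q ^ l := p.q_rpow_pos l
  have hl' : 1 ≤ l := by have := abs_nonneg N; linarith
  have b1 : p.num (l + N) * p.num (l - N) ≤ κ ^ 2 / (p.q ^ l) ^ 2 := by
    calc _ ≤ (κ * p.q ^ (-(l + N))) * (κ * p.q ^ (-(l - N))) := by
          refine mul_le_mul (p.num_le _) (p.num_le _) (p.num_nonneg ?_) ?_
          · have := le_abs_self N; linarith
          · have := p.q_rpow_pos (-(l + N)); positivity
      _ = κ ^ 2 * (p.q ^ (-(l + N)) * p.q ^ (-(l - N))) := by ring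
      _ = κ ^ 2 / (p.q ^ l) ^ 2 := by
          rw [← Real.rpow_add hq, show -(l + N) + -(l - N) = -(2 * l) by ring,
            Real.rpow_neg hq.le, q_rpow_two_mul, div_eq_mul_inv]
  have b1' : 0 ≤ p.num (l + N) * p.num (l - N) :=
    mul_nonneg (p.num_nonneg (by have := neg_abs_le N; linarith))
      (p.num_nonneg (by have := le_abs_self N; linarith))
  have b2 : p.q / (p.q ^ l) ^ 2 ≤ p.num (2 * l) := by
    have := p.le_num (t := 2 * l) (by linarith)
    rwa [Real.rpow_sub hq, Real.rpow_one, q_rpow_two_mul] at this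
  have b3 : 1 / (p.q ^ l) ^ 2 ≤ p.num (2 * l + 1) := by
    have := p.le_num (t := 2 * l + 1) (by linarith)
    rwa [show 1 - (2 * l + 1) = 0 - 2 * l by ring, Real.rpow_sub hq, Real.rpow_zero,
      q_rpow_two_mul] at this
  have b4 : p.q ^ 2 / (p.q ^ l) ^ 2 ≤ p.num (2 * l - 1) := by
    have := p.le_num (t := 2 * l - 1) (by linarith)
    rwa [show 1 - (2 * l - 1) = 2 - 2 * l by ring, Real.rpow_sub hq, Real.rpow_two,
      q_rpow_two_mul] at this
  have hs : |1 - p.s ^ 4| ≤ 1 := by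
    have h1 : 0 ≤ p.s ^ 4 := by positivity
    have h2 : p.s ^ 4 ≤ 1 := pow_le_one₀ p.s_nonneg p.s_le_one
    exact abs_le.2 ⟨by linarith, by linarith⟩
  have key : p.num (2 * l - 1) * (p.num (2 * l) ^ 2 * p.num (2 * l + 1)) *
      (p.alpha N l ^ 2 - p.alpha (-N) l ^ 2) =
      p.num 2 * (p.num (l + N) * p.num (l - N)) *
        ((p.q ^ (2 * N) - p.q ^ (-(2 * N))) * (1 - p.s ^ 4)) := by
    have hn2 : 0 < p.num (2 * l) := p.num_pos (by linarith)
    have hn3 : 0 < p.num (2 * l + 1) := p.num_pos (by linarith)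
    have k1 := p.alpha_sq_rpow h
    have k2 := p.alpha_sq_rpow (LevelRange_neg h)
    rw [eq_div_iff (by positivity)] at k1 k2
    have e1 : p.q ^ (2 * N) = (p.q ^ N) ^ 2 := p.q_rpow_two_mul N
    have hw := p.q_rpow_pos N
    rw [← sub_eq_add_neg, sub_neg_eq_add] at k2
    rw [Real.rpow_neg hq.le (2 * N), e1]
    simp only [Real.rpow_neg hq.le, Real.rpow_add hq, Real.rpow_sub hq] at k1 k2
    rw [mul_sub]
    calc _ = p.num (2 * l - 1) * p.alpha N l ^ 2 * (p.num (2 * l) ^ 2 * p.num (2 * l + 1))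
          - p.num (2 * l - 1) * p.alpha (-N) l ^ 2 * (p.num (2 * l) ^ 2 * p.num (2 * l + 1)) := by
          ring
      _ = _ := by
          rw [k1, k2]
          field_simp
          ring
  have hx2 : 0 < (p.q ^ l) ^ 2 := by positivity
  have hn1 : 0 ≤ p.num (2 * l - 1) := p.num_nonneg (by linarith)
  have hn2 : 0 ≤ p.num (2 * l) := p.num_nonneg (by linarith)
  have b5 : p.q ^ 4 / (p.q ^ l) ^ 8 ≤ p.num (2 * l - 1) * (p.num (2 * l) ^ 2 * p.num (2 * l + 1)) := by
    calc _ = p.q ^ 2 / (p.q ^ l) ^ 2 * ((p.q / (p.q ^ l) ^ 2) ^ 2 * (1 / (p.q ^ l) ^ 2)) := by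
          field_simp
      _ ≤ _ := by gcongr
  have b6 : p.q ^ 4 / (p.q ^ l) ^ 8 * |p.alpha N l ^ 2 - p.alpha (-N) l ^ 2| ≤
      p.num 2 * (κ ^ 2 / (p.q ^ l) ^ 2) * |p.q ^ (2 * N) - p.q ^ (-(2 * N))| := by
    have h9 : 0 < p.q ^ 4 / (p.q ^ l) ^ 8 := by positivity
    calc _ ≤ p.num (2 * l - 1) * (p.num (2 * l) ^ 2 * p.num (2 * l + 1)) *
          |p.alpha N l ^ 2 - p.alpha (-N) l ^ 2| := mul_le_mul_of_nonneg_right b5 (abs_nonneg _)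
      _ = |p.num 2 * (p.num (l + N) * p.num (l - N)) *
        ((p.q ^ (2 * N) - p.q ^ (-(2 * N))) * (1 - p.s ^ 4))| := by
          rw [← key, abs_mul (p.num (2 * l - 1) * _), abs_of_nonneg (h9.le.trans b5)]
      _ = p.num 2 * (p.num (l + N) * p.num (l - N)) *
        (|p.q ^ (2 * N) - p.q ^ (-(2 * N))| * |1 - p.s ^ 4|) := by
          rw [abs_mul, abs_of_nonneg (mul_nonneg h2 b1'), abs_mul]
      _ ≤ p.num 2 * (κ ^ 2 / (p.q ^ l) ^ 2) * (|p.q ^ (2 * N) - p.q ^ (-(2 * N))| * 1) := by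
          gcongr
      _ = _ := by rw [mul_one]
  have b7 : |p.alpha N l ^ 2 - p.alpha (-N) l ^ 2| ≤ D * (p.q ^ l) ^ 6 := by
    have h9 : 0 < p.q ^ 4 / (p.q ^ l) ^ 8 := by positivity
    refine le_of_mul_le_mul_left (b6.trans (le_of_eq ?_)) h9
    rw [hD]
    field_simp
  have e3 : p.q ^ (3 * l) = (p.q ^ l) ^ 3 := by
    rw [mul_comm, Real.rpow_mul hq.le]; norm_cast
  rw [e3]
  refine abs_le_of_sq_le_sq ?_ (by positivity)
  calc _ ≤ _ := sq_sub_le_abs_sub_sq (p.alpha_nonneg (by linarith)) (p.alpha_nonneg (by linarith))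
    _ ≤ _ := b7
    _ = _ := by rw [mul_pow, Real.sq_sqrt hD0]; ring

/-- Exact, since it serves twice: for the decay of T and for the explicit diagonal of T whose traces
give the index. -/
theorem beta_sub_neg (hl : 1 / 2 ≤ l) : p.beta N l - p.beta (-N) l =
    p.num 2 * p.num (2 * N) * (1 + p.s ^ 2) / (p.q * p.num (2 * l) * p.num (2 * l + 2)) := by
  have hq := p.q_pos
  have h1 : 0 < p.num (2 * l) := p.num_pos (by linarith)
  have h2 : 0 < p.num (2 * l + 2) := p.num_pos (by linarith)
  have e : p.q ^ (l - N + 1) * p.num (l + N) - p.q ^ (l + N + 1) * p.num (l - N) =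
      p.q * p.num (2 * N) := by
    rw [p.num_eq_of (Real.rpow_add hq l N), p.num_eq_of (Real.rpow_sub hq l N),
      p.num_eq_of (p.q_rpow_two_mul N), q_rpow_add_one, q_rpow_add_one, Real.rpow_add hq,
      Real.rpow_sub hq]
    have hx := p.q_rpow_pos l
    have hw := p.q_rpow_pos N
    have h3 := p.sub_inv_neg.ne
    field_simp
    ring
  rw [beta, beta, mul_neg, num_neg, ← sub_eq_add_neg, sub_neg_eq_add, div_sub_div_same,
    div_eq_div_iff (by positivity) (by positivity)]
  linear_combination (p.num 2 * (1 - p.s ^ 2) * p.q * p.num (2 * l) * p.num (2 * l + 2)) * e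

theorem exists_beta_sub_le (N : ℝ) : ∃ C, 0 ≤ C ∧ ∀ l, 1 / 2 ≤ l →
    |p.beta N l - p.beta (-N) l| ≤ C * p.q ^ (4 * l) := by
  have hq := p.q_pos
  have h2 : 0 ≤ p.num 2 := p.num_nonneg (by norm_num)
  refine ⟨p.num 2 * |p.num (2 * N)| * (1 + p.s ^ 2) / p.q, by positivity, fun l hl => ?_⟩
  have hx : 0 < p.q ^ l := p.q_rpow_pos l
  have b2 : p.q / (p.q ^ l) ^ 2 ≤ p.num (2 * l) := by
    have := p.le_num (t := 2 * l) (by linarith)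
    rwa [Real.rpow_sub hq, Real.rpow_one, q_rpow_two_mul] at this
  have b3 : 1 / (p.q * (p.q ^ l) ^ 2) ≤ p.num (2 * l + 2) := by
    have := p.le_num (t := 2 * l + 2) (by linarith)
    rwa [show 1 - (2 * l + 2) = 0 - (1 + 2 * l) by ring, Real.rpow_sub hq, Real.rpow_zero,
      Real.rpow_add hq, Real.rpow_one, q_rpow_two_mul] at this
  have b4 : p.q / (p.q ^ l) ^ 4 ≤ p.q * p.num (2 * l) * p.num (2 * l + 2) := by
    calc _ = p.q * (p.q / (p.q ^ l) ^ 2) * (1 / (p.q * (p.q ^ l) ^ 2)) := by field_simp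
      _ ≤ _ := by
          have := p.num_nonneg (t := 2 * l) (by linarith)
          gcongr
  have e4 : p.q ^ (4 * l) = (p.q ^ l) ^ 4 := by
    rw [mul_comm, Real.rpow_mul hq.le]; norm_cast
  have b5 : 0 < p.q / (p.q ^ l) ^ 4 := by positivity
  rw [p.beta_sub_neg hl, abs_div, abs_mul, abs_mul, abs_of_nonneg h2,
    abs_of_nonneg (b5.le.trans b4), abs_of_nonneg (by positivity : 0 ≤ 1 + p.s ^ 2), e4]
  calc _ ≤ p.num 2 * |p.num (2 * N)| * (1 + p.s ^ 2) / (p.q / (p.q ^ l) ^ 4) :=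
        div_le_div_of_nonneg_left (by positivity) b5 b4
    _ = _ := by field_simp

theorem sqrt_num_mul_le {u v w : ℝ} (hu : 0 ≤ u) (hv : 0 ≤ v) (hw : 2 * w = u + v) :
    √(p.num u * p.num v) ≤ (p.q⁻¹ - p.q)⁻¹ * p.q ^ (-w) := by
  have hκ : 0 < (p.q⁻¹ - p.q)⁻¹ := inv_pos.2 p.inv_sub_pos
  have h1 := p.q_rpow_pos (-w)
  refine Real.sqrt_le_iff.2 ⟨by positivity, ?_⟩
  have h2 := p.q_rpow_pos (-u)
  calc _ ≤ ((p.q⁻¹ - p.q)⁻¹ * p.q ^ (-u)) * ((p.q⁻¹ - p.q)⁻¹ * p.q ^ (-v)) :=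
        mul_le_mul (p.num_le _) (p.num_le _) (p.num_nonneg hv) (by positivity)
    _ = (p.q⁻¹ - p.q)⁻¹ ^ 2 * (p.q ^ (-u) * p.q ^ (-v)) := by ring
    _ = _ := by
      rw [← Real.rpow_add p.q_pos, show -u + -v = 2 * -w by linarith, q_rpow_two_mul, mul_pow]

theorem q_rpow_mul_le {c s t : ℝ} (h : t ≤ s) (hc : 0 ≤ c) : c * p.q ^ s ≤ c * p.q ^ t :=
  mul_le_mul_of_nonneg_left (Real.rpow_le_rpow_of_exponent_ge p.q_pos p.q_lt_one.le h) hc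

/-- The coefficients of the representations with labels `N` and `-N` are close. -/
theorem exists_coef_sub_le (N : ℝ) : ∃ C, 0 ≤ C ∧ ∀ l m, LevelRange N l → |m| ≤ l →
    |p.cBp N l m - p.cBp (-N) l m| ≤ C * p.q ^ l ∧
    |p.cB0 N l m - p.cB0 (-N) l m| ≤ C * p.q ^ l ∧
    (l - m = 0 ∨ 1 ≤ l - m → |p.cBm N l m - p.cBm (-N) l m| ≤ C * p.q ^ l) ∧
    |p.cAp N l m - p.cAp (-N) l m| ≤ C * p.q ^ l ∧
    |p.cA0 N l m - p.cA0 (-N) l m| ≤ C * p.q ^ l := by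
  obtain ⟨Ca, ha0, ha⟩ := p.exists_alpha_sub_le N
  obtain ⟨Cb, hb0, hb⟩ := p.exists_beta_sub_le N
  have hq := p.q_pos
  have hκ0 : 0 < (p.q⁻¹ - p.q)⁻¹ := inv_pos.2 p.inv_sub_pos
  set κ := (p.q⁻¹ - p.q)⁻¹ with hκ
  have h2 : 0 ≤ p.num 2 := p.num_nonneg (by norm_num)
  have h20 : 0 ≤ √(p.num 2) := Real.sqrt_nonneg _
  set C := κ * (1 + √(p.num 2)) * (Ca + Cb) + (κ + κ * p.num 2) * Cb with hC
  have c1 : 0 ≤ κ * Ca := by positivity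
  have c2 : 0 ≤ κ * √(p.num 2) * Ca := by positivity
  have c3 : 0 ≤ κ * Cb := by positivity
  have c4 : 0 ≤ κ * √(p.num 2) * Cb := by positivity
  have c5 : 0 ≤ κ * p.num 2 * Cb := by positivity
  have d1 : κ * Ca ≤ C := by rw [hC]; linarith
  have d2 : κ * √(p.num 2) * Ca ≤ C := by rw [hC]; linarith
  have d4 : κ * √(p.num 2) * Cb ≤ C := by rw [hC]; linarith
  have d5 : (κ + κ * p.num 2) * Cb ≤ C := by rw [hC]; linarith
  refine ⟨C, by linarith, fun l m h hm => ?_⟩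
  have hl := h.half_le
  rw [abs_le] at hm
  have A1 := ha _ h.succ
  have A0 := ha _ h
  have B0 := hb _ hl
  have qp := p.q_rpow_pos
  -- Every estimate below ends in a constant times q^s with s ≥ l, because α contributes q^{3l}, β
  -- contributes q^{4l}, and the prefactors lose at most q^{-2l}.
  have fin : ∀ {c s : ℝ}, c ≤ C → 0 ≤ c → l ≤ s → c * p.q ^ s ≤ C * p.q ^ l := by
    intro c s h1 h2 h3
    exact (p.q_rpow_mul_le h3 h2).trans (mul_le_mul_of_nonneg_right h1 (qp l).le)
  refine ⟨?_, ?_, fun hlm => ?_, ?_, ?_⟩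
  · rw [cBp, cBp, ← mul_sub, abs_mul, abs_mul, abs_of_pos (qp _), abs_of_nonneg (Real.sqrt_nonneg _)]
    have s1 := p.sqrt_num_mul_le (u := l + m + 1) (v := l + m + 2) (w := l + m + 3 / 2) (by linarith)
      (by linarith) (by ring)
    calc _ ≤ p.q ^ (-l + m) * (κ * p.q ^ (-(l + m + 3 / 2))) * (Ca * p.q ^ (3 * (l + 1))) := by
          have := qp (-l + m)
          have := qp (-(l + m + 3 / 2))
          gcongr
      _ = κ * Ca * (p.q ^ (-l + m) * p.q ^ (-(l + m + 3 / 2)) * p.q ^ (3 * (l + 1))) := by ring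
      _ ≤ _ := by
          rw [← Real.rpow_add hq, ← Real.rpow_add hq]
          exact fin d1 c1 (by linarith)
  · rw [cB0, cB0, ← mul_sub, abs_mul, abs_mul, abs_neg, abs_of_pos (qp _),
      abs_of_nonneg (Real.sqrt_nonneg _), mul_assoc (p.num 2), Real.sqrt_mul h2]
    have s1 := p.sqrt_num_mul_le (u := l - m) (v := l + m + 1) (w := l + 1 / 2) (by linarith)
      (by linarith) (by ring)
    calc _ ≤ p.q ^ (m + 2) * (√(p.num 2) * (κ * p.q ^ (-(l + 1 / 2)))) * (Cb * p.q ^ (4 * l)) := by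
          have := qp (m + 2)
          have := qp (-(l + 1 / 2))
          gcongr
      _ = κ * √(p.num 2) * Cb * (p.q ^ (m + 2) * p.q ^ (-(l + 1 / 2)) * p.q ^ (4 * l)) := by ring
      _ ≤ _ := by
          rw [← Real.rpow_add hq, ← Real.rpow_add hq]
          exact fin d4 c4 (by linarith)
  · rw [cBm, cBm, ← mul_sub, abs_mul, abs_mul, abs_neg, abs_of_pos (qp _),
      abs_of_nonneg (Real.sqrt_nonneg _)]
    -- For l = m the coefficient is zero. Otherwise l - m - 1 ≥ 0, as the bound on the root
    -- requires.
    rcases hlm with hlm | hlm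
    · rw [hlm, num_zero, zero_mul, Real.sqrt_zero, mul_zero, zero_mul]
      have := qp l
      have : 0 ≤ C := c1.trans d1
      positivity
    have s1 := p.sqrt_num_mul_le (u := l - m) (v := l - m - 1) (w := l - m - 1 / 2) (by linarith)
      (by linarith) (by ring)
    calc _ ≤ p.q ^ (l + m + 1) * (κ * p.q ^ (-(l - m - 1 / 2))) * (Ca * p.q ^ (3 * l)) := by
          have := qp (l + m + 1)
          have := qp (-(l - m - 1 / 2))
          gcongr
      _ = κ * Ca * (p.q ^ (l + m + 1) * p.q ^ (-(l - m - 1 / 2)) * p.q ^ (3 * l)) := by ring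
      _ ≤ _ := by
          rw [← Real.rpow_add hq, ← Real.rpow_add hq]
          exact fin d1 c1 (by linarith)
  · rw [cAp, cAp, ← mul_sub, abs_mul, abs_mul, abs_of_pos (qp _),
      abs_of_nonneg (Real.sqrt_nonneg _), mul_assoc (p.num 2), Real.sqrt_mul h2]
    have s1 := p.sqrt_num_mul_le (u := l - m + 1) (v := l + m + 1) (w := l + 1) (by linarith)
      (by linarith) (by ring)
    calc _ ≤ p.q ^ m * (√(p.num 2) * (κ * p.q ^ (-(l + 1)))) * (Ca * p.q ^ (3 * (l + 1))) := by
          have := qp m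
          have := qp (-(l + 1))
          gcongr
      _ = κ * √(p.num 2) * Ca * (p.q ^ m * p.q ^ (-(l + 1)) * p.q ^ (3 * (l + 1))) := by ring
      _ ≤ _ := by
          rw [← Real.rpow_add hq, ← Real.rpow_add hq]
          exact fin d2 c2 (by linarith)
  · rw [cA0, cA0, ← mul_sub, abs_mul]
    have n1 := p.num_nonneg (t := 2 * l) (by linarith)
    have n2 := p.num_nonneg (t := l - m) (by linarith)
    have e1 : |p.num (2 * l) - p.q ^ (l + m + 1) * p.num 2 * p.num (l - m)| ≤
        (κ + κ * p.num 2) * p.q ^ (-(2 * l)) := by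
      have t1 := p.num_le (2 * l)
      have t2 : p.q ^ (l + m + 1) * p.num 2 * p.num (l - m) ≤ κ * p.num 2 * p.q ^ (-(2 * l)) := by
        calc _ ≤ p.q ^ (l + m + 1) * p.num 2 * (κ * p.q ^ (-(l - m))) := by
              have := qp (l + m + 1)
              exact mul_le_mul_of_nonneg_left (p.num_le _) (by positivity)
          _ = κ * p.num 2 * (p.q ^ (l + m + 1) * p.q ^ (-(l - m))) := by ring
          _ ≤ _ := by
              rw [← Real.rpow_add hq]
              exact p.q_rpow_mul_le (by linarith) (by positivity)
      have t3 : 0 ≤ p.q ^ (l + m + 1) * p.num 2 * p.num (l - m) := by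
        have := qp (l + m + 1)
        positivity
      rw [abs_le]
      constructor <;> nlinarith
    calc _ ≤ (κ + κ * p.num 2) * p.q ^ (-(2 * l)) * (Cb * p.q ^ (4 * l)) := by
          have := qp (-(2 * l))
          gcongr
      _ = (κ + κ * p.num 2) * Cb * (p.q ^ (-(2 * l)) * p.q ^ (4 * l)) := by ring
      _ ≤ _ := by
          rw [← Real.rpow_add hq]
          exact fin d5 (by positivity) (by linarith)

end PodlesParam

/-! ### Orders of decay -/

namespace Ell2

section
variable {ι : Type*} [DecidableEq ι]

/-- `T` maps into order `k` with respect to the scale `δ`: the operators `δ^{-j} T δ^{j-k}` are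
bounded. -/
def HasDecay (δ : ι → ℝ) (k : ℤ) (T : Ell2 ι →L[ℂ] Ell2 ι) : Prop :=
  ∀ j : ℤ, ∃ T' : Ell2 ι →L[ℂ] Ell2 ι, ∀ x y,
    entry T' x y = (δ x : ℂ) ^ (-j) * (δ y : ℂ) ^ (j - k) * entry T x y

variable {δ : ι → ℝ} {k k' : ℤ} {S T : Ell2 ι →L[ℂ] Ell2 ι}

theorem HasDecay.add (hS : HasDecay δ k S) (hT : HasDecay δ k T) : HasDecay δ k (S + T) := by
  intro j
  obtain ⟨S', hS'⟩ := hS j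
  obtain ⟨T', hT'⟩ := hT j
  exact ⟨S' + T', fun x y => by rw [entry_add, entry_add, hS', hT', mul_add]⟩

theorem HasDecay.smul (hT : HasDecay δ k T) (c : ℂ) : HasDecay δ k (c • T) := by
  intro j
  obtain ⟨T', hT'⟩ := hT j
  exact ⟨c • T', fun x y => by rw [entry_smul, entry_smul, hT', mul_left_comm]⟩

theorem HasDecay.neg (hT : HasDecay δ k T) : HasDecay δ k (-T) := by
  rw [← neg_one_smul ℂ]
  exact hT.smul _

theorem HasDecay.sub (hS : HasDecay δ k S) (hT : HasDecay δ k T) : HasDecay δ k (S - T) := by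
  rw [sub_eq_add_neg]
  exact hS.add hT.neg

theorem HasDecay.zero : HasDecay δ k (0 : Ell2 ι →L[ℂ] Ell2 ι) :=
  fun _ => ⟨0, fun x y => by simp⟩

/-- Adjunction exchanges the left and right weights, so the case j for the adjoint is the case k - j
for the operator. Requiring all j in the definition makes this possible. -/
theorem HasDecay.adjoint (hT : HasDecay δ k T) : HasDecay δ k (ContinuousLinearMap.adjoint T) := by
  intro j
  obtain ⟨T', hT'⟩ := hT (k - j)
  refine ⟨ContinuousLinearMap.adjoint T', fun x y => ?_⟩
  rw [entry_adjoint, entry_adjoint, hT', map_mul, map_mul, map_zpow₀, map_zpow₀, Complex.conj_ofReal,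
    Complex.conj_ofReal, neg_sub, mul_comm ((δ y : ℂ) ^ _)]
  ring_nf

variable (hδ : ∀ x, 0 < δ x)
include hδ

theorem HasDecay.one : HasDecay δ 0 (1 : Ell2 ι →L[ℂ] Ell2 ι) := by
  refine fun j => ⟨1, fun x y => ?_⟩
  have h0 : (δ x : ℂ) ≠ 0 := by exact_mod_cast (hδ x).ne'
  rw [entry_one]
  split_ifs with h
  · rw [← h, ← zpow_add₀ h0]
    simp
  · rw [mul_zero]

/-- Orders add because the right weight of the first factor at j cancels the left weight of the
second at j - k. -/
theorem HasDecay.mul (hS : HasDecay δ k S) (hT : HasDecay δ k' T) : HasDecay δ (k + k') (S * T) := by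
  intro j
  obtain ⟨S', hS'⟩ := hS j
  obtain ⟨T', hT'⟩ := hT (j - k)
  refine ⟨S' * T', fun x y => ?_⟩
  have h := hasSum_entry_comp S' T' x y
  have e : (fun z => entry S' x z * entry T' z y) = fun z =>
      (δ x : ℂ) ^ (-j) * (δ y : ℂ) ^ (j - (k + k')) * (entry S x z * entry T z y) := by
    funext z
    have h0 : (δ z : ℂ) ≠ 0 := by exact_mod_cast (hδ z).ne'
    rw [hS', hT', show j - k - k' = j - (k + k') by ring, zpow_neg _ (j - k)]
    field_simp
  rw [e] at h
  exact h.unique ((hasSum_entry_comp S T x y).mul_left _)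

theorem HasDecay.exists_le (hT : HasDecay δ k T) (j : ℤ) :
    ∃ C, 0 ≤ C ∧ ∀ x y, ‖entry T x y‖ ≤ C * (δ x ^ j * δ y ^ (k - j)) := by
  obtain ⟨T', hT'⟩ := hT j
  refine ⟨‖T'‖, norm_nonneg _, fun x y => ?_⟩
  have h1 := norm_entry_le T' x y
  have hx := hδ x
  have hy := hδ y
  rw [hT', norm_mul, norm_mul, norm_zpow, norm_zpow, Complex.norm_real, Complex.norm_real,
    Real.norm_of_nonneg hx.le, Real.norm_of_nonneg hy.le] at h1
  have e : ‖entry T x y‖ =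
      δ x ^ (-j) * δ y ^ (j - k) * ‖entry T x y‖ * (δ x ^ j * δ y ^ (k - j)) := by
    rw [← neg_sub k j, zpow_neg, zpow_neg]
    field_simp
  rw [e]
  exact mul_le_mul_of_nonneg_right h1 (by positivity)

variable (h1 : ∀ x, δ x ≤ 1) (hs : Summable δ)
include h1 hs

/-- Use the order at j = k - 1: the coefficient at (x, y) is O(δ_x^{k-1} δ_y). A weight of size
δ_x^{-i} with i + 2 ≤ k leaves O(δ_x δ_y), which is summable over pairs. -/
theorem HasDecay.exists_weighted (hT : HasDecay δ k T) (w : ι → ℂ) {i : ℤ}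
    (hw : ∀ x, ‖w x‖ ≤ δ x ^ (-i)) (hik : i + 2 ≤ k) :
    ∃ S : Ell2 ι →L[ℂ] Ell2 ι, IsL1 S ∧ ∀ x y, entry S x y = w x * entry T x y := by
  obtain ⟨C, hC, h⟩ := hT.exists_le hδ (k - 1)
  have hb : ∀ x y, ‖w x * entry T x y‖ ≤ C * (δ x * δ y) := by
    intro x y
    have hx := hδ x
    have hy := hδ y
    rw [norm_mul]
    calc _ ≤ δ x ^ (-i) * (C * (δ x ^ (k - 1) * δ y ^ (k - (k - 1)))) := by
          gcongr
          · exact hw x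
          · exact h x y
      _ = C * (δ x ^ (k - 1 - i) * δ y) := by
          rw [sub_sub_cancel, zpow_one, zpow_sub₀ hx.ne' (k - 1) i, zpow_neg]
          field_simp
      _ ≤ C * (δ x ^ (1 : ℤ) * δ y) := by
          have := zpow_le_zpow_right_of_le_one₀ hx (h1 x) (show (1 : ℤ) ≤ k - 1 - i by omega)
          gcongr
      _ = _ := by rw [zpow_one]
  have hsum : Summable fun z : ι × ι => ‖w z.1 * entry T z.1 z.2‖ := by
    refine Summable.of_nonneg_of_le (fun _ => norm_nonneg _) (fun z => hb z.1 z.2) ?_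
    exact (hs.mul_of_nonneg hs (fun x => (hδ x).le) (fun x => (hδ x).le)).mul_left C
  obtain ⟨S, -, hS⟩ := exists_hasSum_matUnit (fun z : ι × ι => w z.1 * entry T z.1 z.2) hsum
  refine ⟨S, ?_, hS⟩
  simpa only [IsL1, hS] using hsum

theorem HasDecay.isL1 (hT : HasDecay δ k T) (hk : 2 ≤ k) : IsL1 T := by
  obtain ⟨S, h, hS⟩ := hT.exists_weighted hδ h1 hs (fun _ => 1) (i := 0) (by simp) (by simpa)
  rwa [ext_entry (S := S) (T := T) (by simpa using hS)] at h

end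

theorem HasDecay.blockHom {ι κ : Type*} [DecidableEq ι] [DecidableEq κ] [Fintype κ] {δ : ι → ℝ}
    {k : ℤ} {M : Matrix κ κ (Ell2 ι →L[ℂ] Ell2 ι)} (h : ∀ i j, HasDecay δ k (M i j)) :
    HasDecay (fun x : ι × κ => δ x.1) k (blockHom M) := by
  intro j
  choose M' hM' using fun i i' => h i i' j
  refine ⟨Ell2.blockHom (Matrix.of M'), fun ⟨x, i⟩ ⟨y, i'⟩ => ?_⟩
  rw [entry_blockHom, entry_blockHom, Matrix.of_apply, hM']

end Ell2

/-! ### Orders of the operators and of their differences -/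

namespace SpinIdx
open Ell2
variable (p : PodlesParam) {a : ℕ}

/-- The scale `q^{l/2}`. -/
noncomputable def scale (x : SpinIdx a) : ℝ := p.q ^ ((x.1.1 : ℝ) / 4)

theorem scale_pos (x : SpinIdx a) : 0 < scale p x := p.q_rpow_pos _

theorem nonneg (x : SpinIdx a) : 0 ≤ x.1.1 := (Int.natCast_nonneg a).trans x.2.1

theorem scale_le_one (x : SpinIdx a) : scale p x ≤ 1 := by
  refine Real.rpow_le_one p.q_pos.le p.q_lt_one.le ?_
  have : (0 : ℝ) ≤ x.1.1 := by exact_mod_cast x.nonneg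
  positivity

theorem scale_zpow (x : SpinIdx a) (k : ℤ) : scale p x ^ k = p.q ^ ((x.1.1 : ℝ) / 4 * k) :=
  (Real.rpow_mul_intCast p.q_pos.le _ _).symm

/-- Since |2l| + |2m| ≤ 4l, the scale is dominated by a product of two geometric sequences with
ratio q^{1/8} in the doubled indices. -/
theorem summable_scale : Summable (scale p (a := a)) := by
  have hq := p.q_pos
  set t := p.q ^ (1 / 8 : ℝ) with ht
  have t0 : 0 < t := p.q_rpow_pos _
  have t1 : t < 1 := p.q_rpow_lt_one (by norm_num)
  have h1 : Summable fun k : ℤ => t ^ k.natAbs := by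
    refine Summable.of_nat_of_neg ?_ ?_ <;>
    simpa using summable_geometric_of_lt_one t0.le t1
  have h2 := h1.mul_of_nonneg h1 (fun _ => by positivity) (fun _ => by positivity)
  refine Summable.of_nonneg_of_le (fun x => (scale_pos p x).le) (fun x => ?_)
    (h2.comp_injective (i := fun x : SpinIdx a => x.1) Subtype.val_injective)
  change p.q ^ ((x.1.1 : ℝ) / 4) ≤ t ^ x.1.1.natAbs * t ^ x.1.2.natAbs
  rw [← pow_add, ht, ← Real.rpow_mul_natCast hq.le]
  refine Real.rpow_le_rpow_of_exponent_ge hq p.q_lt_one.le ?_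
  have h0 := abs_le.1 x.2.2.2.1
  have h1 := x.nonneg
  have h2 : (x.1.1.natAbs : ℤ) + x.1.2.natAbs ≤ 2 * x.1.1 := by omega
  have h3 : ((x.1.1.natAbs : ℤ) : ℝ) + ((x.1.2.natAbs : ℤ) : ℝ) ≤ 2 * x.1.1 := by exact_mod_cast h2
  rw [Int.cast_natCast, Int.cast_natCast] at h3
  push_cast
  linarith

theorem entry_shiftOp {d e : ℤ} {c : ℤ → ℤ → ℝ} {C : ℝ}
    (hc : ∀ L M, SpinValid a L M → SpinValid a (L + d) (M + e) → |c L M| ≤ C)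
    (hC : 0 ≤ C) (x y : SpinIdx a) : entry (shiftOp a d e c) x y =
      if y.1.1 = x.1.1 + d ∧ y.1.2 = x.1.2 + e then (c x.1.1 x.1.2 : ℂ) else 0 := by
  rw [entry, ← ket_eq, shiftOp_ket hc hC y.2, lp.coeFn_smul, Pi.smul_apply, ket_apply]
  by_cases h : y.1.1 = x.1.1 + d ∧ y.1.2 = x.1.2 + e
  · rw [if_pos h, if_pos ⟨by omega, by omega⟩, h.1, h.2]
    simp
  · rw [if_neg h, if_neg (by omega), smul_zero]

/-- Source and target of a weighted shift differ by a fixed amount in l, so conjugating with powers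
of the scale costs only a constant factor. The order is therefore the decay of the coefficients
themselves. -/
theorem hasDecay_shiftOp {d e k : ℤ} {c : ℤ → ℤ → ℝ} {C : ℝ}
    (hc : ∀ L M, SpinValid a L M → SpinValid a (L + d) (M + e) →
      |c L M| ≤ C * p.q ^ (((L + d : ℤ) : ℝ) / 4 * k))
    (hk : 0 ≤ k) (hC : 0 ≤ C) : HasDecay (scale p) k (shiftOp a d e c) := by
  have hq := p.q_pos
  have hc1 : ∀ L M, SpinValid a L M → SpinValid a (L + d) (M + e) → |c L M| ≤ C := by
    intro L M h h'
    refine (hc L M h h').trans (mul_le_of_le_one_right hC ?_)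
    refine Real.rpow_le_one hq.le p.q_lt_one.le ?_
    have h1 : (0 : ℝ) ≤ ((L + d : ℤ) : ℝ) := by exact_mod_cast (Int.natCast_nonneg a).trans h'.1
    have h2 : (0 : ℝ) ≤ k := by exact_mod_cast hk
    positivity
  intro j
  refine ⟨shiftOp a d e fun L M => p.q ^ ((L : ℝ) / 4 * (-j : ℤ)) *
    p.q ^ (((L + d : ℤ) : ℝ) / 4 * (j - k : ℤ)) * c L M, fun x y => ?_⟩
  rw [entry_shiftOp hc1 hC, entry_shiftOp (C := C * p.q ^ ((d : ℝ) / 4 * j))]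
  · split_ifs with h
    · rw [← Complex.ofReal_zpow, ← Complex.ofReal_zpow, scale_zpow, scale_zpow, h.1]
      push_cast
      rfl
    · rw [mul_zero]
  · intro L M h h'
    have q1 := p.q_rpow_pos ((L : ℝ) / 4 * (-j : ℤ))
    have q2 := p.q_rpow_pos (((L + d : ℤ) : ℝ) / 4 * (j - k : ℤ))
    rw [abs_mul, abs_mul, abs_of_pos q1, abs_of_pos q2]
    calc _ ≤ p.q ^ ((L : ℝ) / 4 * (-j : ℤ)) * p.q ^ (((L + d : ℤ) : ℝ) / 4 * (j - k : ℤ)) *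
          (C * p.q ^ (((L + d : ℤ) : ℝ) / 4 * k)) :=
          mul_le_mul_of_nonneg_left (hc L M h h') (by positivity)
      _ = C * (p.q ^ ((L : ℝ) / 4 * (-j : ℤ)) * p.q ^ (((L + d : ℤ) : ℝ) / 4 * (j - k : ℤ)) *
          p.q ^ (((L + d : ℤ) : ℝ) / 4 * k)) := by ring
      _ ≤ _ := by
          rw [← Real.rpow_add hq, ← Real.rpow_add hq]
          refine le_of_eq ?_
          congr 2
          push_cast
          ring
  · have := p.q_rpow_pos ((d : ℝ) / 4 * j)
    positivity

end SpinIdx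

namespace SpinIdx
open Ell2
variable {p : PodlesParam} {N : ℝ} {a : ℕ} (ha : 1 ≤ a) (hN : |N| = a / 2)

theorem _root_.SpinValid.shift_eq {L M d e : ℤ} {l m : ℝ} (hl : l = ((L + d : ℤ) : ℝ) / 2)
    (hm : m = ((M + e : ℤ) : ℝ) / 2) (h : SpinValid a (L + d) (M + e)) :
    |m| ≤ l ∧ (l - m = 0 ∨ 1 ≤ l - m) := by
  obtain ⟨-, -, h3, k, hk⟩ := h
  have h3' := abs_le.1 h3
  constructor
  · have : |((M + e : ℤ) : ℝ)| ≤ ((L + d : ℤ) : ℝ) := by exact_mod_cast h3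
    rw [hl, hm, abs_div, abs_of_pos (zero_lt_two (α := ℝ))]
    linarith
  · have e1 : l - m = k := by
      rw [hl, hm]
      have : (((L + d) - (M + e) : ℤ) : ℝ) = ((2 * k : ℤ) : ℝ) := by exact_mod_cast hk
      push_cast at this ⊢
      linarith
    rw [e1]
    rcases (show k = 0 ∨ 1 ≤ k by omega) with h | h
    · exact Or.inl (by exact_mod_cast h)
    · exact Or.inr (by exact_mod_cast h)

theorem shiftOp_sub {d e : ℤ} {c c' : ℤ → ℤ → ℝ} {C : ℝ}
    (hc : ∀ L M, SpinValid a L M → SpinValid a (L + d) (M + e) → |c L M| ≤ C)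
    (hc' : ∀ L M, SpinValid a L M → SpinValid a (L + d) (M + e) → |c' L M| ≤ C)
    (hC : 0 ≤ C) : shiftOp a d e c - shiftOp a d e c' = shiftOp a d e fun L M => c L M - c' L M := by
  refine ext_entry fun x y => ?_
  rw [entry_sub, entry_shiftOp hc hC, entry_shiftOp hc' hC, entry_shiftOp (C := C + C)]
  · split_ifs <;> simp
  · intro L M h h'
    exact (abs_sub _ _).trans (add_le_add (hc L M h h') (hc' L M h h'))
  · exact add_nonneg hC hC

include ha hN

theorem coef_le {L M : ℤ} (h : SpinValid a L M) {l m : ℝ} (hl : l = L / 2) (hm : m = M / 2) :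
    |p.cBp N l m| ≤ 3 ∧ |p.cB0 N l m| ≤ 3 ∧ |p.cBm N l m| ≤ 3 ∧ |p.cAp N l m| ≤ 3 ∧
      |p.cA0 N l m| ≤ 3 ∧ |p.cAp N (l - 1) m| ≤ 3 := by
  obtain ⟨h0, i, j, hi, hj⟩ := h.range ha hN
  rw [← hl] at h0
  rw [← hl, ← hm] at hi hj
  obtain ⟨a1, a2, a3, -⟩ := p.row_sq_le h0 hi hj
  obtain ⟨b1, b2, b3⟩ := p.col_sq_le h0 hi hj
  exact ⟨abs_le_three b1, abs_le_three b2, abs_le_three b3, abs_le_three a2, abs_le_three a1,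
    abs_le_three a3⟩

theorem hasDecay_opX : HasDecay (scale p) 0 (opX p N a) := by
  refine HasDecay.add (HasDecay.add ?_ ?_) ?_ <;>
  refine hasDecay_shiftOp p (C := 3) (fun L M _ h => ?_) le_rfl (by norm_num) <;>
  rw [Int.cast_zero, mul_zero, Real.rpow_zero, mul_one]
  · exact (coef_le ha hN h (by push_cast; ring) (by push_cast; ring)).1
  · exact (coef_le ha hN h (by push_cast; ring) (by push_cast; ring)).2.1
  · exact (coef_le ha hN h (by push_cast; ring) (by push_cast; ring)).2.2.1

theorem hasDecay_opZ : HasDecay (scale p) 0 (opZ p N a) := by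
  refine HasDecay.add (HasDecay.add ?_ ?_) ?_ <;>
  refine hasDecay_shiftOp p (C := 3) (fun L M h' h => ?_) le_rfl (by norm_num) <;>
  rw [Int.cast_zero, mul_zero, Real.rpow_zero, mul_one]
  · exact (coef_le ha hN h (by push_cast; ring) (by push_cast; ring)).2.2.2.1
  · exact (coef_le ha hN h (by push_cast; ring) (by push_cast; ring)).2.2.2.2.1
  · exact (coef_le ha hN h' rfl rfl).2.2.2.1

theorem hasDecay_opY : HasDecay (scale p) 0 (opY p N a) := by
  rw [← adjoint_opX ha hN]
  exact (hasDecay_opX ha hN).adjoint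

/-- The coefficients differ by O(q^l), and q^l is the square of the scale; hence order 2. -/
theorem hasDecay_opX_sub : HasDecay (scale p) 2 (opX p N a - opX p (-N) a) := by
  have hN' : |-N| = a / 2 := by rwa [abs_neg]
  obtain ⟨C, hC, hd⟩ := p.exists_coef_sub_le N
  have e : opX p N a - opX p (-N) a =
      shiftOp a (-2) (-2) (fun L M => p.cBp N (L / 2 - 1) (M / 2 - 1) -
        p.cBp (-N) (L / 2 - 1) (M / 2 - 1)) +
      shiftOp a 0 (-2) (fun L M => p.cB0 N (L / 2) (M / 2 - 1) - p.cB0 (-N) (L / 2) (M / 2 - 1)) +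
      shiftOp a 2 (-2) (fun L M => p.cBm N (L / 2 + 1) (M / 2 - 1) -
        p.cBm (-N) (L / 2 + 1) (M / 2 - 1)) := by
    rw [← shiftOp_sub (C := 3) _ _ (by norm_num), ← shiftOp_sub (C := 3) _ _ (by norm_num),
      ← shiftOp_sub (C := 3) _ _ (by norm_num), opX, opX]
    · abel
    · exact fun L M _ h => (coef_le ha hN h (by push_cast; ring) (by push_cast; ring)).2.2.1
    · exact fun L M _ h => (coef_le ha hN' h (by push_cast; ring) (by push_cast; ring)).2.2.1
    · exact fun L M _ h => (coef_le ha hN h (by push_cast; ring) (by push_cast; ring)).2.1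
    · exact fun L M _ h => (coef_le ha hN' h (by push_cast; ring) (by push_cast; ring)).2.1
    · exact fun L M _ h => (coef_le ha hN h (by push_cast; ring) (by push_cast; ring)).1
    · exact fun L M _ h => (coef_le ha hN' h (by push_cast; ring) (by push_cast; ring)).1
  rw [e]
  refine HasDecay.add (HasDecay.add ?_ ?_) ?_ <;>
  refine hasDecay_shiftOp p (C := C) (fun L M _ h => ?_) (by norm_num) hC
  · obtain ⟨h1, h2⟩ := h.shift_eq (l := L / 2 - 1) (m := M / 2 - 1) (by push_cast; ring)
      (by push_cast; ring)
    convert (hd _ _ (by convert (h.range ha hN).1 using 1; push_cast; ring) h1).1 using 3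
    push_cast
    ring
  · obtain ⟨h1, h2⟩ := h.shift_eq (l := L / 2) (m := M / 2 - 1) (by push_cast; ring)
      (by push_cast; ring)
    convert (hd _ _ (by convert (h.range ha hN).1 using 1; push_cast; ring) h1).2.1 using 3
    push_cast
    ring
  · obtain ⟨h1, h2⟩ := h.shift_eq (l := L / 2 + 1) (m := M / 2 - 1) (by push_cast; ring)
      (by push_cast; ring)
    convert (hd _ _ (by convert (h.range ha hN).1 using 1; push_cast; ring) h1).2.2.1 h2 using 3
    push_cast
    ring

theorem hasDecay_opZ_sub : HasDecay (scale p) 2 (opZ p N a - opZ p (-N) a) := by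
  have hN' : |-N| = a / 2 := by rwa [abs_neg]
  obtain ⟨C, hC, hd⟩ := p.exists_coef_sub_le N
  have e : opZ p N a - opZ p (-N) a =
      shiftOp a (-2) 0 (fun L M => p.cAp N (L / 2 - 1) (M / 2) - p.cAp (-N) (L / 2 - 1) (M / 2)) +
      shiftOp a 0 0 (fun L M => p.cA0 N (L / 2) (M / 2) - p.cA0 (-N) (L / 2) (M / 2)) +
      shiftOp a 2 0 (fun L M => p.cAp N (L / 2) (M / 2) - p.cAp (-N) (L / 2) (M / 2)) := by
    rw [← shiftOp_sub (C := 3) _ _ (by norm_num), ← shiftOp_sub (C := 3) _ _ (by norm_num),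
      ← shiftOp_sub (C := 3) _ _ (by norm_num), opZ, opZ]
    · abel
    · exact fun L M h _ => (coef_le ha hN h rfl rfl).2.2.2.1
    · exact fun L M h _ => (coef_le ha hN' h rfl rfl).2.2.2.1
    · exact fun L M _ h => (coef_le ha hN h (by push_cast; ring) (by push_cast; ring)).2.2.2.2.1
    · exact fun L M _ h => (coef_le ha hN' h (by push_cast; ring) (by push_cast; ring)).2.2.2.2.1
    · exact fun L M _ h => (coef_le ha hN h (by push_cast; ring) (by push_cast; ring)).2.2.2.1
    · exact fun L M _ h => (coef_le ha hN' h (by push_cast; ring) (by push_cast; ring)).2.2.2.1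
  rw [e]
  refine HasDecay.add (HasDecay.add ?_ ?_) ?_
  · refine hasDecay_shiftOp p (C := C) (fun L M _ h => ?_) (by norm_num) hC
    obtain ⟨h1, h2⟩ := h.shift_eq (l := L / 2 - 1) (m := M / 2) (by push_cast; ring)
      (by push_cast; ring)
    convert (hd _ _ (by convert (h.range ha hN).1 using 1; push_cast; ring) h1).2.2.2.1 using 3
    push_cast
    ring
  · refine hasDecay_shiftOp p (C := C) (fun L M _ h => ?_) (by norm_num) hC
    obtain ⟨h1, h2⟩ := h.shift_eq (l := L / 2) (m := M / 2) (by push_cast; ring)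
      (by push_cast; ring)
    convert (hd _ _ (by convert (h.range ha hN).1 using 1; push_cast; ring) h1).2.2.2.2 using 3
    push_cast
    ring
  -- For this term the estimate is available at the target l, while decay is measured at the source
  -- l + 1. The discrepancy is the factor q⁻¹.
  · refine hasDecay_shiftOp p (C := C * p.q⁻¹) (fun L M h _ => ?_) (by norm_num)
      (mul_nonneg hC (inv_nonneg.2 p.q_pos.le))
    obtain ⟨h1, h2⟩ := (show SpinValid a (L + 0) (M + 0) by simpa using h).shift_eq (l := L / 2)
      (m := M / 2) (by push_cast; ring) (by push_cast; ring)
    convert (hd _ _ (h.range ha hN).1 h1).2.2.2.1 using 1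
    rw [mul_assoc, ← Real.rpow_neg_one, ← Real.rpow_add p.q_pos]
    congr 2
    push_cast
    ring

theorem hasDecay_opY_sub : HasDecay (scale p) 2 (opY p N a - opY p (-N) a) := by
  have hN' : |-N| = a / 2 := by rwa [abs_neg]
  rw [← adjoint_opX ha hN, ← adjoint_opX ha hN', ← map_sub]
  exact (hasDecay_opX_sub ha hN).adjoint

end SpinIdx

/-! ### The difference D of the two representations and the Chern operator -/

namespace Podles
open Ell2 SpinIdx

variable (p : PodlesParam) {n : ℤ} (hn : n ≠ 0)

theorem hasDecay_compRep (b : Bool) (x : Podles p) : HasDecay (scale p) 0 (compRep p hn b x) := by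
  have h1 : HasDecay (scale p) 0 (1 : Ell2 (SpinIdx n.natAbs) →L[ℂ] _) := .one (scale_pos p)
  induction x using Podles.induction with
  | hs c =>
    rw [AlgHom.commutes, Algebra.algebraMap_eq_smul_one]
    exact h1.smul c
  | hA =>
    rw [compRep, levelRep_A]
    exact ((h1.smul _).sub (hasDecay_opZ (one_le_natAbs hn) (abs_label n b))).smul _
  | hB =>
    rw [compRep, levelRep_B]
    exact (hasDecay_opX (one_le_natAbs hn) (abs_label n b)).smul _
  | hBs =>
    rw [compRep, levelRep_Bs]
    exact (hasDecay_opY (one_le_natAbs hn) (abs_label n b)).smul _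
  | hadd x y hx hy =>
    rw [map_add]
    exact hx.add hy
  | hmul x y hx hy =>
    rw [map_mul]
    simpa using HasDecay.mul (scale_pos p) hx hy

/-- The difference of the representations on `ℋ_{-N}` and `ℋ_N`. -/
noncomputable def diffRep :
    Podles p →ₗ[ℂ] (Ell2 (SpinIdx n.natAbs) →L[ℂ] Ell2 (SpinIdx n.natAbs)) :=
  (compRep p hn true).toLinearMap - (compRep p hn false).toLinearMap

theorem diffRep_apply (x : Podles p) : diffRep p hn x = compRep p hn true x - compRep p hn false x := rfl

/-- The Leibniz rule of a difference of homomorphisms, with π_{-N} acting on the right and π_N on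
the left. This asymmetry recurs in the cocycle identity. -/
theorem diffRep_mul (x y : Podles p) : diffRep p hn (x * y) =
    diffRep p hn x * compRep p hn true y + compRep p hn false x * diffRep p hn y := by
  simp only [diffRep_apply, map_mul, sub_mul, mul_sub]
  abel

theorem diffRep_algebraMap (c : ℂ) : diffRep p hn (algebraMap ℂ _ c) = 0 := by
  rw [diffRep_apply, AlgHom.commutes, AlgHom.commutes, sub_self]

theorem diffRep_one : diffRep p hn 1 = 0 := by
  rw [diffRep_apply, map_one, map_one, sub_self]

theorem label_false (n : ℤ) : label n false = -label n true := (neg_neg _).symm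

theorem diffRep_A : diffRep p hn (A p) = (-(1 + p.q ^ 2 : ℂ)⁻¹) •
    (opZ p (label n true) n.natAbs - opZ p (-label n true) n.natAbs) := by
  rw [diffRep_apply, compRep, compRep, levelRep_A, levelRep_A, label_false]
  module

/-- The generators were estimated above. The Leibniz rule carries order 2 to products, because the
representations themselves have order 0. -/
theorem hasDecay_diffRep (x : Podles p) : HasDecay (scale p) 2 (diffRep p hn x) := by
  have ha := one_le_natAbs hn
  have hN := abs_label n true
  induction x using Podles.induction with
  | hs c =>
    rw [diffRep_algebraMap]
    exact .zero
  | hA =>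
    rw [diffRep_A]
    exact (hasDecay_opZ_sub ha hN).smul _
  | hB =>
    rw [diffRep_apply, compRep, compRep, levelRep_B, levelRep_B, label_false, ← smul_sub]
    exact (hasDecay_opX_sub ha hN).smul _
  | hBs =>
    rw [diffRep_apply, compRep, compRep, levelRep_Bs, levelRep_Bs, label_false, ← smul_sub]
    exact (hasDecay_opY_sub ha hN).smul _
  | hadd x y hx hy =>
    rw [map_add]
    exact hx.add hy
  | hmul x y hx hy =>
    rw [diffRep_mul]
    exact .add (by simpa using HasDecay.mul (scale_pos p) hx (hasDecay_compRep p hn true y))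
      (by simpa using HasDecay.mul (scale_pos p) (hasDecay_compRep p hn false x) hy)

/-- The linear extension of `a₀ ⊗ a₁ ⊗ a₂ ↦ D(a₀) D(a₁) D(a₂)`, where `D` is the difference of the
representations on `ℋ_{-N}` and `ℋ_N`. -/
noncomputable def diffTriple :
    HochChain (Podles p) 2 →ₗ[ℂ] (Ell2 (SpinIdx n.natAbs) →L[ℂ] Ell2 (SpinIdx n.natAbs)) :=
  PiTensorProduct.lift ((MultilinearMap.mkPiAlgebraFin ℂ 3 _).compLinearMap (fun _ => diffRep p hn))

theorem diffTriple_tprod (v : Fin 3 → Podles p) : diffTriple p hn (PiTensorProduct.tprod ℂ v) =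
    diffRep p hn (v 0) * diffRep p hn (v 1) * diffRep p hn (v 2) := by
  rw [diffTriple, PiTensorProduct.lift.tprod, MultilinearMap.compLinearMap_apply,
    MultilinearMap.mkPiAlgebraFin_apply]
  simp [List.ofFn_succ, mul_assoc]

theorem hasDecay_diffTriple (ω : HochChain (Podles p) 2) :
    HasDecay (scale p) 6 (diffTriple p hn ω) := by
  induction ω using PiTensorProduct.induction_on with
  | smul_tprod r v =>
    rw [map_smul, diffTriple_tprod]
    exact (HasDecay.mul (scale_pos p) (HasDecay.mul (scale_pos p) (hasDecay_diffRep p hn _)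
      (hasDecay_diffRep p hn _)) (hasDecay_diffRep p hn _)).smul r
  | add x y hx hy =>
    rw [map_add]
    exact hx.add hy

theorem spinF_eq (n : ℤ) : spinF n = blockHom (Matrix.of fun b c : Bool =>
    if b = c then 0 else 1) := by
  refine ext_entry fun ⟨x, b⟩ ⟨y, c⟩ => ?_
  rw [entry_blockHom, entry, spinF_apply, lp.single_apply, Pi.single_apply, Matrix.of_apply]
  cases b <;> cases c <;> simp

theorem spinGamma_eq (n : ℤ) : spinGamma n = blockHom (Matrix.diagonal fun b : Bool =>
    if b then 1 else -1) := by
  refine ext_entry fun ⟨x, b⟩ ⟨y, c⟩ => ?_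
  rw [entry_blockHom, entry, spinGamma_apply, lp.single_apply, Pi.single_apply]
  cases b <;> cases c <;> simp [Matrix.diagonal, apply_ite]

/-- F only exchanges the two components and a representation is block diagonal, so the commutator is
off-diagonal with entries ∓D. -/
theorem commF_spinRep (x : Podles p) : commF n (spinRep p hn x) = blockHom (Matrix.of fun b c : Bool =>
    if b = c then 0 else if b then -diffRep p hn x else diffRep p hn x) := by
  change spinF n * spinRep p hn x - spinRep p hn x * spinF n = _
  rw [spinF_eq, spinRep_apply, ← map_mul, ← map_mul, ← map_sub]
  congr 1
  ext b c : 2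
  rw [Matrix.sub_apply, Matrix.mul_diagonal, Matrix.diagonal_mul]
  cases b <;> cases c <;> simp [diffRep_apply]

/-- F and three commutators exchange the components an even number of times, so the result is block
diagonal. The sign of γ offsets the alternating sign of the commutators, and both blocks equal -D D
D. -/
theorem chernOp_spinRep (ω : HochChain (Podles p) 2) : chernOp p n (spinRep p hn) 2 ω =
    blockHom (Matrix.diagonal fun _ : Bool => -diffTriple p hn ω) := by
  induction ω using PiTensorProduct.induction_on with
  | smul_tprod r v =>
    rw [map_smul, map_smul, ← smul_neg, diffTriple_tprod]
    have e : (Matrix.diagonal fun _ : Bool => r • -(diffRep p hn (v 0) * diffRep p hn (v 1) *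
        diffRep p hn (v 2))) = r • Matrix.diagonal fun _ : Bool => -(diffRep p hn (v 0) *
        diffRep p hn (v 1) * diffRep p hn (v 2)) := by
      rw [← Matrix.diagonal_smul]
      rfl
    rw [e, map_smul]
    congr 1
    rw [chernOp, LinearMap.comp_apply, PiTensorProduct.lift.tprod, MultilinearMap.compLinearMap_apply,
      MultilinearMap.mkPiAlgebraFin_apply]
    simp only [List.ofFn_succ, List.ofFn_zero, List.prod_cons, List.prod_nil, mul_one,
      LinearMap.mulLeft_apply, LinearMap.comp_apply, AlgHom.toLinearMap_apply, commF_spinRep,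
      spinF_eq, spinGamma_eq, ← map_mul]
    congr 1
    ext b c : 2
    cases b <;> cases c <;>
      simp [Matrix.mul_apply, Matrix.diagonal, mul_assoc]
  | add x y hx hy =>
    rw [map_add, map_add, hx, hy, ← map_add, Matrix.diagonal_add]
    simp only [neg_add]

end Podles

/-! ### The trace weighted by K⁻² -/

namespace Ell2
variable {ι : Type*} [DecidableEq ι] {δ : ι → ℝ} {k : ℤ} {T : Ell2 ι →L[ℂ] Ell2 ι}

theorem weightedComp_id_apply {c : ι → ℂ} {C : ℝ} (hc : ∀ x, ‖c x‖ ≤ C) (v : Ell2 ι) (x : ι) :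
    weightedComp id c v x = c x * v x :=
  weightedComp_apply (Set.injOn_id _) C hc v x

theorem HasDecay.exists_weighted_bounded (hδ : ∀ x, 0 < δ x) (hT : HasDecay δ k T) (w : ι → ℂ)
    (hw : ∀ x, ‖w x‖ ≤ δ x ^ (-k)) :
    ∃ S : Ell2 ι →L[ℂ] Ell2 ι, ∀ x y, entry S x y = w x * entry T x y := by
  obtain ⟨T', hT'⟩ := hT k
  have hb : ∀ x, ‖w x * (δ x : ℂ) ^ k‖ ≤ 1 := by
    intro x
    have hx := hδ x
    rw [norm_mul, norm_zpow, Complex.norm_real, Real.norm_of_nonneg hx.le]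
    calc _ ≤ δ x ^ (-k) * δ x ^ k := by
          gcongr
          exact hw x
      _ = 1 := by rw [← zpow_add₀ hx.ne', neg_add_cancel, zpow_zero]
  refine ⟨weightedComp id (fun x => w x * (δ x : ℂ) ^ k) * T', fun x y => ?_⟩
  change weightedComp id (fun x => w x * (δ x : ℂ) ^ k) (T' _) x = _
  rw [weightedComp_id_apply hb]
  change _ * entry T' x y = _
  have h0 : (δ x : ℂ) ≠ 0 := by exact_mod_cast (hδ x).ne'
  rw [hT', sub_self, zpow_zero, mul_one, zpow_neg]
  field_simp

end Ell2

namespace SpinIdx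
open Ell2
variable (p : PodlesParam) {a : ℕ}

/-- The eigenvalue `q^{-2m}` of `K⁻²`. -/
noncomputable def weight (x : SpinIdx a) : ℂ := p.qc ^ (-x.1.2)

theorem norm_qc_zpow (k : ℤ) : ‖p.qc ^ k‖ = p.q ^ (k : ℝ) := by
  rw [norm_zpow, PodlesParam.qc, Complex.norm_real, Real.norm_of_nonneg p.q_pos.le, Real.rpow_intCast]

/-- m ≤ l gives q^{-2m} ≤ q^{-2l}, the scale to the power -4. With 2 more for summability this
accounts for the order 6 in all statements about K⁻²T. -/
theorem norm_weight_le (x : SpinIdx a) : ‖weight p x‖ ≤ scale p x ^ (-4 : ℤ) := by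
  rw [weight, norm_qc_zpow, scale_zpow]
  refine Real.rpow_le_rpow_of_exponent_ge p.q_pos p.q_lt_one.le ?_
  have : (x.1.2 : ℝ) ≤ x.1.1 := by exact_mod_cast (abs_le.1 x.2.2.2.1).2
  push_cast
  linarith

/-- `Tr(K⁻² T)`. -/
noncomputable def wtr (T : Ell2 (SpinIdx a) →L[ℂ] Ell2 (SpinIdx a)) : ℂ :=
  ∑' x, weight p x * entry T x x

variable {p}
variable {S T : Ell2 (SpinIdx a) →L[ℂ] Ell2 (SpinIdx a)}

theorem exists_weight_mul (hT : HasDecay (scale p) 6 T) :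
    ∃ S : Ell2 (SpinIdx a) →L[ℂ] Ell2 (SpinIdx a), IsL1 S ∧
      ∀ x y, entry S x y = weight p x * entry T x y :=
  hT.exists_weighted (scale_pos p) (scale_le_one p) (summable_scale p) _ (norm_weight_le p) le_rfl

theorem summable_weight_diag (hT : HasDecay (scale p) 6 T) :
    Summable fun x => weight p x * entry T x x := by
  obtain ⟨S, h, hS⟩ := exists_weight_mul hT
  simpa only [hS] using h.summable_diag

theorem wtr_add (hS : HasDecay (scale p) 6 S) (hT : HasDecay (scale p) 6 T) :
    wtr p (S + T) = wtr p S + wtr p T := by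
  simp only [wtr, entry_add, mul_add]
  exact (summable_weight_diag hS).tsum_add (summable_weight_diag hT)

theorem wtr_smul (c : ℂ) : wtr p (c • T) = c * wtr p T := by
  simp only [wtr, entry_smul, ← tsum_mul_left]
  exact tsum_congr fun x => by ring

theorem wtr_neg : wtr p (-T) = -wtr p T := by
  rw [← neg_one_smul ℂ, wtr_smul, neg_one_mul]

theorem wtr_sub (hS : HasDecay (scale p) 6 S) (hT : HasDecay (scale p) 6 T) :
    wtr p (S - T) = wtr p S - wtr p T := by
  rw [sub_eq_add_neg, wtr_add hS hT.neg, wtr_neg, sub_eq_add_neg]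

/-- X' stands for K² X K⁻² and Y' for K⁻² Y, so the claim reads Tr(X Y') = Tr(Y' X). Passing through
coefficients avoids the unbounded operator K⁻²; cyclicity needs one of X, Y' to be absolutely
summable. -/
theorem wtr_mul_comm {X X' Y Y' : Ell2 (SpinIdx a) →L[ℂ] Ell2 (SpinIdx a)}
    (hX : ∀ x y, entry X' x y = p.qc ^ (x.1.2 - y.1.2) * entry X x y)
    (hY : ∀ x y, entry Y' x y = weight p x * entry Y x y) (h : IsL1 X ∨ IsL1 Y') :
    wtr p (X' * Y) = wtr p (Y * X) := by
  have h1 : wtr p (X' * Y) = tr (X * Y') := by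
    refine tsum_congr fun x => ?_
    refine ((hasSum_entry_comp X' Y x x).mul_left _).unique ?_
    have e : (fun z => weight p x * (entry X' x z * entry Y z x)) =
        fun z => entry X x z * entry Y' z x := by
      funext z
      rw [hX, hY, weight, weight, zpow_sub₀ p.qc_ne, zpow_neg, zpow_neg]
      have := p.qc_ne
      field_simp
    rw [e]
    exact hasSum_entry_comp X Y' x x
  have h2 : wtr p (Y * X) = tr (Y' * X) := by
    refine tsum_congr fun x => ?_
    refine ((hasSum_entry_comp Y X x x).mul_left _).unique ?_
    have e : (fun z => weight p x * (entry Y x z * entry X z x)) =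
        fun z => entry Y' x z * entry X z x := by
      funext z
      rw [hY, mul_assoc]
    rw [e]
    exact hasSum_entry_comp Y' X x x
  rw [h1, h2]
  rcases h with h | h
  · exact tr_mul_comm h _
  · exact (tr_mul_comm h _).symm

end SpinIdx

/-! ### The character vanishes on twisted boundaries -/

theorem hochBoundary_two_tprod {A : Type*} [Ring A] [Algebra ℂ A] (κ : A ≃ₐ[ℂ] A) (v : Fin 4 → A) :
    hochBoundary κ 2 (PiTensorProduct.tprod ℂ v) =
      PiTensorProduct.tprod ℂ ![v 0 * v 1, v 2, v 3] - PiTensorProduct.tprod ℂ ![v 0, v 1 * v 2, v 3]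
      + PiTensorProduct.tprod ℂ ![v 0, v 1, v 2 * v 3]
      - PiTensorProduct.tprod ℂ ![κ (v 3) * v 0, v 1, v 2] := by
  have e0 : Fin.contractNth (Fin.castSucc (0 : Fin 3)) (· * ·) v = ![v 0 * v 1, v 2, v 3] := by
    funext k; fin_cases k <;> rfl
  have e1 : Fin.contractNth (Fin.castSucc (1 : Fin 3)) (· * ·) v = ![v 0, v 1 * v 2, v 3] := by
    funext k; fin_cases k <;> rfl
  have e2 : Fin.contractNth (Fin.castSucc (2 : Fin 3)) (· * ·) v = ![v 0, v 1, v 2 * v 3] := by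
    funext k; fin_cases k <;> rfl
  have e3 : (Fin.cons (κ (v (Fin.last 3)) * v 0) (fun k : Fin 2 => v k.succ.castSucc) : Fin 3 → A) =
      ![κ (v 3) * v 0, v 1, v 2] := by
    funext k; fin_cases k <;> rfl
  have f : ∀ j : Fin 3, hochFace j v =
      PiTensorProduct.tprod ℂ (Fin.contractNth j.castSucc (· * ·) v) := fun j => rfl
  have g : hochLastFace κ 2 v = PiTensorProduct.tprod ℂ
      (Fin.cons (κ (v (Fin.last 3)) * v 0) (fun k : Fin 2 => v k.succ.castSucc)) := rfl
  rw [hochBoundary, PiTensorProduct.lift.tprod, add_apply, _root_.sum_apply,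
    Fin.sum_univ_three]
  simp only [smul_apply, f, g, e0, e1, e2, e3]
  norm_num
  module

namespace Podles
open Ell2 SpinIdx

variable (p : PodlesParam) {n : ℤ} (hn : n ≠ 0)

/-- The modular automorphism is implemented by conjugation with K²: x₀, x₁, x₋₁ change 2m by 0, 2,
-2, matching the eigenvalues 1, q², q⁻² of κ, and the rule is multiplicative. -/
theorem entry_compRep_modular (b : Bool) (c : Podles p) (x y : SpinIdx n.natAbs) :
    entry (compRep p hn b (modular p c)) x y =
      p.qc ^ (x.1.2 - y.1.2) * entry (compRep p hn b c) x y := by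
  have ha := one_le_natAbs hn
  have hN := abs_label n b
  have q0 := p.qc_ne
  induction c using Podles.induction generalizing x y with
  | hs c =>
    rw [AlgEquiv.commutes, AlgHom.commutes, Algebra.algebraMap_eq_smul_one, entry_smul, entry_one]
    split_ifs with h
    · rw [h, sub_self, zpow_zero, one_mul]
    · simp
  | hA =>
    have e : modular p (A p) = A p := by
      change actK p (actK p (A p)) = _
      rw [scaleHom_A, scaleHom_A]
    rw [e, compRep, levelRep_A, entry_smul, entry_sub, entry_smul, entry_one,
      entry_opZ ha hN _ _ rfl rfl]
    by_cases h : x.1.2 = y.1.2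
    · rw [h, sub_self, zpow_zero, one_mul]
    · rw [if_neg (by rintro rfl; exact h rfl), if_neg (by tauto), if_neg (by tauto), if_neg (by tauto)]
      simp
  | hB =>
    have e : modular p (B p) = p.qc ^ 2 • B p := by
      change actK p (actK p (B p)) = _
      rw [scaleHom_B, map_smul, scaleHom_B, smul_smul, pow_two]
    rw [e, map_smul, entry_smul, compRep, levelRep_B, entry_smul, entry_opX ha hN _ _ rfl rfl]
    by_cases h : x.1.2 = y.1.2 + 2
    · rw [h, add_sub_cancel_left]
      norm_cast
    · rw [if_neg (by tauto), if_neg (by tauto), if_neg (by tauto)]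
      simp
  | hBs =>
    have e : modular p (Bs p) = p.qc ^ (-2 : ℤ) • Bs p := by
      change actK p (actK p (Bs p)) = _
      rw [scaleHom_Bs, map_smul, scaleHom_Bs, smul_smul, ← pow_two, inv_pow, zpow_neg]
      norm_cast
    rw [e, map_smul, entry_smul, compRep, levelRep_Bs, entry_smul, entry_opY ha hN _ _ rfl rfl]
    by_cases h : x.1.2 = y.1.2 - 2
    · rw [h, sub_sub_cancel_left]
    · rw [if_neg (by tauto), if_neg (by tauto), if_neg (by tauto)]
      simp
  | hadd c d hc hd =>
    rw [map_add, map_add, map_add, entry_add, entry_add, hc, hd, mul_add]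
  | hmul c d hc hd =>
    rw [map_mul, map_mul, map_mul]
    refine (hasSum_entry_comp _ _ x y).unique ?_
    have e : (fun z => entry (compRep p hn b (modular p c)) x z *
        entry (compRep p hn b (modular p d)) z y) = fun z => p.qc ^ (x.1.2 - y.1.2) *
        (entry (compRep p hn b c) x z * entry (compRep p hn b d) z y) := by
      funext z
      rw [hc, hd, zpow_sub₀ q0, zpow_sub₀ q0, zpow_sub₀ q0]
      field_simp
    rw [e]
    exact (hasSum_entry_comp _ _ x y).mul_left _

theorem wtr_compRep_modular_mul (b : Bool) (c : Podles p)
    {Y : Ell2 (SpinIdx n.natAbs) →L[ℂ] Ell2 (SpinIdx n.natAbs)} (hY : HasDecay (scale p) 6 Y) :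
    wtr p (compRep p hn b (modular p c) * Y) = wtr p (Y * compRep p hn b c) := by
  obtain ⟨Y', h, hY'⟩ := exists_weight_mul hY
  exact wtr_mul_comm (entry_compRep_modular p hn b c) hY' (Or.inr h)

/-- The mirror image of the preceding lemma: now D(c) is absolutely summable, and Y has only the
order 4 that makes K⁻²Y bounded. -/
theorem wtr_diffRep_modular_mul (c : Podles p)
    {Y : Ell2 (SpinIdx n.natAbs) →L[ℂ] Ell2 (SpinIdx n.natAbs)} (hY : HasDecay (scale p) 4 Y) :
    wtr p (diffRep p hn (modular p c) * Y) = wtr p (Y * diffRep p hn c) := by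
  obtain ⟨Y', hY'⟩ := hY.exists_weighted_bounded (scale_pos p) (weight p) (norm_weight_le p)
  refine wtr_mul_comm (fun x y => ?_) hY' (Or.inl ((hasDecay_diffRep p hn c).isL1 (scale_pos p)
    (scale_le_one p) (summable_scale p) le_rfl))
  rw [diffRep_apply, diffRep_apply, entry_sub, entry_sub, entry_compRep_modular,
    entry_compRep_modular, mul_sub]

/-- Inserting the Leibniz rule into the boundary, the interior terms cancel in pairs. What survives
is two twisted commutators, one from each end. -/
theorem cocycle_identity {R : Type*} [Ring R] (x y z w m x' y' z' w' m' : R) :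
    ((x - x') * y + x' * (y - y')) * (z - z') * (w - w')
      - (x - x') * ((y - y') * z + y' * (z - z')) * (w - w')
      + (x - x') * (y - y') * ((z - z') * w + z' * (w - w'))
      - ((m - m') * x + m' * (x - x')) * (y - y') * (z - z') =
    (x * (y - y') * (z - z') * (w - w') - (m - m') * (x * (y - y') * (z - z')))
      + ((x - x') * (y - y') * (z - z') * w' - m' * ((x - x') * (y - y') * (z - z'))) := by
  noncomm_ring

theorem diffRep_coboundary (x y z w m : Podles p) :
    diffRep p hn (x * y) * diffRep p hn z * diffRep p hn w
        - diffRep p hn x * diffRep p hn (y * z) * diffRep p hn w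
        + diffRep p hn x * diffRep p hn y * diffRep p hn (z * w)
        - diffRep p hn (m * x) * diffRep p hn y * diffRep p hn z =
      (compRep p hn true x * diffRep p hn y * diffRep p hn z * diffRep p hn w
          - diffRep p hn m * (compRep p hn true x * diffRep p hn y * diffRep p hn z))
        + (diffRep p hn x * diffRep p hn y * diffRep p hn z * compRep p hn false w
          - compRep p hn false m * (diffRep p hn x * diffRep p hn y * diffRep p hn z)) := by
  rw [diffRep_mul, diffRep_mul, diffRep_mul, diffRep_mul]
  rw [diffRep_apply, diffRep_apply, diffRep_apply, diffRep_apply, diffRep_apply]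
  exact cocycle_identity ..

/-- The character vanishes on twisted boundaries. -/
theorem wtr_diffTriple_hochBoundary (ξ : HochChain (Podles p) 3) :
    wtr p (diffTriple p hn (hochBoundary (modular p) 2 ξ)) = 0 := by
  induction ξ using PiTensorProduct.induction_on with
  | smul_tprod r v =>
    rw [map_smul, map_smul, wtr_smul, hochBoundary_two_tprod, map_sub, map_add, map_sub]
    simp only [diffTriple_tprod]
    simp only [Matrix.cons_val]
    obtain ⟨x, hx⟩ : ∃ x, v 0 = x := ⟨_, rfl⟩
    obtain ⟨y, hy⟩ : ∃ y, v 1 = y := ⟨_, rfl⟩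
    obtain ⟨z, hz⟩ : ∃ z, v 2 = z := ⟨_, rfl⟩
    obtain ⟨w, hw⟩ : ∃ w, v 3 = w := ⟨_, rfl⟩
    rw [hx, hy, hz, hw]
    have hD := hasDecay_diffRep p hn
    have hR := hasDecay_compRep p hn
    have mul : ∀ {k k' k''} {S T : Ell2 (SpinIdx n.natAbs) →L[ℂ] Ell2 (SpinIdx n.natAbs)},
        HasDecay (scale p) k S → HasDecay (scale p) k' T → k + k' = k'' →
          HasDecay (scale p) k'' (S * T) := by
      rintro k k' _ S T hS hT rfl
      exact hS.mul (scale_pos p) hT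
    have d1 : HasDecay (scale p) 4 (compRep p hn true x * diffRep p hn y * diffRep p hn z) :=
      mul (mul (hR _ _) (hD _) (zero_add 2)) (hD _) (by norm_num)
    have d2 : HasDecay (scale p) 6 (diffRep p hn x * diffRep p hn y * diffRep p hn z) :=
      mul (mul (hD _) (hD _) rfl) (hD _) (by norm_num)
    have e1 := mul d2 (hR false w) (add_zero 6)
    have e2 := mul (hR false (modular p w)) d2 (zero_add 6)
    have e3 := mul d1 (hD w) (by norm_num : (4 : ℤ) + 2 = 6)
    have e4 := mul (hD (modular p w)) d1 (by norm_num : (2 : ℤ) + 4 = 6)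
    -- Here m = κ(w), so each bracket has weighted trace zero: the first by moving D(w), the second
    -- by moving π_N(w) around.
    rw [diffRep_coboundary, wtr_add (e3.sub e4) (e1.sub e2), wtr_sub e3 e4, wtr_sub e1 e2,
      wtr_compRep_modular_mul p hn _ _ d2, wtr_diffRep_modular_mul p hn _ d1]
    simp
  | add x y hx hy =>
    rw [map_add, map_add, wtr_add (hasDecay_diffTriple p hn _) (hasDecay_diffTriple p hn _), hx, hy,
      add_zero]

theorem exists_isL1_kWeight (ω : HochChain (Podles p) 2) : ∃ S : SpinorSpace n →L[ℂ] SpinorSpace n,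
    IsL1 S ∧ ∀ i j, entry S i j = kWeight p i * entry (chernOp p n (spinRep p hn) 2 ω) i j := by
  have h : HasDecay (fun x : SpinIdx n.natAbs × Bool => scale p x.1) 6
      (chernOp p n (spinRep p hn) 2 ω) := by
    rw [chernOp_spinRep]
    refine HasDecay.blockHom fun i j => ?_
    rw [Matrix.diagonal_apply]
    split_ifs
    · exact (hasDecay_diffTriple p hn ω).neg
    · exact .zero
  refine h.exists_weighted (fun x => scale_pos p _) (fun x => scale_le_one p _) ?_ _
    (fun x => norm_weight_le p x.1) le_rfl
  exact (summable_scale p).mul_of_nonneg (g := fun _ : Bool => (1 : ℝ)) (Summable.of_finite)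
    (fun x => (scale_pos p x).le) (fun _ => zero_le_one) |>.congr fun x => by rw [mul_one]

theorem exists_isTraceClass (ω : HochChain (Podles p) 2) :
    ∃ S : SpinorSpace n →L[ℂ] SpinorSpace n, IsTraceClass S ∧
      ∀ v i, S v i = kWeight p i * chernOp p n (spinRep p hn) 2 ω v i := by
  obtain ⟨S, h, hS⟩ := exists_isL1_kWeight p hn ω
  refine ⟨S, isTraceClass_of_isL1 h, fun v i => (hasSum_apply S v i).unique ?_⟩
  simpa only [hS, mul_assoc] using (hasSum_apply (chernOp p n (spinRep p hn) 2 ω) v i).mul_left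
    (kWeight p i)

/-- The two components contribute equally, which absorbs the factor ½. -/
theorem chern_spinRep (ω : HochChain (Podles p) 2) :
    chern p n (spinRep p hn) ω = -wtr p (diffTriple p hn ω) := by
  obtain ⟨S, h, hS⟩ := exists_isL1_kWeight p hn ω
  have hs := h.summable_diag
  simp only [hS] at hs
  have e : ∀ i : SpinIdx n.natAbs × Bool,
      kWeight p i * entry (chernOp p n (spinRep p hn) 2 ω) i i =
        -(weight p i.1 * entry (diffTriple p hn ω) i.1 i.1) := by
    rintro ⟨x, b⟩
    rw [chernOp_spinRep, entry_blockHom, Matrix.diagonal_apply_eq, entry_neg, mul_neg]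
    rfl
  change 1 / 2 * ∑' i, kWeight p i * entry (chernOp p n (spinRep p hn) 2 ω) i i = _
  rw [hs.tsum_prod]
  simp only [e, tsum_fintype, Fintype.sum_bool, tsum_neg, wtr, ← two_mul, tsum_mul_left]
  ring

end Podles

/-! ### ω₂ is a twisted cycle -/

section
variable {A : Type*} [Ring A] [Algebra ℂ A]

/-- `x ⊗ y` as a bilinear function. -/
noncomputable def hochTwo : A →ₗ[ℂ] A →ₗ[ℂ] HochChain A 1 :=
  have u0 : ∀ x y v : A, Function.update ![x, y] 0 v = ![v, y] := fun x y v => by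
    funext i; fin_cases i <;> rfl
  have u1 : ∀ x y v : A, Function.update ![x, y] 1 v = ![x, v] := fun x y v => by
    funext i; fin_cases i <;> rfl
  LinearMap.mk₂ ℂ (fun x y => PiTensorProduct.tprod ℂ ![x, y])
    (fun x x' y => by
      simpa only [u0] using (PiTensorProduct.tprod ℂ).map_update_add ![x, y] 0 x x')
    (fun c x y => by
      simpa only [u0] using (PiTensorProduct.tprod ℂ).map_update_smul ![x, y] 0 c x)
    (fun x y y' => by
      simpa only [u1] using (PiTensorProduct.tprod ℂ).map_update_add ![x, y] 1 y y')
    (fun c x y => by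
      simpa only [u1] using (PiTensorProduct.tprod ℂ).map_update_smul ![x, y] 1 c y)

theorem hochBoundary_one_tprod (κ : A ≃ₐ[ℂ] A) (x y z : A) :
    hochBoundary κ 1 (PiTensorProduct.tprod ℂ ![x, y, z]) =
      hochTwo (x * y) z - hochTwo x (y * z) + hochTwo (κ z * x) y := by
  have e0 : Fin.contractNth (Fin.castSucc (0 : Fin 2)) (· * ·) ![x, y, z] = ![x * y, z] := by
    funext k; fin_cases k <;> rfl
  have e1 : Fin.contractNth (Fin.castSucc (1 : Fin 2)) (· * ·) ![x, y, z] = ![x, y * z] := by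
    funext k; fin_cases k <;> rfl
  have e2 : (Fin.cons (κ (![x, y, z] (Fin.last 2)) * ![x, y, z] 0)
      (fun k : Fin 1 => ![x, y, z] k.succ.castSucc) : Fin 2 → A) = ![κ z * x, y] := by
    funext k; fin_cases k <;> rfl
  have f : ∀ j : Fin 2, hochFace j ![x, y, z] =
      PiTensorProduct.tprod ℂ (Fin.contractNth j.castSucc (· * ·) ![x, y, z]) := fun j => rfl
  have g : hochLastFace κ 1 ![x, y, z] = PiTensorProduct.tprod ℂ
      (Fin.cons (κ (![x, y, z] (Fin.last 2)) * ![x, y, z] 0)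
        (fun k : Fin 1 => ![x, y, z] k.succ.castSucc)) := rfl
  rw [hochBoundary, PiTensorProduct.lift.tprod, add_apply, _root_.sum_apply,
    Fin.sum_univ_two]
  simp only [smul_apply, f, g, e0, e1, e2, hochTwo, LinearMap.mk₂_apply]
  norm_num
  module

/-- Here a, b, c, d are the entries of a matrix γ with γ² = 1, and κ acts on it as conjugation by η.
Contracting matrix indices, the boundary of γ ⊗ (1+γ) ⊗ (1-γ) is (γ+1) ⊗ (1-γ) - 0 + (γ-1) ⊗ (1+γ) =
2(γ ⊗ 1 - 1 ⊗ γ), which becomes 2(τ ⊗ 1 - 1 ⊗ τ) with τ the η-trace of γ. This vanishes as τ is a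
scalar. -/
theorem hochBoundary_idempotent (κ : A ≃ₐ[ℂ] A) {q t : ℂ} {a b c d : A} (hq : q ≠ 0)
    (ht : q • a + q⁻¹ • d = t • 1)
    (g00 : a * a = 1 - b * c) (g01 : a * b = -(b * d)) (g10 : c * a = -(d * c))
    (g11 : d * d = 1 - c * b) (ka : κ a = a) (kd : κ d = d) (kb : κ b = q ^ 2 • b)
    (kc : κ c = q⁻¹ ^ 2 • c) :
    hochBoundary κ 1 (
      q • PiTensorProduct.tprod ℂ ![a, 1 + a, 1 - a] + q • PiTensorProduct.tprod ℂ ![a, b, -c]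
      + (q • PiTensorProduct.tprod ℂ ![b, c, 1 - a] + q • PiTensorProduct.tprod ℂ ![b, 1 + d, -c])
      + (q⁻¹ • PiTensorProduct.tprod ℂ ![c, 1 + a, -b] + q⁻¹ • PiTensorProduct.tprod ℂ ![c, b, 1 - d]
      + (q⁻¹ • PiTensorProduct.tprod ℂ ![d, c, -b] + q⁻¹ • PiTensorProduct.tprod ℂ ![d, 1 + d, 1 - d])))
      = 0 := by
  have u1 := congrArg (fun x => hochTwo x (1 : A)) ht
  have u2 := congrArg (fun x => hochTwo (1 : A) x) ht
  simp only [map_add, map_smul, LinearMap.add_apply, LinearMap.smul_apply] at u1 u2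
  simp only [map_add, map_smul, hochBoundary_one_tprod, map_sub, map_neg, map_one, ka, kb, kc, kd]
  simp only [mul_add, mul_sub, add_mul, sub_mul, one_mul, mul_one, mul_neg, neg_mul, smul_mul_assoc,
    g00, g01, g10, g11, map_add, map_sub, map_neg, map_smul, map_zero, LinearMap.add_apply,
    LinearMap.sub_apply, LinearMap.neg_apply, LinearMap.smul_apply, LinearMap.zero_apply]
  -- Both τ ⊗ 1 and 1 ⊗ τ equal t times 1 ⊗ 1.
  linear_combination (norm := skip) (2:ℂ) • u1 - (2:ℂ) • u2
  match_scalars <;> field_simp <;> ring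

end

namespace Podles
variable (p : PodlesParam)

/-- `x ⊗ y ⊗ z`. -/
noncomputable def hochThree (x y z : Podles p) : HochChain (Podles p) 2 :=
  PiTensorProduct.tprod ℂ ![x, y, z]

theorem _root_.PodlesParam.one_add_sc_sq_ne : 1 + p.sc ^ 2 ≠ 0 := by
  have : 0 < 1 + p.s ^ 2 := by positivity
  rw [PodlesParam.sc]
  exact_mod_cast this.ne'

theorem bott_mul_bott : bott p * bott p = bott p := by
  have h0 := p.one_add_sc_sq_ne
  have hq := p.qc_ne
  rw [bott, smul_mul_smul_comm]
  ext i j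
  fin_cases i <;> fin_cases j <;>
    simp [Matrix.mul_apply, Fin.sum_univ_two, Algebra.algebraMap_eq_smul_one, add_mul, mul_add,
      sub_mul, mul_sub, rel_AB, rel_BsA, rel_BBs', rel_BsB'] <;>
    match_scalars <;> field_simp <;> ring

theorem gammaS_mul_gammaS : gammaS p * gammaS p = 1 := by
  have h := bott_mul_bott p
  rw [gammaS]
  simp only [two_smul, sub_mul, mul_sub, add_mul, mul_add, h, one_mul, mul_one]
  abel

theorem gammaS_zero_zero : gammaS p 0 0 =
    (2 * (1 + p.sc ^ 2)⁻¹) • A p + (2 * (1 + p.sc ^ 2)⁻¹ * p.sc ^ 2 - 1) • (1 : Podles p) := by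
  change (2 : ℕ) • ((1 + p.sc ^ 2)⁻¹ • (algebraMap ℂ _ (p.sc ^ 2) + A p)) - 1 = _
  rw [Algebra.algebraMap_eq_smul_one]
  module

theorem gammaS_zero_one : gammaS p 0 1 = (2 * (1 + p.sc ^ 2)⁻¹ * p.qc) • B p := by
  change (2 : ℕ) • ((1 + p.sc ^ 2)⁻¹ • (p.qc • B p)) - 0 = _
  module

theorem gammaS_one_zero : gammaS p 1 0 = (2 * (1 + p.sc ^ 2)⁻¹ * p.qc⁻¹) • Bs p := by
  change (2 : ℕ) • ((1 + p.sc ^ 2)⁻¹ • (p.qc⁻¹ • Bs p)) - 0 = _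
  module

theorem gammaS_one_one : gammaS p 1 1 =
    (-(2 * (1 + p.sc ^ 2)⁻¹ * p.qc ^ 2)) • A p + (2 * (1 + p.sc ^ 2)⁻¹ - 1) • (1 : Podles p) := by
  change (2 : ℕ) • ((1 + p.sc ^ 2)⁻¹ • (1 - p.qc ^ 2 • A p)) - 1 = _
  module

theorem eta_zero : eta p 0 0 = p.qc := rfl
theorem eta_one : eta p 1 1 = p.qc⁻¹ := rfl

theorem modular_A : modular p (A p) = A p := by
  change actK p (actK p (A p)) = _
  rw [scaleHom_A, scaleHom_A]

theorem modular_B : modular p (B p) = p.qc ^ 2 • B p := by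
  change actK p (actK p (B p)) = _
  rw [scaleHom_B, map_smul, scaleHom_B, smul_smul, pow_two]

theorem modular_Bs : modular p (Bs p) = p.qc⁻¹ ^ 2 • Bs p := by
  change actK p (actK p (Bs p)) = _
  rw [scaleHom_Bs, map_smul, scaleHom_Bs, smul_smul, ← pow_two]

/-- κ is conjugation by η on the matrix γ_s. Therefore η passes through the twisted last face, and
cyclic products of entries are κ-invariant. -/
theorem modular_gammaS (i j : Fin 2) : modular p (gammaS p i j) =
    (eta p i i * (eta p j j)⁻¹) • gammaS p i j := by
  have hq := p.qc_ne
  fin_cases i <;> fin_cases j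
  · change modular p (gammaS p 0 0) = (eta p 0 0 * (eta p 0 0)⁻¹) • gammaS p 0 0
    rw [eta_zero, mul_inv_cancel₀ hq, one_smul, gammaS_zero_zero, map_add, map_smul, map_smul,
      map_one, modular_A]
  · change modular p (gammaS p 0 1) = (eta p 0 0 * (eta p 1 1)⁻¹) • gammaS p 0 1
    rw [eta_zero, eta_one, inv_inv, gammaS_zero_one, map_smul, modular_B]
    module
  · change modular p (gammaS p 1 0) = (eta p 1 1 * (eta p 0 0)⁻¹) • gammaS p 1 0
    rw [eta_zero, eta_one, gammaS_one_zero, map_smul, modular_Bs]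
    module
  · change modular p (gammaS p 1 1) = (eta p 1 1 * (eta p 1 1)⁻¹) • gammaS p 1 1
    rw [eta_one, mul_inv_cancel₀ (inv_ne_zero hq), one_smul, gammaS_one_one, map_add, map_smul,
      map_smul, map_one, modular_A]

/-- The generator A cancels: it enters the diagonal of γ_s with coefficients in the ratio 1 : -q²,
and the η-weights are q and q⁻¹. -/
theorem trace_eta_gammaS : ∃ t : ℂ, p.qc • gammaS p 0 0 + p.qc⁻¹ • gammaS p 1 1 = t • 1 := by
  have hq := p.qc_ne
  refine ⟨2 * (1 + p.sc ^ 2)⁻¹ * (p.qc * p.sc ^ 2 + p.qc⁻¹) - p.qc - p.qc⁻¹, ?_⟩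
  rw [gammaS_zero_zero, gammaS_one_one]
  match_scalars <;> field_simp <;> ring

theorem omega₂_eq : omega₂ p = (1 / 8 : ℂ) • ∑ j, ∑ k, ∑ l, eta p j j •
    hochThree p (gammaS p j k) ((1 + gammaS p) k l) ((1 - gammaS p) l j) := by
  refine congrArg (fun x => (1 / 8 : ℂ) • x) (Finset.sum_congr rfl fun i _ => ?_)
  rw [Finset.sum_eq_single i]
  · rfl
  · intro j _ hj
    have : eta p i j = 0 := by
      fin_cases i <;> fin_cases j <;> first | rfl | exact absurd rfl hj
    simp only [this, zero_smul, Finset.sum_const_zero]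
  · simp

/-- Around the cycle j → k → l → j the eigenvalues η_j/η_k, η_k/η_l, η_l/η_j multiply to 1. The
identity matrices in 1 ± γ_s do no harm, being diagonal. -/
theorem omega₂_mem_twistedChains : omega₂ p ∈ twistedChains (modular p) 2 := by
  have h1 : ∀ i j, modular p ((1 + gammaS p) i j) = (eta p i i * (eta p j j)⁻¹) • (1 + gammaS p) i j := by
    intro i j
    rw [Matrix.add_apply, map_add, modular_gammaS, smul_add]
    congr 1
    have := p.qc_ne
    fin_cases i <;> fin_cases j <;> simp [eta, this]
  have h2 : ∀ i j, modular p ((1 - gammaS p) i j) = (eta p i i * (eta p j j)⁻¹) • (1 - gammaS p) i j := by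
    intro i j
    rw [Matrix.sub_apply, map_sub, modular_gammaS, smul_sub]
    congr 1
    have := p.qc_ne
    fin_cases i <;> fin_cases j <;> simp [eta, this]
  have h3 : ∀ i, eta p i i ≠ 0 := by
    have := p.qc_ne
    intro i
    fin_cases i <;> simp [eta, this]
  rw [twistedChains, LinearMap.mem_ker, LinearMap.sub_apply, LinearMap.id_apply, sub_eq_zero,
    omega₂_eq, map_smul]
  simp only [map_sum, map_smul, hochThree, PiTensorProduct.map_tprod]
  congr 1
  refine Finset.sum_congr rfl fun j _ => Finset.sum_congr rfl fun k _ =>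
    Finset.sum_congr rfl fun l _ => ?_
  congr 1
  have e : (fun i => (modular p).toLinearMap (![gammaS p j k, (1 + gammaS p) k l,
      (1 - gammaS p) l j] i)) = fun i => ![eta p j j * (eta p k k)⁻¹, eta p k k * (eta p l l)⁻¹,
      eta p l l * (eta p j j)⁻¹] i • ![gammaS p j k, (1 + gammaS p) k l, (1 - gammaS p) l j] i := by
    funext i
    fin_cases i
    · exact modular_gammaS p j k
    · exact h1 k l
    · exact h2 l j
  rw [e, MultilinearMap.map_smul_univ, Fin.prod_univ_three]
  have := h3 j
  have := h3 k
  have := h3 l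
  simp only [Matrix.cons_val]
  field_simp
  simp

theorem omega₂_eq_sum : omega₂ p = (1 / 8 : ℂ) • (
    p.qc • hochThree p (gammaS p 0 0) (1 + gammaS p 0 0) (1 - gammaS p 0 0)
      + p.qc • hochThree p (gammaS p 0 0) (gammaS p 0 1) (-gammaS p 1 0)
      + (p.qc • hochThree p (gammaS p 0 1) (gammaS p 1 0) (1 - gammaS p 0 0)
        + p.qc • hochThree p (gammaS p 0 1) (1 + gammaS p 1 1) (-gammaS p 1 0))
      + (p.qc⁻¹ • hochThree p (gammaS p 1 0) (1 + gammaS p 0 0) (-gammaS p 0 1)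
        + p.qc⁻¹ • hochThree p (gammaS p 1 0) (gammaS p 0 1) (1 - gammaS p 1 1)
        + (p.qc⁻¹ • hochThree p (gammaS p 1 1) (gammaS p 1 0) (-gammaS p 0 1)
          + p.qc⁻¹ • hochThree p (gammaS p 1 1) (1 + gammaS p 1 1) (1 - gammaS p 1 1)))) := by
  have e1 : (1 : Matrix (Fin 2) (Fin 2) (Podles p)) 0 1 = 0 := rfl
  have e2 : (1 : Matrix (Fin 2) (Fin 2) (Podles p)) 1 0 = 0 := rfl
  have e3 : (1 : Matrix (Fin 2) (Fin 2) (Podles p)) 0 0 = 1 := rfl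
  have e4 : (1 : Matrix (Fin 2) (Fin 2) (Podles p)) 1 1 = 1 := rfl
  rw [omega₂_eq]
  simp only [Fin.sum_univ_two, Matrix.add_apply, Matrix.sub_apply, e1, e2, e3, e4, zero_add, zero_sub,
    eta_zero, eta_one]

theorem hochBoundary_omega₂ : hochBoundary (modular p) 1 (omega₂ p) = 0 := by
  obtain ⟨t, ht⟩ := trace_eta_gammaS p
  have hg := gammaS_mul_gammaS p
  have hq := p.qc_ne
  rw [omega₂_eq_sum, map_smul]
  refine smul_eq_zero_of_right _ (hochBoundary_idempotent (modular p) hq ht ?_ ?_ ?_ ?_ ?_ ?_ ?_ ?_)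
  · have := congrFun (congrFun hg 0) 0
    rw [Matrix.mul_apply, Fin.sum_univ_two, Matrix.one_apply_eq] at this
    exact eq_sub_of_add_eq this
  · have := congrFun (congrFun hg 0) 1
    rw [Matrix.mul_apply, Fin.sum_univ_two, Matrix.one_apply_ne (by decide)] at this
    exact eq_neg_of_add_eq_zero_left this
  · have := congrFun (congrFun hg 1) 0
    rw [Matrix.mul_apply, Fin.sum_univ_two, Matrix.one_apply_ne (by decide)] at this
    exact eq_neg_of_add_eq_zero_left this
  · have := congrFun (congrFun hg 1) 1
    rw [Matrix.mul_apply, Fin.sum_univ_two, Matrix.one_apply_eq] at this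
    exact eq_sub_of_add_eq' this
  · rw [modular_gammaS, eta_zero, mul_inv_cancel₀ hq, one_smul]
  · rw [modular_gammaS, eta_one, mul_inv_cancel₀ (inv_ne_zero hq), one_smul]
  · rw [modular_gammaS, eta_zero, eta_one, inv_inv, pow_two]
  · rw [modular_gammaS, eta_zero, eta_one, pow_two]

end Podles

/-! ### Invariance of ω₂ -/

theorem map_mul_of_map_mul_tmul {U E : Type*} [Ring U] [Algebra ℂ U] [Ring E] [Algebra ℂ E]
    (f : (U ⊗[ℂ] U) ⊗[ℂ] U →ₗ[ℂ] E)
    (hf : ∀ x y z x' y' z' : U, f (((x * x') ⊗ₜ (y * y')) ⊗ₜ (z * z')) =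
      f ((x ⊗ₜ y) ⊗ₜ z) * f ((x' ⊗ₜ y') ⊗ₜ z')) (u v : (U ⊗[ℂ] U) ⊗[ℂ] U) :
    f (u * v) = f u * f v := by
  induction u using TensorProduct.induction_on with
  | zero => rw [zero_mul, map_zero, zero_mul]
  | add a b ha hb => rw [add_mul, map_add, map_add, add_mul, ha, hb]
  | tmul w z =>
    induction w using TensorProduct.induction_on with
    | zero => rw [TensorProduct.zero_tmul, zero_mul, map_zero, zero_mul]
    | add a b ha hb => rw [TensorProduct.add_tmul, add_mul, map_add, map_add, add_mul, ha, hb]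
    | tmul x y =>
      induction v using TensorProduct.induction_on with
      | zero => rw [mul_zero, map_zero, mul_zero]
      | add a b ha hb => rw [mul_add, map_add, map_add, mul_add, ha, hb]
      | tmul w' z' =>
        induction w' using TensorProduct.induction_on with
        | zero => rw [TensorProduct.zero_tmul, mul_zero, map_zero, mul_zero]
        | add a b ha hb => rw [TensorProduct.add_tmul, mul_add, map_add, map_add, mul_add, ha, hb]
        | tmul x' y' =>
          rw [Algebra.TensorProduct.tmul_mul_tmul, Algebra.TensorProduct.tmul_mul_tmul, hf]

theorem algHom_tensor_one {U : Type*} [Ring U] [Algebra ℂ U] (f : U →ₐ[ℂ] (U ⊗[ℂ] U) ⊗[ℂ] U) :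
    f 1 = (1 ⊗ₜ 1) ⊗ₜ 1 :=
  map_one f

theorem algHom_tensor_mul {U : Type*} [Ring U] [Algebra ℂ U] (f : U →ₐ[ℂ] (U ⊗[ℂ] U) ⊗[ℂ] U)
    (x y : U) : f (x * y) = f x * f y :=
  map_mul f x y

namespace Podles
variable (p : PodlesParam)

theorem hochThree_add_left (x x' y z : Podles p) :
    hochThree p (x + x') y z = hochThree p x y z + hochThree p x' y z :=
  (map_vec3 (PiTensorProduct.tprod ℂ) x y z x' 0).1.1

theorem hochThree_smul_left (c : ℂ) (x y z : Podles p) :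
    hochThree p (c • x) y z = c • hochThree p x y z :=
  (map_vec3 (PiTensorProduct.tprod ℂ) x y z 0 c).1.2

theorem hochThree_add_mid (x y y' z : Podles p) :
    hochThree p x (y + y') z = hochThree p x y z + hochThree p x y' z :=
  (map_vec3 (PiTensorProduct.tprod ℂ) x y z y' 0).2.1.1

theorem hochThree_smul_mid (c : ℂ) (x y z : Podles p) :
    hochThree p x (c • y) z = c • hochThree p x y z :=
  (map_vec3 (PiTensorProduct.tprod ℂ) x y z 0 c).2.1.2

theorem hochThree_add_right (x y z z' : Podles p) :
    hochThree p x y (z + z') = hochThree p x y z + hochThree p x y z' :=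
  (map_vec3 (PiTensorProduct.tprod ℂ) x y z z' 0).2.2.1

theorem hochThree_smul_right (c : ℂ) (x y z : Podles p) :
    hochThree p x y (c • z) = c • hochThree p x y z :=
  (map_vec3 (PiTensorProduct.tprod ℂ) x y z 0 c).2.2.2

theorem hoch_ext {f g : Module.End ℂ (HochChain (Podles p) 2)}
    (h : ∀ x y z, f (hochThree p x y z) = g (hochThree p x y z)) : f = g := by
  refine PiTensorProduct.ext (MultilinearMap.ext fun v => ?_)
  have e : v = ![v 0, v 1, v 2] := by funext i; fin_cases i <;> rfl
  rw [e]
  exact h _ _ _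

/-- These formulas show that the span of the entries of γ_s is stable under the generators, with
coefficients free of s. Invariance of ω₂ thereby becomes a linear computation with four symbols. -/
theorem actE_gammaS_zero_zero : actE p (gammaS p 0 0) = (-(p.rc⁻¹ ^ 3)) • gammaS p 0 1 := by
  have := p.rc_ne
  rw [gammaS_zero_zero, gammaS_zero_one, map_add, map_smul, map_smul, actE_one, actE_A, ← p.rc_sq]
  match_scalars
  field_simp

theorem actE_gammaS_zero_one : actE p (gammaS p 0 1) = 0 := by
  rw [gammaS_zero_one, map_smul, actE_B, smul_zero]

theorem actE_gammaS_one_zero :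
    actE p (gammaS p 1 0) = p.rc⁻¹ • gammaS p 0 0 + (-p.rc⁻¹) • gammaS p 1 1 := by
  have := p.rc_ne
  rw [gammaS_one_zero, gammaS_zero_zero, gammaS_one_one, map_smul, actE_Bs, ← p.rc_sq]
  match_scalars <;> field_simp <;> ring

theorem actE_gammaS_one_one : actE p (gammaS p 1 1) = p.rc • gammaS p 0 1 := by
  have := p.rc_ne
  rw [gammaS_one_one, gammaS_zero_one, map_add, map_smul, map_smul, actE_one, actE_A, ← p.rc_sq]
  match_scalars
  field_simp

theorem actF_gammaS_zero_zero : actF p (gammaS p 0 0) = p.rc⁻¹ • gammaS p 1 0 := by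
  have := p.rc_ne
  rw [gammaS_zero_zero, gammaS_one_zero, map_add, map_smul, map_smul, actF_one, actF_A, ← p.rc_sq]
  match_scalars
  field_simp

theorem actF_gammaS_zero_one :
    actF p (gammaS p 0 1) = (-p.rc) • gammaS p 0 0 + p.rc • gammaS p 1 1 := by
  have := p.rc_ne
  rw [gammaS_zero_one, gammaS_zero_zero, gammaS_one_one, map_smul, actF_B, ← p.rc_sq]
  match_scalars <;> field_simp <;> ring

theorem actF_gammaS_one_zero : actF p (gammaS p 1 0) = 0 := by
  rw [gammaS_one_zero, map_smul, actF_Bs, smul_zero]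

theorem actF_gammaS_one_one : actF p (gammaS p 1 1) = (-(p.rc ^ 3)) • gammaS p 1 0 := by
  have := p.rc_ne
  rw [gammaS_one_one, gammaS_one_zero, map_add, map_smul, map_smul, actF_one, actF_A, ← p.rc_sq]
  match_scalars
  field_simp

theorem actK_gammaS (i j : Fin 2) :
    actK p (gammaS p i j) = ((p.qc ^ (j : ℕ)) * (p.qc⁻¹ ^ (i : ℕ))) • gammaS p i j := by
  have := p.qc_ne
  fin_cases i <;> fin_cases j
  · change actK p (gammaS p 0 0) = (p.qc ^ 0 * p.qc⁻¹ ^ 0) • gammaS p 0 0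
    rw [gammaS_zero_zero, map_add, map_smul, map_smul, map_one, scaleHom_A]
    module
  · change actK p (gammaS p 0 1) = (p.qc ^ 1 * p.qc⁻¹ ^ 0) • gammaS p 0 1
    rw [gammaS_zero_one, map_smul, scaleHom_B]
    module
  · change actK p (gammaS p 1 0) = (p.qc ^ 0 * p.qc⁻¹ ^ 1) • gammaS p 1 0
    rw [gammaS_one_zero, map_smul, scaleHom_Bs]
    module
  · change actK p (gammaS p 1 1) = (p.qc ^ 1 * p.qc⁻¹ ^ 1) • gammaS p 1 1
    rw [gammaS_one_one, map_add, map_smul, map_smul, map_one, scaleHom_A]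
    match_scalars <;> field_simp

theorem actKi_gammaS (i j : Fin 2) :
    actKi p (gammaS p i j) = ((p.qc⁻¹ ^ (j : ℕ)) * (p.qc ^ (i : ℕ))) • gammaS p i j := by
  have := p.qc_ne
  have h := congrArg (fun x => ((p.qc⁻¹ ^ (j : ℕ)) * (p.qc ^ (i : ℕ))) • actKi p x) (actK_gammaS p i j)
  simp only [actKi_actK, map_smul, smul_smul] at h
  rw [h]
  have e : p.qc⁻¹ ^ (j : ℕ) * p.qc ^ (i : ℕ) * (p.qc ^ (j : ℕ) * p.qc⁻¹ ^ (i : ℕ)) = 1 := by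
    simp only [inv_pow]
    field_simp
  rw [e, one_smul]

end Podles

namespace Uq
variable (p : PodlesParam)

theorem tensorAct_apply (h h' h'' : Uq p) (x y z : Podles p) :
    tensorAct p ((h ⊗ₜ h') ⊗ₜ h'') (Podles.hochThree p x y z) =
      Podles.hochThree p (act p h x) (act p h' y) (act p h'' z) := by
  change PiTensorProduct.map _ (PiTensorProduct.tprod ℂ ![x, y, z]) = PiTensorProduct.tprod ℂ _
  rw [PiTensorProduct.map_tprod]
  congr 1
  funext i
  fin_cases i <;> rfl

theorem tensorAct_mul (u v : (Uq p ⊗[ℂ] Uq p) ⊗[ℂ] Uq p) :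
    tensorAct p (u * v) = tensorAct p u * tensorAct p v := by
  refine map_mul_of_map_mul_tmul _ (fun x y z x' y' z' => ?_) u v
  refine Podles.hoch_ext p fun a b c => ?_
  rw [Module.End.mul_apply, tensorAct_apply, tensorAct_apply, tensorAct_apply, map_mul,
    map_mul, map_mul]
  rfl

/-- The iterated coproduct `(Δ ⊗ id) Δ`. -/
noncomputable def comulTwo : Uq p →ₐ[ℂ] (Uq p ⊗[ℂ] Uq p) ⊗[ℂ] Uq p :=
  (Algebra.TensorProduct.map (comul p) (AlgHom.id ℂ (Uq p))).comp (comul p)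

theorem actTensor_eq (h : Uq p) : actTensor p h = tensorAct p (comulTwo p h) := rfl

theorem actTensor_mul (h h' : Uq p) :
    actTensor p (h * h') = actTensor p h * actTensor p h' := by
  rw [actTensor_eq, algHom_tensor_mul, tensorAct_mul]
  rfl

theorem actTensor_one : actTensor p 1 = 1 := by
  rw [actTensor_eq, algHom_tensor_one]
  refine Podles.hoch_ext p fun a b c => ?_
  rw [tensorAct_apply, map_one]
  rfl

theorem act_K (x : Podles p) : act p (K p) x = Podles.actK p x := by
  rw [act, lift_K]; rfl
theorem act_Ki (x : Podles p) : act p (Ki p) x = Podles.actKi p x := by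
  rw [act, lift_Ki]; rfl
theorem act_E (x : Podles p) : act p (E p) x = Podles.actE p x := by
  rw [act, lift_E]
theorem act_F (x : Podles p) : act p (F p) x = Podles.actF p x := by
  rw [act, lift_F]

theorem actTensor_K (x y z : Podles p) : actTensor p (K p) (Podles.hochThree p x y z) =
    Podles.hochThree p (Podles.actK p x) (Podles.actK p y) (Podles.actK p z) := by
  have : comulTwo p (K p) = (K p ⊗ₜ K p) ⊗ₜ K p := by
    simp [comulTwo, comul]
  rw [actTensor_eq, this, tensorAct_apply, act_K, act_K, act_K]

theorem actTensor_Ki (x y z : Podles p) : actTensor p (Ki p) (Podles.hochThree p x y z) =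
    Podles.hochThree p (Podles.actKi p x) (Podles.actKi p y) (Podles.actKi p z) := by
  have : comulTwo p (Ki p) = (Ki p ⊗ₜ Ki p) ⊗ₜ Ki p := by
    simp [comulTwo, comul]
  rw [actTensor_eq, this, tensorAct_apply, act_Ki, act_Ki, act_Ki]

theorem actTensor_E (x y z : Podles p) : actTensor p (E p) (Podles.hochThree p x y z) =
    Podles.hochThree p (Podles.actE p x) (Podles.actK p y) (Podles.actK p z)
      + Podles.hochThree p (Podles.actKi p x) (Podles.actE p y) (Podles.actK p z)
      + Podles.hochThree p (Podles.actKi p x) (Podles.actKi p y) (Podles.actE p z) := by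
  have : comulTwo p (E p) = (E p ⊗ₜ K p) ⊗ₜ K p + (Ki p ⊗ₜ E p) ⊗ₜ K p + (Ki p ⊗ₜ Ki p) ⊗ₜ E p := by
    simp [comulTwo, comul, TensorProduct.add_tmul]
  rw [actTensor_eq, this, map_add, map_add, LinearMap.add_apply, LinearMap.add_apply]
  simp only [tensorAct_apply, act_K, act_Ki, act_E]

theorem actTensor_F (x y z : Podles p) : actTensor p (F p) (Podles.hochThree p x y z) =
    Podles.hochThree p (Podles.actF p x) (Podles.actK p y) (Podles.actK p z)
      + Podles.hochThree p (Podles.actKi p x) (Podles.actF p y) (Podles.actK p z)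
      + Podles.hochThree p (Podles.actKi p x) (Podles.actKi p y) (Podles.actF p z) := by
  have : comulTwo p (F p) = (F p ⊗ₜ K p) ⊗ₜ K p + (Ki p ⊗ₜ F p) ⊗ₜ K p + (Ki p ⊗ₜ Ki p) ⊗ₜ F p := by
    simp [comulTwo, comul, TensorProduct.add_tmul]
  rw [actTensor_eq, this, map_add, map_add, LinearMap.add_apply, LinearMap.add_apply]
  simp only [tensorAct_apply, act_K, act_Ki, act_F]

/-- Only the linear action on the entries of γ_s enters, not their products, so the check takes
place among tensors in four unrelated symbols and 1. -/
theorem actTensor_gen_omega₂ (g : UqGen) :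
    actTensor p (gen p g) (Podles.omega₂ p) = counit p (gen p g) • Podles.omega₂ p := by
  have hr := p.rc_ne
  have k00 := Podles.actK_gammaS p 0 0
  have k01 := Podles.actK_gammaS p 0 1
  have k10 := Podles.actK_gammaS p 1 0
  have k11 := Podles.actK_gammaS p 1 1
  have i00 := Podles.actKi_gammaS p 0 0
  have i01 := Podles.actKi_gammaS p 0 1
  have i10 := Podles.actKi_gammaS p 1 0
  have i11 := Podles.actKi_gammaS p 1 1
  have e00 := Podles.actE_gammaS_zero_zero p
  have e01 := Podles.actE_gammaS_zero_one p
  have e10 := Podles.actE_gammaS_one_zero p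
  have e11 := Podles.actE_gammaS_one_one p
  have f00 := Podles.actF_gammaS_zero_zero p
  have f01 := Podles.actF_gammaS_zero_one p
  have f10 := Podles.actF_gammaS_one_zero p
  have f11 := Podles.actF_gammaS_one_one p
  have hz : ∀ y z, Podles.hochThree p 0 y z = 0 := fun y z => by
    simpa using Podles.hochThree_smul_left p 0 0 y z
  have hz' : ∀ y z, Podles.hochThree p y 0 z = 0 := fun y z => by
    simpa using Podles.hochThree_smul_mid p 0 y 0 z
  have hz'' : ∀ y z, Podles.hochThree p y z 0 = 0 := fun y z => by
    simpa using Podles.hochThree_smul_right p 0 y z 0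
  have hs : ∀ x : Podles p, 1 - x = 1 + (-1 : ℂ) • x := fun x => by module
  have hn : ∀ x : Podles p, -x = (-1 : ℂ) • x := fun x => by module
  simp only [Fin.val_zero, Fin.val_one, pow_zero, pow_one, mul_one, one_mul, one_smul] at k00 k01 k10 k11 i00 i01 i10 i11
  rw [Podles.omega₂_eq_sum, hs, hs, hn, hn]
  -- From here on the entries are independent symbols; everything is expanded by trilinearity and
  -- compared.
  generalize Podles.gammaS p 0 0 = a at *
  generalize Podles.gammaS p 0 1 = b at *
  generalize Podles.gammaS p 1 0 = c at *
  generalize Podles.gammaS p 1 1 = d at *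
  have hrq : p.qc = p.rc ^ 2 := p.rc_sq.symm
  cases g
  · have : counit p (gen p .K) = 1 := lift_K ..
    rw [this, one_smul]
    simp only [map_add, map_smul, actTensor_K, map_one, k00, k01, k10, k11]
    simp only [Podles.hochThree_add_left, Podles.hochThree_add_mid, Podles.hochThree_add_right,
      Podles.hochThree_smul_left, Podles.hochThree_smul_mid, Podles.hochThree_smul_right]
    simp only [hrq]
    match_scalars <;> field_simp
  · have : counit p (gen p .Ki) = 1 := lift_Ki ..
    rw [this, one_smul]
    simp only [map_add, map_smul, actTensor_Ki, map_one, i00, i01, i10, i11]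
    simp only [Podles.hochThree_add_left, Podles.hochThree_add_mid, Podles.hochThree_add_right,
      Podles.hochThree_smul_left, Podles.hochThree_smul_mid, Podles.hochThree_smul_right]
    simp only [hrq]
    match_scalars <;> field_simp
  · have : counit p (gen p .E) = 0 := lift_E ..
    rw [this, zero_smul]
    simp only [map_add, map_smul, actTensor_E, map_one, i00, i01, i10, i11, k00, k01, k10, k11,
      e00, e01, e10, e11, Podles.actE_one]
    simp only [Podles.hochThree_add_left, Podles.hochThree_add_mid, Podles.hochThree_add_right,
      Podles.hochThree_smul_left, Podles.hochThree_smul_mid, Podles.hochThree_smul_right, hz, hz',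
      hz'', smul_zero, add_zero, zero_add]
    simp only [hrq]
    match_scalars <;> field_simp <;> ring
  · have : counit p (gen p .F) = 0 := lift_F ..
    rw [this, zero_smul]
    simp only [map_add, map_smul, actTensor_F, map_one, i00, i01, i10, i11, k00, k01, k10, k11,
      f00, f01, f10, f11, Podles.actF_one]
    simp only [Podles.hochThree_add_left, Podles.hochThree_add_mid, Podles.hochThree_add_right,
      Podles.hochThree_smul_left, Podles.hochThree_smul_mid, Podles.hochThree_smul_right, hz, hz',
      hz'', smul_zero, add_zero, zero_add]
    simp only [hrq]
    match_scalars <;> field_simp <;> ring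

/-- The action on tensors and the counit are multiplicative, so the generators suffice. -/
theorem actTensor_omega₂ (h : Uq p) :
    actTensor p h (Podles.omega₂ p) = counit p h • Podles.omega₂ p := by
  obtain ⟨y, rfl⟩ := RingQuot.mkAlgHom_surjective ℂ (UqRel p) h
  induction y using FreeAlgebra.induction with
  | grade0 c =>
    rw [AlgHom.commutes, AlgHom.commutes, Algebra.algebraMap_eq_smul_one, map_smul, actTensor_one]
    simp
  | grade1 g => exact actTensor_gen_omega₂ p g
  | mul a b ha hb =>
    rw [map_mul, actTensor_mul, Module.End.mul_apply, hb, map_smul, ha, map_mul, smul_smul, mul_comm]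
  | add a b ha hb => rw [map_add, map_add, LinearMap.add_apply, ha, hb, map_add, add_smul]

end Uq

/-! ### Pairs of projections with compact difference -/

section
variable {R : Type*} [Ring R] {p q : R}

/-- The algebra of two idempotents: S = 1 - p - q anticommutes with T = p - q, and S² + T² = 1. All
index computations below rest on this. -/
theorem IsIdempotentElem.compl_mul_sub (hp : p * p = p) (hq : q * q = q) :
    (1 - p - q) * (p - q) = -((p - q) * (1 - p - q)) := by
  simp only [sub_mul, mul_sub, one_mul, mul_one, hp, hq]
  abel

theorem IsIdempotentElem.compl_sq_add (hp : p * p = p) (hq : q * q = q) :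
    (1 - p - q) * (1 - p - q) + (p - q) * (p - q) = 1 := by
  simp only [sub_mul, mul_sub, one_mul, mul_one, hp, hq]
  abel

theorem IsIdempotentElem.mul_compl_sq (hp : p * p = p) (hq : q * q = q) :
    p * ((1 - p - q) * (1 - p - q)) = p * q * p := by
  simp only [sub_mul, mul_sub, one_mul, mul_one, hp, hq, ← mul_assoc]
  abel

end

/-- Two orthogonal projections whose difference is compact. -/
structure IsProjPair {X : Type*} [NormedAddCommGroup X] [InnerProductSpace ℂ X] [CompleteSpace X]
    (P Q : X →L[ℂ] X) : Prop where
  mul_self_left : P * P = P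
  mul_self_right : Q * Q = Q
  selfAdjoint_left : IsSelfAdjoint P
  selfAdjoint_right : IsSelfAdjoint Q
  compact : IsCompactOperator (P - Q)

namespace IsProjPair
variable {X : Type*} [NormedAddCommGroup X] [InnerProductSpace ℂ X] [CompleteSpace X]
  {P Q : X →L[ℂ] X}

theorem symm (h : IsProjPair P Q) : IsProjPair Q P :=
  ⟨h.mul_self_right, h.mul_self_left, h.selfAdjoint_right, h.selfAdjoint_left, by
    have := h.compact.neg
    rwa [← FunLike.coe_neg, neg_sub] at this⟩

/-- The fixed vectors of `P - Q`, which are the vectors in `ran P ∩ ker Q`. -/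
def fixed (P Q : X →L[ℂ] X) : Submodule ℂ X := Module.End.eigenspace (P - Q).toLinearMap 1

theorem inner_left (h : IsProjPair P Q) (v : X) : inner ℂ (P v) v = inner ℂ (P v) (P v) := by
  have := h.selfAdjoint_left.isSymmetric (P v) v
  change inner ℂ ((P * P) v) v = inner ℂ (P v) (P v) at this
  rwa [h.mul_self_left] at this

/-- From Pv = v + Qv one gets ‖Pv‖² = ‖v‖² + 3‖Qv‖², whereas pairing Pv - Qv = v with v gives ‖Pv‖²
- ‖Qv‖² = ‖v‖². Hence Qv = 0. -/
theorem mem_fixed (h : IsProjPair P Q) {v : X} : v ∈ fixed P Q ↔ P v = v ∧ Q v = 0 := by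
  rw [fixed, Module.End.mem_eigenspace_iff, one_smul]
  change P v - Q v = v ↔ _
  constructor
  · intro hv
    have h1 := h.inner_left v
    have h2 := h.symm.inner_left v
    have h3 : inner ℂ (P v) v - inner ℂ (Q v) v = inner ℂ v v := by
      rw [← inner_sub_left, hv]
    have h4 : P v = v + Q v := sub_eq_iff_eq_add.1 hv
    have h5 : inner ℂ (P v) (P v) = inner ℂ v v + inner ℂ v (Q v) + inner ℂ (Q v) v +
        inner ℂ (Q v) (Q v) := by
      rw [h4]; simp only [inner_add_left, inner_add_right]; ring
    have h6 : inner ℂ v (Q v) = inner ℂ (Q v) v := (h.selfAdjoint_right.isSymmetric v v).symm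
    have h7 : inner ℂ (Q v) (Q v) = (0 : ℂ) := by
      rw [h6] at h5
      linear_combination (1 / 2 : ℂ) * (h3 - h5 - h1 - h2)
    have h8 : Q v = 0 := inner_self_eq_zero.1 h7
    exact ⟨by rw [h4, h8, add_zero], h8⟩
  · rintro ⟨h1, h2⟩
    rw [h1, h2, sub_zero]

theorem finiteDimensional_fixed (h : IsProjPair P Q) : FiniteDimensional ℂ (fixed P Q) :=
  ContinuousLinearMap.finite_dimensional_eigenspace h.compact 1 one_ne_zero

instance : CompleteSpace (fixed P Q) := by
  have : fixed P Q = LinearMap.ker (P - Q - 1 : X →L[ℂ] X).toLinearMap := by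
    ext v
    rw [fixed, Module.End.mem_eigenspace_iff, one_smul, LinearMap.mem_ker]
    exact sub_eq_zero.symm
  rw [this]
  infer_instance

/-- The orthogonal projection onto the fixed vectors of `P - Q`. -/
noncomputable def proj (P Q : X →L[ℂ] X) : X →L[ℂ] X := (fixed P Q).starProjection

theorem proj_apply_mem (v : X) : proj P Q v ∈ fixed P Q :=
  Submodule.starProjection_apply_mem ..

theorem proj_eq_self {v : X} : proj P Q v = v ↔ v ∈ fixed P Q :=
  Submodule.starProjection_eq_self_iff ..

theorem proj_isSelfAdjoint : IsSelfAdjoint (proj P Q) :=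
  isSelfAdjoint_starProjection _

theorem proj_mul_self : proj P Q * proj P Q = proj P Q :=
  ContinuousLinearMap.ext fun v => proj_eq_self.2 (proj_apply_mem v)

theorem left_mul_proj (h : IsProjPair P Q) : P * proj P Q = proj P Q :=
  ContinuousLinearMap.ext fun v => (h.mem_fixed.1 (proj_apply_mem v)).1

theorem right_mul_proj (h : IsProjPair P Q) : Q * proj P Q = 0 :=
  ContinuousLinearMap.ext fun v => (h.mem_fixed.1 (proj_apply_mem v)).2

theorem proj_mul_left (h : IsProjPair P Q) : proj P Q * P = proj P Q := by
  have := congrArg star h.left_mul_proj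
  rwa [star_mul, proj_isSelfAdjoint.star_eq, h.selfAdjoint_left.star_eq] at this

theorem proj_mul_right (h : IsProjPair P Q) : proj P Q * Q = 0 := by
  have := congrArg star h.right_mul_proj
  rwa [star_mul, proj_isSelfAdjoint.star_eq, h.selfAdjoint_right.star_eq, star_zero] at this

theorem proj_mul_proj_swap (h : IsProjPair P Q) : proj P Q * proj Q P = 0 := by
  rw [← h.proj_mul_left, mul_assoc, h.symm.right_mul_proj, mul_zero]

/-- D preserves the fixed space because it commutes with P and Q, and being self-adjoint it
preserves the orthogonal complement too. -/
theorem commute_proj (h : IsProjPair P Q) {D : X →L[ℂ] X} (hD : IsSelfAdjoint D)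
    (hP : Commute D P) (hQ : Commute D Q) : Commute D (proj P Q) := by
  have h1 : proj P Q * (D * proj P Q) = D * proj P Q := by
    ext v
    refine proj_eq_self.2 (h.mem_fixed.2 ⟨?_, ?_⟩)
    · change (P * (D * proj P Q)) v = _
      rw [← mul_assoc, ← hP.eq, mul_assoc, h.left_mul_proj]
      rfl
    · change (Q * (D * proj P Q)) v = _
      rw [← mul_assoc, ← hQ.eq, mul_assoc, h.right_mul_proj, mul_zero]
      rfl
  have h2 := congrArg star h1
  rw [star_mul, star_mul, proj_isSelfAdjoint.star_eq, hD.star_eq] at h2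
  rw [Commute, SemiconjBy, ← h1, ← mul_assoc, h2]

/-- `1 - (P - Q)² + E₊ + E₋`, which is invertible. -/
noncomputable def shifted (P Q : X →L[ℂ] X) : X →L[ℂ] X :=
  (1 - P - Q) * (1 - P - Q) + (proj P Q + proj Q P)

/-- Let E be the sum of the two spectral projections. The operator is 1 minus the compact T² - E, so
by the Fredholm alternative injectivity suffices. If (T² - E)v = v, then Ev = 0 and T²v = v; hence v
+ Tv and v - Tv lie in the fixed spaces, E fixes their sum 2v, and v = 0. -/
theorem isUnit_shifted (h : IsProjPair P Q) : IsUnit (shifted P Q) := by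
  set E := proj P Q + proj Q P with hE
  have hTE : (P - Q) * ((P - Q) * E) = E := by
    simp only [hE, mul_add, sub_mul, h.left_mul_proj, h.right_mul_proj, h.symm.left_mul_proj,
      h.symm.right_mul_proj, mul_sub, mul_zero]
    abel
  have hET : E * ((P - Q) * (P - Q)) = E := by
    simp only [hE, add_mul, mul_sub, ← mul_assoc, h.proj_mul_left, h.proj_mul_right,
      h.symm.proj_mul_left, h.symm.proj_mul_right, sub_mul, zero_mul]
    abel
  have hEE : E * E = E := by
    simp only [hE, add_mul, mul_add, proj_mul_self, h.proj_mul_proj_swap, h.symm.proj_mul_proj_swap]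
    abel
  have hc : IsCompactOperator ((P - Q) * (P - Q) - E : X →L[ℂ] X) := by
    rw [← hTE, ← mul_sub]
    exact h.compact.comp_clm _
  have hs : shifted P Q = 1 - ((P - Q) * (P - Q) - E) := by
    rw [shifted, eq_sub_of_add_eq (IsIdempotentElem.compl_sq_add h.mul_self_left h.mul_self_right), hE]
    abel
  rcases hc.hasEigenvalue_or_mem_resolventSet one_ne_zero with h1 | h1
  · exfalso
    obtain ⟨v, hv, hv0⟩ := h1.exists_hasEigenvector
    rw [Module.End.mem_eigenspace_iff, one_smul] at hv
    have hv1 : ((P - Q) * (P - Q) - E) v = v := hv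
    have h2 : E v = 0 := by
      have h3 : (E * ((P - Q) * (P - Q) - E)) v = E v := congrArg E hv1
      rw [mul_sub, hET, hEE, sub_self] at h3
      exact h3.symm
    have h4 : (P - Q) ((P - Q) v) = v := by
      have h5 : (P - Q) ((P - Q) v) - E v = v := hv1
      rwa [h2, sub_zero] at h5
    have h6 : v + (P - Q) v ∈ fixed P Q := by
      rw [fixed, Module.End.mem_eigenspace_iff, one_smul]
      change (P - Q) (v + (P - Q) v) = _
      rw [map_add, h4, add_comm]
    have h7 : v - (P - Q) v ∈ fixed Q P := by
      rw [fixed, Module.End.mem_eigenspace_iff, one_smul]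
      change (Q - P) (v - (P - Q) v) = _
      rw [← neg_sub P Q, FunLike.coe_neg, Pi.neg_apply, map_sub, h4]
      abel
    have h8 : E (v + (P - Q) v) = v + (P - Q) v := by
      have := proj_eq_self.2 h6
      change proj P Q _ + proj Q P _ = _
      rw [this]
      nth_rewrite 2 [← this]
      change _ + (proj Q P * proj P Q) _ = _
      rw [h.symm.proj_mul_proj_swap]
      simp
    have h9 : E (v - (P - Q) v) = v - (P - Q) v := by
      have := proj_eq_self.2 h7
      change proj P Q _ + proj Q P _ = _
      rw [this]
      nth_rewrite 1 [← this]
      change (proj P Q * proj Q P) _ + _ = _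
      rw [h.proj_mul_proj_swap]
      simp
    have h10 : E ((2 : ℂ) • v) = (2 : ℂ) • v := by
      have := congrArg₂ (· + ·) h8 h9
      simp only [← map_add] at this
      have e : v + (P - Q) v + (v - (P - Q) v) = (2 : ℂ) • v := by module
      rwa [e] at this
    rw [map_smul, h2, smul_zero] at h10
    exact hv0 (by simpa using h10.symm)
  · rw [spectrum.mem_resolventSet_iff, map_one] at h1
    rwa [hs]

theorem compl_mul_proj (h : IsProjPair P Q) : (1 - P - Q) * proj P Q = 0 := by
  rw [sub_mul, sub_mul, h.left_mul_proj, h.right_mul_proj, one_mul, sub_self, sub_zero]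

theorem proj_mul_compl (h : IsProjPair P Q) : proj P Q * (1 - P - Q) = 0 := by
  rw [mul_sub, mul_sub, h.proj_mul_left, h.proj_mul_right, mul_one, sub_self, sub_zero]

theorem compl_mul_proj_swap (h : IsProjPair P Q) : (1 - P - Q) * proj Q P = 0 := by
  rw [sub_right_comm]; exact h.symm.compl_mul_proj

theorem proj_swap_mul_compl (h : IsProjPair P Q) : proj Q P * (1 - P - Q) = 0 := by
  rw [sub_right_comm]; exact h.symm.proj_mul_compl

theorem commute_compl_shifted (h : IsProjPair P Q) : Commute (1 - P - Q) (shifted P Q) := by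
  rw [Commute, SemiconjBy, shifted, mul_add, add_mul, mul_add, add_mul, h.compl_mul_proj,
    h.proj_mul_compl, h.compl_mul_proj_swap, h.proj_swap_mul_compl, mul_assoc]

theorem proj_add_mul_inv (h : IsProjPair P Q) (U : (X →L[ℂ] X)ˣ) (hU : ↑U = shifted P Q) :
    (proj P Q + proj Q P) * (↑U⁻¹ : X →L[ℂ] X) = proj P Q + proj Q P := by
  rw [Units.mul_inv_eq_iff_eq_mul, hU, shifted, add_mul, mul_add, mul_add, mul_add, mul_add,
    ← mul_assoc, ← mul_assoc, h.proj_mul_compl, h.proj_swap_mul_compl, proj_mul_self,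
    proj_mul_self, h.proj_mul_proj_swap, h.symm.proj_mul_proj_swap]
  simp only [zero_mul, zero_add, add_zero]

/-- The image of `ran P` under `Q` consists of the vectors of `ran Q` that are orthogonal to the
fixed vectors of `Q - P`. -/
theorem mem_image_iff (h : IsProjPair P Q) {w : X} (hw : Q w = w) :
    (∃ u, P u = u ∧ Q u = w) ↔ proj Q P w = 0 := by
  constructor
  · rintro ⟨u, hu, rfl⟩
    change (proj Q P * Q) u = 0
    rw [h.symm.proj_mul_left, ← hu]
    change (proj Q P * P) u = 0
    rw [h.symm.proj_mul_right]
    rfl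
  · intro h0
    obtain ⟨U, hU⟩ := h.isUnit_shifted
    have h1 : proj P Q w = 0 := by
      rw [← hw]
      change (proj P Q * Q) w = 0
      rw [h.proj_mul_right]
      rfl
    have h2 := IsIdempotentElem.mul_compl_sq h.mul_self_right h.mul_self_left
    rw [sub_right_comm] at h2
    have h3 : ((1 - P - Q) * (1 - P - Q)) ((↑U⁻¹ : X →L[ℂ] X) w) = w := by
      have h4 := h.proj_add_mul_inv U hU
      have h5 : (shifted P Q * (↑U⁻¹ : X →L[ℂ] X)) w = w := by
        rw [← hU, Units.mul_inv]
        rfl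
      rw [shifted, add_mul, h4] at h5
      change _ + (proj P Q w + proj Q P w) = w at h5
      rw [h0, h1, add_zero, add_zero] at h5
      exact h5
    -- As w is orthogonal to both fixed spaces, S²U⁻¹w = w. Since QPQ = QS², the vector PQU⁻¹w is a
    -- preimage.
    refine ⟨P (Q ((↑U⁻¹ : X →L[ℂ] X) w)), ?_, ?_⟩
    · change (P * P) _ = _
      rw [h.mul_self_left]
    · change (Q * P * Q) _ = _
      rw [← h2]
      change Q (((1 - P - Q) * (1 - P - Q)) _) = w
      rw [h3, hw]

end IsProjPair

/-! ### Traces and multiplicities weight by weight -/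

namespace Ell2
variable {J : Type*} [DecidableEq J] (ν : J → ℤ)

/-- The projection onto the span of the basis vectors of weight `k`. -/
noncomputable def weightProj (k : ℤ) : Ell2 J →L[ℂ] Ell2 J :=
  weightedComp id fun y => if ν y = k then 1 else 0

theorem weightProj_apply (k : ℤ) (v : Ell2 J) (y : J) :
    weightProj ν k v y = if ν y = k then v y else 0 := by
  rw [weightProj, weightedComp_apply (Function.injective_id.injOn) 1
    (fun y => by split_ifs <;> simp)]
  split_ifs <;> simp

theorem weightProj_mul_apply (k : ℤ) (T : Ell2 J →L[ℂ] Ell2 J) (x y : J) :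
    entry (weightProj ν k * T) x y = if ν x = k then entry T x y else 0 :=
  weightProj_apply ν k _ x

theorem mul_weightProj_apply (k : ℤ) (T : Ell2 J →L[ℂ] Ell2 J) (x y : J) :
    entry (T * weightProj ν k) x y = if ν y = k then entry T x y else 0 := by
  have : weightProj ν k (lp.single 2 y (1 : ℂ)) = if ν y = k then lp.single 2 y (1 : ℂ) else 0 := by
    ext z
    rw [weightProj_apply]
    by_cases h : z = y
    · subst h; split_ifs <;> simp
    · have : (lp.single 2 y (1 : ℂ) : Ell2 J) z = 0 := by
        rw [lp.single_apply, Pi.single_eq_of_ne h]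
      rw [this]
      split_ifs
      exacts [this.symm, rfl, this.symm, rfl]
  change T (weightProj ν k _) x = _
  rw [this]
  split_ifs
  · rfl
  · rw [map_zero]; rfl

theorem weightProj_isSelfAdjoint (k : ℤ) : IsSelfAdjoint (weightProj ν k) := by
  refine isSelfAdjoint_of_entry fun i j => ?_
  have h := fun i j => weightProj_mul_apply ν k 1 i j
  simp only [mul_one] at h
  rw [h, h, entry_one, entry_one]
  by_cases e : i = j
  · subst e; split_ifs <;> simp
  · simp [e, Ne.symm e]

/-- Operators that preserve the weight commute with the weight projections. -/
theorem commute_weightProj {T : Ell2 J →L[ℂ] Ell2 J} (k : ℤ)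
    (h : ∀ x y, ν x ≠ ν y → entry T x y = 0) : Commute (weightProj ν k) T := by
  refine ext_entry fun x y => ?_
  rw [weightProj_mul_apply, mul_weightProj_apply]
  by_cases e : ν x = ν y
  · rw [e]
  · rw [h x y e]; simp

theorem IsL1.weightProj_mul {T : Ell2 J →L[ℂ] Ell2 J} (hT : IsL1 T) (k : ℤ) :
    IsL1 (weightProj ν k * T) := by
  refine Summable.of_nonneg_of_le (fun _ => norm_nonneg _) (fun z => ?_) hT
  rw [weightProj_mul_apply]
  split_ifs <;> simp

/-- Anticommutation turns tr(D S S Y) into -tr(D S Y S), and cyclicity together with DS = SD turns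
that back into -tr(D S S Y). Only D S Y has to be absolutely summable. -/
theorem tr_mul_sq_eq_zero {D S Y : Ell2 J →L[ℂ] Ell2 J} (hDS : Commute D S)
    (hSY : S * Y = -(Y * S)) (hL : IsL1 (D * (S * Y))) : tr (D * (S * (S * Y))) = 0 := by
  have h1 : tr (D * (S * (S * Y))) = -tr (D * (S * Y) * S) := by
    rw [← tr_neg]
    congr 1
    nth_rewrite 1 [hSY]
    rw [mul_neg, mul_neg, mul_assoc, mul_assoc]
  have h2 : tr (D * (S * Y) * S) = tr (D * (S * (S * Y))) := by
    rw [tr_mul_comm hL, ← mul_assoc, ← hDS.eq, mul_assoc]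
  rw [h2] at h1
  exact self_eq_neg.1 h1

/-- Expanding the projection in an orthonormal basis of V, each basis vector contributes one inner
product computed in coordinates. This identifies the coordinate trace with the algebraic trace on V.
-/
theorem tr_mul_starProjection (V : Submodule ℂ (Ell2 J)) [FiniteDimensional ℂ V]
    [V.HasOrthogonalProjection] (D : Ell2 J →L[ℂ] Ell2 J) (hD : ∀ v ∈ V, D.toLinearMap v ∈ V) :
    tr (D * V.starProjection) = LinearMap.trace ℂ V (D.toLinearMap.restrict hD) := by
  let b := stdOrthonormalBasis ℂ V
  rw [LinearMap.trace_eq_sum_inner _ b]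
  have h : ∀ y, entry (D * V.starProjection) y y =
      ∑ i, inner ℂ ((b i : Ell2 J) y) (D (b i : Ell2 J) y) := by
    intro y
    have e : V.starProjection (lp.single 2 y (1 : ℂ)) =
        ∑ i, inner ℂ (b i : Ell2 J) (lp.single 2 y (1 : ℂ)) • (b i : Ell2 J) := by
      rw [b.starProjection_eq_sum_rankOne]
      simp
    change D (V.starProjection _) y = _
    rw [e, map_sum, lp.coeFn_sum, Finset.sum_apply]
    refine Finset.sum_congr rfl fun i _ => ?_
    rw [map_smul, lp.coeFn_smul, Pi.smul_apply, smul_eq_mul, lp.inner_single_right]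
    simp [mul_comm]
  rw [tr, tsum_congr h]
  refine HasSum.tsum_eq (hasSum_sum fun i _ => ?_)
  exact lp.hasSum_inner (b i : Ell2 J) (D (b i : Ell2 J))

/-- Two projections that preserve the weight and whose difference is small. -/
structure IsWeightedProjPair (P Q : Ell2 J →L[ℂ] Ell2 J) : Prop extends IsProjPair P Q where
  weight_left : ∀ k, Commute (weightProj ν k) P
  weight_right : ∀ k, Commute (weightProj ν k) Q
  isL1 : IsL1 (P - Q)
  isL1_compl_mul : IsL1 ((1 - P - Q) * (P - Q))

namespace IsWeightedProjPair
variable {ν} {P Q : Ell2 J →L[ℂ] Ell2 J}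

theorem symm (h : IsWeightedProjPair ν P Q) : IsWeightedProjPair ν Q P where
  __ := h.toIsProjPair.symm
  weight_left := h.weight_right
  weight_right := h.weight_left
  isL1 := by have := h.isL1.neg; rwa [neg_sub] at this
  isL1_compl_mul := by
    have := h.isL1_compl_mul.neg
    rwa [← mul_neg, neg_sub, sub_right_comm] at this

theorem commute_proj (h : IsWeightedProjPair ν P Q) (k : ℤ) :
    Commute (weightProj ν k) (IsProjPair.proj P Q) :=
  h.toIsProjPair.commute_proj (weightProj_isSelfAdjoint ν k) (h.weight_left k) (h.weight_right k)

theorem commute_compl (h : IsWeightedProjPair ν P Q) (k : ℤ) :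
    Commute (weightProj ν k) (1 - P - Q) :=
  ((Commute.one_right _).sub_right (h.weight_left k)).sub_right (h.weight_right k)

/-- On its range T acts as the identity, so the projection E equals T E T, and both outer factors
are absolutely summable. -/
theorem isL1_proj (h : IsWeightedProjPair ν P Q) : IsL1 (IsProjPair.proj P Q) := by
  have h1 : (P - Q) * IsProjPair.proj P Q * (P - Q) = IsProjPair.proj P Q := by
    rw [sub_mul, h.left_mul_proj, h.right_mul_proj, sub_zero, mul_sub, h.proj_mul_left,
      h.proj_mul_right, sub_zero]
  rw [← h1]
  exact h.isL1.sandwich h.isL1 _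

theorem weightProj_mem_fixed (h : IsWeightedProjPair ν P Q) (k : ℤ) (v : Ell2 J)
    (hv : v ∈ IsProjPair.fixed P Q) : (weightProj ν k).toLinearMap v ∈ IsProjPair.fixed P Q := by
  rw [← IsProjPair.proj_eq_self] at hv ⊢
  change (IsProjPair.proj P Q * weightProj ν k) v = weightProj ν k v
  rw [← (h.commute_proj k).eq]
  exact congrArg (weightProj ν k) hv

/-- The projection commutes with multiplication by any function of the weight, even an unbounded
one, since only one weight block is involved in each coordinate. This is how K⁻²η descends to the
cokernel. -/
theorem proj_apply_of_weight (h : IsWeightedProjPair ν P Q) (c : ℤ → ℂ) {v w : Ell2 J}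
    (hw : ∀ y, w y = c (ν y) * v y) (y : J) :
    IsProjPair.proj P Q w y = c (ν y) * IsProjPair.proj P Q v y := by
  have e : weightProj ν (ν y) w = c (ν y) • weightProj ν (ν y) v := by
    ext z
    rw [lp.coeFn_smul, Pi.smul_apply, weightProj_apply, weightProj_apply, smul_eq_mul, hw]
    split_ifs with hz
    · rw [hz]
    · rw [mul_zero]
  have key : ∀ u, IsProjPair.proj P Q u y = IsProjPair.proj P Q (weightProj ν (ν y) u) y := by
    intro u
    change _ = (IsProjPair.proj P Q * weightProj ν (ν y)) u y
    rw [← (h.commute_proj _).eq]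
    change _ = weightProj ν (ν y) (IsProjPair.proj P Q u) y
    rw [weightProj_apply, if_pos rfl]
  rw [key w, key v, e, map_smul]
  rfl

/-- The trace of a weight projection on the fixed vectors of `P - Q`. -/
noncomputable def multiplicity (h : IsWeightedProjPair ν P Q) (k : ℤ) : ℂ :=
  LinearMap.trace ℂ (IsProjPair.fixed P Q)
    ((weightProj ν k).toLinearMap.restrict (h.weightProj_mem_fixed k))

theorem tr_mul_proj (h : IsWeightedProjPair ν P Q) (k : ℤ) :
    tr (weightProj ν k * IsProjPair.proj P Q) = h.multiplicity k := by
  have := h.finiteDimensional_fixed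
  exact tr_mul_starProjection _ _ _

/-- Remove from T its eigenspaces for ±1, leaving T' = T - E + E'. There S² is invertible and S
anticommutes with T', so T' = S S Y with Y anticommuting with S, and the trace of T' on each weight
space vanishes. What was removed contributes the multiplicities. -/
theorem tr_weightProj_mul (h : IsWeightedProjPair ν P Q) (k : ℤ) :
    tr (weightProj ν k * (P - Q)) = h.multiplicity k - h.symm.multiplicity k := by
  set E := IsProjPair.proj P Q with hE
  set E' := IsProjPair.proj Q P with hE'
  set S := 1 - P - Q with hS
  set T' := P - Q - E + E' with hT'
  have hSE : S * E = 0 := h.compl_mul_proj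
  have hSE' : S * E' = 0 := h.compl_mul_proj_swap
  have hES : E * S = 0 := h.proj_mul_compl
  have hES' : E' * S = 0 := h.proj_swap_mul_compl
  have hL' : IsL1 T' := (h.isL1.sub h.isL1_proj).add h.symm.isL1_proj
  have hST := IsIdempotentElem.compl_mul_sub h.mul_self_left h.mul_self_right
  have hST' : S * T' = S * (P - Q) := by
    rw [hT', mul_add, mul_sub, hSE, hSE', sub_zero, add_zero]
  have hTS' : T' * S = (P - Q) * S := by
    rw [hT', add_mul, sub_mul _ E, hES, hES', sub_zero, add_zero]
  have hET' : (E + E') * T' = 0 := by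
    simp only [hT', add_mul, mul_add, mul_sub, hE, hE', h.proj_mul_left, h.proj_mul_right,
      h.symm.proj_mul_left, h.symm.proj_mul_right, IsProjPair.proj_mul_self, h.proj_mul_proj_swap,
      h.symm.proj_mul_proj_swap]
    abel
  obtain ⟨U, hU⟩ := h.isUnit_shifted
  have hUS : Commute S (↑U⁻¹ : Ell2 J →L[ℂ] Ell2 J) :=
    Commute.units_inv_right (by rw [hU]; exact h.commute_compl_shifted)
  set Y := (↑U⁻¹ : Ell2 J →L[ℂ] Ell2 J) * T' with hY
  have hSY : S * Y = -(Y * S) := by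
    rw [hY, ← mul_assoc, hUS.eq, mul_assoc, mul_assoc, hST', hTS', hST, mul_neg]
  have hEY : (E + E') * Y = 0 := by
    rw [hY, ← mul_assoc, h.proj_add_mul_inv U hU, hET']
  have hSSY : S * S * Y = T' := by
    have h1 : IsProjPair.shifted P Q * Y = T' := by
      rw [hY, ← mul_assoc, ← hU, Units.mul_inv, one_mul]
    rw [IsProjPair.shifted, add_mul, hEY, add_zero] at h1
    exact h1
  -- Y contains the inverse U⁻¹, which is merely bounded. Rewriting S² as 1 - T² isolates T' and
  -- puts the rest between the absolutely summable factors S T and T', so that S Y is absolutely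
  -- summable.
  have hYeq : Y = T' + (P - Q) * (P - Q) * Y := by
    have h2 : S * S = 1 - (P - Q) * (P - Q) :=
      eq_sub_of_add_eq (IsIdempotentElem.compl_sq_add h.mul_self_left h.mul_self_right)
    rw [h2, sub_mul, one_mul] at hSSY
    exact eq_add_of_sub_eq hSSY
  have hLSY : IsL1 (S * Y) := by
    have h3 : S * Y = S * (P - Q) +
        S * (P - Q) * ((P - Q) * (↑U⁻¹ : Ell2 J →L[ℂ] Ell2 J)) * T' := by
      rw [hYeq, mul_add, hST', hY]
      simp only [mul_assoc]
    rw [h3]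
    exact h.isL1_compl_mul.add (h.isL1_compl_mul.sandwich hL' _)
  have hzero := tr_mul_sq_eq_zero (h.commute_compl k) hSY (hLSY.weightProj_mul ν k)
  rw [← mul_assoc S, hSSY, hT', mul_add, mul_sub, tr_add, tr_sub, h.tr_mul_proj, h.symm.tr_mul_proj] at hzero
  · linear_combination hzero
  · exact h.isL1.weightProj_mul ν k
  · exact h.isL1_proj.weightProj_mul ν k
  · exact (h.isL1.weightProj_mul ν k).sub (h.isL1_proj.weightProj_mul ν k)
  · exact h.symm.isL1_proj.weightProj_mul ν k

theorem tr_weightProj_mul_mul_compl_sq (h : IsWeightedProjPair ν P Q) (k : ℤ) :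
    tr (weightProj ν k * ((1 - P - Q) * ((1 - P - Q) * (P - Q)))) = 0 :=
  tr_mul_sq_eq_zero (h.commute_compl k)
    (IsIdempotentElem.compl_mul_sub h.mul_self_left h.mul_self_right)
    (h.isL1_compl_mul.weightProj_mul ν k)

/-- Only finitely many weights occur in the fixed vectors of `P - Q`. -/
theorem finite_weights (h : IsWeightedProjPair ν P Q) :
    {k : ℤ | ∃ v ∈ IsProjPair.fixed P Q, weightProj ν k v ≠ 0}.Finite := by
  have := h.finiteDimensional_fixed
  choose f hf hf0 using fun k : {k : ℤ | ∃ v ∈ IsProjPair.fixed P Q, weightProj ν k v ≠ 0} => k.2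
  let g : {k : ℤ | ∃ v ∈ IsProjPair.fixed P Q, weightProj ν k v ≠ 0} → IsProjPair.fixed P Q :=
    fun k => ⟨weightProj ν k (f k), h.weightProj_mem_fixed k _ (hf k)⟩
  have hg : LinearIndependent ℂ g := by
    refine linearIndependent_of_ne_zero_of_inner_eq_zero
      (fun k e => hf0 k (congrArg Subtype.val e)) fun i j hij => ?_
    have e : ∀ y, inner ℂ (weightProj ν i (f i) y) (weightProj ν j (f j) y) = (0 : ℂ) := by
      intro y
      rw [weightProj_apply, weightProj_apply]
      by_cases h1 : ν y = i
      · have h2 : ν y ≠ j := fun h2 => hij (Subtype.ext (h1.symm.trans h2))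
        rw [if_neg h2, inner_zero_right]
      · rw [if_neg h1, inner_zero_left]
    have := lp.hasSum_inner (𝕜 := ℂ) (weightProj ν i (f i)) (weightProj ν j (f j))
    simp only [e] at this
    exact this.unique hasSum_zero
  exact Set.finite_coe_iff.1 hg.finite

/-- Multiplication by a function of the weight, on the fixed vectors of `P - Q`. -/
theorem exists_fixed_weight (h : IsWeightedProjPair ν P Q) (c : ℤ → ℂ) :
    ∃ (S : Module.End ℂ (IsProjPair.fixed P Q)) (M : Finset ℤ),
      (∀ v y, (S v).1 y = c (ν y) * v.1 y) ∧
      ∀ M', M ⊆ M' → LinearMap.trace ℂ _ S = ∑ k ∈ M', c k * h.multiplicity k := by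
  set M := h.finite_weights.toFinset with hM
  have h0 : ∀ k, k ∉ M → (weightProj ν k).toLinearMap.restrict (h.weightProj_mem_fixed k) = 0 := by
    intro k hk
    ext v : 2
    by_contra hne
    exact hk (h.finite_weights.mem_toFinset.2 ⟨v.1, v.2, hne⟩)
  refine ⟨∑ k ∈ M, c k • (weightProj ν k).toLinearMap.restrict (h.weightProj_mem_fixed k), M,
    fun v y => ?_, fun M' hM' => ?_⟩
  · have e : ((∑ k ∈ M, c k • (weightProj ν k).toLinearMap.restrict (h.weightProj_mem_fixed k)) v).1
        = ∑ k ∈ M, c k • weightProj ν k v.1 := by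
      rw [LinearMap.sum_apply, Submodule.coe_sum]
      rfl
    rw [e, lp.coeFn_sum, Finset.sum_apply]
    have e' : ∀ k, (c k • weightProj ν k v.1) y = if ν y = k then c k * v.1 y else 0 := by
      intro k
      rw [lp.coeFn_smul, Pi.smul_apply, weightProj_apply, smul_eq_mul, mul_ite, mul_zero]
    simp only [e']
    rw [Finset.sum_ite_eq]
    split_ifs with hy
    · rfl
    · have := congrArg (fun f => (f v).1 y) (h0 _ hy)
      change weightProj ν (ν y) v.1 y = 0 at this
      rw [weightProj_apply, if_pos rfl] at this
      rw [this, mul_zero]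
  · rw [map_sum]
    refine (Finset.sum_congr rfl fun k _ => ?_).trans (Finset.sum_subset hM' fun k _ hk => ?_)
    · rw [map_smul, smul_eq_mul]; rfl
    · rw [multiplicity, h0 k hk, map_zero, mul_zero]

/-- The weighted index of `Q` as a map `ran P → ran Q`. -/
theorem exists_index (h : IsWeightedProjPair ν P Q) (c : ℤ → ℂ) {M₀ : Finset ℤ}
    (hM₀ : ∀ k, k ∉ M₀ → tr (weightProj ν k * (P - Q)) = 0) :
    ∃ (S : Module.End ℂ (IsProjPair.fixed P Q)) (S' : Module.End ℂ (IsProjPair.fixed Q P)),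
      (∀ v y, (S v).1 y = c (ν y) * v.1 y) ∧ (∀ v y, (S' v).1 y = c (ν y) * v.1 y) ∧
      LinearMap.trace ℂ _ S - LinearMap.trace ℂ _ S' =
        ∑ k ∈ M₀, c k * tr (weightProj ν k * (P - Q)) := by
  obtain ⟨S, M, hS, hM⟩ := h.exists_fixed_weight c
  obtain ⟨S', M', hS', hM'⟩ := h.symm.exists_fixed_weight c
  refine ⟨S, S', hS, hS', ?_⟩
  rw [hM (M ∪ M' ∪ M₀) fun x hx => by simp [hx], hM' (M ∪ M' ∪ M₀) fun x hx => by simp [hx],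
    ← Finset.sum_sub_distrib]
  simp only [← mul_sub, ← h.tr_weightProj_mul]
  exact (Finset.sum_subset Finset.subset_union_right fun k _ hk => by rw [hM₀ k hk, mul_zero]).symm

end IsWeightedProjPair

end Ell2

/-! ### `e_s` as a pair of projections -/

section
open Ell2 SpinIdx

namespace Podles
section
variable (p : PodlesParam)

/-- The self-adjoint idempotent `(1 + s²)⁻¹ !![s² + A, B; B^*, 1 - q² A]`, which is conjugate to
`e_s`. -/
noncomputable def bottSym : Matrix (Fin 2) (Fin 2) (Podles p) :=
  (1 + p.sc ^ 2)⁻¹ • !![algebraMap ℂ _ (p.sc ^ 2) + A p, B p; Bs p, 1 - p.qc ^ 2 • A p]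

/-- The diagonal entries of the matrix that conjugates `e_s` into `bottSym`. -/
noncomputable def conjWeight (j : Fin 2) : ℂ := p.qc ^ (j : ℕ)

theorem conjWeight_ne (j : Fin 2) : conjWeight p j ≠ 0 := pow_ne_zero _ p.qc_ne

theorem bottSym_eq (j k : Fin 2) :
    bottSym p j k = (conjWeight p j * (conjWeight p k)⁻¹) • bott p j k := by
  have hq := p.qc_ne
  fin_cases j <;> fin_cases k <;> simp [bottSym, bott, conjWeight, smul_smul, mul_comm, hq]

theorem gammaS_eq (j k : Fin 2) :
    gammaS p j k = (2 : ℂ) • bott p j k - algebraMap ℂ _ (if j = k then 1 else 0) := by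
  rw [gammaS, Matrix.sub_apply, Matrix.smul_apply, Matrix.one_apply, ← Nat.cast_smul_eq_nsmul ℂ]
  split_ifs <;> simp

theorem bottSym_mul_bottSym : bottSym p * bottSym p = bottSym p := by
  ext i k
  have h := congrFun (congrFun (bott_mul_bott p) i) k
  rw [Matrix.mul_apply] at h ⊢
  rw [bottSym_eq, ← h, Finset.smul_sum]
  refine Finset.sum_congr rfl fun j _ => ?_
  rw [bottSym_eq, bottSym_eq, smul_mul_smul_comm]
  congr 1
  have := conjWeight_ne p j
  field_simp

theorem modular_bottSym (j k : Fin 2) :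
    modular p (bottSym p j k) = p.qc ^ (2 * (k : ℤ) - 2 * (j : ℤ)) • bottSym p j k := by
  have hq := p.qc_ne
  fin_cases j <;> fin_cases k
  · simp [bottSym, modular_A]
  · simp [bottSym, modular_B, smul_smul, mul_comm]
  · simp [bottSym, modular_Bs, smul_smul, mul_comm]
  · simp [bottSym, modular_A]

end

section
variable (p : PodlesParam) {n : ℤ} (hn : n ≠ 0)

theorem adjoint_compRep_A (b : Bool) :
    ContinuousLinearMap.adjoint (compRep p hn b (A p)) = compRep p hn b (A p) := by
  have h1 := (isSelfAdjoint_opZ (p := p) (one_le_natAbs hn) (abs_label n b)).adjoint_eq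
  rw [compRep, levelRep_A, map_smulₛₗ, map_sub, map_smulₛₗ, h1]
  have e1 : (starRingEnd ℂ) (1 + p.q ^ 2 : ℂ)⁻¹ = (1 + p.q ^ 2 : ℂ)⁻¹ := by
    simp [Complex.conj_ofReal]
  have e2 : (starRingEnd ℂ) (1 - p.s ^ 2 : ℂ) = (1 - p.s ^ 2 : ℂ) := by
    simp [Complex.conj_ofReal]
  rw [e1, e2]
  congr 3
  exact ContinuousLinearMap.adjoint_id

theorem adjoint_compRep_B (b : Bool) :
    ContinuousLinearMap.adjoint (compRep p hn b (B p)) = compRep p hn b (Bs p) := by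
  rw [compRep, levelRep_B, levelRep_Bs, map_smulₛₗ, adjoint_opX (one_le_natAbs hn) (abs_label n b)]
  congr 1
  simp [Complex.conj_ofReal]

theorem adjoint_compRep_Bs (b : Bool) :
    ContinuousLinearMap.adjoint (compRep p hn b (Bs p)) = compRep p hn b (B p) := by
  rw [← adjoint_compRep_B, ContinuousLinearMap.adjoint_adjoint]

theorem adjoint_compRep_smul {x y : Podles p} {b : Bool} (c : ℝ)
    (h : ContinuousLinearMap.adjoint (compRep p hn b x) = compRep p hn b y) :
    ContinuousLinearMap.adjoint (compRep p hn b ((c : ℂ) • x)) = compRep p hn b ((c : ℂ) • y) := by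
  rw [map_smul (compRep p hn b), map_smul (compRep p hn b), map_smulₛₗ, h, Complex.conj_ofReal]

theorem adjoint_compRep_bottSym (b : Bool) (j k : Fin 2) :
    ContinuousLinearMap.adjoint (compRep p hn b (bottSym p j k)) = compRep p hn b (bottSym p k j) := by
  have h1 : ContinuousLinearMap.adjoint (compRep p hn b 1) = compRep p hn b 1 := by
    rw [map_one]
    exact ContinuousLinearMap.adjoint_id
  have hA := adjoint_compRep_A p hn b
  have e0 : (1 + p.sc ^ 2)⁻¹ = (((1 + p.s ^ 2)⁻¹ : ℝ) : ℂ) := by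
    simp [PodlesParam.sc]
  have e1 : p.sc ^ 2 = ((p.s ^ 2 : ℝ) : ℂ) := by
    simp [PodlesParam.sc]
  have e2 : p.qc ^ 2 = ((p.q ^ 2 : ℝ) : ℂ) := by
    simp [PodlesParam.qc]
  have hs : ∀ j k, bottSym p j k = (((1 + p.s ^ 2)⁻¹ : ℝ) : ℂ) •
      !![((p.s ^ 2 : ℝ) : ℂ) • 1 + A p, B p; Bs p, 1 - ((p.q ^ 2 : ℝ) : ℂ) • A p] j k := by
    intro j k
    rw [← e0, ← e1, ← e2, ← Algebra.algebraMap_eq_smul_one]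
    rfl
  rw [hs, hs]
  refine adjoint_compRep_smul p hn _ ?_
  fin_cases j <;> fin_cases k
  · change ContinuousLinearMap.adjoint (compRep p hn b (((p.s ^ 2 : ℝ) : ℂ) • 1 + A p)) =
      compRep p hn b (((p.s ^ 2 : ℝ) : ℂ) • 1 + A p)
    rw [map_add, map_add, adjoint_compRep_smul p hn _ h1, hA]
  · exact adjoint_compRep_B p hn b
  · exact adjoint_compRep_Bs p hn b
  · change ContinuousLinearMap.adjoint (compRep p hn b (1 - ((p.q ^ 2 : ℝ) : ℂ) • A p)) =
      compRep p hn b (1 - ((p.q ^ 2 : ℝ) : ℂ) • A p)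
    rw [map_sub, map_sub, adjoint_compRep_smul p hn _ hA, h1]

/-- The image of `e_s`, made self-adjoint, in a component of the spinor representation. -/
noncomputable def bottOp (b : Bool) : Ell2 (SpinIdx n.natAbs × Fin 2) →L[ℂ] Ell2 (SpinIdx n.natAbs × Fin 2) :=
  blockHom ((compRep p hn b).mapMatrix (bottSym p))

theorem entry_bottOp (b : Bool) (x y : SpinIdx n.natAbs) (j k : Fin 2) :
    entry (bottOp p hn b) (x, j) (y, k) = entry (compRep p hn b (bottSym p j k)) x y :=
  entry_blockHom ..

/-- The doubled weights on `ℋ_{±N} ⊗ ℂ²`: `K⁻²η` is multiplication by `q^{-ν}`. -/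
def spinWeight {a : ℕ} (y : SpinIdx a × Fin 2) : ℤ := y.1.1.2 + (2 * (y.2 : ℤ) - 1)

theorem bottOp_sub : bottOp p hn true - bottOp p hn false =
    blockHom (Matrix.of fun j k => diffRep p hn (bottSym p j k)) := by
  rw [bottOp, bottOp, ← map_sub]
  rfl

theorem hasDecay_bottOp (b : Bool) :
    HasDecay (fun y : SpinIdx n.natAbs × Fin 2 => scale p y.1) 0 (bottOp p hn b) :=
  .blockHom fun _ _ => hasDecay_compRep p hn b _

theorem hasDecay_bottOp_sub : HasDecay (fun y : SpinIdx n.natAbs × Fin 2 => scale p y.1) 2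
    (bottOp p hn true - bottOp p hn false) := by
  rw [bottOp_sub]
  exact .blockHom fun _ _ => hasDecay_diffRep p hn _

theorem isL1_of_hasDecay {k : ℤ} (hk : 2 ≤ k)
    {T : Ell2 (SpinIdx n.natAbs × Fin 2) →L[ℂ] Ell2 (SpinIdx n.natAbs × Fin 2)}
    (hT : HasDecay (fun y : SpinIdx n.natAbs × Fin 2 => scale p y.1) k T) : IsL1 T := by
  refine hT.isL1 (fun y => scale_pos p y.1) (fun y => scale_le_one p y.1) ?_ hk
  have := (summable_scale p (a := n.natAbs)).mul_of_nonneg (g := fun _ : Fin 2 => (1 : ℝ))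
    (Summable.of_finite) (fun x => (scale_pos p x).le) (fun _ => zero_le_one)
  simpa only [mul_one] using this

theorem bottOp_mul_self (b : Bool) : bottOp p hn b * bottOp p hn b = bottOp p hn b := by
  rw [bottOp, ← map_mul, ← map_mul, bottSym_mul_bottSym]

theorem isSelfAdjoint_bottOp (b : Bool) : IsSelfAdjoint (bottOp p hn b) := by
  refine isSelfAdjoint_of_entry fun x y => ?_
  obtain ⟨x, j⟩ := x
  obtain ⟨y, k⟩ := y
  rw [entry_bottOp, entry_bottOp, ← entry_adjoint, adjoint_compRep_bottSym]

/-- κ acts on the entry (i, j) of the matrix as a power of q, and in the representation as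
conjugation by K². A nonzero coefficient forces the two exponents to agree, and this says that the
weight is preserved. -/
theorem entry_bottOp_eq_zero (b : Bool) (x y : SpinIdx n.natAbs × Fin 2)
    (h : spinWeight x ≠ spinWeight y) : entry (bottOp p hn b) x y = 0 := by
  obtain ⟨x, i⟩ := x
  obtain ⟨y, j⟩ := y
  rw [entry_bottOp]
  have h1 := entry_compRep_modular p hn b (bottSym p i j) x y
  rw [modular_bottSym, map_smul, entry_smul] at h1
  by_contra h0
  have h2 := mul_right_cancel₀ h0 h1
  rw [PodlesParam.qc] at h2
  have h3 : 2 * (j : ℤ) - 2 * (i : ℤ) = x.1.2 - y.1.2 :=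
    zpow_right_injective₀ p.q_pos p.q_lt_one.ne (by exact_mod_cast h2)
  refine h ?_
  change x.1.2 + (2 * (i : ℤ) - 1) = y.1.2 + (2 * (j : ℤ) - 1)
  omega

theorem isL1_bottOp_sub : IsL1 (bottOp p hn true - bottOp p hn false) :=
  isL1_of_hasDecay p le_rfl (hasDecay_bottOp_sub p hn)

theorem hasDecay_compl_bottOp : HasDecay (fun y : SpinIdx n.natAbs × Fin 2 => scale p y.1) 0
    (1 - bottOp p hn true - bottOp p hn false) := by
  have h1 : HasDecay (fun y : SpinIdx n.natAbs × Fin 2 => scale p y.1) 0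
      (1 : Ell2 (SpinIdx n.natAbs × Fin 2) →L[ℂ] Ell2 (SpinIdx n.natAbs × Fin 2)) :=
    HasDecay.one fun y => scale_pos p y.1
  have h2 := h1.sub (hasDecay_bottOp p hn true)
  exact h2.sub (hasDecay_bottOp p hn false)

theorem isL1_compl_mul_bottOp_sub : IsL1
    ((1 - bottOp p hn true - bottOp p hn false) * (bottOp p hn true - bottOp p hn false)) := by
  refine isL1_of_hasDecay p (k := 0 + 2) (by norm_num) ?_
  exact (hasDecay_compl_bottOp p hn).mul (fun y => scale_pos p y.1) (hasDecay_bottOp_sub p hn)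

theorem isProjPair_bottOp : IsProjPair (bottOp p hn true) (bottOp p hn false) where
  mul_self_left := bottOp_mul_self p hn true
  mul_self_right := bottOp_mul_self p hn false
  selfAdjoint_left := isSelfAdjoint_bottOp p hn true
  selfAdjoint_right := isSelfAdjoint_bottOp p hn false
  compact := (isL1_bottOp_sub p hn).isCompactOperator

theorem isWeightedProjPair_bottOp :
    IsWeightedProjPair spinWeight (bottOp p hn true) (bottOp p hn false) where
  toIsProjPair := isProjPair_bottOp p hn
  weight_left k := commute_weightProj _ k (entry_bottOp_eq_zero p hn true)
  weight_right k := commute_weightProj _ k (entry_bottOp_eq_zero p hn false)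
  isL1 := isL1_bottOp_sub p hn
  isL1_compl_mul := isL1_compl_mul_bottOp_sub p hn

end
end Podles
end

/-! ### The diagonal of T and its telescoping sums -/

section
open Ell2 SpinIdx Filter Topology

namespace PodlesParam
variable (p : PodlesParam)

/-- The diagonal coefficient at `|L/2, M/2⟩` of `(1 + s²)⁻¹` times the difference of the two
representations of `A`. -/
noncomputable def gap (n L M : ℝ) : ℝ :=
  p.num n * (p.num L - p.q ^ ((L + M) / 2 + 1) * p.num 2 * p.num ((L - M) / 2)) /
    (p.q ^ 2 * p.num L * p.num (L + 2))

variable {n L : ℝ}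

/-- At weight k the first component of ℂ² sits at 2m = k + 1 and the second at 2m = k - 1, the
latter with factor -q² from the entry 1 - q²A. Their joint contribution is a difference of
consecutive values of [n]/[L]. -/
theorem gap_add_one_sub (hL : 0 < L) (k : ℝ) : p.gap n L (k + 1) - p.q ^ 2 * p.gap n L (k - 1) =
    p.num n / p.num L - p.num n / p.num (L + 2) := by
  have hq := p.q_pos
  have h1 := (p.num_pos hL).ne'
  have h2 := (p.num_pos (show 0 < L + 2 by linarith)).ne'
  have e : (p.num L - p.q ^ ((L + (k + 1)) / 2 + 1) * p.num 2 * p.num ((L - (k + 1)) / 2))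
      - p.q ^ 2 * (p.num L - p.q ^ ((L + (k - 1)) / 2 + 1) * p.num 2 * p.num ((L - (k - 1)) / 2))
      = p.q ^ 2 * (p.num (L + 2) - p.num L) := by
    have e1 : (L + (k + 1)) / 2 + 1 = (L + k) / 2 + 1 / 2 + 1 := by ring
    have e2 : (L + (k - 1)) / 2 + 1 = (L + k) / 2 + 1 / 2 := by ring
    have e3 : (L - (k + 1)) / 2 = (L - k) / 2 - 1 / 2 := by ring
    have e4 : (L - (k - 1)) / 2 = (L - k) / 2 + 1 / 2 := by ring
    have e5 : p.num L = p.num ((L + k) / 2 + (L - k) / 2) := by congr 1; ring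
    have e6 : L + 2 = (L + k) / 2 + (L - k) / 2 + 2 := by ring
    -- The arguments involve halves, so the identity is rational in q^{1/2} rather than in q.
    have hr : p.q = (p.q ^ (1 / 2 : ℝ)) ^ 2 := by
      rw [← Real.rpow_natCast, ← Real.rpow_mul hq.le]; norm_num
    rw [e1, e2, e3, e4, e6, e5]
    have hu := p.q_rpow_pos ((L + k) / 2)
    have hv := p.q_rpow_pos ((L - k) / 2)
    have hw := p.q_rpow_pos (1 / 2)
    have hs := p.sub_inv_neg.ne
    rw [num_two, q_rpow_add_one, p.num_eq_of (Real.rpow_add hq _ _),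
      p.num_eq_of (Real.rpow_sub hq _ (1 / 2)), p.num_eq_of (Real.rpow_add hq ((L - k) / 2) (1 / 2)),
      p.num_eq_of (q_rpow_add_two p _), Real.rpow_add hq _ (1 / 2), Real.rpow_add hq]
    generalize p.q ^ ((L + k) / 2) = u at *
    generalize p.q ^ ((L - k) / 2) = v at *
    generalize p.q ^ (1 / 2 : ℝ) = r at *
    have hq' : p.q ^ 2 - 1 ≠ 0 := by
      intro h
      apply hs
      field_simp
      rw [h, mul_zero]
    generalize p.q = q at *
    subst hr
    field_simp
    ring
  rw [gap, gap, ← mul_div_assoc, ← sub_div, div_sub_div _ _ h1 h2, div_eq_div_iff (by positivity)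
    (by positivity)]
  linear_combination (p.num n * p.num L * p.num (L + 2)) * e

/-- At the extreme weights k = L + 1 and k = -L - 1 only one component is in range. Here and in the
next lemma its value is the single missing term [n]/[L + 2] of the telescope, up to sign. -/
theorem gap_self (hL : 0 < L) : p.q ^ 2 * p.gap n L L = p.num n / p.num (L + 2) := by
  have hq := p.q_pos
  have h1 := (p.num_pos hL).ne'
  have h2 := (p.num_pos (show 0 < L + 2 by linarith)).ne'
  rw [gap, sub_self, zero_div, num_zero]
  field_simp
  ring

theorem gap_neg_self (hL : 0 < L) : p.gap n L (-L) = -(p.num n / p.num (L + 2)) := by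
  have hq := p.q_pos
  have h1 := (p.num_pos hL).ne'
  have h2 := (p.num_pos (show 0 < L + 2 by linarith)).ne'
  have e : (L - -L) / 2 = L := by ring
  rw [gap, add_neg_cancel, zero_div, zero_add, Real.rpow_one, e, num_two]
  field_simp
  ring

/-- `[n]/[L]`, for the weights `k` that occur at spin `(L - 1)/2`. -/
noncomputable def levelGap (n : ℝ) (k L : ℤ) : ℝ := if |k| ≤ L - 1 then p.num n / p.num L else 0

/-- Four cases: both components in range, only the second (k = L + 1), only the first (k = -L - 1),
or none. The cutoff in `levelGap` makes them uniform. -/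
theorem gap_sum (n : ℝ) {k L : ℤ} (hL : 0 < L) (hk : 2 ∣ L - 1 - k) :
    (if |k + 1| ≤ L then p.gap n L ((k + 1 : ℤ) : ℝ) else 0) -
      (if |k - 1| ≤ L then p.q ^ 2 * p.gap n L ((k - 1 : ℤ) : ℝ) else 0) =
      p.levelGap n k L - p.levelGap n k (L + 2) := by
  have hL' : (0 : ℝ) < L := by exact_mod_cast hL
  rw [levelGap, levelGap]
  push_cast
  by_cases h1 : |k| ≤ L - 1
  · have h2 := abs_le.1 h1
    rw [if_pos (abs_le.2 ⟨by omega, by omega⟩), if_pos (abs_le.2 ⟨by omega, by omega⟩), if_pos h1,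
      if_pos (by omega), p.gap_add_one_sub hL']
  · rw [if_neg h1, zero_sub]
    by_cases h3 : k = L + 1
    · have h4 : ¬|k + 1| ≤ L := fun h => by have := abs_le.1 h; omega
      rw [if_neg h4, if_pos (abs_le.2 ⟨by omega, by omega⟩), if_pos (abs_le.2 ⟨by omega, by omega⟩), h3]
      push_cast
      rw [add_sub_cancel_right, p.gap_self hL', zero_sub]
    · by_cases h5 : k = -L - 1
      · have h4 : ¬|k - 1| ≤ L := fun h => by have := abs_le.1 h; omega
        rw [if_neg h4, if_pos (abs_le.2 ⟨by omega, by omega⟩), if_pos (abs_le.2 ⟨by omega, by omega⟩), h5]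
        push_cast
        rw [sub_add_cancel, p.gap_neg_self hL', sub_zero]
      · have h6 : ¬|k| ≤ L + 2 - 1 := fun h => by
          have := abs_le.1 h
          rw [abs_le] at h1
          omega
        have h7 : ¬|k + 1| ≤ L := fun h => h6 (by have := abs_le.1 h; exact abs_le.2 ⟨by omega, by rw [abs_le] at h1; omega⟩)
        have h8 : ¬|k - 1| ≤ L := fun h => h6 (by have := abs_le.1 h; exact abs_le.2 ⟨by rw [abs_le] at h1; omega, by omega⟩)
        rw [if_neg h6, if_neg h7, if_neg h8, sub_zero, neg_zero]

theorem tendsto_levelGap (n : ℝ) (k : ℤ) (a : ℕ) :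
    Tendsto (fun i : ℕ => p.levelGap n k (a + 2 * i)) atTop (𝓝 0) := by
  have hq := p.q_pos
  have hb : ∀ i : ℕ, 1 ≤ i → ‖p.levelGap n k (a + 2 * i)‖ ≤ |p.num n| * p.q ^ (i : ℕ) := by
    intro i hi
    rw [levelGap]
    split_ifs
    · have hi' : (1 : ℝ) ≤ i := by exact_mod_cast hi
      have ha : (0 : ℝ) ≤ a := Nat.cast_nonneg a
      have h1 : (1 : ℝ) ≤ ((a + 2 * i : ℤ) : ℝ) := by push_cast; linarith
      have h2 := p.le_num h1
      have h3 : (p.q ^ i)⁻¹ ≤ p.q ^ (1 - ((a + 2 * i : ℤ) : ℝ)) := by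
        rw [← Real.rpow_natCast, ← Real.rpow_neg hq.le]
        refine Real.rpow_le_rpow_of_exponent_ge hq p.q_lt_one.le ?_
        push_cast
        linarith
      have h4 : 0 < p.num ((a + 2 * i : ℤ) : ℝ) := p.num_pos (by linarith)
      rw [norm_div, Real.norm_eq_abs, Real.norm_of_nonneg h4.le, div_le_iff₀ h4]
      have h5 : 1 ≤ p.q ^ i * p.num ((a + 2 * i : ℤ) : ℝ) := by
        have := mul_le_mul_of_nonneg_left (h3.trans h2) (pow_pos hq i).le
        rwa [mul_inv_cancel₀ (pow_pos hq i).ne'] at this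
      calc |p.num n| = |p.num n| * 1 := (mul_one _).symm
        _ ≤ |p.num n| * (p.q ^ i * p.num ((a + 2 * i : ℤ) : ℝ)) :=
          mul_le_mul_of_nonneg_left h5 (abs_nonneg _)
        _ = _ := by ring
    · rw [norm_zero]; positivity
  refine squeeze_zero_norm' (eventually_atTop.2 ⟨1, hb⟩) ?_
  have := (tendsto_pow_atTop_nhds_zero_of_lt_one hq.le p.q_lt_one).const_mul |p.num n|
  rwa [mul_zero] at this

end PodlesParam

namespace Podles
variable (p : PodlesParam) {n : ℤ} (hn : n ≠ 0)

theorem entry_diffRep_A_diag (x : SpinIdx n.natAbs) : entry (diffRep p hn (A p)) x x =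
    (1 + p.sc ^ 2) * (p.gap n x.1.1 x.1.2 : ℝ) := by
  have ha := one_le_natAbs hn
  have hN := abs_label n true
  have hq := p.q_pos
  have hL : (1 : ℝ) ≤ x.1.1 := by
    have h1 := x.2.1
    have : (1 : ℤ) ≤ x.1.1 := by omega
    exact_mod_cast this
  rw [diffRep_A, entry_smul, entry_sub, entry_opZ ha hN _ _ rfl rfl,
    entry_opZ ha (by rwa [abs_neg]) _ _ rfl rfl]
  have h1 : ¬x.1.1 = x.1.1 + 2 := by omega
  have h2 : ¬x.1.1 = x.1.1 - 2 := by omega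
  simp only [h1, h2, false_and, and_self, if_true, if_false, zero_add, add_zero]
  have hb := p.beta_sub_neg (l := x.1.1 / 2) (N := label n true) (by linarith)
  have e0 : label n true = -((n : ℝ) / 2) := rfl
  have e1 : 2 * ((x.1.1 : ℝ) / 2) = x.1.1 := by ring
  have e2 : 2 * label n true = -n := by rw [e0]; ring
  rw [e1, e2, PodlesParam.num_neg] at hb
  have h3 := p.num_pos (show (0 : ℝ) < x.1.1 by linarith)
  have h4 := p.num_pos (show (0 : ℝ) < x.1.1 + 2 by linarith)
  have key : -(1 + p.q ^ 2)⁻¹ * (p.cA0 (label n true) (x.1.1 / 2) (x.1.2 / 2) -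
      p.cA0 (-label n true) (x.1.1 / 2) (x.1.2 / 2)) = (1 + p.s ^ 2) * p.gap n x.1.1 x.1.2 := by
    rw [PodlesParam.cA0, PodlesParam.cA0, ← mul_sub, hb, PodlesParam.gap, e1, PodlesParam.num_two]
    have e3 : (x.1.1 : ℝ) / 2 + x.1.2 / 2 + 1 = (x.1.1 + x.1.2) / 2 + 1 := by ring
    have e4 : (x.1.1 : ℝ) / 2 - x.1.2 / 2 = (x.1.1 - x.1.2) / 2 := by ring
    rw [e3, e4]
    field_simp
  rw [← Complex.ofReal_sub, PodlesParam.sc]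
  exact_mod_cast congrArg Complex.ofReal key

theorem bottSym_zero_zero : bottSym p 0 0 =
    (1 + p.sc ^ 2)⁻¹ • (algebraMap ℂ _ (p.sc ^ 2) + A p) := rfl

theorem bottSym_one_one : bottSym p 1 1 = (1 + p.sc ^ 2)⁻¹ • (1 - p.qc ^ 2 • A p) := rfl

theorem entry_bottOp_sub_diag (x : SpinIdx n.natAbs) (j : Fin 2) :
    entry (bottOp p hn true - bottOp p hn false) (x, j) (x, j) =
      ((if j = 0 then 1 else -p.q ^ 2) * p.gap n x.1.1 x.1.2 : ℝ) := by
  have h0 := p.one_add_sc_sq_ne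
  rw [bottOp_sub, entry_blockHom, Matrix.of_apply]
  fin_cases j
  · change entry (diffRep p hn (bottSym p 0 0)) x x = _
    rw [bottSym_zero_zero, map_smul, map_add, diffRep_algebraMap, zero_add, entry_smul,
      entry_diffRep_A_diag]
    simp [h0]
  · change entry (diffRep p hn (bottSym p 1 1)) x x = _
    rw [bottSym_one_one, map_smul, map_sub, diffRep_one, zero_sub, map_smul, entry_smul, entry_neg,
      entry_smul, entry_diffRep_A_diag]
    simp [PodlesParam.qc]
    field_simp

/-- The diagonal of `e_s` at weight `k`, indexed by the level and the component of `ℂ²`. -/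
noncomputable def weightDiag (n k : ℤ) (z : ℕ × Fin 2) : ℝ :=
  if |k - (2 * (z.2 : ℤ) - 1)| ≤ n.natAbs + 2 * z.1 then
    (if z.2 = 0 then 1 else -p.q ^ 2) *
      p.gap n ((n.natAbs + 2 * z.1 : ℤ) : ℝ) ((k - (2 * (z.2 : ℤ) - 1) : ℤ) : ℝ) else 0

theorem hasSum_weightDiag {k : ℤ} (hk : 2 ∣ (n.natAbs : ℤ) - 1 - k) :
    HasSum (fun z => (weightDiag p n k z : ℂ))
      (tr (weightProj spinWeight k * (bottOp p hn true - bottOp p hn false))) := by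
  have hs := ((isL1_bottOp_sub p hn).weightProj_mul spinWeight k).summable_diag.hasSum
  change HasSum _ (tr _) at hs
  -- Once the weight is fixed, m is determined by the component of ℂ², so basis vectors are labelled
  -- by level and component.
  let g : {y : SpinIdx n.natAbs × Fin 2 // spinWeight y = k} → ℕ × Fin 2 := fun y =>
    (((y.1.1.1.1 - n.natAbs) / 2).toNat, y.1.2)
  have hlev : ∀ y : {y : SpinIdx n.natAbs × Fin 2 // spinWeight y = k},
      y.1.1.1.1 = n.natAbs + 2 * ((g y).1 : ℤ) := by
    rintro ⟨⟨⟨⟨L, M⟩, h1, h2, h3, h4⟩, j⟩, hy⟩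
    simp only [g] at *
    omega
  have hwt : ∀ y : {y : SpinIdx n.natAbs × Fin 2 // spinWeight y = k},
      y.1.1.1.2 = k - (2 * ((g y).2 : ℤ) - 1) := by
    intro y
    exact eq_sub_of_add_eq y.2
  have hg : Function.Injective g := by
    intro y y' h
    have h1 := hlev y
    have h2 := hwt y
    rw [h, ← hlev y'] at h1
    rw [h, ← hwt y'] at h2
    exact Subtype.ext (Prod.ext (Subtype.ext (Prod.ext h1 h2)) (congrArg (fun z => z.2) h))
  rw [← hg.hasSum_iff]
  · have hv : Function.Injective
        (Subtype.val : {y : SpinIdx n.natAbs × Fin 2 // spinWeight y = k} → _) :=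
      Subtype.val_injective
    rw [← hv.hasSum_iff] at hs
    · refine hs.congr_fun fun y => ?_
      have h1 := hlev y
      have h2 := hwt y
      have h3 := y.1.1.2.2.2.1
      change (weightDiag p n k (g y) : ℂ) = entry _ (y.1.1, y.1.2) (y.1.1, y.1.2)
      rw [weightProj_mul_apply, if_pos y.2, entry_bottOp_sub_diag, weightDiag, if_pos, ← h1, ← h2]
      rw [← h1, ← h2]
      exact h3
    · intro y hy
      rw [weightProj_mul_apply, if_neg fun h => hy ⟨⟨y, h⟩, rfl⟩]
  -- Labels not attained have |2m| > 2l, which is where the summand was defined to be 0.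
  · intro z hz
    rw [weightDiag, if_neg, Complex.ofReal_zero]
    intro hM
    obtain ⟨i, j⟩ := z
    have h1 : SpinValid n.natAbs (n.natAbs + 2 * i) (k - (2 * (j : ℤ) - 1)) := by
      refine ⟨by omega, by omega, hM, by omega⟩
    refine hz ⟨⟨(⟨(n.natAbs + 2 * i, k - (2 * (j : ℤ) - 1)), h1⟩, j), ?_⟩, ?_⟩
    · change k - (2 * (j : ℤ) - 1) + (2 * (j : ℤ) - 1) = k
      ring
    · refine Prod.ext ?_ rfl
      change (((n.natAbs : ℤ) + 2 * i - n.natAbs) / 2).toNat = i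
      omega

/-- Summing over levels L = |n|, |n| + 2, … telescopes to the first term, because [n]/[L] → 0. That
term is [n]/[|n|] or is cut off by |k| > |n| - 1. Weights of the wrong parity do not occur at all.
-/
theorem tr_weightProj_mul_bottOp_sub (k : ℤ) :
    tr (weightProj spinWeight k * (bottOp p hn true - bottOp p hn false)) =
      if |k| ≤ n.natAbs - 1 ∧ 2 ∣ (n.natAbs : ℤ) - 1 - k then
        ((p.num n / p.num n.natAbs : ℝ) : ℂ) else 0 := by
  have ha := one_le_natAbs hn
  by_cases hk : 2 ∣ (n.natAbs : ℤ) - 1 - k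
  · have hs := (hasSum_weightDiag p hn hk).prod_fiberwise fun i => hasSum_fintype _
    have hu : ∀ i : ℕ, ∑ j : Fin 2, (weightDiag p n k (i, j) : ℂ) =
        ((p.levelGap n k (n.natAbs + 2 * i) - p.levelGap n k (n.natAbs + 2 * (i + 1 : ℕ)) : ℝ) : ℂ) := by
      intro i
      have h := p.gap_sum n (k := k) (L := n.natAbs + 2 * i) (by omega) (by omega)
      have e : (n.natAbs : ℤ) + 2 * (i + 1 : ℕ) = n.natAbs + 2 * i + 2 := by push_cast; ring
      rw [e, ← h, Fin.sum_univ_two, ← Complex.ofReal_add, weightDiag, weightDiag]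
      have e0 : k - (2 * (((0 : Fin 2) : ℕ) : ℤ) - 1) = k + 1 := by simp
      have e1 : k - (2 * (((1 : Fin 2) : ℕ) : ℤ) - 1) = k - 1 := by simp
      simp only [e0, e1, if_true, one_mul, one_ne_zero, if_false, neg_mul]
      congr 1
      split_ifs <;> ring
    simp only [hu] at hs
    have ht := hs.tendsto_sum_nat
    have ht' : Tendsto (fun K => ∑ i ∈ Finset.range K, ((p.levelGap n k (n.natAbs + 2 * i) -
        p.levelGap n k (n.natAbs + 2 * (i + 1 : ℕ)) : ℝ) : ℂ)) atTop
        (𝓝 ((p.levelGap n k n.natAbs - 0 : ℝ) : ℂ)) := by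
      have h1 := (p.tendsto_levelGap n k n.natAbs).const_sub (p.levelGap n k n.natAbs)
      have h2 := (Complex.continuous_ofReal.tendsto _).comp h1
      refine h2.congr fun K => ?_
      rw [← Complex.ofReal_sum, Finset.sum_range_sub' (fun i : ℕ => p.levelGap n k (n.natAbs + 2 * i))]
      simp
    rw [tendsto_nhds_unique ht ht', sub_zero, PodlesParam.levelGap]
    simp only [hk, and_true]
    split_ifs <;> simp
  · rw [if_neg fun h => hk h.2, tr]
    refine (tsum_congr fun y => ?_).trans tsum_zero
    rw [weightProj_mul_apply, if_neg]
    rintro rfl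
    obtain ⟨⟨⟨L, M⟩, h1, h2, h3, h4⟩, j⟩ := y
    apply hk
    change 2 ∣ (n.natAbs : ℤ) - 1 - (M + (2 * (j : ℤ) - 1))
    simp only at h1 h2 h3 h4
    omega

end Podles
end

/-! ### The pairing with ω₂ -/

section
open Ell2 SpinIdx Filter Topology

theorem hasSum_prod_of_fintype {ι κ : Type*} [Fintype κ] [DecidableEq κ] {f : ι × κ → ℂ} {s : κ → ℂ}
    (h : ∀ j, HasSum (fun x => f (x, j)) (s j)) : HasSum f (∑ j, s j) := by
  have h1 : ∀ j, HasSum (fun y : ι × κ => if y.2 = j then f y else 0) (s j) := by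
    intro j
    have hi : Function.Injective fun x : ι => (x, j) := fun x y h => congrArg Prod.fst h
    rw [← hi.hasSum_iff]
    · simpa [Function.comp_def] using h j
    · rintro ⟨x, k⟩ hx
      exact if_neg fun hk => hx ⟨x, by simp only at hk; rw [hk]⟩
  refine (hasSum_sum fun j _ => h1 j).congr_fun fun y => ?_
  simp

namespace PodlesParam
variable (p : PodlesParam)

/-- The weights of the irreducible representation of dimension `a`. -/
def irrWeights (a : ℕ) : Finset ℤ := (Finset.range a).image fun i : ℕ => 2 * (i : ℤ) - (a - 1)

theorem mem_irrWeights {a : ℕ} {k : ℤ} :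
    k ∈ irrWeights a ↔ |k| ≤ a - 1 ∧ 2 ∣ (a : ℤ) - 1 - k := by
  simp only [irrWeights, Finset.mem_image, Finset.mem_range, abs_le]
  constructor
  · rintro ⟨i, hi, rfl⟩
    omega
  · rintro ⟨⟨h1, h2⟩, h3⟩
    exact ⟨((k + (a - 1)) / 2).toNat, by omega, by omega⟩

/-- The character of an irreducible representation; after multiplication by q - q⁻¹ the geometric
sum telescopes. -/
theorem sum_irrWeights (a : ℕ) : ∑ k ∈ irrWeights a, p.qc ^ (-k) = (p.num a : ℂ) := by
  have hq := p.qc_ne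
  have h1 : p.qc - p.qc⁻¹ ≠ 0 := p.qc_sub_ne
  rw [irrWeights, Finset.sum_image fun i _ j _ h => by simpa using h, num, qNum, Real.rpow_neg p.q_pos.le,
    Real.rpow_natCast]
  push_cast
  change _ = (p.qc ^ a - (p.qc ^ a)⁻¹) / (p.qc - p.qc⁻¹)
  rw [eq_div_iff h1, Finset.sum_mul]
  have h2 : ∀ i : ℕ, p.qc ^ (-(2 * (i : ℤ) - (a - 1))) * (p.qc - p.qc⁻¹) =
      p.qc ^ ((a : ℤ) - 2 * (i : ℕ)) - p.qc ^ ((a : ℤ) - 2 * (i + 1 : ℕ)) := by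
    intro i
    have e1 : (a : ℤ) - 2 * (i : ℕ) = -(2 * (i : ℤ) - (a - 1)) + 1 := by ring
    have e2 : (a : ℤ) - 2 * (i + 1 : ℕ) = -(2 * (i : ℤ) - (a - 1)) - 1 := by push_cast; ring
    rw [e1, e2, zpow_add_one₀ hq, zpow_sub_one₀ hq]
    ring
  simp only [h2]
  rw [Finset.sum_range_sub' (fun i : ℕ => p.qc ^ ((a : ℤ) - 2 * (i : ℕ)))]
  have e3 : (a : ℤ) - 2 * (a : ℕ) = -(a : ℕ) := by ring
  rw [e3, zpow_neg]
  simp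

end PodlesParam

namespace Podles
variable (p : PodlesParam) {n : ℤ} (hn : n ≠ 0)

theorem tr_weightProj_eq_zero {k : ℤ} (hk : k ∉ PodlesParam.irrWeights n.natAbs) :
    tr (weightProj spinWeight k * (bottOp p hn true - bottOp p hn false)) = 0 := by
  rw [tr_weightProj_mul_bottOp_sub, if_neg fun h => hk (PodlesParam.mem_irrWeights.2 h)]

/-- Every weight of the irreducible representation contributes the same sign [n]/[|n|], and the
character supplies [|n|]. -/
theorem sum_weight_tr : ∑ k ∈ PodlesParam.irrWeights n.natAbs, p.qc ^ (-k) *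
    tr (weightProj spinWeight k * (bottOp p hn true - bottOp p hn false)) = (qNum p.q n : ℂ) := by
  have ha := one_le_natAbs hn
  have h0 : p.num n.natAbs ≠ 0 := (p.num_pos (by exact_mod_cast ha)).ne'
  have h1 : ∀ k ∈ PodlesParam.irrWeights n.natAbs, p.qc ^ (-k) *
      tr (weightProj spinWeight k * (bottOp p hn true - bottOp p hn false)) =
      p.qc ^ (-k) * ((p.num n / p.num n.natAbs : ℝ) : ℂ) := fun k hk => by
    rw [tr_weightProj_mul_bottOp_sub, if_pos (PodlesParam.mem_irrWeights.1 hk)]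
  rw [Finset.sum_congr rfl h1, ← Finset.sum_mul, p.sum_irrWeights, ← Complex.ofReal_mul,
    mul_div_cancel₀ _ h0]
  rfl

/-- T³ = T - S²T, and the trace of S²T vanishes at each weight because S anticommutes with T. This
equates the pairing, cubic in T, with the index, linear in T. -/
theorem tr_weightProj_mul_cube (k : ℤ) :
    tr (weightProj spinWeight k * ((bottOp p hn true - bottOp p hn false) *
      (bottOp p hn true - bottOp p hn false) * (bottOp p hn true - bottOp p hn false))) =
    tr (weightProj spinWeight k * (bottOp p hn true - bottOp p hn false)) := by
  have h := isWeightedProjPair_bottOp p hn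
  set P := bottOp p hn true
  set Q := bottOp p hn false
  have h1 : (P - Q) * (P - Q) = 1 - (1 - P - Q) * (1 - P - Q) :=
    eq_sub_of_add_eq' (IsIdempotentElem.compl_sq_add h.mul_self_left h.mul_self_right)
  have h2 : (P - Q) * (P - Q) * (P - Q) = (P - Q) - (1 - P - Q) * ((1 - P - Q) * (P - Q)) := by
    rw [h1, sub_mul, one_mul, mul_assoc]
  have h3 : IsL1 ((1 - P - Q) * ((1 - P - Q) * (P - Q))) := by
    have h4 : (1 - P - Q) * ((1 - P - Q) * (P - Q)) = (P - Q) - (P - Q) * (P - Q) * (P - Q) := by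
      rw [h2, sub_sub_cancel]
    rw [h4]
    exact h.isL1.sub (h.isL1.sandwich h.isL1 _)
  rw [h2, mul_sub, tr_sub (h.isL1.weightProj_mul _ k) (h3.weightProj_mul _ k),
    h.tr_weightProj_mul_mul_compl_sq, sub_zero]

/-- The matrix of differences of the entries of the self-adjoint form of `e_s`. -/
noncomputable def diffMat : Matrix (Fin 2) (Fin 2)
    (Ell2 (SpinIdx n.natAbs) →L[ℂ] Ell2 (SpinIdx n.natAbs)) :=
  Matrix.of fun j k => diffRep p hn (bottSym p j k)

theorem diffRep_gammaS (j k : Fin 2) : diffRep p hn (gammaS p j k) =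
    (2 * (conjWeight p k * (conjWeight p j)⁻¹)) • diffMat p hn j k := by
  have h1 := conjWeight_ne p j
  have h2 := conjWeight_ne p k
  rw [gammaS_eq, map_sub, diffRep_algebraMap, sub_zero, map_smul, diffMat, Matrix.of_apply,
    bottSym_eq, map_smul, smul_smul]
  congr 1
  field_simp

theorem diffRep_one_matrix (j k : Fin 2) :
    diffRep p hn ((1 : Matrix (Fin 2) (Fin 2) (Podles p)) j k) = 0 := by
  rw [Matrix.one_apply]
  split_ifs
  · exact diffRep_one p hn
  · exact map_zero _

/-- D annihilates scalars, so 1 ± γ_s contribute ±D(γ_s), and γ_s = 2e_s - 1 gives 2³ against the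
factor ⅛. The conjugating weights cancel around the cycle of indices, and the sign comes from 1 -
γ_s. -/
theorem diffTriple_omega₂ : diffTriple p hn (omega₂ p) =
    -∑ j, eta p j j • (diffMat p hn * diffMat p hn * diffMat p hn) j j := by
  have h1 : ∀ j k l, diffTriple p hn (hochThree p (gammaS p j k) ((1 + gammaS p) k l)
      ((1 - gammaS p) l j)) =
      (-8 : ℂ) • (diffMat p hn j k * diffMat p hn k l * diffMat p hn l j) := by
    intro j k l
    rw [hochThree, diffTriple_tprod]
    change diffRep p hn (gammaS p j k) * diffRep p hn ((1 + gammaS p) k l) *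
      diffRep p hn ((1 - gammaS p) l j) = _
    rw [Matrix.add_apply, Matrix.sub_apply, map_add, map_sub, diffRep_one_matrix, diffRep_one_matrix,
      zero_add, zero_sub, diffRep_gammaS, diffRep_gammaS, diffRep_gammaS, smul_mul_smul_comm, mul_neg,
      smul_mul_smul_comm, ← neg_smul]
    congr 1
    have := conjWeight_ne p j
    have := conjWeight_ne p k
    have := conjWeight_ne p l
    field_simp
    norm_num
  have h2 : ∀ j, (diffMat p hn * diffMat p hn * diffMat p hn) j j =
      ∑ k, ∑ l, diffMat p hn j k * diffMat p hn k l * diffMat p hn l j := by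
    intro j
    rw [Matrix.mul_apply, Finset.sum_comm]
    refine Finset.sum_congr rfl fun l _ => ?_
    rw [Matrix.mul_apply, Finset.sum_mul]
  rw [omega₂_eq, map_smul]
  simp only [map_sum, map_smul, h1, h2, Finset.smul_sum]
  rw [← Finset.sum_neg_distrib]
  refine Finset.sum_congr rfl fun j _ => ?_
  rw [← Finset.sum_neg_distrib]
  refine Finset.sum_congr rfl fun k _ => ?_
  rw [← Finset.sum_neg_distrib]
  refine Finset.sum_congr rfl fun l _ => ?_
  module

theorem hasDecay_diffMat_cube (j k : Fin 2) :
    HasDecay (scale p) 6 ((diffMat p hn * diffMat p hn * diffMat p hn) j k) := by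
  have h : ∀ j k l m, HasDecay (scale p) 6
      (diffMat p hn j k * diffMat p hn k l * diffMat p hn l m) := fun j k l m =>
    HasDecay.mul (k := 4) (k' := 2) (scale_pos p) (HasDecay.mul (k := 2) (k' := 2) (scale_pos p) (hasDecay_diffRep p hn _)
      (hasDecay_diffRep p hn _)) (hasDecay_diffRep p hn _)
  simp only [Matrix.mul_apply, Fin.sum_univ_two, add_mul]
  exact ((h _ _ _ _).add (h _ _ _ _)).add ((h _ _ _ _).add (h _ _ _ _))

/-- The pairing is a convergent sum of q^{-ν} times the diagonal of T³. Grouped by weight, T³ may be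
replaced by T, after which only finitely many weights contribute. -/
theorem chern_omega₂ : chern p n (spinRep p hn) (omega₂ p) = (qNum p.q n : ℂ) := by
  have hq := p.qc_ne
  set T := bottOp p hn true - bottOp p hn false with hT
  have hd : ∀ x j, entry (T * T * T) (x, j) (x, j) =
      entry ((diffMat p hn * diffMat p hn * diffMat p hn) j j) x x := by
    intro x j
    rw [hT, bottOp_sub, ← map_mul, ← map_mul, entry_blockHom]
    rfl
  have hw : ∀ (x : SpinIdx n.natAbs) j, p.qc ^ (-spinWeight (x, j)) = eta p j j * weight p x := by
    intro x j
    have e : p.qc ^ (-spinWeight (x, j)) = p.qc ^ (1 - 2 * (j : ℤ)) * p.qc ^ (-x.1.2) := by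
      rw [← zpow_add₀ hq]
      congr 1
      change -(x.1.2 + (2 * (j : ℤ) - 1)) = _
      ring
    rw [e]
    congr 1
    fin_cases j
    · simp [eta]
    · simp [eta]
  have h1 : HasSum (fun y : SpinIdx n.natAbs × Fin 2 => p.qc ^ (-spinWeight y) * entry (T * T * T) y y)
      (chern p n (spinRep p hn) (omega₂ p)) := by
    have h2 : ∀ j, HasSum (fun x : SpinIdx n.natAbs =>
        p.qc ^ (-spinWeight (x, j)) * entry (T * T * T) (x, j) (x, j))
        (eta p j j * wtr p ((diffMat p hn * diffMat p hn * diffMat p hn) j j)) := by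
      intro j
      refine ((summable_weight_diag (hasDecay_diffMat_cube p hn j j)).hasSum.mul_left
        (eta p j j)).congr_fun fun x => ?_
      rw [hw, hd, mul_assoc]
    have h3 : chern p n (spinRep p hn) (omega₂ p) =
        ∑ j, eta p j j * wtr p ((diffMat p hn * diffMat p hn * diffMat p hn) j j) := by
      rw [chern_spinRep, diffTriple_omega₂, wtr_neg, neg_neg, Fin.sum_univ_two, Fin.sum_univ_two,
        wtr_add ((hasDecay_diffMat_cube p hn _ _).smul _) ((hasDecay_diffMat_cube p hn _ _).smul _),
        wtr_smul, wtr_smul]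
    rw [h3]
    exact hasSum_prod_of_fintype h2
  -- On each fibre q^{-ν} is constant, so an ordinary trace on a weight space remains. Replacing T³
  -- by T before this regrouping would need a weighted summability of T that is not established.
  have h4 := h1.tsum_fiberwise (spinWeight (a := n.natAbs))
  have h5 : ∀ k : ℤ, ∑' y : (spinWeight (a := n.natAbs)) ⁻¹' {k},
      p.qc ^ (-spinWeight y.1) * entry (T * T * T) y.1 y.1 =
      p.qc ^ (-k) * tr (weightProj spinWeight k * T) := by
    intro k
    rw [hT, ← tr_weightProj_mul_cube, ← hT, tr, ← tsum_mul_left,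
      tsum_subtype ((spinWeight (a := n.natAbs)) ⁻¹' {k})
        fun y => p.qc ^ (-spinWeight y) * entry (T * T * T) y y]
    refine tsum_congr fun y => ?_
    rw [weightProj_mul_apply, Set.indicator]
    by_cases hy : spinWeight y = k
    · rw [if_pos (show y ∈ spinWeight ⁻¹' {k} from hy), if_pos hy, hy]
    · rw [if_neg (show y ∉ spinWeight ⁻¹' {k} from hy), if_neg hy, mul_zero]
  simp only [h5] at h4
  rw [← sum_weight_tr p hn]
  refine h4.unique (hasSum_sum_of_ne_finset_zero fun k hk => ?_)
  rw [hT, tr_weightProj_eq_zero p hn hk, mul_zero]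

end Podles
end

/-! ### The q-index -/

section
theorem trace_conj_symm {V W : Type*} [AddCommMonoid V] [Module ℂ V] [AddCommMonoid W]
    [Module ℂ W] (e : V ≃ₗ[ℂ] W) (f : Module.End ℂ W) :
    LinearMap.trace ℂ V (e.symm.conj f) = LinearMap.trace ℂ W f := by
  let _ : AddCommGroup V := Module.addCommMonoidToAddCommGroup ℂ
  let _ : AddCommGroup W := Module.addCommMonoidToAddCommGroup ℂ
  exact LinearMap.trace_conj' f e.symm

open Ell2 SpinIdx

namespace Podles

section
variable (p : PodlesParam) {n : ℤ}

/-- The component of label `b` of `ℋ ⊗ ℂ²`, rescaled such that `e_s` becomes self-adjoint. -/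
noncomputable def compProj (b : Bool) : SpinorSpace₂ n →ₗ[ℂ] Ell2 (SpinIdx n.natAbs × Fin 2) :=
  ∑ j, conjWeight p j • ((blockIncl j).toLinearMap ∘ₗ (blockProj b).toLinearMap ∘ₗ LinearMap.proj j)

/-- The embedding of the component of label `b` into `ℋ ⊗ ℂ²`. -/
noncomputable def compIncl (b : Bool) : Ell2 (SpinIdx n.natAbs × Fin 2) →ₗ[ℂ] SpinorSpace₂ n :=
  LinearMap.pi fun j => (conjWeight p j)⁻¹ • ((blockIncl b).toLinearMap ∘ₗ (blockProj j).toLinearMap)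

theorem compProj_apply (b : Bool) (v : SpinorSpace₂ n) (x : SpinIdx n.natAbs) (j : Fin 2) :
    compProj p b v (x, j) = conjWeight p j * v j (x, b) := by
  have h : compProj p b v = ∑ k, conjWeight p k • blockIncl k (blockProj b (v k)) := by
    rw [compProj, LinearMap.sum_apply]
    rfl
  rw [h, lp.coeFn_sum, Finset.sum_apply, Finset.sum_eq_single j]
  · rw [lp.coeFn_smul, Pi.smul_apply, blockIncl_apply, if_pos rfl, blockProj_apply, smul_eq_mul]
  · intro k _ hk
    rw [lp.coeFn_smul, Pi.smul_apply, blockIncl_apply, if_neg (Ne.symm hk), smul_zero]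
  · simp

theorem compIncl_apply (b : Bool) (w : Ell2 (SpinIdx n.natAbs × Fin 2)) (x : SpinIdx n.natAbs)
    (c : Bool) (j : Fin 2) :
    compIncl p b w j (x, c) = if c = b then (conjWeight p j)⁻¹ * w (x, j) else 0 := by
  have h : compIncl p b w j = (conjWeight p j)⁻¹ • blockIncl b (blockProj j w) := rfl
  rw [h, lp.coeFn_smul, Pi.smul_apply, blockIncl_apply, blockProj_apply, smul_eq_mul, mul_ite, mul_zero]

theorem compProj_compIncl (b c : Bool) (w : Ell2 (SpinIdx n.natAbs × Fin 2)) :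
    compProj p c (compIncl p b w) = if c = b then w else 0 := by
  ext ⟨x, j⟩
  have := conjWeight_ne p j
  rw [compProj_apply, compIncl_apply]
  split_ifs
  · field_simp
  · exact mul_zero _

theorem ext_compProj {v w : SpinorSpace₂ n} (h : ∀ b, compProj p b v = compProj p b w) : v = w := by
  funext j
  ext ⟨x, b⟩
  have h1 := congrArg (fun u => u (x, j)) (h b)
  simp only [compProj_apply] at h1
  exact mul_left_cancel₀ (conjWeight_ne p j) h1

theorem compProj_spinF₂ (b : Bool) (v : SpinorSpace₂ n) :
    compProj p b (spinF₂ n v) = compProj p (!b) v := by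
  ext ⟨x, j⟩
  rw [compProj_apply, compProj_apply]
  exact congrArg (conjWeight p j * ·) (spinF_apply n (v j) x b)

theorem compProj_spinGamma₂ (b : Bool) (v : SpinorSpace₂ n) :
    compProj p b (spinGamma₂ n v) = if b then compProj p b v else -compProj p b v := by
  ext ⟨x, j⟩
  have h := congrArg (conjWeight p j * ·) (spinGamma_apply n (v j) x b)
  rw [compProj_apply]
  cases b
  · refine h.trans ?_
    change _ = -(compProj p false v (x, j))
    rw [compProj_apply]
    exact mul_neg _ _
  · refine h.trans ?_
    change _ = compProj p true v (x, j)
    rw [compProj_apply]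
    rfl

theorem conj_kWeight (x : SpinIdx n.natAbs) (b : Bool) (j : Fin 2) :
    eta p j j * kWeight p (x, b) = p.qc ^ (-spinWeight (x, j)) := by
  have e : p.qc ^ (-spinWeight (x, j)) = p.qc ^ (1 - 2 * (j : ℤ)) * p.qc ^ (-x.1.2) := by
    rw [← zpow_add₀ p.qc_ne]
    congr 1
    change -(x.1.2 + (2 * (j : ℤ) - 1)) = _
    ring
  rw [e]
  congr 1
  fin_cases j <;> simp [eta]

/-- In rescaled coordinates K⁻²η is multiplication by q^{-ν} on either component, so its maximal
domain can be handled coordinatewise. -/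
theorem kEta_iff (v w : SpinorSpace₂ n) : KEta p v w ↔
    ∀ b y, compProj p b w y = p.qc ^ (-spinWeight y) * compProj p b v y := by
  constructor
  · rintro h b ⟨x, j⟩
    rw [compProj_apply, compProj_apply, h j (x, b), conj_kWeight]
    ring
  · rintro h j ⟨x, b⟩
    have h1 := h b (x, j)
    rw [compProj_apply, compProj_apply] at h1
    rw [conj_kWeight]
    refine mul_left_cancel₀ (conjWeight_ne p j) ?_
    rw [h1]
    ring

end

section
variable (p : PodlesParam) {n : ℤ} (hn : n ≠ 0)

/-- The rescaling by diag(1, q) intertwines `e_s` with its self-adjoint form, which makes the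
Hilbert space results on projections applicable. -/
theorem compProj_matOp (b : Bool) (v : SpinorSpace₂ n) :
    compProj p b (matOp p n (spinRep p hn) (bott p) v) = bottOp p hn b (compProj p b v) := by
  have hv : ∀ k, blockProj k (compProj p b v) = conjWeight p k • blockProj b (v k) := by
    intro k
    ext x
    rw [blockProj_apply, compProj_apply, lp.coeFn_smul, Pi.smul_apply, blockProj_apply, smul_eq_mul]
  refine ext_blockProj fun j => ?_
  rw [bottOp, blockProj_blockHom]
  have hm : matOp p n (spinRep p hn) (bott p) v j = ∑ k, spinRep p hn (bott p j k) (v k) := by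
    rw [matOp, LinearMap.pi_apply, LinearMap.sum_apply]
    rfl
  have hw : blockProj j (compProj p b (matOp p n (spinRep p hn) (bott p) v)) =
      conjWeight p j • blockProj b (matOp p n (spinRep p hn) (bott p) v j) := by
    ext x
    rw [blockProj_apply, compProj_apply, lp.coeFn_smul, Pi.smul_apply, blockProj_apply, smul_eq_mul]
  rw [hw, hm, map_sum, Finset.smul_sum]
  refine Finset.sum_congr rfl fun k _ => ?_
  rw [blockProj_spinRep, hv, map_smul]
  change _ = conjWeight p k • (compRep p hn b (bottSym p j k)) _
  have := conjWeight_ne p k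
  rw [bottSym_eq, map_smul]
  change _ = conjWeight p k • ((conjWeight p j * (conjWeight p k)⁻¹) • compRep p hn b (bott p j k) _)
  rw [smul_smul]
  congr 1
  field_simp

theorem mem_chiralPlus {v : SpinorSpace₂ n} : v ∈ chiralPlus p n (spinRep p hn) (bott p) ↔
    compProj p false v = 0 ∧ bottOp p hn true (compProj p true v) = compProj p true v := by
  constructor
  · rintro ⟨u, rfl⟩
    simp only [LinearMap.comp_apply, LinearMap.smul_apply, LinearMap.add_apply, LinearMap.id_apply,
      map_smul, map_add, compProj_spinGamma₂, compProj_matOp, if_true]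
    refine ⟨by simp, ?_⟩
    change (1 / 2 : ℂ) • ((bottOp p hn true * bottOp p hn true) _ +
      (bottOp p hn true * bottOp p hn true) _) = _
    rw [bottOp_mul_self]
  · rintro ⟨h1, h2⟩
    refine ⟨v, ext_compProj p fun b => ?_⟩
    simp only [LinearMap.comp_apply, LinearMap.smul_apply, LinearMap.add_apply, LinearMap.id_apply,
      map_smul, map_add, compProj_spinGamma₂, compProj_matOp]
    cases b
    · simp [h1]
    · simp only [if_true, h2]
      module

theorem mem_chiralMinus {v : SpinorSpace₂ n} : v ∈ chiralMinus p n (spinRep p hn) (bott p) ↔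
    compProj p true v = 0 ∧ bottOp p hn false (compProj p false v) = compProj p false v := by
  constructor
  · rintro ⟨u, rfl⟩
    simp only [LinearMap.comp_apply, LinearMap.smul_apply, LinearMap.sub_apply, LinearMap.id_apply,
      map_smul, map_sub, compProj_spinGamma₂, compProj_matOp, if_true]
    refine ⟨by simp, ?_⟩
    simp only [Bool.false_eq_true, if_false, map_neg, sub_neg_eq_add]
    change (1 / 2 : ℂ) • ((bottOp p hn false * bottOp p hn false) _ +
      (bottOp p hn false * bottOp p hn false) _) = _
    rw [bottOp_mul_self]
  · rintro ⟨h1, h2⟩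
    refine ⟨v, ext_compProj p fun b => ?_⟩
    simp only [LinearMap.comp_apply, LinearMap.smul_apply, LinearMap.sub_apply, LinearMap.id_apply,
      map_smul, map_sub, compProj_spinGamma₂, compProj_matOp]
    cases b
    · simp only [Bool.false_eq_true, if_false, h2]
      module
    · simp [h1]

theorem compProj_indexOp_false (v : SpinorSpace₂ n) :
    compProj p false (indexOp p n (spinRep p hn) (bott p) v) =
      bottOp p hn false (bottOp p hn true (compProj p true v)) := by
  simp only [indexOp, LinearMap.comp_apply, LinearMap.smul_apply, LinearMap.sub_apply,
    LinearMap.add_apply, LinearMap.id_apply, map_smul, map_sub, map_add, compProj_spinGamma₂,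
    compProj_matOp, compProj_spinF₂, Bool.not_false, if_true, Bool.false_eq_true, if_false]
  module

theorem compProj_FePlus (v : chiralPlus p n (spinRep p hn) (bott p)) :
    compProj p false (FePlus p n (spinRep p hn) (bott p) v).1 =
      bottOp p hn false (compProj p true v.1) := by
  change compProj p false (indexOp p n (spinRep p hn) (bott p) v.1) = _
  rw [compProj_indexOp_false, ((mem_chiralPlus p hn).1 v.2).2]

/-- With ℋ'_+ = ran P and ℋ'_- = ran Q, the operator is Q restricted to ran P; the factors 2 from 1
± γ offset ¼. -/
theorem FePlus_eq_iff (v : chiralPlus p n (spinRep p hn) (bott p))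
    (w : chiralMinus p n (spinRep p hn) (bott p)) :
    FePlus p n (spinRep p hn) (bott p) v = w ↔
      bottOp p hn false (compProj p true v.1) = compProj p false w.1 := by
  rw [← compProj_FePlus]
  constructor
  · intro h
    rw [h]
  · intro h
    refine Subtype.ext (ext_compProj p fun b => ?_)
    cases b
    · exact h
    · rw [((mem_chiralMinus p hn).1 w.2).1, ((mem_chiralMinus p hn).1 (Subtype.property _)).1]

/-- The kernel of `F^+_e` as a space of fixed vectors. -/
noncomputable def kerEquiv : LinearMap.ker (FePlus p n (spinRep p hn) (bott p)) ≃ₗ[ℂ]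
    IsProjPair.fixed (bottOp p hn true) (bottOp p hn false) :=
  LinearEquiv.ofBijective
    ((compProj p true ∘ₗ Submodule.subtype _ ∘ₗ Submodule.subtype _).codRestrict _ fun v => by
      have h := (FePlus_eq_iff p hn v.1 0).1 v.2
      rw [(isProjPair_bottOp p hn).mem_fixed]
      refine ⟨((mem_chiralPlus p hn).1 v.1.2).2, h.trans (map_zero _)⟩) (by
    constructor
    · rintro ⟨⟨v, hv⟩, hv'⟩ ⟨⟨w, hw⟩, hw'⟩ h
      have h1 : compProj p true v = compProj p true w := congrArg Subtype.val h
      refine Subtype.ext (Subtype.ext (ext_compProj p fun b => ?_))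
      cases b
      · exact ((mem_chiralPlus p hn).1 hv).1.trans ((mem_chiralPlus p hn).1 hw).1.symm
      · exact h1
    · rintro ⟨u, hu⟩
      obtain ⟨h1, h2⟩ := (isProjPair_bottOp p hn).mem_fixed.1 hu
      have e1 : compProj p true (compIncl p true u) = u := by rw [compProj_compIncl, if_pos rfl]
      have e2 : compProj p false (compIncl p true u) = 0 := by
        rw [compProj_compIncl, if_neg Bool.false_ne_true]
      refine ⟨⟨⟨compIncl p true u, (mem_chiralPlus p hn).2 ⟨e2, by rw [e1, h1]⟩⟩, ?_⟩,
        Subtype.ext e1⟩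
      refine (FePlus_eq_iff p hn _ 0).2 ?_
      change bottOp p hn false (compProj p true (compIncl p true u)) = compProj p false 0
      rw [e1, h2, map_zero])

theorem coe_kerEquiv (v : LinearMap.ker (FePlus p n (spinRep p hn) (bott p))) :
    (kerEquiv p hn v : Ell2 (SpinIdx n.natAbs × Fin 2)) = compProj p true v.1.1 := rfl

/-- The projection of `ℋ'_-` to the fixed vectors that represent the cokernel. -/
noncomputable def cokerMap : chiralMinus p n (spinRep p hn) (bott p) →ₗ[ℂ]
    IsProjPair.fixed (bottOp p hn false) (bottOp p hn true) :=
  ((IsProjPair.proj (bottOp p hn false) (bottOp p hn true)).toLinearMap ∘ₗ compProj p false ∘ₗ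
    Submodule.subtype _).codRestrict _ fun _ => IsProjPair.proj_apply_mem _

theorem coe_cokerMap (v : chiralMinus p n (spinRep p hn) (bott p)) :
    (cokerMap p hn v : Ell2 (SpinIdx n.natAbs × Fin 2)) =
      IsProjPair.proj (bottOp p hn false) (bottOp p hn true) (compProj p false v.1) := rfl

/-- By `mem_image_iff` the range of Q on ran P is the part of ran Q orthogonal to ran Q ∩ ker P. So
this orthogonal projection represents the cokernel. -/
theorem ker_cokerMap :
    LinearMap.range (FePlus p n (spinRep p hn) (bott p)) = LinearMap.ker (cokerMap p hn) := by
  ext w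
  have h0 : w ∈ LinearMap.ker (cokerMap p hn) ↔
      IsProjPair.proj (bottOp p hn false) (bottOp p hn true) (compProj p false w.1) = 0 :=
    Subtype.ext_iff
  rw [h0, ← (isProjPair_bottOp p hn).mem_image_iff ((mem_chiralMinus p hn).1 w.2).2]
  constructor
  · rintro ⟨v, rfl⟩
    exact ⟨_, ((mem_chiralPlus p hn).1 v.2).2, (compProj_FePlus p hn v).symm⟩
  · rintro ⟨u, h1, h2⟩
    have e1 : compProj p true (compIncl p true u) = u := by rw [compProj_compIncl, if_pos rfl]
    have e2 : compProj p false (compIncl p true u) = 0 := by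
      rw [compProj_compIncl, if_neg Bool.false_ne_true]
    refine ⟨⟨compIncl p true u, (mem_chiralPlus p hn).2 ⟨e2, by rw [e1, h1]⟩⟩, ?_⟩
    rw [FePlus_eq_iff]
    change bottOp p hn false (compProj p true (compIncl p true u)) = _
    rw [e1, h2]

/-- The fixed vectors of `Q - P` as elements of `ℋ'_-`. -/
noncomputable def fixedIncl (u : IsProjPair.fixed (bottOp p hn false) (bottOp p hn true)) :
    chiralMinus p n (spinRep p hn) (bott p) :=
  ⟨compIncl p false u.1, (mem_chiralMinus p hn).2 (by
    rw [compProj_compIncl, compProj_compIncl, if_neg (by decide), if_pos rfl]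
    exact ⟨rfl, ((isProjPair_bottOp p hn).symm.mem_fixed.1 u.2).1⟩)⟩

theorem compProj_false_fixedIncl (u : IsProjPair.fixed (bottOp p hn false) (bottOp p hn true)) :
    compProj p false (fixedIncl p hn u).1 = u := by
  change compProj p false (compIncl p false u.1) = u
  rw [compProj_compIncl, if_pos rfl]

theorem cokerMap_fixedIncl (u : IsProjPair.fixed (bottOp p hn false) (bottOp p hn true)) :
    cokerMap p hn (fixedIncl p hn u) = u := by
  refine Subtype.ext ?_
  rw [coe_cokerMap, compProj_false_fixedIncl]
  exact IsProjPair.proj_eq_self.2 u.2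

/-- The cokernel of `F^+_e` as a space of fixed vectors. -/
noncomputable def cokerEquiv : (chiralMinus p n (spinRep p hn) (bott p) ⧸
    LinearMap.range (FePlus p n (spinRep p hn) (bott p))) ≃ₗ[ℂ]
    IsProjPair.fixed (bottOp p hn false) (bottOp p hn true) :=
  (Submodule.quotEquivOfEq _ _ (ker_cokerMap p hn)).trans
    ((cokerMap p hn).quotKerEquivOfSurjective fun u => ⟨_, cokerMap_fixedIncl p hn u⟩)

theorem cokerEquiv_mkQ (v : chiralMinus p n (spinRep p hn) (bott p)) :
    cokerEquiv p hn ((LinearMap.range (FePlus p n (spinRep p hn) (bott p))).mkQ v) =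
      cokerMap p hn v := rfl

/-- Kernel and cokernel are transported to the fixed spaces of P - Q and Q - P, where K⁻²η acts as
q^{-ν}; the difference of traces is the weighted sum of tr(W_k T). -/
theorem hasQIndex_bott : HasQIndex p n (spinRep p hn) (bott p) (qNum p.q n) := by
  have hpair := isWeightedProjPair_bottOp p hn
  have := hpair.finiteDimensional_fixed
  have := hpair.symm.finiteDimensional_fixed
  refine ⟨Module.Finite.equiv (kerEquiv p hn).symm, Module.Finite.equiv (cokerEquiv p hn).symm, ?_⟩
  obtain ⟨S, S', hS, hS', htr⟩ := hpair.exists_index (fun k => p.qc ^ (-k))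
    (M₀ := PodlesParam.irrWeights n.natAbs) fun k hk => tr_weightProj_eq_zero p hn hk
  refine ⟨(kerEquiv p hn).symm.conj S, (cokerEquiv p hn).symm.conj S', fun v => ?_, fun x => ?_,
    fun v w h => ?_, ?_⟩
  · rw [kEta_iff]
    intro b y
    cases b
    · rw [((mem_chiralPlus p hn).1 (Subtype.property _)).1, ((mem_chiralPlus p hn).1 v.1.2).1]
      exact (mul_zero _).symm
    · rw [← coe_kerEquiv, ← coe_kerEquiv, LinearEquiv.conj_apply_apply, LinearEquiv.apply_symm_apply]
      exact hS _ y
  -- Each class has a representative among the fixed vectors. These involve finitely many weights,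
  -- hence lie in the domain of K⁻²η.
  · refine ⟨fixedIncl p hn (cokerEquiv p hn x), fixedIncl p hn (S' (cokerEquiv p hn x)), ?_, ?_⟩
    · apply (cokerEquiv p hn).injective
      rw [cokerEquiv_mkQ, cokerMap_fixedIncl]
    · rw [kEta_iff]
      intro b y
      cases b
      · rw [compProj_false_fixedIncl, compProj_false_fixedIncl]
        exact hS' _ y
      · rw [((mem_chiralMinus p hn).1 (Subtype.property _)).1,
          ((mem_chiralMinus p hn).1 (Subtype.property _)).1]
        exact (mul_zero _).symm
  -- The induced operator does not depend on the representative, because the projection onto the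
  -- fixed vectors commutes with multiplication by q^{-ν}.
  · apply (cokerEquiv p hn).injective
    rw [LinearEquiv.conj_apply_apply, LinearEquiv.apply_symm_apply, LinearEquiv.symm_symm,
      cokerEquiv_mkQ, cokerEquiv_mkQ]
    refine Subtype.ext ?_
    ext y
    rw [hS', coe_cokerMap, coe_cokerMap]
    exact (hpair.symm.proj_apply_of_weight (fun k => p.qc ^ (-k)) ((kEta_iff p _ _).1 h false) y).symm
  · have h1 : LinearMap.trace ℂ _ ((kerEquiv p hn).symm.conj S) = LinearMap.trace ℂ _ S :=
      trace_conj_symm (kerEquiv p hn) S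
    have h2 : LinearMap.trace ℂ _ ((cokerEquiv p hn).symm.conj S') = LinearMap.trace ℂ _ S' :=
      trace_conj_symm (cokerEquiv p hn) S'
    exact ((congrArg₂ (· - ·) h1 h2).trans (htr.trans (sum_weight_tr p hn))).symm

end
end Podles
end

/-! ### Nonvanishing of the class of ω₂ -/

namespace Podles
variable (p : PodlesParam)

theorem omega₂_mem_twistedCycles : omega₂ p ∈ twistedCycles (modular p) 2 :=
  ⟨omega₂_mem_twistedChains p, hochBoundary_omega₂ p⟩

/-- The class of `ω₂` is detected by its pairing with the Chern character. -/
theorem mk_omega₂_ne_zero {n : ℤ} (hn : n ≠ 0) :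
    (Submodule.Quotient.mk ⟨omega₂ p, omega₂_mem_twistedCycles p⟩ :
      TwistedHH (modular p) 2) ≠ 0 := by
  intro h
  -- That ξ is κ-invariant is not needed, since the character vanishes on the boundary of every
  -- chain.
  obtain ⟨ξ, -, hξ⟩ := (Submodule.Quotient.mk_eq_zero _).1 h
  have hξ' : hochBoundary (modular p) 2 ξ = omega₂ p := hξ
  have h0 : chern p n (spinRep p hn) (omega₂ p) = 0 := by
    rw [chern_spinRep, ← hξ', wtr_diffTriple_hochBoundary, neg_zero]
  rw [chern_omega₂, Complex.ofReal_eq_zero] at h0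
  change p.num n = 0 at h0
  rcases hn.lt_or_gt with hlt | hgt
  · refine (p.num_pos (neg_pos.2 (Int.cast_lt_zero.2 hlt))).ne' ?_
    rw [p.num_neg, h0, neg_zero]
  · exact (p.num_pos (Int.cast_pos.2 hgt)).ne' h0

/-- Any nonzero label detects the class; n = 1, that is N = 1/2, is taken. -/
theorem two_le_twistedHochschildDim : 2 ≤ twistedHochschildDim (modular p) :=
  le_iSup₂ (f := fun (k : ℕ) (_ : k ∈ {k : ℕ | Nontrivial (TwistedHH (modular p) k)}) => (k : ℕ∞))
    2 (nontrivial_of_ne _ _ (mk_omega₂_ne_zero p one_ne_zero))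

end Podles

theorem lemma6p27 (p : PodlesParam) (n : ℤ) (hn : n ≠ 0) :
    -- `ω₂` is invariant under `U_q(su(2))`
    (∀ h : Uq p, Uq.actTensor p h (Podles.omega₂ p) = Uq.counit p h • Podles.omega₂ p) ∧
    -- `ω₂` is a twisted 2-cycle, its class is not zero, and there is no dimension drop
    (∃ hω : Podles.omega₂ p ∈ twistedCycles (Podles.modular p) 2,
      (Submodule.Quotient.mk ⟨Podles.omega₂ p, hω⟩ : TwistedHH (Podles.modular p) 2) ≠ 0) ∧
    2 ≤ twistedHochschildDim (Podles.modular p) ∧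
    -- the representation on `ℋ_{-N} ⊕ ℋ_N`, `n = 2N`, exists and is determined by its formulas
    (∃! π, Podles.IsSpinorRep p n π) ∧
    ∀ π, Podles.IsSpinorRep p n π →
      -- `K⁻² γ F [F,a₀][F,a₁][F,a₂]` is of trace class
      (∀ ω : HochChain (Podles p) 2, ∃ S : SpinorSpace n →L[ℂ] SpinorSpace n,
        IsTraceClass S ∧
          ∀ v i, S v i = Podles.kWeight p i * Podles.chernOp p n π 2 ω v i) ∧
      -- the `q`-index and the pairing are both equal to `[2N]`
      Podles.HasQIndex p n π (Podles.bott p) (qNum p.q n) ∧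
      Podles.chern p n π (Podles.omega₂ p) = qNum p.q n := by
  refine ⟨Uq.actTensor_omega₂ p, ⟨_, Podles.mk_omega₂_ne_zero p hn⟩,
    Podles.two_le_twistedHochschildDim p,
    ⟨Podles.spinRep p hn, Podles.isSpinorRep_spinRep p hn,
      fun π h => h.unique (Podles.isSpinorRep_spinRep p hn)⟩, fun π h => ?_⟩
  obtain rfl := h.unique (Podles.isSpinorRep_spinRep p hn)
  exact ⟨Podles.exists_isTraceClass p hn, Podles.hasQIndex_bott p hn, Podles.chern_omega₂ p hn⟩
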